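/- **Setting.** Let $k$ be a field of characteristic $0$ and $\mathcal U$ a small category. A *quiver* $\mathcal A$ on $\mathcal U$ consists of a set $\mathrm{Ob}\,\mathcal A(U)$ for each object $U$, a $k$-module $\mathcal A(U)(A,A')$ for all $A,A'\in \mathrm{Ob}\,\mathcal A(U)$, and a function $u^*:\mathrm{Ob}\,\mathcal A(U)\to \mathrm{Ob}\,\mathcal A(V)$ for each $u:V\to U$ (not required to be functorial in $u$). For a simplex $\sigma=(V=U_0\xrightarrow{u_1}\cdots\xrightarrow{u_p}U_p=U)$ put $\sigma^*=u_1^*\cdots u_p^*$ and $|\sigma|^*=(u_p\cdots u_1)^*$, both read as the identity if $p=0$. For $p,q\ge 0$ let $$C^{p,q}(\mathcal A)=\prod_{\sigma:V\to U\ p\text{-simplex}}\ \prod_{A_0,\dots,A_q\in\mathcal A(U)}\mathrm{Hom}_k\Big(\bigotimes_{i=1}^q\mathcal A(U)(A_{i-1},A_i),\ \mathcal A(V)(\sigma^*A_0,|\sigma|^*A_q)\Big),$$ and let $s^{-1}C_{GS}(\mathcal A)$ be the graded $k$-module with $\bigoplus_{p+q=d+1}C^{p,q}(\mathcal A)$ in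 degree $d$. **Lax prestacks.** A *lax prestack* $(\mathcal A,m,f,c)$ consists of a quiver $\mathcal A$ and $k$-linear data: compositions $m^U:\mathcal A(U)(A_0,A_1)\otimes\mathcal A(U)(A_1,A_2)\to\mathcal A(U)(A_0,A_2)$, restrictions $f^u:\mathcal A(U)(A_0,A_1)\to\mathcal A(V)(u^*A_0,u^*A_1)$ for $u:V\to U$, and twists $c^{u,v}_A\in\mathcal A(W)(v^*u^*A,(uv)^*A)$ for $W\xrightarrow{v}V\xrightarrow{u}U$, such that each $m^U$ is associative, $f^u(m^U(x,y))=m^V(f^u x,f^u y)$, $m^W(f^vf^u x,c^{u,v}_{A_1})=m^W(c^{u,v}_{A_0},f^{uv}x)$ for $x\in\mathcal A(U)(A_0,A_1)$, and $m^T(c^{v,w}_{u^*A},c^{u,vw}_A)=m^T(f^w(c^{u,v}_A),c^{uv,w}_A)$ for $T\xrightarrow{w}W\xrightarrow{v}V\xrightarrow{u}U$. Identity arrows, and their preservation, are not part of the structure. The triple $\alpha=(m,f,c)$ is an element of $C^{0,2}\oplus C^{1,1}\oplus C^{2,0}$, the degree $1$ part of $s^{-1}C_{GS}(\mathcal A)$.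 **Stackings.** View $\theta\in C^{p,q}$ as a box of size $(p,q,r)$, $r=\min(1,p)$, with the $p$ arrows of $\sigma$ on its left side, $|\sigma|$ on its right side (nothing if $p=0$), and $q$ inputs on top. Put $\mathrm{td}(p,q,r)=q-1$ if $p=r=0$ (a *thin* box) and $p-r+q$ otherwise. A *stacking* $S$ is a planar tree of boxes in which each input of a box is open or carries another stacking. Its boxes are numbered in the *standard order*: a box comes before the boxes above it, and these are ordered from left to right. Given the left depth $d$ of a box $(p,q,r)$ with the boxes above it, the stackings above it have left depths $p_0=d-p\ge 0,p_1,\dots,p_{q-1}$, where $p_i$ is the right depth of the $i$-th of them, and the right depth of the whole is $r+p_q$. An open input must have left depth $0$, and then has right depth $0$. A stacking with left depth $p$, right depth $r$ and $q$ open inputs is filled with elements $\theta_i$ of $s^{-1}C_{GS}(\mathcal A)$ (box $i$ of size $(p_i,q_i,r_i)$ uses the $C^{p_i,q_i}$-component of $\theta_i$). It is evaluated at a $p$-simplex $\sigma$ by evaluating its bottom box, of size $(p',q',r')$, at the first $p'$ arrows of $\sigma$ and at the values of the stackings above it; the first of these has the other arrows of $\sigma$ on its left, and each next one has on its left the simplex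 on the right of the one before it. This gives $S(\theta_1,\dots,\theta_n)\in C^{p,q}$ if $r=\min(1,p)$. Write $|S|=\mathrm{td}(p,q,r)-\sum_i\mathrm{td}(p_i,q_i,r_i)$. The *horizontal graph* of $S$ has as vertices the boxes and the $p$ left wires; boxes that share a vertical edge are adjacent, as are a left wire and the box where it ends. $S$ is *thin-quadratic* if $|S|=2-n$ for $n$ the number of boxes, and its horizontal graph has exactly two connected components. **Signs.** Let $\epsilon(S)\in\mathbb Z/2$ be additive over the boxes of $S$, a box $(p,q,r)$ whose stackings above have $q_1,\dots,q_q$ open inputs and sides $p_0,\dots,p_q$ contributing $(p_0+p_q)r+\sum_{i=1}^q(q_i-1)(q-i+p-r+p_0-p_{i-1})$ (an open input counts as a stacking with one open input). Write $\mathrm{td}_t=\mathrm{td}(p_t,q_t,r_t)$ and let $\nu_t$ be the number of non-thin boxes after box $t$. For $n\ge 1$ the *brace* is $$P_n(\theta_1,\dots,\theta_n)=\sum_{S}(-1)^{\epsilon(S)+n+\sum_t \mathrm{td}_t\nu_t+\frac{|S|(|S|+1)}2+|S|\,\mathrm{td}(p,q,r)+\sum_{i<j}\mathrm{td}_i\mathrm{td}_j}\,S(\theta_1,\dots,\theta_n),$$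 the sum over all thin-quadratic stackings of $n$ boxes, and $L_n(\theta_1,\dots,\theta_n)=\sum_{\pi\in S_n}\mathrm{sgn}(\pi)\varepsilon(\pi;\theta)P_n(\theta_{\pi(1)},\dots,\theta_{\pi(n)})$ with the Koszul sign $\varepsilon$. In particular $L_1$ vanishes on $C^{p,q}$ for $(p,q)\neq(0,0)$, and for $\theta\in C^{0,0}$ it is the element of $C^{1,0}$ with $L_1(\theta)^u_A=\theta^V_{u^*A}$ for $u:V\to U$. **$L_\infty$-algebras.** An $L_\infty$-algebra is a graded module with graded antisymmetric multilinear operations $\ell_n$ of degree $2-n$, $n\ge1$, such that for all $n\ge 1$ $$\sum_{l=1}^n\ \sum_{\pi\ (l,n-l)\text{-unshuffle}}(-1)^{(n-l)l}\mathrm{sgn}(\pi)\varepsilon(\pi;x)\,\ell_{n-l+1}(\ell_l(x_{\pi(1)},\dots,x_{\pi(l)}),x_{\pi(l+1)},\dots,x_{\pi(n)})=0.$$ A Maurer–Cartan element is an $x$ of degree $1$ with $\sum_{n\ge1}\frac{(-1)^{n(n+1)/2}}{n!}\ell_n(x,\dots,x)=0$, where only finitely many terms are non-zero. **Theorem.**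 Let $(\mathcal A,m,f,c)$ be a lax prestack and $\alpha=(m,f,c)$. For $n\ge 1$ and homogeneous $\theta_1,\dots,\theta_n\in s^{-1}C_{GS}(\mathcal A)$, only finitely many terms of $$L_n^\alpha(\theta_1,\dots,\theta_n):=\sum_{r\ge0}\frac{(-1)^{rn+\frac{r(r+1)}2}}{r!}L_{n+r}(\underbrace{\alpha,\dots,\alpha}_{r},\theta_1,\dots,\theta_n)$$ are non-zero, and the operations $L_n^\alpha$, $n\ge1$, define an $L_\infty$-algebra on the graded $k$-module $s^{-1}C_{GS}(\mathcal A)$. Moreover, $\alpha'=(m',f',c')\in C^{0,2}\oplus C^{1,1}\oplus C^{2,0}$ is a Maurer–Cartan element of $(s^{-1}C_{GS}(\mathcal A),L_1^\alpha,L_2^\alpha,\dots)$ if and only if $(\mathcal A,m+m',f+f',c+c')$ is a lax prestack. -/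

import Mathlib

open CategoryTheory

namespace LaxPrestack

universe u v w w' t

/-! ## Simplices of a small category and quivers over it -/

/-- A simplex `V = U₀ → U₁ → ⋯ → U_p = X` of the nerve of `𝒰`, of arbitrary dimension `p`. -/
inductive Simp {𝒰 : Type u} [Category.{v} 𝒰] : 𝒰 → 𝒰 → Type (max u v)
  | nil (X : 𝒰) : Simp X X
  | cons {V W X : 𝒰} (f : V ⟶ W) (τ : Simp W X) : Simp V X

namespace Simp

variable {𝒰 : Type u} [Category.{v} 𝒰]

/-- The dimension `p` of a `p`-simplex. -/
def length : {V X : 𝒰} → Simp V X → ℕ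
  | _, _, nil _ => 0
  | _, _, cons _ τ => length τ + 1

/-- The vertex `U_p` of a simplex (its last vertex, if there are fewer than `p` arrows). -/
def mid : {V X : 𝒰} → ℕ → Simp V X → 𝒰
  | V, _, 0, _ => V
  | _, X, _ + 1, nil _ => X
  | _, _, p + 1, cons _ τ => mid p τ

/-- The first `p` arrows of a simplex. -/
def take : {V X : 𝒰} → (p : ℕ) → (τ : Simp V X) → Simp V (mid p τ)
  | V, _, 0, _ => nil V
  | _, X, _ + 1, nil _ => nil X
  | _, _, p + 1, cons f τ => cons f (take p τ)

/-- What remains of a simplex after its first `p` arrows. -/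
def drop : {V X : 𝒰} → (p : ℕ) → (τ : Simp V X) → Simp (mid p τ) X
  | _, _, 0, τ => τ
  | _, X, _ + 1, nil _ => nil X
  | _, _, p + 1, cons _ τ => drop p τ

/-- The composite `|σ|` of the non-empty simplex `σ = (f, τ)`. -/
def comp : {V W X : 𝒰} → (V ⟶ W) → Simp W X → (V ⟶ X)
  | _, _, _, f, nil _ => f
  | _, _, _, f, cons g τ => f ≫ comp g τ

/-- Put the right-hand side of a box with left-hand side `σ` in front of `τ`: for a simplex `σ` of
positive dimension this is the single arrow `|σ|`, and nothing if `σ` has dimension `0`. -/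
def bdryAppend : {V W X : 𝒰} → Simp V W → Simp W X → Simp V X
  | _, _, _, nil _, τ => τ
  | _, _, _, cons f σ, τ => cons (comp f σ) τ

/-- The right-hand side of a box of the Gerstenhaber-Schack object with left-hand side `σ`. -/
def bdry {V X : 𝒰} (σ : Simp V X) : Simp V X := bdryAppend σ (nil X)

end Simp

/-- A `k`-quiver on `𝒰`: quivers `A(U)` of `k`-modules, and functions `u^* : Ob A(U) → Ob A(V)`
for all `u : V ⟶ U`. The functions `u^*` are not required to be functorial in `u`. -/
structure LinQuiver (k : Type t) [CommRing k] (𝒰 : Type u) [Category.{v} 𝒰] where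
  Ob : 𝒰 → Type w
  Hom : {X : 𝒰} → Ob X → Ob X → Type w'
  addCommGroup : ∀ {X : 𝒰} (a b : Ob X), AddCommGroup (Hom a b)
  module : ∀ {X : 𝒰} (a b : Ob X), Module k (Hom a b)
  res : {V X : 𝒰} → (V ⟶ X) → Ob X → Ob V

attribute [instance] LinQuiver.addCommGroup LinQuiver.module

section

variable {k : Type t} [CommRing k] {𝒰 : Type u} [Category.{v} 𝒰]

namespace LinQuiver

variable (A : LinQuiver.{u, v, w, w', t} k 𝒰)

/-- `σ^* = u₁^* ∘ ⋯ ∘ u_p^*` on objects. -/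
def lower : {V X : 𝒰} → Simp V X → A.Ob X → A.Ob V
  | _, _, .nil _, a => a
  | _, _, .cons f τ, a => A.res f (lower τ a)

/-- `|σ|^*` on objects, read as the identity if `σ` has dimension `0`. -/
def upper : {V X : 𝒰} → Simp V X → A.Ob X → A.Ob V
  | _, _, .nil _, a => a
  | _, _, .cons f τ, a => A.res (Simp.comp f τ) a

theorem lower_take_drop {V X : 𝒰} (p : ℕ) (τ : Simp V X) (a : A.Ob X) :
    A.lower (τ.take p) (A.lower (τ.drop p) a) = A.lower τ a := by
  induction p generalizing V with
  | zero => rfl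
  | succ p ih =>
    cases τ with
    | nil => rfl
    | cons f τ => exact congrArg (A.res f) (ih τ)

theorem lower_bdryAppend {V W X : 𝒰} (σ : Simp V W) (τ : Simp W X) (a : A.Ob X) :
    A.upper σ (A.lower τ a) = A.lower (σ.bdryAppend τ) a := by
  cases σ <;> rfl

theorem lower_bdry {V X : 𝒰} (σ : Simp V X) (a : A.Ob X) :
    A.lower σ.bdry a = A.upper σ a :=
  (A.lower_bdryAppend σ (.nil X) a).symm

/-- Transport of arrows along equalities of their end points. -/
def homCast {X : 𝒰} {a a' b b' : A.Ob X} (h : a = a') (h' : b = b') :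
    A.Hom a b →ₗ[k] A.Hom a' b' :=
  match h, h' with
  | rfl, rfl => LinearMap.id

end LinQuiver

/-! ## The Gerstenhaber-Schack object -/

/-- The product over all `p, q` of the `k`-modules `C^{p,q}(A)`: an element is a family of
multilinear maps `A(X)(a₀,a₁) × ⋯ × A(X)(a_{q-1},a_q) → A(V)(σ^* a₀, |σ|^* a_q)`, indexed by `q`, the
simplices `σ : V → X` of all dimensions `p`, and `a₀, …, a_q`. -/
def GSObj (A : LinQuiver.{u, v, w, w', t} k 𝒰) : Type (max u v w w') :=
  ∀ (q : ℕ) (V X : 𝒰) (σ : Simp V X) (a : Fin (q + 1) → A.Ob X),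
    MultilinearMap k (fun i : Fin q => A.Hom (a i.castSucc) (a i.succ))
      (A.Hom (A.lower σ (a 0)) (A.upper σ (a (Fin.last q))))

noncomputable instance (A : LinQuiver.{u, v, w, w', t} k 𝒰) : AddCommGroup (GSObj A) :=
  inferInstanceAs (AddCommGroup (∀ (q : ℕ) (V X : 𝒰) (σ : Simp V X) (a : Fin (q + 1) → A.Ob X),
    MultilinearMap k (fun i : Fin q => A.Hom (a i.castSucc) (a i.succ))
      (A.Hom (A.lower σ (a 0)) (A.upper σ (a (Fin.last q))))))

noncomputable instance (A : LinQuiver.{u, v, w, w', t} k 𝒰) : Module k (GSObj A) :=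
  inferInstanceAs (Module k (∀ (q : ℕ) (V X : 𝒰) (σ : Simp V X) (a : Fin (q + 1) → A.Ob X),
    MultilinearMap k (fun i : Fin q => A.Hom (a i.castSucc) (a i.succ))
      (A.Hom (A.lower σ (a 0)) (A.upper σ (a (Fin.last q))))))

/-- The graded `k`-module `s⁻¹ C_GS(A)`: its part of degree `d` is `⨁_{p + q = d + 1} C^{p,q}(A)`. -/
def gsDegree (A : LinQuiver.{u, v, w, w', t} k 𝒰) (d : ℤ) : Submodule k (GSObj A) where
  carrier := {θ | ∀ (q : ℕ) (V X : 𝒰) (σ : Simp V X) (a : Fin (q + 1) → A.Ob X),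
    (σ.length : ℤ) + q ≠ d + 1 → θ q V X σ a = 0}
  add_mem' {x y} hx hy q V X σ a h := by
    change x q V X σ a + y q V X σ a = 0
    rw [hx q V X σ a h, hy q V X σ a h, add_zero]
  zero_mem' _ _ _ _ _ _ := rfl
  smul_mem' c x hx q V X σ a h := by
    change c • x q V X σ a = 0
    rw [hx q V X σ a h, smul_zero]

end

/-! ## Stackings of boxes -/

/-- All values of the iteration `b, g₀ b, g₁ (g₀ b), …`. -/
def scan {β : Type*} {q : ℕ} (g : Fin q → β → β) (b : β) : Fin (q + 1) → β :=
  Fin.induction (motive := fun _ => β) b (fun j s => g j s)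

/-- Planar trees of boxes. Above each of the `q` inputs of a box `(p, q, r)` either nothing is
stacked (`unit`) or another tree. The boxes are always numbered in the standard order: a box precedes
the boxes above it, and these are ordered from left to right. -/
inductive Stacking : Type
  | unit : Stacking
  | box (p q r : ℕ) (ch : Fin q → Stacking) : Stacking

/-- The thin desuspended degree of a box of size `(p, q, r)`. -/
def td (b : ℕ × ℕ × ℕ) : ℤ :=
  if b.1 = 0 ∧ b.2.2 = 0 then (b.2.1 : ℤ) - 1 else (b.1 : ℤ) - b.2.2 + b.2.1

/-- Boxes with `p = r = 0`. -/
abbrev IsThin (b : ℕ × ℕ × ℕ) : Prop := b.1 = 0 ∧ b.2.2 = 0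

/-- Boxes with exactly one of `p` and `r` equal to `0`. -/
abbrev IsSemiThin (b : ℕ × ℕ × ℕ) : Prop := ¬ IsThin b ∧ (b.1 = 0 ∨ b.2.2 = 0)

/-- Boxes that are neither thin nor semi-thin. -/
abbrev IsNonThin (b : ℕ × ℕ × ℕ) : Prop := ¬ IsThin b ∧ ¬ IsSemiThin b

/-- The boxes `(p, q, min 1 p)`, which are the sizes of the elements of the `C^{p,q}(A)`. -/
abbrev IsGSBox (b : ℕ × ℕ × ℕ) : Prop := b.2.2 = min 1 b.1

namespace Stacking

/-- The sizes `(p, q, r)` of the boxes, in the standard order. -/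
def sizes : Stacking → List (ℕ × ℕ × ℕ)
  | unit => []
  | box p q r ch => (p, q, r) :: (List.ofFn fun j => sizes (ch j)).flatten

/-- The number of boxes. -/
def card (S : Stacking) : ℕ := S.sizes.length

/-- If the inputs of the tree are numbered from `o` on, then the first number after them. -/
def endOff : Stacking → ℕ → ℕ
  | unit, o => o + 1
  | box _ _ _ ch, o => scan (fun j s => endOff (ch j) s) o (Fin.last _)

/-- The number of inputs of the tree. -/
def inputs (S : Stacking) : ℕ := S.endOff 0

/-- The right depth of a tree whose left depth is `d`. The children of a box stand side by side:
the left depth of each one is the right depth of the one before it. If a box has no inputs, there is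
only its start value `d - p` above it. -/
def rdepth : Stacking → ℕ → ℕ
  | unit, d => d
  | box p _ r ch, d => r + scan (fun j s => rdepth (ch j) s) (d - p) (Fin.last _)

/-- The depths of the vertical sides `p₀, …, p_q` of the layer above the bottom box `(p, q, r)`, if
`p₀ = d`. -/
def sides {q : ℕ} (ch : Fin q → Stacking) (d : ℕ) : Fin (q + 1) → ℕ :=
  scan (fun j s => rdepth (ch j) s) d

/-- The tree is an admissible stacking if its left depth is `d`: all vertical sides match, and
nothing is below an open input. -/
def Admissible : Stacking → ℕ → Prop
  | unit, d => d = 0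
  | box p _ _ ch, d => p ≤ d ∧ ∀ j, Admissible (ch j) (sides ch (d - p) j.castSucc)

/-- The size of the box that results from a stacking of left depth `p`. -/
def result (S : Stacking) (p : ℕ) : ℕ × ℕ × ℕ := (p, S.inputs, S.rdepth p)

/-- The thin desuspended degree of a stacking of left depth `p`. -/
def degree (S : Stacking) (p : ℕ) : ℤ := td (S.result p) - (S.sizes.map td).sum

/-- The number of boxes that precede the `j`-th child of a box among the boxes above it. -/
def cardBefore {q : ℕ} (ch : Fin q → Stacking) (j : Fin q) : ℕ :=
  ∑ i : Fin q, if i < j then (ch i).card else 0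

/-- The edges of the horizontal composite graph, together with its outgoing wires. The box with
number `i` is `Sum.inr i`, and `Sum.inl i` is the `i`-th input of the whole graph. The tree stands
right of the wires `w`, each given by the vertex where it starts, and its boxes are numbered from `c`
on. A box takes the first `p` wires, the trees above it take the others. -/
def hgraph : Stacking → ℕ → List (ℕ ⊕ ℕ) → List ((ℕ ⊕ ℕ) × (ℕ ⊕ ℕ)) × List (ℕ ⊕ ℕ)
  | unit, _, ws => ([], ws)
  | box p _ r ch, c, ws =>
    let above := scan (fun j (s : List ((ℕ ⊕ ℕ) × (ℕ ⊕ ℕ)) × List (ℕ ⊕ ℕ)) =>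
        let e := hgraph (ch j) (c + 1 + cardBefore ch j) s.2
        (s.1 ++ e.1, e.2)) ([], ws.drop p) (Fin.last _)
    ((ws.take p).map (fun x => (x, Sum.inr c)) ++ above.1,
      List.replicate r (Sum.inr c) ++ above.2)

/-- The horizontal composite graph of a stacking of left depth `p`. Its vertices are the inputs
and the boxes, so that a wire without a box on it is a connected component. -/
def horizontalGraph (S : Stacking) (p : ℕ) : SimpleGraph (Fin p ⊕ Fin S.card) :=
  SimpleGraph.fromRel fun x y =>
    (Sum.map Fin.val Fin.val x, Sum.map Fin.val Fin.val y) ∈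
      (S.hgraph 0 (List.ofFn fun i : Fin p => Sum.inl i.val)).1

/-- The exponent of the desuspended sign of a stacking of left depth `d`. -/
def dExp : Stacking → ℕ → ℤ
  | unit, _ => 0
  | box p q r ch, d =>
    let s := sides ch (d - p)
    ((s 0 : ℤ) + s (Fin.last q)) * r
      + ∑ i : Fin q, (((ch i).inputs : ℤ) - 1) * ((q : ℤ) - (i + 1))
      + ∑ i : Fin q, (((ch i).inputs : ℤ) - 1) * ((p : ℤ) - r + s 0 - s i.castSucc)
      + ∑ i : Fin q, dExp (ch i) (s i.castSucc)

/-- The exponent of the thin desuspended sign: for each box, its degree times the number of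
non-thin boxes after it is added to the desuspended sign, and the number of boxes. -/
def tdExp (S : Stacking) (p : ℕ) : ℤ :=
  S.dExp p + S.card + ∑ i : Fin S.sizes.length, td (S.sizes.get i) *
    (Finset.univ.filter fun j : Fin S.sizes.length => i < j ∧ IsNonThin (S.sizes.get j)).card

/-- The exponent of the sign with which a stacking acts on shifted elements. -/
def actExp (S : Stacking) (p : ℕ) : ℤ :=
  S.degree p * (S.degree p + 1) / 2 + S.degree p * td (S.result p)
    + ∑ i : Fin S.sizes.length, ∑ j : Fin S.sizes.length,
      if i < j then td (S.sizes.get i) * td (S.sizes.get j) else 0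

/-- Thin-quadratic stackings of `n` boxes whose result has size `(p, q, min 1 p)`, and all of whose
boxes have a size `(p', q', min 1 p')`. -/
structure IsThinQuadratic (n p q : ℕ) (S : Stacking) : Prop where
  card_eq : S.card = n
  admissible : S.Admissible p
  inputs_eq : S.inputs = q
  degree_eq : S.degree p = 2 - n
  components : Nat.card (S.horizontalGraph p).ConnectedComponent = 2
  not_semiThin : ∀ b ∈ S.sizes, ¬ IsSemiThin b
  isGSBox : ∀ b ∈ S.sizes, IsGSBox b
  isGSBox_result : IsGSBox (S.result p)

theorem le_endOff (S : Stacking) (o : ℕ) : o ≤ S.endOff o := by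
  induction S generalizing o with
  | unit => exact Nat.le_succ o
  | box p q r ch ih =>
    change o ≤ scan (fun j s => endOff (ch j) s) o (Fin.last _)
    generalize Fin.last q = j
    induction j using Fin.induction with
    | zero => exact le_rfl
    | succ j hj => exact hj.trans (ih j _)

/-- The input with which each child of a box starts. -/
def offsets {q : ℕ} (ch : Fin q → Stacking) (o : ℕ) : Fin (q + 1) → ℕ :=
  scan (fun j s => endOff (ch j) s) o

theorem offsets_mono {q : ℕ} (ch : Fin q → Stacking) (o : ℕ) : Monotone (offsets ch o) :=
  Fin.monotone_iff_le_succ.2 fun j => le_endOff (ch j) (offsets ch o j.castSucc)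

theorem offsets_succ {q : ℕ} (ch : Fin q → Stacking) (o : ℕ) (j : Fin q) :
    offsets ch o j.succ = (ch j).endOff (offsets ch o j.castSucc) := rfl

theorem endOff_child_le {p q r : ℕ} (ch : Fin q → Stacking) (o : ℕ) (j : Fin q) {N : ℕ}
    (h : (box p q r ch).endOff o ≤ N) : (ch j).endOff (offsets ch o j.castSucc) ≤ N :=
  (offsets_succ ch o j).symm.trans_le ((offsets_mono ch o (Fin.le_last j.succ)).trans h)

/-! ## The action of stackings on the Gerstenhaber-Schack object -/

section

variable {k : Type t} [CommRing k] {𝒰 : Type u} [Category.{v} 𝒰]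

/-- The simplex on the right-hand side of a tree whose left-hand side is the simplex `τ`. -/
def out : Stacking → {V X : 𝒰} → Simp V X → Simp V X
  | unit, _, _, τ => τ
  | box p _ _ ch, _, _, τ =>
    (τ.take p).bdryAppend (scan (fun j s => out (ch j) s) (τ.drop p) (Fin.last _))

/-- The vertical sides of the layer above a box, if the first one is `τ`. -/
def outs {q : ℕ} (ch : Fin q → Stacking) {V X : 𝒰} (τ : Simp V X) : Fin (q + 1) → Simp V X :=
  scan (fun j s => out (ch j) s) τ

variable {A : LinQuiver.{u, v, w, w', t} k 𝒰}

theorem lower_outs_succ {q : ℕ} (ch : Fin q → Stacking) {V X : 𝒰} (τ : Simp V X) (o : ℕ) (j : Fin q)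
    {N : ℕ} (a : Fin (N + 1) → A.Ob X) (h : (ch j).endOff (offsets ch o j.castSucc) < N + 1)
    (h' : offsets ch o j.succ < N + 1) :
    A.lower ((ch j).out (outs ch τ j.castSucc)) (a ⟨(ch j).endOff (offsets ch o j.castSucc), h⟩) =
      A.lower (outs ch τ j.succ) (a ⟨offsets ch o j.succ, h'⟩) := rfl

/-- The value of a tree of elements of the Gerstenhaber-Schack object on the arrows
`x_o, x_{o+1}, …`, where `τ` is the left-hand side of the tree, and its boxes are filled with
`θ_c, θ_{c+1}, …`. The bottom box is evaluated at the first `p` arrows of `τ`, and its arguments are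
the values of the trees above it, the first of which has the other arrows of `τ` on its left. -/
def val (θ : ℕ → GSObj A) {X : 𝒰} {N : ℕ} (a : Fin (N + 1) → A.Ob X)
    (x : ∀ i : Fin N, A.Hom (a i.castSucc) (a i.succ)) :
    (S : Stacking) → {V : 𝒰} → (τ : Simp V X) → (c o : ℕ) → (h : S.endOff o ≤ N) →
      A.Hom (A.lower τ (a ⟨o, Nat.lt_succ_of_le ((S.le_endOff o).trans h)⟩))
        (A.lower (S.out τ) (a ⟨S.endOff o, Nat.lt_succ_of_le h⟩))
  | unit, _, .nil _, _, o, h => x ⟨o, h⟩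
  | unit, _, .cons _ _, _, _, _ => 0
  | box p q _ ch, _, τ, c, o, h =>
    A.homCast (A.lower_take_drop p τ _) (A.lower_bdryAppend (τ.take p) _ _)
      (θ c q _ _ (τ.take p)
        (fun j => A.lower (outs ch (τ.drop p) j) (a ⟨offsets ch o j,
          Nat.lt_succ_of_le ((offsets_mono ch o (Fin.le_last j)).trans h)⟩))
        (fun j => A.homCast rfl (lower_outs_succ ch (τ.drop p) o j a _ _)
          (val θ a x (ch j) (outs ch (τ.drop p) j.castSucc) (c + 1 + cardBefore ch j)
            (offsets ch o j.castSucc) (endOff_child_le ch o j h))))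


theorem val_congr (θ : ℕ → GSObj A) {X : 𝒰} {N : ℕ} (a : Fin (N + 1) → A.Ob X)
    (x y : ∀ i : Fin N, A.Hom (a i.castSucc) (a i.succ)) (S : Stacking) {V : 𝒰} (τ : Simp V X)
    (c o : ℕ) (h : S.endOff o ≤ N)
    (hxy : ∀ i : Fin N, o ≤ i.val → i.val < S.endOff o → x i = y i) :
    val θ a x S τ c o h = val θ a y S τ c o h := by
  induction S generalizing V c o with
  | unit =>
    cases τ with
    | nil => exact hxy ⟨o, h⟩ le_rfl (Nat.lt_succ_self o)
    | cons => rfl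
  | box p q r ch ih =>
    unfold val
    congr 2
    funext j
    refine congrArg _ ?_
    exact ih j _ _ _ _ fun i h1 h2 => hxy i ((offsets_mono ch o (Fin.zero_le j.castSucc)).trans h1)
      (h2.trans_le (offsets_mono ch o (Fin.le_last j.succ)))

theorem exists_offset {q : ℕ} (g : Fin (q + 1) → ℕ) (i : ℕ) (h0 : g 0 ≤ i) (h1 : i < g (Fin.last q)) :
    ∃ j : Fin q, g j.castSucc ≤ i ∧ i < g j.succ := by
  by_contra hn
  push Not at hn
  have : ∀ j, g j ≤ i := fun j => by
    induction j using Fin.induction with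
    | zero => exact h0
    | succ j hj => exact hn j hj
  exact absurd (this (Fin.last q)) (not_le.2 h1)

theorem val_linear (θ : ℕ → GSObj A) {X : 𝒰} {N : ℕ} (a : Fin (N + 1) → A.Ob X)
    (x : ∀ i : Fin N, A.Hom (a i.castSucc) (a i.succ)) (i : Fin N) (S : Stacking) {V : 𝒰}
    (τ : Simp V X) (c o : ℕ) (h : S.endOff o ≤ N) (h1 : o ≤ i.val) (h2 : i.val < S.endOff o) :
    ∃ f : A.Hom (a i.castSucc) (a i.succ) →ₗ[k] A.Hom _ _,
      ∀ y, val θ a (Function.update x i y) S τ c o h = f y := by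
  induction S generalizing V c o with
  | unit =>
    cases τ with
    | nil =>
      obtain rfl : o = i.val := le_antisymm h1 (Nat.le_of_lt_succ h2)
      refine ⟨LinearMap.id, fun y => ?_⟩
      change Function.update x i y i = y
      exact Function.update_self i y x
    | cons => exact ⟨0, fun _ => rfl⟩
  | box p q r ch ih =>
    obtain ⟨j, hj1, hj2⟩ := exists_offset (offsets ch o) i.val h1 h2
    obtain ⟨f, hf⟩ := ih j (outs ch (τ.drop p) j.castSucc) (c + 1 + cardBefore ch j)
      (offsets ch o j.castSucc) (endOff_child_le ch o j h) hj1 hj2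
    refine ⟨(A.homCast (A.lower_take_drop p τ _) (A.lower_bdryAppend (τ.take p) _ _)).comp
      (((θ c q _ _ (τ.take p) fun j => A.lower (outs ch (τ.drop p) j) (a ⟨offsets ch o j,
          Nat.lt_succ_of_le ((offsets_mono ch o (Fin.le_last j)).trans h)⟩)).toLinearMap
        (fun j => A.homCast rfl (lower_outs_succ ch (τ.drop p) o j a _ _)
          (val θ a x (ch j) (outs ch (τ.drop p) j.castSucc) (c + 1 + cardBefore ch j)
            (offsets ch o j.castSucc) (endOff_child_le ch o j h))) j).comp
        ((A.homCast rfl (lower_outs_succ ch (τ.drop p) o j a _ _)).comp f)),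
      fun y => ?_⟩
    rw [val]
    refine congrArg _ (congrArg _ ?_)
    funext l
    by_cases hl : l = j
    · subst hl
      rw [Function.update_self]
      exact congrArg _ (hf y)
    · rw [Function.update_of_ne hl]
      refine congrArg _ ?_
      refine val_congr θ a _ _ (ch l) _ _ _ _ fun i' h3 h4 => ?_
      refine Function.update_of_ne (a := i') (a' := i) ?_ y x
      rintro rfl
      rcases lt_or_gt_of_ne hl with hlt | hlt
      · exact absurd (h4.trans_le (offsets_mono ch o (Fin.succ_le_castSucc_iff.2 hlt)))
          (not_lt.2 hj1)
      · exact absurd (hj2.trans_le (offsets_mono ch o (Fin.succ_le_castSucc_iff.2 hlt)))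
          (not_lt.2 h3)

/-- The multilinear map that a stacking, filled with `θ₀, θ₁, …`, yields for the simplex `σ`. -/
def valMap (θ : ℕ → GSObj A) (S : Stacking) {V X : 𝒰} (σ : Simp V X)
    (a : Fin (S.inputs + 1) → A.Ob X) :
    MultilinearMap k (fun i : Fin S.inputs => A.Hom (a i.castSucc) (a i.succ))
      (A.Hom (A.lower σ (a 0)) (A.lower (S.out σ) (a (Fin.last S.inputs)))) where
  toFun x := val θ a x S σ 0 0 le_rfl
  map_update_add' {inst} x i y z := by
    obtain rfl : inst = instDecidableEqFin S.inputs := Subsingleton.elim _ _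
    obtain ⟨f, hf⟩ := val_linear θ a x i S σ 0 0 le_rfl (Nat.zero_le _) i.2
    exact (hf _).trans ((f.map_add y z).trans (congrArg₂ _ (hf y).symm (hf z).symm))
  map_update_smul' {inst} x i c y := by
    obtain rfl : inst = instDecidableEqFin S.inputs := Subsingleton.elim _ _
    obtain ⟨f, hf⟩ := val_linear θ a x i S σ 0 0 le_rfl (Nat.zero_le _) i.2
    exact (hf _).trans ((f.map_smul c y).trans (congrArg _ (hf y).symm))

open scoped Classical in
/-- The element of the Gerstenhaber-Schack object that results from filling a stacking `S` with
`θ₀, θ₁, …`, at `q` and `σ`. The two conditions hold if the result of `S` has size `(p, q, min 1 p)`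
and `σ` has dimension `p`. -/
noncomputable def act (θ : ℕ → GSObj A) (S : Stacking) (q : ℕ) {V X : 𝒰} (σ : Simp V X)
    (a : Fin (q + 1) → A.Ob X) :
    MultilinearMap k (fun i : Fin q => A.Hom (a i.castSucc) (a i.succ))
      (A.Hom (A.lower σ (a 0)) (A.upper σ (a (Fin.last q)))) :=
  if h : S.inputs = q ∧ S.out σ = σ.bdry then
    match q, h.1, a with
    | _, rfl, a =>
      (A.homCast rfl ((congrArg (fun τ => A.lower τ _) h.2).trans (A.lower_bdry σ _))).compMultilinearMap
        (valMap θ S σ a)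
  else 0

end

end Stacking

/-! ## `L∞`-algebras -/

/-- The Koszul sign of the permutation `x₀, x₁, … ↦ x_{π 0}, x_{π 1}, …` of homogeneous elements, where
`d i` is the degree of `x_{π i}`. -/
def koszul {n : ℕ} (π : Equiv.Perm (Fin n)) (d : Fin n → ℤ) : ℤˣ :=
  ∏ i : Fin n, ∏ j : Fin n, if i < j ∧ π j < π i then (d i * d j).negOnePow else 1

/-- `π` is increasing on the first `l` numbers and on the remaining ones. -/
def IsUnshuffle {n : ℕ} (l : ℕ) (π : Equiv.Perm (Fin n)) : Prop :=
  ∀ i j : Fin n, i < j → (j.val < l ∨ l ≤ i.val) → π i < π j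

section

variable {k : Type t} [CommRing k] {M : Type w} [AddCommGroup M] [Module k M]

open scoped Classical in
/-- The operations `ℓ₁, ℓ₂, …` form an `L∞`-algebra on the graded module `D`. They are multilinear and
graded antisymmetric, `ℓ_n` has degree `2 - n`, and for all `n ≥ 1` the sum over `l + m = n`, `l ≥ 1`,
and all `(l, m)`-unshuffles `π` of
`(-1)^{m l} sgn(π) ε(π) ℓ_{m+1}(ℓ_l(x_{π 1}, …, x_{π l}), x_{π(l+1)}, …, x_{π n})` vanishes.
Only the values of the operations at homogeneous elements matter. -/
structure IsLInfinityAlgebra (D : ℤ → Submodule k M) (ℓ : (n : ℕ) → (Fin n → M) → M) : Prop where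
  map_add : ∀ (n : ℕ), 1 ≤ n → ∀ (d : Fin n → ℤ) (x : Fin n → M), (∀ i, x i ∈ D (d i)) →
    ∀ (i : Fin n), ∀ y ∈ D (d i), ∀ z ∈ D (d i),
      ℓ n (Function.update x i (y + z)) = ℓ n (Function.update x i y) + ℓ n (Function.update x i z)
  map_smul : ∀ (n : ℕ), 1 ≤ n → ∀ (d : Fin n → ℤ) (x : Fin n → M), (∀ i, x i ∈ D (d i)) →
    ∀ (i : Fin n) (c : k), ∀ y ∈ D (d i),
      ℓ n (Function.update x i (c • y)) = c • ℓ n (Function.update x i y)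
  degree : ∀ (n : ℕ), 1 ≤ n → ∀ (d : Fin n → ℤ) (x : Fin n → M), (∀ i, x i ∈ D (d i)) →
    ℓ n x ∈ D (∑ i, d i + 2 - n)
  antisymm : ∀ (n : ℕ), 1 ≤ n → ∀ (d : Fin n → ℤ) (x : Fin n → M), (∀ i, x i ∈ D (d i)) →
    ∀ π : Equiv.Perm (Fin n),
      ℓ n (fun i => x (π i)) = (Equiv.Perm.sign π * koszul π fun i => d (π i)) • ℓ n x
  jacobi : ∀ (n : ℕ), 1 ≤ n → ∀ (d : Fin n → ℤ) (x : Fin n → M), (∀ i, x i ∈ D (d i)) →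
    ∑ l ∈ (Finset.Icc 1 n).attach, ∑ π : Equiv.Perm (Fin n) with IsUnshuffle l.1 π,
      ((((n - l.1 : ℕ) : ℤ) * l.1).negOnePow * Equiv.Perm.sign π * koszul π fun i => d (π i)) •
        ℓ (n - l.1 + 1)
          (Fin.cons (ℓ l.1 fun i => x (π ⟨i, i.2.trans_le (Finset.mem_Icc.1 l.2).2⟩))
            fun j => x (π ⟨l.1 + j, Nat.add_lt_of_lt_sub' j.2⟩)) = 0

end

section

variable {k : Type t} [Field k] {M : Type w} [AddCommGroup M] [Module k M]

/-- The `n`-th term `(-1)^{n(n+1)/2} / n! ℓ_n(x, …, x)` of the Maurer-Cartan equation. -/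
noncomputable def mcTerm (ℓ : (n : ℕ) → (Fin n → M) → M) (x : M) (n : ℕ) : M :=
  ((-1 : k) ^ (n * (n + 1) / 2) / (n.factorial : k)) • ℓ n fun _ => x

/-- The Maurer-Cartan elements of an `L∞`-algebra: the elements `x` of degree `1` with
`∑_{n ≥ 1} (-1)^{n(n+1)/2} / n! ℓ_n(x, …, x) = 0`, where the sum has only finitely many non-zero
terms. -/
def IsMaurerCartan (D : ℤ → Submodule k M) (ℓ : (n : ℕ) → (Fin n → M) → M) (x : M) : Prop :=
  x ∈ D 1 ∧ (Function.support fun n => mcTerm (k := k) ℓ x (n + 1)).Finite ∧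
    ∑ᶠ n : ℕ, mcTerm (k := k) ℓ x (n + 1) = 0

/-- The `r`-th term `(-1)^{rn + r(r+1)/2} / r! ℓ_{r+n}(α, …, α, x₁, …, x_n)` of the `α`-twisted
operation. -/
noncomputable def twistTerm (ℓ : (n : ℕ) → (Fin n → M) → M) (α : M) (n : ℕ) (x : Fin n → M) (r : ℕ) :
    M :=
  ((-1 : k) ^ (r * n + r * (r + 1) / 2) / (r.factorial : k)) • ℓ (r + n) (Fin.append (fun _ => α) x)

/-- The `α`-twisted operations. -/
noncomputable def twist (ℓ : (n : ℕ) → (Fin n → M) → M) (α : M) (n : ℕ) (x : Fin n → M) : M :=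
  ∑ᶠ r : ℕ, twistTerm (k := k) ℓ α n x r

end

/-! ## The brackets on the Gerstenhaber-Schack object -/

section

variable {k : Type t} [CommRing k] {𝒰 : Type u} [Category.{v} 𝒰]
  {A : LinQuiver.{u, v, w, w', t} k 𝒰}

/-- The sequence `θ₁, …, θ_n, 0, 0, …`. -/
noncomputable def extend {n : ℕ} (θ : Fin n → GSObj A) (i : ℕ) : GSObj A := if h : i < n then θ ⟨i, h⟩ else 0

/-- The higher Gerstenhaber brace `P_n = ∑_S (-1)^{S^td} S^td`, summed over the thin-quadratic stackings
of `n` boxes, twisted by a permutation: the term of `sgn(π) P_n^π`. The boxes of `S` are filled with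
`θ_{π 1}, …, θ_{π n}`, and the Koszul sign is that of the degrees of these boxes. For `n = 1` there is
one stacking: a box `(0, 0, 0)` with start value `1`. It sends `θ` in `C^{0,0}(A)` to the element of
`C^{1,0}(A)` whose value at `g : V ⟶ X` and `a` is `θ^V_{g^* a}`. -/
noncomputable def brace (n : ℕ) (π : Equiv.Perm (Fin n)) (θ : Fin n → GSObj A) : GSObj A :=
  fun q _ _ σ a => ∑ᶠ (S : Stacking) (_ : S.IsThinQuadratic n σ.length q),
    (Equiv.Perm.sign π * koszul π (fun i => td (S.sizes.getD i (0, 0, 0))) *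
      (S.tdExp σ.length + S.actExp σ.length).negOnePow) • S.act (extend fun i => θ (π i)) q σ a

/-- The higher Gerstenhaber bracket `L_n`, the antisymmetrisation of the brace `P_n`. -/
noncomputable def bracket (A : LinQuiver.{u, v, w, w', t} k 𝒰) (n : ℕ) (θ : Fin n → GSObj A) :
    GSObj A :=
  ∑ π : Equiv.Perm (Fin n), brace n π θ

end

/-! ## Lax prestacks -/

section

variable {k : Type t} [CommRing k] {𝒰 : Type u} [Category.{v} 𝒰]

/-- A triple `(m, f, c)` of `k`-linear compositions, restrictions and twists on a quiver. Compositions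
are written in the order of the arrows. -/
@[ext]
structure LaxData (A : LinQuiver.{u, v, w, w', t} k 𝒰) where
  m : ∀ {X : 𝒰} (a₀ a₁ a₂ : A.Ob X), A.Hom a₀ a₁ →ₗ[k] A.Hom a₁ a₂ →ₗ[k] A.Hom a₀ a₂
  f : ∀ {V X : 𝒰} (g : V ⟶ X) (a₀ a₁ : A.Ob X), A.Hom a₀ a₁ →ₗ[k] A.Hom (A.res g a₀) (A.res g a₁)
  c : ∀ {W V X : 𝒰} (h : W ⟶ V) (g : V ⟶ X) (a : A.Ob X),
    A.Hom (A.res h (A.res g a)) (A.res (h ≫ g) a)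

namespace LaxData

variable {A : LinQuiver.{u, v, w, w', t} k 𝒰}

instance : Add (LaxData A) where
  add α β :=
    { m := fun a₀ a₁ a₂ => α.m a₀ a₁ a₂ + β.m a₀ a₁ a₂
      f := fun g a₀ a₁ => α.f g a₀ a₁ + β.f g a₀ a₁
      c := fun h g a => α.c h g a + β.c h g a }

/-- `(A, m, f, c)` is a lax prestack. Identity arrows are not part of the structure: the compositions `m` are associative, the restrictions preserve
them, the twists are natural, and they satisfy the coherence condition. -/
structure IsLaxPrestack (α : LaxData A) : Prop where
  assoc : ∀ {X : 𝒰} (a₀ a₁ a₂ a₃ : A.Ob X) (x : A.Hom a₀ a₁) (y : A.Hom a₁ a₂) (z : A.Hom a₂ a₃),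
    α.m a₀ a₂ a₃ (α.m a₀ a₁ a₂ x y) z = α.m a₀ a₁ a₃ x (α.m a₁ a₂ a₃ y z)
  functorial : ∀ {V X : 𝒰} (g : V ⟶ X) (a₀ a₁ a₂ : A.Ob X) (x : A.Hom a₀ a₁) (y : A.Hom a₁ a₂),
    α.f g a₀ a₂ (α.m a₀ a₁ a₂ x y) = α.m _ _ _ (α.f g a₀ a₁ x) (α.f g a₁ a₂ y)
  natural : ∀ {W V X : 𝒰} (h : W ⟶ V) (g : V ⟶ X) (a₀ a₁ : A.Ob X) (x : A.Hom a₀ a₁),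
    α.m _ _ _ (α.f h _ _ (α.f g a₀ a₁ x)) (α.c h g a₁) =
      α.m _ _ _ (α.c h g a₀) (α.f (h ≫ g) a₀ a₁ x)
  coherent : ∀ {T W V X : 𝒰} (e : T ⟶ W) (h : W ⟶ V) (g : V ⟶ X) (a : A.Ob X),
    A.homCast rfl (congrArg (fun i => A.res i a) (Category.assoc e h g))
        (α.m _ _ _ (α.c e h (A.res g a)) (α.c (e ≫ h) g a)) =
      α.m _ _ _ (α.f e _ _ (α.c h g a)) (α.c e (h ≫ g) a)

/-- The element `(m, f, c)` of `C^{0,2}(A) ⊕ C^{1,1}(A) ⊕ C^{2,0}(A)`. -/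
def toGS (α : LaxData A) : GSObj A
  | 2, _, _, .nil _, a =>
    { toFun := fun x => α.m (a 0) (a 1) (a 2) (x 0) (x 1)
      map_update_add' := fun x i y z => by
        fin_cases i <;> simp <;> rfl
      map_update_smul' := fun x i c y => by
        fin_cases i <;> simp <;> rfl }
  | 1, _, _, .cons g (.nil _), a =>
    { toFun := fun x => α.f g (a 0) (a 1) (x 0)
      map_update_add' := fun x i y z => by
        fin_cases i; simp; rfl
      map_update_smul' := fun x i c y => by
        fin_cases i; simp; rfl }
  | 0, _, _, .cons h (.cons g (.nil _)), a => MultilinearMap.constOfIsEmpty k _ (α.c h g (a 0))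
  | _, _, _, _, _ => 0

end LaxData

end

end LaxPrestack

namespace LaxPrestack

universe u v w w' t

set_option linter.unusedSectionVars false

/-! ## Signs and untyped morphisms -/

section

variable {k : Type t} [Field k]

/-- The sign `(-1)^a` in `k`. -/
def sg (k : Type t) [Field k] (a : ZMod 2) : k := if a = 0 then 1 else -1

@[simp] theorem sg_zero : sg k 0 = 1 := if_pos rfl

theorem sg_one : sg k 1 = -1 := if_neg (by decide)

theorem zmod_two_cases (a : ZMod 2) : a = 0 ∨ a = 1 := by
  revert a; decide

theorem sg_add (a b : ZMod 2) : sg k (a + b) = sg k a * sg k b := by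
  rcases zmod_two_cases a with rfl | rfl <;> rcases zmod_two_cases b with rfl | rfl
  · simp
  · simp
  · simp
  · have : (1 + 1 : ZMod 2) = 0 := by decide
    rw [this, sg_one]; simp

theorem sg_mul_self (a : ZMod 2) : sg k a * sg k a = 1 := by
  rw [← sg_add, CharTwo.add_self_eq_zero, sg_zero]

theorem sg_smul_smul {M : Type*} [AddCommGroup M] [Module k M] (a b : ZMod 2) (x : M) :
    sg k a • sg k b • x = sg k (a + b) • x := by
  rw [smul_smul, sg_add]

theorem sg_add_one {M : Type*} [AddCommGroup M] [Module k M] (a : ZMod 2) (x : M) :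
    sg k (a + 1) • x = - (sg k a • x) := by
  rw [sg_add, sg_one]; simp

end

section

variable {k : Type t} [Field k] {𝒰 : Type u} [Category.{v} 𝒰]

/-- The product of all modules of morphisms of `A(V)`, used to avoid casts. -/
abbrev HH (A : LinQuiver.{u, v, w, w', t} k 𝒰) (V : 𝒰) : Type (max w w') :=
  ∀ a b : A.Ob V, A.Hom a b

variable {A : LinQuiver.{u, v, w, w', t} k 𝒰}

open scoped Classical in
/-- A morphism, as an element of the product of all modules of morphisms. -/
noncomputable def emb {V : 𝒰} {a b : A.Ob V} : A.Hom a b →ₗ[k] HH A V :=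
  LinearMap.single k (fun a => ∀ b, A.Hom a b) a ∘ₗ LinearMap.single k (fun b => A.Hom a b) b

theorem emb_apply {V : 𝒰} {a b : A.Ob V} (x : A.Hom a b) : emb x a b = x := by
  simp [emb]

theorem emb_homCast {V : 𝒰} {a a' b b' : A.Ob V} (h : a = a') (h' : b = b') (x : A.Hom a b) :
    emb (A.homCast h h' x) = emb x := by
  subst h h'; rfl

theorem emb_apply_cast {V : 𝒰} {a a' b b' : A.Ob V} (h : a = a') (h' : b = b') (x : A.Hom a b) :
    emb x a' b' = A.homCast h h' x := by
  subst h h'; exact emb_apply x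

/-! ## Words -/

/-- A word: a list of morphisms, each together with its target. -/
abbrev Word (A : LinQuiver.{u, v, w, w', t} k 𝒰) (W : 𝒰) : Type (max w w') :=
  List (HH A W × A.Ob W)

/-- The vertices of a word that starts at `b`. -/
def objAt {W : 𝒰} : A.Ob W → Word A W → ℕ → A.Ob W
  | b, [], _ => b
  | b, _ :: _, 0 => b
  | _, e :: l, n + 1 => objAt e.2 l n

/-- The morphisms of a word. -/
def valAt {W : 𝒰} : Word A W → ℕ → HH A W
  | [], _ => 0
  | e :: _, 0 => e.1
  | _ :: l, n + 1 => valAt l n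

@[simp] theorem objAt_zero {W : 𝒰} (b : A.Ob W) (l : Word A W) : objAt b l 0 = b := by
  cases l <;> rfl

/-- The value of an element of the Gerstenhaber-Schack object on a simplex and a sequence of
arrows. -/
noncomputable def app (θ : GSObj A) {V W : 𝒰} (σ : Simp V W) (q : ℕ) (b : ℕ → A.Ob W)
    (y : ℕ → HH A W) : HH A V :=
  emb (θ q V W σ (fun j => b j) (fun j => y j (b j) (b (j + 1))))

/-- The value of an element of the Gerstenhaber-Schack object on a simplex and a word. -/
noncomputable def appL (θ : GSObj A) {V W : 𝒰} (σ : Simp V W) (b : A.Ob W) (l : Word A W) :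
    HH A V :=
  app θ σ l.length (objAt b l) (valAt l)

end

/-! ## Sources of letters -/

section

variable {k : Type t} [Field k] {𝒰 : Type u} [Category.{v} 𝒰]
  {A : LinQuiver.{u, v, w, w', t} k 𝒰} {M : Type*} [AddCommGroup M] [Module k M]
  {W : 𝒰} {St : Type*}

/-- Transfers: from a state they produce a letter and a new state, in a formal linear combination
which is given by the results for all continuations. -/
abbrev Tr (A : LinQuiver.{u, v, w, w', t} k 𝒰) (W : 𝒰) (St : Type*) (M : Type*) [AddCommGroup M]
    [Module k M] := (St → HH A W → M) →ₗ[k] (St → M)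

/-- Producers of words. -/
abbrev WTr (A : LinQuiver.{u, v, w, w', t} k 𝒰) (W : 𝒰) (St : Type*) (M : Type*) [AddCommGroup M]
    [Module k M] := (St → Word A W → M) →ₗ[k] (St → M)

/-- First a letter, then a word. -/
def bindT (obj : St → A.Ob W) (Y : Tr A W St M) (C : WTr A W St M) : WTr A W St M where
  toFun K := Y fun s' y => C (fun s'' l => K s'' ((y, obj s') :: l)) s'
  map_add' K K' := by
    rw [← map_add]; congr 1; funext s' y
    exact congrFun (C.map_add (fun s'' l => K s'' ((y, obj s') :: l)) _) s'
  map_smul' c K := by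
    rw [RingHom.id_apply, ← map_smul]; congr 1; funext s' y
    exact congrFun (C.map_smul c (fun s'' l => K s'' ((y, obj s') :: l))) s'

/-- The empty word. -/
def nilT : WTr A W St M where
  toFun K s := K s []
  map_add' _ _ := rfl
  map_smul' _ _ := rfl

theorem tr_congr {X : Type*} (Y : (St → X → M) →ₗ[k] (St → M)) {κ κ' : St → X → M}
    (h : ∀ s y, κ s y = κ' s y) (s : St) : Y κ s = Y κ' s := by
  rw [show κ = κ' from funext fun s => funext (h s)]

theorem smul_tr {X : Type*} (Y : (St → X → M) →ₗ[k] (St → M)) (c : k) (κ : St → X → M) (s : St) :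
    c • Y κ s = Y (fun s' y => c • κ s' y) s :=
  (congrFun (map_smul Y c κ) s).symm

/-- Words of letters from a sequence of transfers. -/
def chainF (obj : St → A.Ob W) : (q : ℕ) → (Fin q → Tr A W St M) → WTr A W St M
  | 0, _ => nilT
  | q + 1, Y => bindT obj (Y 0) (chainF obj q fun j => Y j.succ)

/-- Words of `q` letters. -/
def chain (obj : St → A.Ob W) (Y : Tr A W St M) : ℕ → WTr A W St M
  | 0 => nilT
  | q + 1 => bindT obj Y (chain obj Y q)

/-- Words of `q` letters, exactly one of which comes from `Y'`. -/
def dchain (obj : St → A.Ob W) (Y Y' : Tr A W St M) : ℕ → WTr A W St M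
  | 0 => 0
  | q + 1 => bindT obj Y' (chain obj Y q) + bindT obj Y (dchain obj Y Y' q)

theorem bindT_apply (obj : St → A.Ob W) (Y : Tr A W St M) (C : WTr A W St M) (K s) :
    bindT obj Y C K s = Y (fun s' y => C (fun s'' l => K s'' ((y, obj s') :: l)) s') s := rfl

theorem bindT_add_right (obj : St → A.Ob W) (Y : Tr A W St M) (C C' : WTr A W St M) :
    bindT obj Y (C + C') = bindT obj Y C + bindT obj Y C' := by
  ext K s
  exact congrFun (map_add Y (fun s' y => C (fun s'' l => K s'' ((y, obj s') :: l)) s') _) s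

/-- Apply an operator to the result. -/
def postT (x : Module.End k M) {X : Type*} : (X → M) →ₗ[k] (X → M) where
  toFun f s := x (f s)
  map_add' f g := by funext s; exact map_add x _ _
  map_smul' c f := by funext s; exact map_smul x _ _

/-! ### Passing operators through transfers -/

/-- The operator `x` of parity `ε` can be moved through the transfer `Y`; `δ` is an additional sign. -/
def Comm (par : St → ZMod 2) (Y : Tr A W St M) (x : Module.End k M) (ε δ : ZMod 2) : Prop :=
  ∀ κ s, x (Y κ s) = Y (fun s' y => sg k (ε * (par s + par s' + 1) + δ) • x (κ s' y)) s

/-- The operator `x` of parity `ε` can be moved through `C`, which produces `q` letters. -/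
def CommW (par : St → ZMod 2) (q : ℕ) (C : WTr A W St M) (x : Module.End k M) (ε δ : ZMod 2) : Prop :=
  ∀ K s, x (C K s) = C (fun s' l => sg k (ε * (par s + par s' + q) + δ) • x (K s' l)) s

theorem two_eq_zero_zmod : (2 : ZMod 2) = 0 := by decide

theorem CommW.bindT {par : St → ZMod 2} (obj : St → A.Ob W) {Y : Tr A W St M} {C : WTr A W St M}
    {q : ℕ} {x : Module.End k M} {ε δ δ' : ZMod 2} (hY : Comm par Y x ε δ)
    (hC : CommW par q C x ε δ') : CommW par (q + 1) (bindT obj Y C) x ε (δ + δ') := by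
  intro K s
  rw [bindT_apply, hY, bindT_apply]
  refine tr_congr _ (fun s' y => ?_) s
  rw [hC, smul_tr]
  refine tr_congr _ (fun s'' l => ?_) s'
  rw [sg_smul_smul]
  congr 2
  push_cast
  linear_combination (ε * par s') * two_eq_zero_zmod

theorem commW_nilT (par : St → ZMod 2) (x : Module.End k M) (ε : ZMod 2) :
    CommW (A := A) (W := W) par 0 nilT x ε 0 := by
  intro K s
  have : ε * (par s + par s + (0 : ℕ)) + 0 = 0 := by
    push_cast
    linear_combination (ε * par s) * two_eq_zero_zmod
  change x (K s []) = sg k (ε * (par s + par s + (0 : ℕ)) + 0) • x (K s [])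
  rw [this]; simp

theorem CommW.add {par : St → ZMod 2} {C C' : WTr A W St M}
    {q : ℕ} {x : Module.End k M} {ε δ : ZMod 2} (hC : CommW par q C x ε δ)
    (hC' : CommW par q C' x ε δ) : CommW par q (C + C') x ε δ := by
  intro K s
  exact (map_add x _ _).trans (congrArg₂ _ (hC K s) (hC' K s))

theorem CommW.chain {par : St → ZMod 2} (obj : St → A.Ob W) {Y : Tr A W St M}
    {x : Module.End k M} {ε : ZMod 2} (hY : Comm par Y x ε 0) :
    ∀ q, CommW par q (chain obj Y q) x ε 0
  | 0 => commW_nilT par x ε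
  | q + 1 => by
    have := CommW.bindT obj hY (CommW.chain obj hY q)
    rwa [add_zero] at this

theorem commW_zero (par : St → ZMod 2) (q : ℕ) (x : Module.End k M) (ε δ : ZMod 2) :
    CommW (A := A) (W := W) par q 0 x ε δ := by
  intro K s
  exact map_zero x

theorem CommW.dchain {par : St → ZMod 2} (obj : St → A.Ob W) {Y Y' : Tr A W St M}
    {x : Module.End k M} {ε δ : ZMod 2} (hY : Comm par Y x ε 0) (hY' : Comm par Y' x ε δ) :
    ∀ q, CommW par q (dchain obj Y Y' q) x ε δ
  | 0 => commW_zero par 0 x ε δ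
  | q + 1 => by
    refine CommW.add ?_ ?_
    · have := CommW.bindT obj hY' (CommW.chain obj hY q)
      rwa [add_zero] at this
    · have := CommW.bindT obj hY (CommW.dchain obj hY hY' q)
      rwa [zero_add] at this

theorem Comm.add {par : St → ZMod 2} {Y Y' : Tr A W St M}
    {x : Module.End k M} {ε δ : ZMod 2} (h : Comm par Y x ε δ)
    (h' : Comm par Y' x ε δ) : Comm par (Y + Y') x ε δ := by
  intro K s
  exact (map_add x _ _).trans (congrArg₂ _ (h K s) (h' K s))

theorem Comm.mul {par : St → ZMod 2} {Y : Tr A W St M} {x x' : Module.End k M}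
    {ε ε' δ δ' : ZMod 2} (h : Comm par Y x ε δ) (h' : Comm par Y x' ε' δ') :
    Comm par Y (x * x') (ε + ε') (δ + δ') := by
  intro κ s
  rw [Module.End.mul_apply, h', h]
  refine tr_congr _ (fun s' y => ?_) s
  rw [map_smul, sg_smul_smul, Module.End.mul_apply]
  congr 2
  ring

theorem comm_one (par : St → ZMod 2) (Y : Tr A W St M) : Comm par Y 1 0 0 := by
  intro κ s
  simp

end

/-! ## Decompositions of simplices -/

namespace Simp

variable {𝒰 : Type u} [Category.{v} 𝒰] {M : Type*} [AddCommGroup M]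

/-- The sum over all decompositions of a simplex into two. -/
def dec : {V X : 𝒰} → (τ : Simp V X) → (∀ W, Simp V W → Simp W X → M) → M
  | _, X, nil _, g => g X (nil X) (nil X)
  | V, _, cons f τ, g => g V (nil V) (cons f τ) + dec τ fun W a b => g W (cons f a) b

/-- The sum over all decompositions of a simplex into two, the first of which is not empty. -/
def decPos : {V X : 𝒰} → (τ : Simp V X) → (∀ W, Simp V W → Simp W X → M) → M
  | _, _, nil _, _ => 0
  | _, _, cons f τ, g => dec τ fun W a b => g W (cons f a) b

theorem dec_eq {V X : 𝒰} (τ : Simp V X) (g : ∀ W, Simp V W → Simp W X → M) :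
    dec τ g = g V (nil V) τ + decPos τ g := by
  cases τ with
  | nil => exact (add_zero _).symm
  | cons f τ => rfl

/-- The concatenation of two simplices. -/
def append : {V W X : 𝒰} → Simp V W → Simp W X → Simp V X
  | _, _, _, nil _, τ => τ
  | _, _, _, cons f σ, τ => cons f (append σ τ)

theorem length_append {V W X : 𝒰} (σ : Simp V W) (τ : Simp W X) :
    (σ.append τ).length = σ.length + τ.length := by
  induction σ with
  | nil => simp [append, length]
  | cons f σ ih => simp [append, length, ih]; omega

theorem comp_append_nil {V W X : 𝒰} (f : V ⟶ W) (σ : Simp W X) :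
    comp f (σ.append (nil X)) = comp f σ := by
  induction σ generalizing V with
  | nil => rfl
  | cons g σ ih => exact congrArg (f ≫ ·) (ih g)

theorem comp_append_cons {V W W' W'' X : 𝒰} (f : V ⟶ W) (σ : Simp W W') (g : W' ⟶ W'')
    (τ : Simp W'' X) : comp f (σ.append (cons g τ)) = comp f σ ≫ comp g τ := by
  induction σ generalizing V with
  | nil => rfl
  | cons f' σ ih =>
    change f ≫ comp f' _ = (f ≫ comp f' _) ≫ _
    rw [ih, Category.assoc]

theorem bdry_bdryAppend {V W X : 𝒰} (σ : Simp V W) {τ τ' : Simp W X} (h : τ'.bdry = τ.bdry) :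
    (σ.bdryAppend τ').bdry = (σ.append τ).bdry := by
  cases σ with
  | nil => exact h
  | cons f σ =>
    cases τ with
    | nil =>
      cases τ' with
      | nil => exact congrArg (fun g => cons g (nil _)) (comp_append_nil f σ).symm
      | cons g τ' => cases h
    | cons g τ =>
      cases τ' with
      | nil => cases h
      | cons g' τ' =>
        have h' : cons (comp g' τ') (nil X) = cons (comp g τ) (nil X) := h
        refine congrArg (fun g => cons g (nil _)) (Eq.trans ?_ (comp_append_cons f σ g τ).symm)
        change comp f σ ≫ comp g' τ' = _
        rw [Simp.cons.injEq] at h'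
        obtain ⟨-, h', -⟩ := h'
        rw [eq_of_heq h']

theorem dec_congr {V X : 𝒰} (τ : Simp V X) {g g' : ∀ W, Simp V W → Simp W X → M}
    (h : ∀ W a b, a.append b = τ → g W a b = g' W a b) : dec τ g = dec τ g' := by
  induction τ with
  | nil => exact h _ _ _ rfl
  | cons f τ ih =>
    exact congrArg₂ (· + ·) (h _ _ _ rfl) (ih fun W a b hab => h _ _ _ (congrArg (cons f) hab))

theorem decPos_congr {V X : 𝒰} (τ : Simp V X) {g g' : ∀ W, Simp V W → Simp W X → M}
    (h : ∀ W a b, a.append b = τ → 0 < a.length → g W a b = g' W a b) :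
    decPos τ g = decPos τ g' := by
  cases τ with
  | nil => rfl
  | cons f τ =>
    exact dec_congr τ fun W a b hab => h _ _ _ (congrArg (cons f) hab) (Nat.succ_pos _)

theorem dec_add {V X : 𝒰} (τ : Simp V X) (g g' : ∀ W, Simp V W → Simp W X → M) :
    (dec τ fun W a b => g W a b + g' W a b) = dec τ g + dec τ g' := by
  induction τ with
  | nil => rfl
  | cons f τ ih =>
    simp only [dec]
    rw [ih fun W a b => g W (cons f a) b]
    abel

theorem decPos_add {V X : 𝒰} (τ : Simp V X) (g g' : ∀ W, Simp V W → Simp W X → M) :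
    (decPos τ fun W a b => g W a b + g' W a b) = decPos τ g + decPos τ g' := by
  cases τ with
  | nil => exact (add_zero _).symm
  | cons f τ => exact dec_add τ _ _

theorem map_dec {N : Type*} [AddCommGroup N] (φ : M →+ N) {V X : 𝒰} (τ : Simp V X)
    (g : ∀ W, Simp V W → Simp W X → M) : φ (dec τ g) = dec τ fun W a b => φ (g W a b) := by
  induction τ with
  | nil => rfl
  | cons f τ ih => simp only [dec, map_add, ih]

theorem map_decPos {N : Type*} [AddCommGroup N] (φ : M →+ N) {V X : 𝒰} (τ : Simp V X)
    (g : ∀ W, Simp V W → Simp W X → M) : φ (decPos τ g) = decPos τ fun W a b => φ (g W a b) := by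
  cases τ with
  | nil => exact map_zero φ
  | cons f τ => exact map_dec φ τ _

theorem decPos_smul {k : Type*} [Field k] [Module k M] (c : k) {V X : 𝒰} (τ : Simp V X)
    (g : ∀ W, Simp V W → Simp W X → M) : c • decPos τ g = decPos τ fun W a b => c • g W a b :=
  map_decPos (DistribSMul.toAddMonoidHom M c) τ g

theorem dec_smul {k : Type*} [Field k] [Module k M] (c : k) {V X : 𝒰} (τ : Simp V X)
    (g : ∀ W, Simp V W → Simp W X → M) : c • dec τ g = dec τ fun W a b => c • g W a b :=
  map_dec (DistribSMul.toAddMonoidHom M c) τ g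

theorem dec_zero {V X : 𝒰} (τ : Simp V X) :
    (dec τ fun W (_ : Simp V W) (_ : Simp W X) => (0 : M)) = 0 :=
  (map_dec (0 : M →+ M) τ fun _ _ _ => 0).symm

theorem dec_dec {V X : 𝒰} (τ : Simp V X)
    (g : ∀ W W', Simp V W → Simp W W' → Simp W' X → M) :
    (dec τ fun W a ρ => dec ρ fun W' b c => g W W' a b c) =
      dec τ fun W' ρ c => dec ρ fun W a b => g W W' a b c := by
  induction τ with
  | nil => rfl
  | cons f τ ih =>
    simp only [dec]
    rw [ih fun W W' a b c => g W W' (cons f a) b c, add_assoc, ← dec_add]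

theorem decPos_dec {V X : 𝒰} (τ : Simp V X)
    (g : ∀ W W', Simp V W → Simp W W' → Simp W' X → M) :
    (decPos τ fun W a ρ => dec ρ fun W' b c => g W W' a b c) =
      dec τ fun W' ρ c => decPos ρ fun W a b => g W W' a b c := by
  cases τ with
  | nil => rfl
  | cons f τ => exact (dec_dec τ _).trans (zero_add _).symm

theorem length_bdryAppend_le {V W X : 𝒰} (σ : Simp V W) (τ : Simp W X) :
    (σ.bdryAppend τ).length ≤ σ.length + τ.length := by
  cases σ <;> simp [bdryAppend, length]

end Simp

section

variable {k : Type t} [Field k] {𝒰 : Type u} [Category.{v} 𝒰]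
  {A : LinQuiver.{u, v, w, w', t} k 𝒰} {M : Type*} [AddCommGroup M] [Module k M]
  {W : 𝒰} {St : Type*} {ι : Type*}

open Simp

/-- A box that is filled with `θ`, with an operator `x` of parity `ε`, and with words from `C` above
it. -/
noncomputable def oneBox (θ : GSObj A) (x : Module.End k M) (ε : ZMod 2) (obj : St → A.Ob W)
    (par : St → ZMod 2) {V : 𝒰} (σ : Simp V W) (C : WTr A W St M) :
    (St → HH A V → M) →ₗ[k] (St → M) where
  toFun κ s := sg k (ε * par s) • x (C (fun s' l => κ s' (appL θ σ (obj s) l)) s)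
  map_add' κ κ' := by
    funext s
    have h := congrFun (map_add C (fun s' l => κ s' (appL θ σ (obj s) l))
      (fun s' l => κ' s' (appL θ σ (obj s) l))) s
    exact (congrArg (fun m => sg k (ε * par s) • x m) h).trans
      ((congrArg _ (map_add x _ _)).trans (smul_add _ _ _))
  map_smul' c κ := by
    funext s
    have h := congrFun (map_smul C c (fun s' l => κ s' (appL θ σ (obj s) l))) s
    exact (congrArg (fun m => sg k (ε * par s) • x m) h).trans
      ((congrArg _ (map_smul x _ _)).trans (smul_comm _ _ _))

theorem oneBox_apply (θ : GSObj A) (x : Module.End k M) (ε : ZMod 2) (obj : St → A.Ob W)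
    (par : St → ZMod 2) {V : 𝒰} (σ : Simp V W) (C : WTr A W St M) (κ s) :
    oneBox θ x ε obj par σ C κ s =
      sg k (ε * par s) • x (C (fun s' l => κ s' (appL θ σ (obj s) l)) s) := rfl

/-- Families of elements of the Gerstenhaber-Schack object. The box with `p` arrows which is filled
with `θ i` is used if `i ∈ lab p`. Then it has `q` inputs if `ar i p = some q`, and it is zero if
`ar i p = none`. If `p > 0`, then it comes with the operator `N i` of parity `e i`, and with `T i` of parity `e i + 1` otherwise. -/
structure Family (A : LinQuiver.{u, v, w, w', t} k 𝒰) (M : Type*) [AddCommGroup M] [Module k M]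
    (ι : Type*) where
  θ : ι → GSObj A
  lab : ℕ → Finset ι
  ar : ι → ℕ → Option ℕ
  e : ι → ZMod 2
  N : ι → Module.End k M
  T : ι → Module.End k M

namespace Family

variable (F : Family A M ι)

/-- The boxes with at least one arrow. -/
noncomputable def boxN (obj : St → A.Ob W) (par : St → ZMod 2) {V : 𝒰} (σ : Simp V W)
    (C : ℕ → WTr A W St M) : (St → HH A V → M) →ₗ[k] (St → M) :=
  ∑ i ∈ F.lab σ.length, (F.ar i σ.length).elim 0 fun q => oneBox (F.θ i) (F.N i) (F.e i) obj par σ (C q)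

/-- The boxes without arrows. -/
noncomputable def boxT (obj : St → A.Ob W) (par : St → ZMod 2) (C : ℕ → WTr A W St M) :
    Tr A W St M :=
  ∑ i ∈ F.lab 0, (F.ar i 0).elim 0 fun q => oneBox (F.θ i) (F.T i) (F.e i + 1) obj par (nil W) (C q)

/-- A box without arrows below letters. -/
noncomputable def tHat (obj : St → A.Ob W) (par : St → ZMod 2) (Y : Tr A W St M) : Tr A W St M :=
  F.boxT obj par (chain obj Y)

/-- Two boxes without arrows, one above the other. -/
noncomputable def ttHat (obj : St → A.Ob W) (par : St → ZMod 2) (Y : Tr A W St M) : Tr A W St M :=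
  F.boxT obj par (dchain obj Y (F.tHat obj par Y))

end Family

theorem boxN_apply (F : Family A M ι) (obj : St → A.Ob W) (par : St → ZMod 2) {V : 𝒰}
    (σ : Simp V W) (C : ℕ → WTr A W St M) (κ s) :
    F.boxN obj par σ C κ s = ∑ i ∈ F.lab σ.length, (F.ar i σ.length).elim 0 fun q =>
      oneBox (F.θ i) (F.N i) (F.e i) obj par σ (C q) κ s := by
  unfold Family.boxN
  rw [LinearMap.sum_apply, Finset.sum_apply]
  refine Finset.sum_congr rfl fun i _ => ?_
  cases F.ar i σ.length <;> rfl

theorem boxT_apply (F : Family A M ι) (obj : St → A.Ob W) (par : St → ZMod 2)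
    (C : ℕ → WTr A W St M) (κ s) :
    F.boxT obj par C κ s = ∑ i ∈ F.lab 0, (F.ar i 0).elim 0 fun q =>
      oneBox (F.θ i) (F.T i) (F.e i + 1) obj par (nil W) (C q) κ s := by
  unfold Family.boxT
  rw [LinearMap.sum_apply, Finset.sum_apply]
  refine Finset.sum_congr rfl fun i _ => ?_
  cases F.ar i 0 <;> rfl

/-- The objects that belong to the states at the start of a simplex. -/
def lev (obj : St → A.Ob W) (V : 𝒰) (p : Simp V W × St) : A.Ob V := A.lower p.1 (obj p.2)

/-- The parities of the states at the start of a simplex. -/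
def lpar (par : St → ZMod 2) (V : 𝒰) (p : Simp V W × St) : ZMod 2 := p.1.length + par p.2

/-- An open input. -/
def leafFn : {V W : 𝒰} → (τ : Simp V W) → (Y : Tr A W St M) →
    (Simp V W × St → HH A V → M) → St → M
  | _, _, nil X, Y, κ => Y fun s' y => κ (nil X, s') y
  | _, _, cons _ _, _, _ => 0

/-- An open input. -/
def leaf (Y : Tr A W St M) (V : 𝒰) : Tr A V (Simp V W × St) M where
  toFun κ p := leafFn p.1 Y κ p.2
  map_add' κ κ' := by
    funext ⟨τ, s⟩
    cases τ with
    | nil => exact congrFun (map_add Y (fun s' y => κ (nil W, s') y) _) s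
    | cons => exact (add_zero _).symm
  map_smul' c κ := by
    funext ⟨τ, s⟩
    cases τ with
    | nil => exact congrFun (map_smul Y c (fun s' y => κ (nil W, s') y)) s
    | cons => exact (smul_zero c).symm

theorem leaf_nil (Y : Tr A W St M) (κ : Simp W W × St → HH A W → M) (s : St) :
    leaf Y W κ (nil W, s) = Y (fun s' y => κ (nil W, s') y) s := rfl

theorem leaf_cons (Y : Tr A W St M) {V V' : 𝒰} (f : V ⟶ V') (τ : Simp V' W)
    (κ : Simp V W × St → HH A V → M) (s : St) : leaf Y V κ (cons f τ, s) = 0 := rfl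

namespace Family

variable (F : Family A M ι)

/-- A box with at least one arrow at the bottom, and words from `C` above it. -/
noncomputable def recB (obj : St → A.Ob W) (par : St → ZMod 2)
    (C : ∀ V, ℕ → WTr A V (Simp V W × St) M) (V : 𝒰) : Tr A V (Simp V W × St) M where
  toFun κ p := decPos p.1 fun W' σ ρ => F.boxN (lev obj W') (lpar par W') σ (C W')
    (fun p' y => κ (σ.bdryAppend p'.1, p'.2) y) (ρ, p.2)
  map_add' κ κ' := by
    funext p
    rw [Pi.add_apply, ← decPos_add]
    refine decPos_congr _ fun W' σ ρ _ _ => ?_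
    exact congrFun (map_add (F.boxN (lev obj W') (lpar par W') σ (C W'))
      (fun p' y => κ (σ.bdryAppend p'.1, p'.2) y) _) _
  map_smul' c κ := by
    funext p
    rw [Pi.smul_apply, decPos_smul]
    refine decPos_congr _ fun W' σ ρ _ _ => ?_
    exact congrFun (map_smul (F.boxN (lev obj W') (lpar par W') σ (C W')) c
      (fun p' y => κ (σ.bdryAppend p'.1, p'.2) y)) _

theorem recB_apply (obj : St → A.Ob W) (par : St → ZMod 2)
    (C : ∀ V, ℕ → WTr A V (Simp V W × St) M) (V : 𝒰) (κ) (τ : Simp V W) (s : St) :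
    F.recB obj par C V κ (τ, s) = decPos τ fun W' σ ρ => F.boxN (lev obj W') (lpar par W') σ (C W')
      (fun p' y => κ (σ.bdryAppend p'.1, p'.2) y) (ρ, s) := rfl

/-- All trees of height at most `H` of boxes with at least one arrow. -/
noncomputable def Zf (obj : St → A.Ob W) (par : St → ZMod 2) (Y : Tr A W St M) :
    ℕ → ∀ V, Tr A V (Simp V W × St) M
  | 0 => leaf Y
  | H + 1 => fun V => leaf Y V + F.recB obj par (fun W' => chain (lev obj W') (Zf obj par Y H W')) V

end Family

/-- The number of arrows on the right is at most the number of arrows on the left, and they have the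
same composite. -/
def Shrink {V : 𝒰} {X : Type*} (G : (Simp V W × St → X → M) →ₗ[k] (Simp V W × St → M)) : Prop :=
  ∀ (κ κ' : Simp V W × St → X → M) (τ : Simp V W) (s : St),
    (∀ τ' s' y, τ'.length ≤ τ.length → τ'.bdry = τ.bdry → κ (τ', s') y = κ' (τ', s') y) → G κ (τ, s) = G κ' (τ, s)

theorem shrink_leaf (Y : Tr A W St M) (V : 𝒰) : Shrink (leaf Y V) := by
  intro κ κ' τ s h
  cases τ with
  | nil => exact tr_congr Y (fun s' y => h _ _ _ le_rfl rfl) s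
  | cons => rfl

theorem Shrink.bindT {V : 𝒰} {obj : Simp V W × St → A.Ob V} {Y : Tr A V (Simp V W × St) M}
    {C : WTr A V (Simp V W × St) M} (hY : Shrink Y) (hC : Shrink C) : Shrink (bindT obj Y C) := by
  intro κ κ' τ s h
  exact hY _ _ _ _ fun τ' s' y h' hb => hC _ _ _ _ fun τ'' s'' l h'' hb' =>
    h _ _ _ (h''.trans h') (hb'.trans hb)

theorem shrink_nilT {V : 𝒰} : Shrink (nilT : WTr A V (Simp V W × St) M) :=
  fun _ _ _ _ h => h _ _ _ le_rfl rfl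

theorem Shrink.chain {V : 𝒰} {obj : Simp V W × St → A.Ob V} {Y : Tr A V (Simp V W × St) M}
    (hY : Shrink Y) : ∀ q, Shrink (chain obj Y q)
  | 0 => shrink_nilT
  | q + 1 => hY.bindT (Shrink.chain hY q)

theorem Shrink.add {V : 𝒰} {X : Type*} {G G' : (Simp V W × St → X → M) →ₗ[k] (Simp V W × St → M)}
    (h : Shrink G) (h' : Shrink G') : Shrink (G + G') := by
  intro κ κ' τ s hκ
  exact congrArg₂ (· + ·) (h κ κ' τ s hκ) (h' κ κ' τ s hκ)

theorem chain_agree {V : 𝒰} {obj : Simp V W × St → A.Ob V} {Y Y' : Tr A V (Simp V W × St) M} {n : ℕ}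
    (h : ∀ κ τ s, τ.length ≤ n → Y κ (τ, s) = Y' κ (τ, s)) (hY' : Shrink Y') (q : ℕ) :
    ∀ K τ s, τ.length ≤ n → chain obj Y q K (τ, s) = chain obj Y' q K (τ, s) := by
  induction q with
  | zero => intro K τ s _; rfl
  | succ q ih =>
    intro K τ s hτ
    exact (h _ _ _ hτ).trans (hY' _ _ _ _ fun τ' s' y h' _ => ih _ _ _ (h'.trans hτ))

section

variable (F : Family A M ι)

theorem oneBox_congr {θ : GSObj A} {x : Module.End k M} {ε : ZMod 2} {obj : St → A.Ob W}
    {par : St → ZMod 2} {V : 𝒰} {σ : Simp V W} {C C' : WTr A W St M} {κ κ'} {s : St}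
    (h : C (fun s' l => κ s' (appL θ σ (obj s) l)) s =
      C' (fun s' l => κ' s' (appL θ σ (obj s) l)) s) :
    oneBox θ x ε obj par σ C κ s = oneBox θ x ε obj par σ C' κ' s := by
  rw [oneBox_apply, oneBox_apply, h]

theorem boxN_congr {obj : St → A.Ob W} {par : St → ZMod 2} {V : 𝒰} {σ : Simp V W}
    {C C' : ℕ → WTr A W St M} {κ κ'} {s : St}
    (h : ∀ q (g : Word A W → HH A V), C q (fun s' l => κ s' (g l)) s =
      C' q (fun s' l => κ' s' (g l)) s) :
    F.boxN obj par σ C κ s = F.boxN obj par σ C' κ' s := by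
  rw [boxN_apply, boxN_apply]
  refine Finset.sum_congr rfl fun i _ => ?_
  cases F.ar i σ.length with
  | none => rfl
  | some q => exact oneBox_congr (h q _)

theorem boxT_congr {obj : St → A.Ob W} {par : St → ZMod 2}
    {C C' : ℕ → WTr A W St M} {κ κ'} {s : St}
    (h : ∀ q (g : Word A W → HH A W), C q (fun s' l => κ s' (g l)) s =
      C' q (fun s' l => κ' s' (g l)) s) :
    F.boxT obj par C κ s = F.boxT obj par C' κ' s := by
  rw [boxT_apply, boxT_apply]
  refine Finset.sum_congr rfl fun i _ => ?_
  cases F.ar i 0 with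
  | none => rfl
  | some q => exact oneBox_congr (h q _)

theorem shrink_recB (obj : St → A.Ob W) (par : St → ZMod 2)
    (C : ∀ V, ℕ → WTr A V (Simp V W × St) M) (hC : ∀ V q, Shrink (C V q)) (V : 𝒰) :
    Shrink (F.recB obj par C V) := by
  intro κ κ' τ s h
  refine decPos_congr _ fun W' σ ρ h1 h2 => boxN_congr F fun q g => ?_
  refine hC W' q _ _ _ _ fun τ' s' y h' hb => h _ _ _ ?_ ?_
  · rw [show τ = _ from h1.symm, length_append]
    exact (length_bdryAppend_le σ τ').trans (Nat.add_le_add_left h' _)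
  · rw [show τ = _ from h1.symm]
    exact bdry_bdryAppend σ hb

theorem shrink_Zf (obj : St → A.Ob W) (par : St → ZMod 2) (Y : Tr A W St M) (H : ℕ) (V : 𝒰) :
    Shrink (F.Zf obj par Y H V) := by
  induction H generalizing V with
  | zero => exact shrink_leaf Y V
  | succ H ih =>
    exact (shrink_leaf Y V).add (shrink_recB F obj par _ (fun V q => (ih V).chain q) V)

theorem Zf_succ (obj : St → A.Ob W) (par : St → ZMod 2) (Y : Tr A W St M) (H : ℕ) (V : 𝒰) (κ)
    (τ : Simp V W) (s : St) (hτ : τ.length ≤ H) :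
    F.Zf obj par Y (H + 1) V κ (τ, s) = F.Zf obj par Y H V κ (τ, s) := by
  induction H generalizing V s with
  | zero =>
    cases τ with
    | nil => exact add_zero _
    | cons => simp [length] at hτ
  | succ H ih =>
    refine congrArg (leaf Y V κ (τ, s) + ·) ?_
    refine decPos_congr _ fun W' σ ρ h1 h2 => boxN_congr F fun q g => ?_
    refine chain_agree (n := H) (fun κ τ' s' h' => ih W' κ τ' s' h') (shrink_Zf F obj par Y H W') q
      _ _ _ ?_
    have h3 := congrArg length (show _ = τ from h1)
    rw [length_append] at h3
    omega

/-- All trees of boxes with at least one arrow, as transfers at the start of a simplex. -/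
noncomputable def Family.Z (obj : St → A.Ob W) (par : St → ZMod 2) (Y : Tr A W St M) (V : 𝒰) :
    Tr A V (Simp V W × St) M where
  toFun κ p := F.Zf obj par Y p.1.length V κ p
  map_add' κ κ' := by funext p; exact congrFun (map_add (F.Zf obj par Y p.1.length V) κ κ') p
  map_smul' c κ := by funext p; exact congrFun (map_smul (F.Zf obj par Y p.1.length V) c κ) p

theorem Zf_eq_Z (obj : St → A.Ob W) (par : St → ZMod 2) (Y : Tr A W St M) (H : ℕ) (V : 𝒰) (κ)
    (τ : Simp V W) (s : St) (hτ : τ.length ≤ H) :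
    F.Zf obj par Y H V κ (τ, s) = F.Z obj par Y V κ (τ, s) := by
  induction H, hτ using Nat.le_induction with
  | base => rfl
  | succ H hH ih => rw [Zf_succ F obj par Y H V κ τ s hH, ih]

theorem shrink_Z (obj : St → A.Ob W) (par : St → ZMod 2) (Y : Tr A W St M) (V : 𝒰) :
    Shrink (F.Z obj par Y V) := by
  intro κ κ' τ s h
  exact shrink_Zf F obj par Y τ.length V κ κ' τ s h

theorem Z_eq (obj : St → A.Ob W) (par : St → ZMod 2) (Y : Tr A W St M) (V : 𝒰) (κ)
    (τ : Simp V W) (s : St) :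
    F.Z obj par Y V κ (τ, s) = leaf Y V κ (τ, s) +
      F.recB obj par (fun W' => chain (lev obj W') (F.Z obj par Y W')) V κ (τ, s) := by
  rw [← Zf_eq_Z F obj par Y (τ.length + 1) V κ τ s (Nat.le_succ _)]
  refine congrArg (leaf Y V κ (τ, s) + ·) ?_
  refine decPos_congr _ fun W' σ ρ h1 h2 => boxN_congr F fun q g => ?_
  refine chain_agree (n := τ.length) (fun κ τ' s' h' => Zf_eq_Z F obj par Y _ W' κ τ' s' h')
    (shrink_Z F obj par Y W') q _ _ _ ?_
  have h3 := congrArg length (show _ = τ from h1)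
  rw [length_append] at h3
  omega

theorem Z_nil (obj : St → A.Ob W) (par : St → ZMod 2) (Y : Tr A W St M) (κ) (s : St) :
    F.Z obj par Y W κ (nil W, s) = Y (fun s' y => κ (nil W, s') y) s := rfl

/-! ## Splitting a row of boxes off the bottom -/

/-- Continuations for a simplex that is split into two. -/
def nabla {V : 𝒰} {X : Type*} (h : ∀ W', Simp V W' → Simp W' W × St → X → M) :
    Simp V W × St → X → M :=
  fun p y => dec p.1 fun W' a b => h W' a (b, p.2) y

end

end

section

variable {k : Type t} [Field k] {𝒰 : Type u} [Category.{v} 𝒰]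
  {A : LinQuiver.{u, v, w, w', t} k 𝒰} {M : Type*} [AddCommGroup M] [Module k M]
  {W : 𝒰} {St : Type*} {ι : Type*}

open Simp

/-! ### Splitting -/

theorem lower_append {V W X : 𝒰} (σ : Simp V W) (τ : Simp W X) (a : A.Ob X) :
    A.lower (σ.append τ) a = A.lower σ (A.lower τ a) := by
  induction σ with
  | nil => rfl
  | cons f σ ih => exact congrArg (A.res f) (ih τ)

theorem lev_append {V V' : 𝒰} (obj : St → A.Ob W) (a : Simp V V') (b : Simp V' W) (s : St) :
    lev obj V (a.append b, s) = lev (lev obj V') V (a, (b, s)) :=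
  lower_append a b (obj s)

theorem lpar_append {V V' : 𝒰} (par : St → ZMod 2) (a : Simp V V') (b : Simp V' W) (s : St) :
    lpar par V (a.append b, s) = lpar (lpar par V') V (a, (b, s)) := by
  simp only [lpar, length_append]
  push_cast
  ring

/-- On simplices with at most `n` arrows that are split into two, the transfer `G` is given by the
transfers `G'` on the first part. -/
def Split (n : ℕ) {V : 𝒰} {X : Type*} (G : (Simp V W × St → X → M) →ₗ[k] (Simp V W × St → M))
    (G' : ∀ W', (Simp V W' × (Simp W' W × St) → X → M) →ₗ[k] (Simp V W' × (Simp W' W × St) → M)) :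
    Prop :=
  ∀ (h : ∀ W', Simp V W' → Simp W' W × St → X → M) (τ : Simp V W) (s : St), τ.length ≤ n →
    G (nabla h) (τ, s) = dec τ fun W' a b => G' W' (fun p y => h W' p.1 p.2 y) (a, (b, s))

theorem split_nilT (n : ℕ) {V : 𝒰} :
    Split n (nilT : WTr A V (Simp V W × St) M) fun _ => nilT := fun _ _ _ _ => rfl

theorem Split.bindT {n : ℕ} {V : 𝒰} {obj : St → A.Ob W} {Y : Tr A V (Simp V W × St) M}
    {Y' : ∀ W', Tr A V (Simp V W' × (Simp W' W × St)) M} {C : WTr A V (Simp V W × St) M}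
    {C' : ∀ W', WTr A V (Simp V W' × (Simp W' W × St)) M} (hY : Split n Y Y') (hC : Split n C C')
    (hsh : Shrink Y) : Split n (bindT (lev obj V) Y C)
      fun W' => bindT (lev (lev obj W') V) (Y' W') (C' W') := by
  intro h τ s hτ
  refine Eq.trans ?_ (hY (fun W' a p y => C' W' (fun p' l =>
    h W' p'.1 p'.2 ((y, lev (lev obj W') V (a, p)) :: l)) (a, p)) τ s hτ)
  refine hsh _ _ _ _ fun τ' s' y h1 _ => ?_
  refine (hC (fun W' a p l => h W' a p ((y, lev obj V (τ', s')) :: l)) τ' s' (h1.trans hτ)).trans ?_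
  refine dec_congr _ fun W' a b hab => ?_
  rw [← hab, lev_append]

theorem Split.add {n : ℕ} {V : 𝒰} {X : Type*}
    {G H : (Simp V W × St → X → M) →ₗ[k] (Simp V W × St → M)}
    {G' H' : ∀ W', (Simp V W' × (Simp W' W × St) → X → M) →ₗ[k] (Simp V W' × (Simp W' W × St) → M)}
    (hG : Split n G G') (hH : Split n H H') : Split n (G + H) fun W' => G' W' + H' W' := by
  intro h τ s hτ
  refine (congrArg₂ (· + ·) (hG h τ s hτ) (hH h τ s hτ)).trans (dec_add _ _ _).symm

theorem split_zero (n : ℕ) {V : 𝒰} {X : Type*} :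
    Split n (0 : (Simp V W × St → X → M) →ₗ[k] (Simp V W × St → M)) fun _ => 0 :=
  fun _ τ _ _ => (dec_zero τ).symm

theorem Split.sum {n : ℕ} {V : 𝒰} {X : Type*} (I : Finset ι)
    {G : ι → (Simp V W × St → X → M) →ₗ[k] (Simp V W × St → M)}
    {G' : ι → ∀ W', (Simp V W' × (Simp W' W × St) → X → M) →ₗ[k]
      (Simp V W' × (Simp W' W × St) → M)}
    (hG : ∀ i ∈ I, Split n (G i) (G' i)) : Split n (∑ i ∈ I, G i) fun W' => ∑ i ∈ I, G' i W' := by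
  classical
  induction I using Finset.induction_on with
  | empty => exact split_zero n
  | insert i I hi ih =>
    simp only [Finset.sum_insert hi]
    exact (hG i (Finset.mem_insert_self i I)).add
      (ih fun j hj => hG j (Finset.mem_insert_of_mem hj))

theorem Split.chain {n : ℕ} {V : 𝒰} (obj : St → A.Ob W) {Y : Tr A V (Simp V W × St) M}
    {Y' : ∀ W', Tr A V (Simp V W' × (Simp W' W × St)) M} (hY : Split n Y Y')
    (hsh : Shrink Y) : ∀ q, Split n (chain (lev obj V) Y q)
      fun W' => chain (lev (lev obj W') V) (Y' W') q
  | 0 => split_nilT n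
  | q + 1 => hY.bindT (Split.chain obj hY hsh q) hsh

theorem Split.oneBox {n : ℕ} {V V' : 𝒰} (θ : GSObj A) (x : Module.End k M) (ε : ZMod 2)
    (obj : St → A.Ob W) (par : St → ZMod 2) (σ : Simp V' V) {C : WTr A V (Simp V W × St) M}
    {C' : ∀ W', WTr A V (Simp V W' × (Simp W' W × St)) M} (hC : Split n C C') :
    Split n (oneBox θ x ε (lev obj V) (lpar par V) σ C)
      fun W' => oneBox θ x ε (lev (lev obj W') V) (lpar (lpar par W') V) σ (C' W') := by
  intro h τ s hτ
  rw [oneBox_apply]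
  have h1 := hC (fun W' a p l => h W' a p (appL θ σ (lev obj V (τ, s)) l)) τ s hτ
  refine (congrArg (fun m => sg k (ε * lpar par V (τ, s)) • x m) h1).trans ?_
  refine (congrArg _ (map_dec x.toAddMonoidHom τ _)).trans ?_
  rw [dec_smul]
  refine dec_congr _ fun W' a b hab => ?_
  rw [oneBox_apply, ← hab, lev_append, lpar_append]
  rfl

namespace Family

variable (F : Family A M ι)

theorem split_boxN {n : ℕ} {V V' : 𝒰} (obj : St → A.Ob W) (par : St → ZMod 2) (σ : Simp V' V)
    {C : ℕ → WTr A V (Simp V W × St) M} {C' : ∀ W', ℕ → WTr A V (Simp V W' × (Simp W' W × St)) M}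
    (hC : ∀ q, Split n (C q) fun W' => C' W' q) :
    Split n (F.boxN (lev obj V) (lpar par V) σ C)
      fun W' => F.boxN (lev (lev obj W') V) (lpar (lpar par W') V) σ (C' W') := by
  refine Split.sum _ fun i _ => ?_
  cases F.ar i σ.length with
  | none => exact split_zero n
  | some q => exact (hC q).oneBox _ _ _ obj par σ

theorem split_boxT {n : ℕ} {V : 𝒰} (obj : St → A.Ob W) (par : St → ZMod 2)
    {C : ℕ → WTr A V (Simp V W × St) M} {C' : ∀ W', ℕ → WTr A V (Simp V W' × (Simp W' W × St)) M}
    (hC : ∀ q, Split n (C q) fun W' => C' W' q) :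
    Split n (F.boxT (lev obj V) (lpar par V) C)
      fun W' => F.boxT (lev (lev obj W') V) (lpar (lpar par W') V) (C' W') := by
  refine Split.sum _ fun i _ => ?_
  cases F.ar i 0 with
  | none => exact split_zero n
  | some q => exact (hC q).oneBox _ _ _ obj par (nil V)

theorem nabla_bdryAppend {V V' : 𝒰} {X : Type*} (h : ∀ W', Simp V W' → Simp W' W × St → X → M)
    (σ : Simp V V') (hσ : 0 < σ.length) (p : Simp V' W × St) (y : X) :
    nabla h (σ.bdryAppend p.1, p.2) y = h V (nil V) (σ.bdryAppend p.1, p.2) y +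
      nabla (fun W' a p => h W' (σ.bdryAppend a) p) p y := by
  cases σ with
  | nil => exact absurd hσ (lt_irrefl _)
  | cons f σ => rfl

theorem split_Z (obj : St → A.Ob W) (par : St → ZMod 2) (Y : Tr A W St M) (n : ℕ) (V : 𝒰) :
    Split n (F.Z obj par Y V) fun W' => F.Z (lev obj W') (lpar par W') (F.Z obj par Y W') V := by
  induction n generalizing V with
  | zero =>
    intro h τ s hτ
    cases τ with
    | nil => rfl
    | cons => simp [length] at hτ
  | succ n ih =>
    intro h τ s hτ
    rw [Z_eq, recB_apply]
    have hr : (dec τ fun W' a b => F.Z (lev obj W') (lpar par W') (F.Z obj par Y W') V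
        (fun p y => h W' p.1 p.2 y) (a, (b, s))) =
      F.Z obj par Y V (fun p y => h V (nil V) p y) (τ, s) +
        dec τ fun W' a b => decPos a fun W1 σ a' =>
          F.boxN (lev (lev obj W') W1) (lpar (lpar par W') W1) σ
            (chain (lev (lev obj W') W1) (F.Z (lev obj W') (lpar par W') (F.Z obj par Y W') W1))
            (fun p y => h W' (σ.bdryAppend p.1) p.2 y) (a', (b, s)) := by
      rw [dec_congr τ (g' := fun W' a b => leaf (F.Z obj par Y W') V
        (fun p y => h W' p.1 p.2 y) (a, (b, s)) + _) fun W' a b _ => Z_eq _ _ _ _ _ _ _ _, dec_add]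
      refine congrArg₂ (· + ·) ?_ rfl
      cases τ with
      | nil => rfl
      | cons f τ => exact (congrArg (_ + ·) (dec_zero τ)).trans (add_zero _)
    rw [hr, ← decPos_dec, Z_eq, recB_apply, add_assoc, ← decPos_add]
    congr 1
    · cases τ <;> rfl
    refine decPos_congr _ fun W1 σ ρ h1 h2 => ?_
    have h3 := congrArg length h1
    rw [length_append] at h3
    have h4 := F.split_boxN obj par σ (fun q => (ih W1).chain obj (shrink_Z F obj par Y W1) q)
      (fun W' a p y => h W' (σ.bdryAppend a) p y) ρ s (by change _ = τ.length at h3; omega)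
    refine Eq.trans ?_ (congrArg (_ + ·) h4)
    refine Eq.trans ?_ (congrFun (map_add (F.boxN (lev obj W1) (lpar par W1) σ _) _ _) _)
    refine congrArg (fun κ => F.boxN _ _ σ _ κ (ρ, s)) ?_
    funext p y
    exact nabla_bdryAppend h σ h2 p y

theorem split_tHat_Z (obj : St → A.Ob W) (par : St → ZMod 2) (Y : Tr A W St M) (n : ℕ) (V : 𝒰) :
    Split n (F.tHat (lev obj V) (lpar par V) (F.Z obj par Y V)) fun W' =>
      F.tHat (lev (lev obj W') V) (lpar (lpar par W') V)
        (F.Z (lev obj W') (lpar par W') (F.Z obj par Y W') V) :=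
  F.split_boxT obj par fun q => (F.split_Z obj par Y n V).chain obj (shrink_Z F obj par Y V) q

end Family

/-! ### Operators and boxes -/

theorem comm_oneBoxN {par : St → ZMod 2} {obj : St → A.Ob W} {θ : GSObj A} {q : ℕ}
    {x x0 : Module.End k M} {ε ε0 δ : ZMod 2} {V : 𝒰} (σ : Simp V W) {C : WTr A W St M}
    (hC : CommW par q C x ε δ) (hx : x * x0 = sg k (ε * ε0) • (x0 * x))
    (hε : ε0 = σ.length + q) (κ : St → HH A V → M) (s : St) :
    x (oneBox θ x0 ε0 obj par σ C κ s) = oneBox θ x0 ε0 obj par σ C (fun s' y =>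
      sg k (ε * (σ.length + par s + par s') + δ) • x (κ s' y)) s := by
  have h1 : ∀ m, x (x0 m) = sg k (ε * ε0) • x0 (x m) := fun m => LinearMap.congr_fun hx m
  rw [oneBox_apply, oneBox_apply, map_smul, h1, hC]
  congr 1
  rw [← map_smul, smul_tr]
  refine congrArg x0 (tr_congr _ (fun s' l => ?_) s)
  rw [sg_smul_smul]
  congr 2
  rw [hε]
  linear_combination (ε * q) * two_eq_zero_zmod

theorem comm_oneBoxT {par : St → ZMod 2} {obj : St → A.Ob W} {θ : GSObj A} {q : ℕ}
    {x x0 : Module.End k M} {ε ε0 δ δ' : ZMod 2} {C : WTr A W St M}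
    (hC : CommW par q C x ε δ) (hx : x * x0 = sg k (ε * ε0 + δ') • (x0 * x))
    (hε : ε0 = q + 1) :
    Comm par (oneBox θ x0 ε0 obj par (nil W) C) x ε (δ + δ') := by
  intro κ s
  have h1 : ∀ m, x (x0 m) = sg k (ε * ε0 + δ') • x0 (x m) := fun m => LinearMap.congr_fun hx m
  rw [oneBox_apply, oneBox_apply, map_smul, h1, hC]
  congr 1
  rw [← map_smul, smul_tr]
  refine congrArg x0 (tr_congr _ (fun s' l => ?_) s)
  rw [sg_smul_smul]
  congr 2
  rw [hε]
  linear_combination (ε * q) * two_eq_zero_zmod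

theorem Comm.sum {par : St → ZMod 2} (I : Finset ι) {Y : ι → Tr A W St M} {x : Module.End k M}
    {ε δ : ZMod 2} (h : ∀ i ∈ I, Comm par (Y i) x ε δ) : Comm par (∑ i ∈ I, Y i) x ε δ := by
  classical
  induction I using Finset.induction_on with
  | empty => exact fun κ s => map_zero x
  | insert i I hi ih =>
    rw [Finset.sum_insert hi]
    exact (h i (Finset.mem_insert_self i I)).add (ih fun j hj => h j (Finset.mem_insert_of_mem hj))

/-- The sign rules between an operator `x` of parity `ε` and the operators of the family; `δ` is an
additional sign for the operators `T`. -/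
structure Family.Rel (F : Family A M ι) (x : Module.End k M) (ε δ : ZMod 2) : Prop where
  relN : ∀ i, x * F.N i = sg k (ε * F.e i) • (F.N i * x)
  relT : ∀ i, x * F.T i = sg k (ε * (F.e i + 1) + δ) • (F.T i * x)

/-- The sizes of the boxes determine the parities. -/
def Family.Par (F : Family A M ι) : Prop := ∀ i p q, i ∈ F.lab p → F.ar i p = some q → F.e i = (p : ZMod 2) + q

namespace Family

variable (F : Family A M ι)

variable {F} in
theorem Rel.boxT (hp : F.Par) {x : Module.End k M} {ε δ δ' : ZMod 2} (hx : F.Rel x ε δ')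
    {par : St → ZMod 2} {obj : St → A.Ob W} {C : ℕ → WTr A W St M}
    (hC : ∀ q, CommW par q (C q) x ε δ) : Comm par (F.boxT obj par C) x ε (δ + δ') := by
  refine Comm.sum _ fun i hi' => ?_
  cases hi : F.ar i 0 with
  | none => exact fun κ s => map_zero x
  | some q =>
    refine comm_oneBoxT (hC q) (hx.relT i) ?_
    rw [hp i 0 q hi' hi]; simp

variable {F} in
theorem Rel.tHat (hp : F.Par) {x : Module.End k M} {ε δ' : ZMod 2} (hx : F.Rel x ε δ')
    {par : St → ZMod 2} {obj : St → A.Ob W} {Y : Tr A W St M} (hY : Comm par Y x ε 0) :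
    Comm par (F.tHat obj par Y) x ε δ' := by
  have := Rel.boxT hp hx (obj := obj) fun q => CommW.chain obj hY q
  rwa [zero_add] at this

variable {F} in
theorem Rel.boxN (hp : F.Par) {x : Module.End k M} {ε δ δ' : ZMod 2} (hx : F.Rel x ε δ')
    {par : St → ZMod 2} {obj : St → A.Ob W} {V : 𝒰} (σ : Simp V W) {C : ℕ → WTr A W St M}
    (hC : ∀ q, CommW par q (C q) x ε δ) (κ : St → HH A V → M) (s : St) :
    x (F.boxN obj par σ C κ s) = F.boxN obj par σ C (fun s' y =>
      sg k (ε * (σ.length + par s + par s') + δ) • x (κ s' y)) s := by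
  rw [boxN_apply, boxN_apply, map_sum]
  refine Finset.sum_congr rfl fun i hi' => ?_
  cases hi : F.ar i σ.length with
  | none => exact map_zero x
  | some q => exact comm_oneBoxN σ (hC q) (hx.relN i) (hp i _ q hi' hi) κ s

theorem lpar_bdryAppend {V V' : 𝒰} (par : St → ZMod 2) (σ : Simp V V') (hσ : 0 < σ.length)
    (p : Simp V' W × St) : lpar par V (σ.bdryAppend p.1, p.2) = lpar par V' p + 1 := by
  cases σ with
  | nil => exact absurd hσ (lt_irrefl _)
  | cons f σ =>
    simp only [lpar, bdryAppend, length]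
    push_cast
    ring

variable {F} in
theorem Rel.Z (hp : F.Par) {x : Module.End k M} {ε δ' : ZMod 2} (hx : F.Rel x ε δ')
    {par : St → ZMod 2} {obj : St → A.Ob W} {Y : Tr A W St M} (hY : Comm par Y x ε 0) (V : 𝒰) :
    Comm (lpar par V) (F.Z obj par Y V) x ε 0 := by
  suffices H : ∀ n V, Comm (lpar par V) (F.Zf obj par Y n V) x ε 0 from
    fun κ ⟨τ, s⟩ => H τ.length V κ (τ, s)
  intro n
  have hleaf : ∀ V, Comm (lpar par V) (leaf Y V) x ε 0 := by
    rintro V κ ⟨τ, s⟩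
    cases τ with
    | nil =>
      refine (hY _ s).trans (tr_congr Y (fun s' y => ?_) s)
      simp [lpar, length]
    | cons => exact map_zero x
  induction n with
  | zero => exact hleaf
  | succ n ih =>
    refine fun V => (hleaf V).add ?_
    rintro κ ⟨τ, s⟩
    rw [recB_apply, recB_apply]
    refine (map_decPos x.toAddMonoidHom τ _).trans (decPos_congr τ fun W' σ ρ h1 h2 => ?_)
    refine (Rel.boxN hp hx σ (fun q => CommW.chain (lev obj W') (ih W') q) _ _).trans ?_
    refine boxN_congr F fun q g => tr_congr _ (fun p l => ?_) _
    rw [lpar_bdryAppend par σ h2, ← h1, lpar_append]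
    congr 2
    simp only [lpar]
    linear_combination (- ε) * two_eq_zero_zmod

end Family

end

section

variable {k : Type t} [Field k] {𝒰 : Type u} [Category.{v} 𝒰]
  {A : LinQuiver.{u, v, w, w', t} k 𝒰} {M : Type*} [AddCommGroup M] [Module k M]
  {W : 𝒰} {St : Type*} {ι ι' : Type*}

open Simp

/-! ## First order deformations of sources -/

section

variable {par : St → ZMod 2} {η : Module.End k M} {Y T U : Tr A W St M} {δ : ZMod 2}

theorem Comm.pass (h : Comm par Y η 0 0) (κ : St → HH A W → M) (s : St) : Y (fun s' y => η (κ s' y)) s = η (Y κ s) := by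
  rw [h κ s]; simp

theorem Comm.pass_neg (h : Comm par T η 0 1) (κ : St → HH A W → M) (s : St) :
    T (fun s' y => η (κ s' y)) s = - η (T κ s) := by
  rw [h κ s, ← neg_eq_iff_eq_neg]
  refine (congrFun (map_neg T _) s).symm.trans (tr_congr T (fun s' y => ?_) s)
  simp [sg_one]

theorem Comm.eta_pass_eta (hη : η * η = 0) (h : Comm par U η 0 δ) (κ : St → HH A W → M) (s : St) :
    η (U (fun s' y => η (κ s' y)) s) = 0 := by
  rw [h _ s]
  have : ∀ m, η (η m) = 0 := fun m => LinearMap.congr_fun hη m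
  simp only [this, smul_zero]
  exact congrFun (map_zero U) s

theorem Comm.neg_op {x : Module.End k M} {ε : ZMod 2} (h : Comm par Y x ε δ) :
    Comm par Y (-x) ε δ := by
  intro κ s
  rw [LinearMap.neg_apply, h κ s]
  refine (congrFun (map_neg Y _) s).symm.trans (tr_congr Y (fun s' y => ?_) s)
  simp

theorem Comm.neg_tr {x : Module.End k M} {ε : ZMod 2} (h : Comm par Y x ε δ) :
    Comm par (-Y) x ε δ := by
  intro κ s
  exact (map_neg x _).trans (congrArg Neg.neg (h κ s))

theorem tr_add {X : Type*} (Y : (St → X → M) →ₗ[k] (St → M)) (κ κ' : St → X → M) (s : St) :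
    Y (fun s' y => κ s' y + κ' s' y) s = Y κ s + Y κ' s := congrFun (map_add Y κ κ') s

variable (obj : St → A.Ob W)

theorem chain_deform (hη : η * η = 0) (hY : Comm par Y η 0 0) (hT : Comm par T η 0 δ) (q : ℕ) (K s) :
    chain obj (Y + postT η ∘ₗ T) q K s = chain obj Y q K s + η (dchain obj Y T q K s) := by
  induction q generalizing s K with
  | zero => exact (add_zero _).symm.trans (congrArg (_ + ·) (map_zero η).symm)
  | succ q ih =>
    change Y (fun s' y => chain obj _ q _ s') s + η (T (fun s' y => chain obj _ q _ s') s) =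
      Y _ s + η (T _ s + Y _ s)
    simp only [ih]
    rw [tr_add, tr_add, hY.pass, map_add, map_add, hT.eta_pass_eta hη]
    abel

theorem dchain_deform (hη : η * η = 0) (hY : Comm par Y η 0 0) (hT : Comm par T η 0 1)
    (hU : Comm par U η 0 δ) (q : ℕ) (K s) :
    dchain obj (Y + postT η ∘ₗ T) (T + postT η ∘ₗ U) q K s =
      dchain obj Y T q K s + η (dchain obj Y U q K s) := by
  induction q generalizing s K with
  | zero => exact (add_zero _).symm.trans (congrArg (_ + ·) (map_zero η).symm)
  | succ q ih =>
    change (T (fun s' y => chain obj _ q _ s') s + η (U (fun s' y => chain obj _ q _ s') s)) +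
        (Y (fun s' y => dchain obj _ _ q _ s') s + η (T (fun s' y => dchain obj _ _ q _ s') s)) =
      (T _ s + Y _ s) + η (U _ s + Y _ s)
    simp only [ih, chain_deform obj hη hY hT]
    have h0 : ∀ m, η (η m) = 0 := fun m => LinearMap.congr_fun hη m
    simp only [tr_add, hY.pass, map_add, map_neg, hU.eta_pass_eta hη, hT.pass_neg, h0]
    abel

theorem dchain_deform_right (hY : Comm par Y η 0 0) (q : ℕ) (K s) :
    dchain obj Y (T + postT η ∘ₗ U) q K s =
      dchain obj Y T q K s + η (dchain obj Y U q K s) := by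
  induction q generalizing s K with
  | zero => exact (add_zero _).symm.trans (congrArg (_ + ·) (map_zero η).symm)
  | succ q ih =>
    change (T (fun s' y => chain obj _ q _ s') s + η (U (fun s' y => chain obj _ q _ s') s)) +
        Y (fun s' y => dchain obj _ _ q _ s') s =
      (T _ s + Y _ s) + η (U _ s + Y _ s)
    simp only [ih]
    simp only [tr_add, hY.pass, map_add]
    abel

end

theorem oneBox_deform {θ : GSObj A} {x η : Module.End k M} {ε : ZMod 2} {obj : St → A.Ob W}
    {par : St → ZMod 2} {V : 𝒰} {σ : Simp V W} {C C₀ C₁ : WTr A W St M} {c : k}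
    (hx : ∀ m, x (η m) = c • η (x m)) {κ} {s : St}
    (hC : ∀ K, C K s = C₀ K s + η (C₁ K s)) :
    oneBox θ x ε obj par σ C κ s = oneBox θ x ε obj par σ C₀ κ s +
      c • η (oneBox θ x ε obj par σ C₁ κ s) := by
  rw [oneBox_apply, oneBox_apply, oneBox_apply, hC, map_add, smul_add, hx, map_smul, smul_comm c]

namespace Family

variable {F : Family A M ι} {η : Module.End k M}

theorem boxN_deform_aux {c : k} {obj : St → A.Ob W} {par : St → ZMod 2} {V : 𝒰} {σ : Simp V W}
    (hx : ∀ i ∈ F.lab σ.length, ∀ m, F.N i (η m) = c • η (F.N i m))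
    {C C₀ C₁ : ℕ → WTr A W St M} {s : St}
    (hC : ∀ q K, C q K s = C₀ q K s + η (C₁ q K s)) (κ) :
    F.boxN obj par σ C κ s = F.boxN obj par σ C₀ κ s + c • η (F.boxN obj par σ C₁ κ s) := by
  rw [boxN_apply, boxN_apply, boxN_apply, map_sum, Finset.smul_sum, ← Finset.sum_add_distrib]
  refine Finset.sum_congr rfl fun i hi => ?_
  cases F.ar i σ.length with
  | none => simp
  | some q => exact oneBox_deform (hx i hi) (hC q)

theorem boxT_deform_aux {c : k} {obj : St → A.Ob W} {par : St → ZMod 2}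
    (hx : ∀ i ∈ F.lab 0, ∀ m, F.T i (η m) = c • η (F.T i m))
    {C C₀ C₁ : ℕ → WTr A W St M} {s : St}
    (hC : ∀ q K, C q K s = C₀ q K s + η (C₁ q K s)) (κ) :
    F.boxT obj par C κ s = F.boxT obj par C₀ κ s + c • η (F.boxT obj par C₁ κ s) := by
  rw [boxT_apply, boxT_apply, boxT_apply, map_sum, Finset.smul_sum, ← Finset.sum_add_distrib]
  refine Finset.sum_congr rfl fun i hi => ?_
  cases F.ar i 0 with
  | none => simp
  | some q => exact oneBox_deform (hx i hi) (hC q)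

theorem Rel.boxN_deform (hη : F.Rel η 0 1) {obj : St → A.Ob W} {par : St → ZMod 2} {V : 𝒰}
    {σ : Simp V W} {C C₀ C₁ : ℕ → WTr A W St M} {s : St}
    (hC : ∀ q K, C q K s = C₀ q K s + η (C₁ q K s)) (κ) :
    F.boxN obj par σ C κ s = F.boxN obj par σ C₀ κ s + η (F.boxN obj par σ C₁ κ s) := by
  rw [boxN_deform_aux (c := 1) (fun i _ m => ?_) hC, one_smul]
  have := LinearMap.congr_fun (hη.relN i) m
  simp at this
  rw [this, one_smul]

theorem Rel.boxT_deform (hη : F.Rel η 0 1) {obj : St → A.Ob W} {par : St → ZMod 2}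
    {C C₀ C₁ : ℕ → WTr A W St M} {s : St}
    (hC : ∀ q K, C q K s = C₀ q K s + η (C₁ q K s)) (κ) :
    F.boxT obj par C κ s = F.boxT obj par C₀ κ s - η (F.boxT obj par C₁ κ s) := by
  rw [boxT_deform_aux (c := -1) (fun i _ m => ?_) hC, neg_one_smul, sub_eq_add_neg]
  have := LinearMap.congr_fun (hη.relT i) m
  simp [sg_one] at this
  rw [this]; simp

theorem Rel.neg_op {x : Module.End k M} {ε δ : ZMod 2} (h : F.Rel x ε δ) : F.Rel (-x) ε δ where
  relN i := by rw [neg_mul, h.relN, mul_neg, smul_neg]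
  relT i := by rw [neg_mul, h.relT, mul_neg, smul_neg]

theorem shrink_boxT (obj : St → A.Ob W) (par : St → ZMod 2) {V : 𝒰}
    {C : ℕ → WTr A V (Simp V W × St) M} (hC : ∀ q, Shrink (C q)) :
    Shrink (F.boxT (lev obj V) (lpar par V) C) := by
  intro κ κ' τ s h
  exact boxT_congr F fun q g => hC q _ _ _ _ fun τ' s' y h' hb => h _ _ _ h' hb

theorem shrink_tHat_Z (obj : St → A.Ob W) (par : St → ZMod 2) (Y : Tr A W St M) (V : 𝒰) :
    Shrink (F.tHat (lev obj V) (lpar par V) (F.Z obj par Y V)) :=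
  shrink_boxT obj par fun q => (shrink_Z F obj par Y V).chain q

theorem _root_.LaxPrestack.Shrink.postT {V : 𝒰} {X : Type*}
    {G : (Simp V W × St → X → M) →ₗ[k] (Simp V W × St → M)} (x : Module.End k M)
    (h : Shrink G) : Shrink (postT x ∘ₗ G) :=
  fun κ κ' τ s hκ => congrArg x (h κ κ' τ s hκ)

/-! ## The quadratic operation -/

variable (F) in
/-- All stackings whose result has at least one arrow, with one box without arrows: it is stacked on a
box with arrows, or trees of boxes with arrows are stacked on it. -/
noncomputable def QN (obj : St → A.Ob W) (par : St → ZMod 2) (Y : Tr A W St M) {V : 𝒰}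
    (σ : Simp V W) (κ : St → HH A V → M) (s : St) : M :=
  F.boxN obj par σ (dchain obj Y (F.tHat obj par Y)) κ s -
    F.tHat (lev obj V) (lpar par V) (F.Z obj par Y V)
      (fun p y => if p.1.length = 1 then κ p.2 y else 0) (σ, s)

variable (F) in
/-- All stackings of two boxes without arrows. -/
noncomputable def QT (obj : St → A.Ob W) (par : St → ZMod 2) (Y : Tr A W St M)
    (κ : St → HH A W → M) (s : St) : M := - F.ttHat obj par Y κ s

variable (F) in
/-- The sources through which all operators of the family can be moved. -/
structure Good (par : St → ZMod 2) (Y : Tr A W St M) : Prop where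
  commN : ∀ i, Comm par Y (F.N i) (F.e i) 0
  commT : ∀ i, Comm par Y (F.T i) (F.e i + 1) 0

variable (F) in
/-- The sign rules for the operators of a family. -/
structure Rels : Prop where
  par : F.Par
  relN : ∀ i, F.Rel (F.N i) (F.e i) 0
  relT : ∀ i, F.Rel (F.T i) (F.e i + 1) 1

/-- The boxes of the second family collect the quadratic operation of the first one. -/
def Collects.{x, y} {k : Type t} [Field k] {𝒰 : Type u} [Category.{v} 𝒰]
    {A : LinQuiver.{u, v, w, w', t} k 𝒰} {M : Type y} [AddCommGroup M] [Module k M]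
    {ι ι' : Type*} (F : Family A M ι) (G : Family A M ι') : Prop :=
  ∀ (W : 𝒰) (St : Type (max u v x)) (obj : St → A.Ob W) (par : St → ZMod 2) (Y : Tr A W St M),
    F.Good par Y →
    (∀ (V : 𝒰) (σ : Simp V W) (κ s), 0 < σ.length →
      G.boxN obj par σ (chain obj Y) κ s = F.QN obj par Y σ κ s) ∧
    ∀ κ s, G.boxT obj par (chain obj Y) κ s = F.QT obj par Y κ s

/-- Two families together. The operators of the second one are composed with `η`. -/
def ext (F : Family A M ι) (G : Family A M ι') (η : Module.End k M) : Family A M (ι ⊕ ι') where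
  θ := Sum.elim F.θ G.θ
  lab p := (F.lab p).disjSum (G.lab p)
  ar := Sum.elim F.ar G.ar
  e := Sum.elim F.e G.e
  N := Sum.elim F.N fun i => η * G.N i
  T := Sum.elim F.T fun i => η * G.T i

variable {G : Family A M ι'}

theorem oneBox_eta (θ : GSObj A) (x : Module.End k M) (ε : ZMod 2) (obj : St → A.Ob W)
    (par : St → ZMod 2) {V : 𝒰} (σ : Simp V W) (C : WTr A W St M) (κ s) :
    oneBox θ (η * x) ε obj par σ C κ s = η (oneBox θ x ε obj par σ C κ s) := by
  rw [oneBox_apply, oneBox_apply, map_smul]; rfl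

theorem ext_boxN (obj : St → A.Ob W) (par : St → ZMod 2) {V : 𝒰} (σ : Simp V W)
    (C : ℕ → WTr A W St M) (κ s) : (F.ext G η).boxN obj par σ C κ s =
      F.boxN obj par σ C κ s + η (G.boxN obj par σ C κ s) := by
  rw [boxN_apply, boxN_apply, boxN_apply, Family.ext, Finset.sum_disjSum, map_sum]
  refine congrArg (_ + ·) (Finset.sum_congr rfl fun i _ => ?_)
  change (G.ar i σ.length).elim 0 _ = _
  cases G.ar i σ.length with
  | none => exact (map_zero η).symm
  | some q => exact oneBox_eta _ _ _ _ _ _ _ _ _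

theorem ext_boxT (obj : St → A.Ob W) (par : St → ZMod 2)
    (C : ℕ → WTr A W St M) (κ s) : (F.ext G η).boxT obj par C κ s =
      F.boxT obj par C κ s + η (G.boxT obj par C κ s) := by
  rw [boxT_apply, boxT_apply, boxT_apply, Family.ext, Finset.sum_disjSum, map_sum]
  refine congrArg (_ + ·) (Finset.sum_congr rfl fun i _ => ?_)
  change (G.ar i 0).elim 0 _ = _
  cases G.ar i 0 with
  | none => exact (map_zero η).symm
  | some q => exact oneBox_eta _ _ _ _ _ _ _ _ _

theorem Good.Z (hF : F.Rels) {par : St → ZMod 2} {Y : Tr A W St M} (hY : F.Good par Y)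
    (obj : St → A.Ob W) (V : 𝒰) : F.Good (lpar par V) (F.Z obj par Y V) where
  commN i := (hF.relN i).Z hF.par (hY.commN i) V
  commT i := (hF.relT i).Z hF.par (hY.commT i) V

theorem tHat_Z_nil (obj : St → A.Ob W) (par : St → ZMod 2) (Y : Tr A W St M) (κ s) :
    F.tHat (lev obj W) (lpar par W) (F.Z obj par Y W) κ (nil W, s) =
      F.tHat obj par Y (fun s' y => κ (nil W, s') y) s := by
  have h : ∀ q K s, chain (lev obj W) (F.Z obj par Y W) q K (nil W, s) =
      chain obj Y q (fun s' l => K (nil W, s') l) s := by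
    intro q
    induction q with
    | zero => intro K s; rfl
    | succ q ih =>
      intro K s
      change bindT _ _ _ _ _ = bindT _ _ _ _ _
      rw [bindT_apply, bindT_apply, Z_nil]
      exact tr_congr Y (fun s' y => ih _ _) s
  rw [tHat, tHat, boxT_apply, boxT_apply]
  refine Finset.sum_congr rfl fun i _ => ?_
  cases F.ar i 0 with
  | none => rfl
  | some q =>
    change oneBox _ _ _ _ _ _ _ _ _ = oneBox _ _ _ _ _ _ _ _ _
    rw [oneBox_apply, oneBox_apply, h]
    simp [lpar, length, lev, LinQuiver.lower]

theorem _root_.LaxPrestack.Comm.eta {par : St → ZMod 2} {T : Tr A W St M} {δ : ZMod 2}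
    (hη : η * η = 0) (h : Comm par T η 0 δ) : Comm par (postT η ∘ₗ T) η 0 0 := by
  intro κ s
  have h0 : ∀ m, η (η m) = 0 := fun m => LinearMap.congr_fun hη m
  simp only [zero_mul, add_zero, sg_zero, one_smul]
  exact (h0 _).trans (h.eta_pass_eta hη κ s).symm

theorem _root_.LaxPrestack.Comm.comp_eta {par : St → ZMod 2} {T : Tr A W St M} {x : Module.End k M}
    {ε δ δ' : ZMod 2} (hx : x * η = sg k δ' • (η * x)) (h : Comm par T x ε δ) :
    Comm par (postT η ∘ₗ T) x ε (δ + δ') := by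
  intro κ s
  refine (LinearMap.congr_fun hx _).trans ?_
  change sg k δ' • η (x (T κ s)) = _
  rw [h, ← map_smul, smul_tr]
  refine congrArg η (tr_congr T (fun s' y => ?_) s)
  rw [sg_smul_smul]
  congr 2
  ring

/-- The letters, and the letters below a box without arrows. -/
noncomputable def push (F : Family A M ι) (η : Module.End k M) (obj : St → A.Ob W)
    (par : St → ZMod 2) (Y : Tr A W St M) : Tr A W St M := Y + postT η ∘ₗ F.tHat obj par Y

theorem push_neg_apply (obj : St → A.Ob W) (par : St → ZMod 2) (Y : Tr A W St M) (κ s) :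
    push F (-η) obj par Y κ s = Y κ s - η (F.tHat obj par Y κ s) := (sub_eq_add_neg _ _).symm

/-- The conditions on two families and an operator `η` for first order deformations. -/
structure Deform (F : Family A M ι) (G : Family A M ι') (η : Module.End k M) : Prop where
  rels : F.Rels
  sq : η * η = 0
  rel : F.Rel η 0 1
  relN : ∀ p, 0 < p → ∀ i ∈ G.lab p, ∀ m, G.N i (η m) = - η (G.N i m)
  relT : ∀ i ∈ G.lab 0, ∀ m, G.T i (η m) = η (G.T i m)

section

variable (h : Deform F G η)
include h

theorem Deform.eta_eta (m : M) : η (η m) = 0 := LinearMap.congr_fun h.sq m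

theorem Deform.boxN {obj : St → A.Ob W} {par : St → ZMod 2} {V : 𝒰}
    {σ : Simp V W} (hσ : 0 < σ.length) {C C₀ C₁ : ℕ → WTr A W St M} {s : St}
    (hC : ∀ q K, C q K s = C₀ q K s + η (C₁ q K s)) (κ) :
    G.boxN obj par σ C κ s = G.boxN obj par σ C₀ κ s - η (G.boxN obj par σ C₁ κ s) := by
  rw [boxN_deform_aux (c := -1) (fun i hi m => ?_) hC, neg_one_smul, sub_eq_add_neg]
  rw [h.relN _ hσ i hi, neg_one_smul]

theorem Deform.boxT {obj : St → A.Ob W} {par : St → ZMod 2}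
    {C C₀ C₁ : ℕ → WTr A W St M} {s : St}
    (hC : ∀ q K, C q K s = C₀ q K s + η (C₁ q K s)) (κ) :
    G.boxT obj par C κ s = G.boxT obj par C₀ κ s + η (G.boxT obj par C₁ κ s) := by
  rw [boxT_deform_aux (c := 1) (fun i hi m => ?_) hC, one_smul]
  rw [h.relT i hi, one_smul]

theorem Deform.neg : Deform F G (-η) where
  rels := h.rels
  sq := by rw [neg_mul_neg, h.sq]
  rel := h.rel.neg_op
  relN p hp i hi m := by
    rw [LinearMap.neg_apply, LinearMap.neg_apply, map_neg, h.relN p hp i hi]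
  relT i hi m := by
    rw [LinearMap.neg_apply, LinearMap.neg_apply, map_neg, h.relT i hi]

theorem Deform.good_push {obj : St → A.Ob W} {par : St → ZMod 2} {Y : Tr A W St M}
    (hY : F.Good par Y) : F.Good par (push F η obj par Y) where
  commN i := by
    refine (hY.commN i).add (Comm.comp_eta (δ := 0) (δ' := 0) ?_ ?_)
    · rw [h.rel.relN, zero_mul, sg_zero, one_smul, one_smul]
    · exact Rel.tHat h.rels.par (h.rels.relN i) (hY.commN i)
  commT i := by
    have := Comm.comp_eta (δ := 1) (δ' := 1) (η := η) (x := F.T i) ?_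
      (Rel.tHat (obj := obj) h.rels.par (h.rels.relT i) (hY.commT i))
    · exact (hY.commT i).add this
    · rw [h.rel.relT, zero_mul, zero_add, smul_smul, sg_mul_self, one_smul]

theorem Deform.comm_push {obj : St → A.Ob W} {par : St → ZMod 2} {Y : Tr A W St M}
    (hY : Comm par Y η 0 0) : Comm par (push F η obj par Y) η 0 0 :=
  hY.add (Comm.eta h.sq (Rel.tHat h.rels.par h.rel hY))

theorem Deform.comm_ttHat {obj : St → A.Ob W} {par : St → ZMod 2} {Y : Tr A W St M}
    (hY : Comm par Y η 0 0) : Comm par (F.ttHat obj par Y) η 0 0 := by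
  have := Rel.boxT (obj := obj) h.rels.par h.rel
    (fun q => CommW.dchain obj hY (Rel.tHat (obj := obj) h.rels.par h.rel hY) q)
  rwa [CharTwo.add_self_eq_zero] at this

theorem Deform.chain_push {obj : St → A.Ob W} {par : St → ZMod 2} {Y : Tr A W St M}
    (hY : Comm par Y η 0 0) (q : ℕ) (K s) : chain obj (push F η obj par Y) q K s =
      chain obj Y q K s + η (dchain obj Y (F.tHat obj par Y) q K s) :=
  chain_deform obj h.sq hY (Rel.tHat h.rels.par h.rel hY) q K s

theorem Deform.tHat_push {obj : St → A.Ob W} {par : St → ZMod 2} {Y : Tr A W St M}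
    (hY : Comm par Y η 0 0) (κ s) : F.tHat obj par (push F η obj par Y) κ s =
      F.tHat obj par Y κ s - η (F.ttHat obj par Y κ s) :=
  h.rel.boxT_deform (fun q K => h.chain_push hY q K s) κ

theorem Deform.tHat_push_eq {obj : St → A.Ob W} {par : St → ZMod 2} {Y : Tr A W St M}
    (hY : Comm par Y η 0 0) : F.tHat obj par (push F η obj par Y) =
      F.tHat obj par Y + postT η ∘ₗ (-F.ttHat obj par Y) := by
  refine LinearMap.ext fun κ => funext fun s => ?_
  rw [h.tHat_push hY, sub_eq_add_neg, ← map_neg]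
  rfl

theorem Deform.dchain_push {obj : St → A.Ob W} {par : St → ZMod 2} {Y : Tr A W St M}
    (hY : Comm par Y η 0 0) (q : ℕ) (K s) :
    dchain obj (push F η obj par Y) (F.tHat obj par (push F η obj par Y)) q K s =
      dchain obj Y (F.tHat obj par Y) q K s + η (dchain obj Y (-F.ttHat obj par Y) q K s) := by
  rw [h.tHat_push_eq hY]
  refine dchain_deform (δ := 0) obj h.sq hY (Rel.tHat h.rels.par h.rel hY) ?_ q K s
  exact (h.comm_ttHat hY).neg_tr

theorem Deform.push_neg_push {obj : St → A.Ob W} {par : St → ZMod 2} {Y : Tr A W St M}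
    (hY : Comm par Y η 0 0) : push F (-η) obj par (push F η obj par Y) = Y := by
  refine LinearMap.ext fun κ => funext fun s => ?_
  rw [push_neg_apply, h.tHat_push hY, map_sub, h.eta_eta, sub_zero]
  exact add_sub_cancel_right _ _

end

section

universe x y

variable {k : Type t} [Field k] {𝒰 : Type u} [Category.{v} 𝒰]
  {A : LinQuiver.{u, v, w, w', t} k 𝒰} {M : Type y} [AddCommGroup M] [Module k M]
  {W : 𝒰} {St : Type (max u v x)} {ι ι' : Type*} {F : Family A M ι}
  {G : Family A M ι'} {η : Module.End k M}

theorem bdryAppend_of_bdry {V W X : 𝒰} {σ τ : Simp V W} (h : τ.bdry = σ.bdry) (ρ : Simp W X) :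
    τ.bdryAppend ρ = σ.bdryAppend ρ := by
  cases σ with
  | nil =>
    cases τ with
    | nil => rfl
    | cons => cases h
  | cons f σ =>
    cases τ with
    | nil => cases h
    | cons g τ =>
      have h' : cons (comp g τ) (nil W) = cons (comp f σ) (nil W) := h
      rw [Simp.cons.injEq] at h'
      obtain ⟨-, h', -⟩ := h'
      exact congrArg (fun f => cons f ρ) (eq_of_heq h')

theorem dec_first {V W : 𝒰} {f : Simp V W → M} (σ : Simp V W) (hσ : 0 < σ.length) :
    (dec σ fun _ a b => if a.length = 1 then f (a.bdryAppend b) else 0) = f σ := by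
  cases σ with
  | nil => exact absurd hσ (lt_irrefl _)
  | cons g σ =>
    change (if 0 = 1 then _ else 0) + dec σ (fun _ a b => if a.length + 1 = 1 then _ else 0) = _
    rw [dec_eq, decPos_congr σ (g' := fun _ _ _ => 0) fun W' a b _ ha => if_neg (by omega)]
    have : (decPos σ fun W' (_ : Simp _ W') (_ : Simp W' W) => (0 : M)) = 0 :=
      (map_decPos (0 : M →+ M) σ fun _ _ _ => 0).symm
    rw [this]
    simp [length, bdryAppend, comp]

theorem Deform.Z_push_neg (h : Deform F G η) (hc : Collects.{u, v, w, w', t, x} F G)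
    {obj : St → A.Ob W} {par : St → ZMod 2} {Y : Tr A W St M} (hY : F.Good par Y)
    (hYη : Comm par Y η 0 0) (V : 𝒰) :
    (F.ext G η).Z obj par (push F (-η) obj par Y) V =
      push F (-η) (lev obj V) (lpar par V) (F.Z obj par Y V) := by
  suffices H : ∀ n V κ (τ : Simp V W) s, τ.length ≤ n →
      (F.ext G η).Z obj par (push F (-η) obj par Y) V κ (τ, s) =
        push F (-η) (lev obj V) (lpar par V) (F.Z obj par Y V) κ (τ, s) from
    LinearMap.ext fun κ => funext fun ⟨τ, s⟩ => H _ V κ τ s le_rfl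
  intro n
  induction n with
  | zero =>
    intro V κ τ s hτ
    cases τ with
    | nil => rw [Z_nil, push_neg_apply, push_neg_apply, Z_nil, tHat_Z_nil]
    | cons => simp [length] at hτ
  | succ n ih =>
    intro V κ τ s hτ
    cases hτ' : τ with
    | nil => rw [Z_nil, push_neg_apply, push_neg_apply, Z_nil, tHat_Z_nil]
    | cons f τ0 =>
    rw [← hτ', push_neg_apply, Z_eq, Z_eq, recB_apply, recB_apply]
    have hτ0 : 0 < τ.length := by rw [hτ']; exact Nat.succ_pos _
    have hl : leaf (push F (-η) obj par Y) V κ (τ, s) = 0 := by subst hτ'; rfl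
    have hl' : leaf Y V κ (τ, s) = 0 := by subst hτ'; rfl
    rw [hl, hl', zero_add, zero_add]
    have hT : F.tHat (lev obj V) (lpar par V) (F.Z obj par Y V) κ (τ, s) =
        decPos τ fun W' σ ρ => F.tHat (lev (lev obj W') V) (lpar (lpar par W') V)
          (F.Z (lev obj W') (lpar par W') (F.Z obj par Y W') V)
          (fun p y => if p.1.length = 1 then κ (σ.bdryAppend p.2.1, p.2.2) y else 0)
          (σ, (ρ, s)) := by
      have h1 : F.tHat (lev obj V) (lpar par V) (F.Z obj par Y V) κ (τ, s) =
          F.tHat (lev obj V) (lpar par V) (F.Z obj par Y V) (nabla fun W' a p y =>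
            if a.length = 1 then κ (a.bdryAppend p.1, p.2) y else 0) (τ, s) := by
        refine shrink_tHat_Z obj par Y V _ _ _ _ fun τ' s' y _ hb => ?_
        refine (dec_first (f := fun ρ => κ (ρ, s') y) τ' ?_).symm
        cases τ' with
        | nil => subst hτ'; cases hb
        | cons => exact Nat.succ_pos _
      rw [h1, F.split_tHat_Z obj par Y τ.length V _ τ s le_rfl, dec_eq, tHat_Z_nil]
      refine (congrArg (· + _) (congrFun (map_zero _) _)).trans ((zero_add _).trans ?_)
      refine decPos_congr _ fun W' σ ρ _ _ => ?_
      refine shrink_tHat_Z (lev obj W') (lpar par W') (F.Z obj par Y W') V _ _ _ _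
        fun τ' s' y _ hb => ?_
      simp only [bdryAppend_of_bdry hb]
    rw [hT, eq_sub_iff_add_eq]
    refine (congrArg (_ + ·) (map_decPos η.toAddMonoidHom τ _)).trans ?_
    rw [← decPos_add]
    refine decPos_congr _ fun W' σ ρ hτσ hσ => ?_
    have hρ : ρ.length ≤ n := by
      have := congrArg length hτσ
      rw [length_append] at this
      omega
    have hZη : Comm (lpar par W') (F.Z obj par Y W') η 0 0 := h.rel.Z h.rels.par hYη W'
    have hsh : Shrink (push F (-η) (lev obj W') (lpar par W') (F.Z obj par Y W')) :=
      (shrink_Z F obj par Y W').add ((shrink_tHat_Z obj par Y W').postT (-η))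
    have hC := fun q K => h.neg.chain_push (obj := lev obj W') hZη.neg_op q K (ρ, s)
    rw [boxN_congr (F.ext G η) fun q g => chain_agree (n := n)
      (fun κ τ' s' h' => ih W' κ τ' s' h') hsh q _ _ _ hρ, ext_boxN,
      h.neg.rel.boxN_deform hC, h.neg.boxN hσ hC,
      (hc W' _ (lev obj W') (lpar par W') _ (hY.Z h.rels obj W')).1 V σ _ _ hσ, QN]
    simp only [LinearMap.neg_apply, map_sub, map_neg, h.eta_eta]
    change _ + η _ = _
    abel

section

variable (h : Deform F G η) (hc : Collects.{u, v, w, w', t, x} F G)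
  {obj : St → A.Ob W} {par : St → ZMod 2} {Y : Tr A W St M} (hY : F.Good par Y)
  (hYη : Comm par Y η 0 0)
include h hc hY hYη

theorem Deform.ext_Z (V : 𝒰) : (F.ext G η).Z obj par Y V =
    push F (-η) (lev obj V) (lpar par V) (F.Z obj par (push F η obj par Y) V) := by
  rw [← h.Z_push_neg hc (h.good_push hY) (h.comm_push hYη), h.push_neg_push hYη]

theorem Deform.ext_tHat : (F.ext G η).tHat obj par Y =
    F.tHat obj par Y + postT η ∘ₗ (-F.ttHat obj par Y) := by
  refine LinearMap.ext fun κ => funext fun s => ?_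
  refine (ext_boxT _ _ _ _ _).trans ?_
  rw [(hc W St obj par Y hY).2]
  rfl

theorem Deform.ext_tHat_push_neg : (F.ext G η).tHat obj par (push F (-η) obj par Y) =
    F.tHat obj par Y := by
  refine LinearMap.ext fun κ => funext fun s => ?_
  have hC := fun q K => h.neg.chain_push (obj := obj) hYη.neg_op q K s
  refine (ext_boxT _ _ _ _ _).trans ?_
  rw [h.neg.rel.boxT_deform hC, h.neg.boxT hC, (hc W St obj par Y hY).2]
  simp only [LinearMap.neg_apply, map_add, map_neg, h.eta_eta, QT]
  change _ - -η (F.ttHat obj par Y κ s) + _ = F.tHat obj par Y κ s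
  change F.tHat obj par Y κ s - -η (F.ttHat obj par Y κ s) + _ = F.tHat obj par Y κ s
  abel

/-- The stackings in the extended family that contain one of the new boxes cancel. -/
theorem Deform.ext_QN {V : 𝒰} (σ : Simp V W) (hσ : 0 < σ.length) (κ s) :
    (F.ext G η).QN obj par Y σ κ s = F.QN obj par Y σ κ s := by
  have hp := h.good_push (obj := obj) hY
  have hpη := h.comm_push (obj := obj) hYη
  have e1 := (hc W St obj par _ hp).1 V σ κ s hσ
  have e2 := (hc W St obj par _ hY).1 V σ κ s hσ
  rw [h.boxN hσ (fun q K => h.chain_push hYη q K s) κ, e2, QN, QN] at e1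
  rw [h.rel.boxN_deform (fun q K => h.dchain_push hYη q K s) κ] at e1
  rw [QN, h.ext_Z hc hY hYη, h.ext_tHat_push_neg hc (hp.Z h.rels obj V)
    (h.rel.Z h.rels.par hpη V), h.ext_tHat hc hY hYη, ext_boxN,
    h.rel.boxN_deform (fun q K => dchain_deform_right obj hYη q K s) κ,
    h.boxN hσ (fun q K => dchain_deform_right obj hYη q K s) κ]
  simp only [map_sub, h.eta_eta, sub_zero]
  rw [QN]
  rw [sub_eq_iff_eq_add] at e1
  rw [e1]
  abel

/-- The stackings in the extended family that contain one of the new boxes cancel. -/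
theorem Deform.ext_QT (κ s) : (F.ext G η).QT obj par Y κ s = F.QT obj par Y κ s := by
  have hp := h.good_push (obj := obj) hY
  have e1 := (hc W St obj par _ hp).2 κ s
  have e2 := (hc W St obj par _ hY).2 κ s
  rw [h.boxT (fun q K => h.chain_push hYη q K s) κ, e2, QT, QT] at e1
  rw [ttHat, ttHat, h.rel.boxT_deform (fun q K => h.dchain_push hYη q K s) κ] at e1
  rw [QT, QT, ttHat, h.ext_tHat hc hY hYη, ext_boxT,
    h.rel.boxT_deform (fun q K => dchain_deform_right obj hYη q K s) κ,
    h.boxT (fun q K => dchain_deform_right obj hYη q K s) κ]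
  simp only [map_add, h.eta_eta, add_zero]
  rw [add_comm, ← eq_sub_iff_add_eq] at e1
  rw [e1, ttHat]
  abel

end

end

end Family

end

/-! ## Shapes -/

theorem scan_zero {β : Type*} {q : ℕ} (g : Fin q → β → β) (b : β) : scan g b 0 = b := rfl

theorem scan_succ {β : Type*} {q : ℕ} (g : Fin q → β → β) (b : β) (j : Fin q) :
    scan g b j.succ = g j (scan g b j.castSucc) := rfl

theorem scan_front {β : Type*} {q : ℕ} (g : Fin (q + 1) → β → β) (b : β) (j : Fin (q + 1)) :
    scan g b j.succ = scan (fun i => g i.succ) (g 0 b) j := by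
  induction j using Fin.induction with
  | zero => rfl
  | succ j ih => rw [scan_succ, scan_succ, ← ih]; rfl

namespace Stacking

theorem offsets_front {q : ℕ} (ch : Fin (q + 1) → Stacking) (o : ℕ) (j : Fin (q + 1)) :
    offsets ch o j.succ = offsets (fun i => ch i.succ) ((ch 0).endOff o) j :=
  scan_front _ _ _

theorem sides_front {q : ℕ} (ch : Fin (q + 1) → Stacking) (d : ℕ) (j : Fin (q + 1)) :
    sides ch d j.succ = sides (fun i => ch i.succ) ((ch 0).rdepth d) j :=
  scan_front _ _ _

theorem outs_succ {𝒰 : Type u} [Category.{v} 𝒰] {q : ℕ} (ch : Fin q → Stacking) {V X : 𝒰}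
    (τ : Simp V X) (j : Fin q) : outs ch τ j.succ = (ch j).out (outs ch τ j.castSucc) := rfl

theorem sides_succ {q : ℕ} (ch : Fin q → Stacking) (d : ℕ) (j : Fin q) :
    sides ch d j.succ = (ch j).rdepth (sides ch d j.castSucc) := rfl

theorem outs_front {𝒰 : Type u} [Category.{v} 𝒰] {q : ℕ} (ch : Fin (q + 1) → Stacking) {V X : 𝒰}
    (τ : Simp V X) (j : Fin (q + 1)) :
    outs ch τ j.succ = outs (fun i => ch i.succ) ((ch 0).out τ) j :=
  scan_front _ _ _

theorem endOff_eq (S : Stacking) (o : ℕ) : S.endOff o = o + S.inputs := by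
  induction S generalizing o with
  | unit => rfl
  | box p q r ch ih =>
    have h : ∀ j o, offsets ch o j = o + offsets ch 0 j := by
      intro j
      induction j using Fin.induction with
      | zero => exact fun o => rfl
      | succ j hj =>
        intro o
        rw [offsets_succ, offsets_succ, ih, ih j (offsets ch 0 _), hj]
        exact Nat.add_assoc _ _ _
    exact h (Fin.last q) o

theorem offsets_eq {q : ℕ} (ch : Fin q → Stacking) (o : ℕ) (j : Fin (q + 1)) :
    offsets ch o j = o + offsets ch 0 j := by
  induction j using Fin.induction with
  | zero => rfl
  | succ j hj =>
    rw [offsets_succ, offsets_succ, endOff_eq, endOff_eq _ (offsets ch 0 _), hj]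
    exact Nat.add_assoc _ _ _

theorem offsets_castSucc_add {q : ℕ} (ch : Fin q → Stacking) (o : ℕ) (j : Fin q) :
    offsets ch o j.castSucc + (ch j).inputs = offsets ch o j.succ := by
  rw [offsets_succ, endOff_eq]

theorem inputs_box (p q r : ℕ) (ch : Fin q → Stacking) :
    (box p q r ch).inputs = offsets ch 0 (Fin.last q) := rfl

theorem inputs_unit : unit.inputs = 1 := rfl

/-- The sizes of the boxes of several trees that stand side by side. -/
def layerSizes {q : ℕ} (ch : Fin q → Stacking) : List (ℕ × ℕ × ℕ) :=
  (List.ofFn fun j => sizes (ch j)).flatten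

theorem sizes_box (p q r : ℕ) (ch : Fin q → Stacking) :
    (box p q r ch).sizes = (p, q, r) :: layerSizes ch := by
  rw [sizes]; rfl

theorem sizes_unit : unit.sizes = [] := by rw [sizes]

theorem layerSizes_zero (ch : Fin 0 → Stacking) : layerSizes ch = [] := by
  simp [layerSizes]

theorem layerSizes_succ {q : ℕ} (ch : Fin (q + 1) → Stacking) :
    layerSizes ch = (ch 0).sizes ++ layerSizes fun i => ch i.succ := by
  simp [layerSizes, List.ofFn_succ]

theorem mem_layerSizes {q : ℕ} {ch : Fin q → Stacking} {b : ℕ × ℕ × ℕ} :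
    b ∈ layerSizes ch ↔ ∃ j, b ∈ (ch j).sizes := by
  simp [layerSizes, List.mem_flatten, List.mem_ofFn]

theorem cardBefore_zero {q : ℕ} (ch : Fin (q + 1) → Stacking) : cardBefore ch 0 = 0 := by
  simp [cardBefore]

theorem cardBefore_succ {q : ℕ} (ch : Fin (q + 1) → Stacking) (j : Fin q) :
    cardBefore ch j.succ = (ch 0).card + cardBefore (fun i => ch i.succ) j := by
  simp [cardBefore, Fin.sum_univ_succ]

theorem length_layerSizes {q : ℕ} (ch : Fin q → Stacking) :
    (layerSizes ch).length = ∑ j, (ch j).card := by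
  simp [layerSizes, List.length_flatten, List.sum_ofFn, card, List.map_ofFn, Function.comp_def]

theorem cardBefore_add_le {q : ℕ} (ch : Fin q → Stacking) (j : Fin q) :
    cardBefore ch j + (ch j).card ≤ ∑ i, (ch i).card := by
  have h : (ch j).card = ∑ i : Fin q, if i = j then (ch i).card else 0 := by simp
  rw [cardBefore, h, ← Finset.sum_add_distrib]
  refine Finset.sum_le_sum fun i _ => ?_
  by_cases hij : i = j
  · subst hij; simp
  · simp only [hij, if_false]
    split_ifs <;> simp

theorem card_box (p q r : ℕ) (ch : Fin q → Stacking) :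
    (box p q r ch).card = 1 + ∑ j, (ch j).card := by
  rw [card, sizes_box, List.length_cons, length_layerSizes, Nat.add_comm]

theorem rdepth_box (p q r : ℕ) (ch : Fin q → Stacking) (d : ℕ) :
    (box p q r ch).rdepth d = r + sides ch (d - p) (Fin.last q) := rfl

/-- All boxes have the size of an element of some `C^{p,q}`. -/
def GS (S : Stacking) : Prop := ∀ b ∈ S.sizes, IsGSBox b

theorem gs_unit : unit.GS := by simp [GS, sizes_unit]

theorem gs_box {p q r : ℕ} {ch : Fin q → Stacking} :
    (box p q r ch).GS ↔ r = min 1 p ∧ ∀ j, (ch j).GS := by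
  simp only [GS, sizes_box, List.mem_cons, mem_layerSizes]
  constructor
  · exact fun h => ⟨h _ (Or.inl rfl), fun j b hb => h b (Or.inr ⟨j, hb⟩)⟩
  · rintro ⟨h1, h2⟩ b (rfl | ⟨j, hb⟩)
    · exact h1
    · exact h2 j b hb

theorem length_bdryAppend {𝒰 : Type u} [Category.{v} 𝒰] {V W X : 𝒰} (σ : Simp V W) (τ : Simp W X) :
    (σ.bdryAppend τ).length = min 1 σ.length + τ.length := by
  cases σ with
  | nil => simp [Simp.bdryAppend, Simp.length]
  | cons f σ =>
    simp only [Simp.bdryAppend, Simp.length]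
    omega

theorem length_take {𝒰 : Type u} [Category.{v} 𝒰] {V X : 𝒰} (τ : Simp V X) (p : ℕ)
    (h : p ≤ τ.length) : (τ.take p).length = p := by
  induction p generalizing V with
  | zero => rfl
  | succ p ih =>
    cases τ with
    | nil => simp [Simp.length] at h
    | cons f τ => exact congrArg (· + 1) (ih τ (Nat.le_of_succ_le_succ h))

theorem length_drop {𝒰 : Type u} [Category.{v} 𝒰] {V X : 𝒰} (τ : Simp V X) (p : ℕ) :
    (τ.drop p).length = τ.length - p := by
  induction p generalizing V with
  | zero => rfl
  | succ p ih =>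
    cases τ with
    | nil => exact (Nat.zero_sub _).symm
    | cons f τ =>
      refine (ih τ).trans ?_
      simp [Simp.length]

theorem append_take_drop {𝒰 : Type u} [Category.{v} 𝒰] {V X : 𝒰} (τ : Simp V X) (p : ℕ) :
    (τ.take p).append (τ.drop p) = τ := by
  induction p generalizing V with
  | zero => rfl
  | succ p ih =>
    cases τ with
    | nil => rfl
    | cons f τ => exact congrArg (Simp.cons f) (ih τ)

theorem length_outs_of {𝒰 : Type u} [Category.{v} 𝒰] {q : ℕ} {ch : Fin q → Stacking} {V X : 𝒰}
    (τ : Simp V X) (ha : ∀ j, (ch j).Admissible (sides ch τ.length j.castSucc))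
    (h : ∀ j {V' : 𝒰} (τ : Simp V' X), (ch j).Admissible τ.length →
      ((ch j).out τ).length = (ch j).rdepth τ.length) (j : Fin (q + 1)) :
    (outs ch τ j).length = sides ch τ.length j := by
  induction j using Fin.induction with
  | zero => rfl
  | succ j hj => rw [outs_succ, sides_succ, h j _ (hj ▸ ha j), hj]

theorem length_out {𝒰 : Type u} [Category.{v} 𝒰] {S : Stacking} (hS : S.GS) {V X : 𝒰}
    (τ : Simp V X) (ha : S.Admissible τ.length) : (S.out τ).length = S.rdepth τ.length := by
  induction S generalizing V with
  | unit => rfl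
  | box p q r ch ih =>
    obtain ⟨hr, hch⟩ := gs_box.1 hS
    obtain ⟨hp, ha⟩ := ha
    rw [← length_drop τ p] at ha
    have h := length_outs_of (τ.drop p) ha (fun j _ τ => ih j (hch j) τ) (Fin.last q)
    rw [rdepth_box, out, length_bdryAppend, length_take τ p hp, hr, ← length_drop τ p]
    exact congrArg _ h

theorem length_outs {𝒰 : Type u} [Category.{v} 𝒰] {q : ℕ} {ch : Fin q → Stacking}
    (hch : ∀ j, (ch j).GS) {V X : 𝒰} (τ : Simp V X)
    (ha : ∀ j, (ch j).Admissible (sides ch τ.length j.castSucc)) (j : Fin (q + 1)) :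
    (outs ch τ j).length = sides ch τ.length j :=
  length_outs_of τ ha (fun j _ τ => length_out (hch j) τ) j

/-- The total parity of the boxes of the given sizes. -/
def sizePar (bs : List (ℕ × ℕ × ℕ)) : ZMod 2 :=
  (bs.map fun b => (b.1 + b.2.1 + b.2.2 + 1 : ZMod 2)).sum

/-- The sign of a tree of boxes at left depth `d` whose inputs are numbered from `o` on. -/
def mSign : Stacking → ℕ → ℕ → ZMod 2
  | unit, _, _ => 0
  | box p q r ch, d, o => (p + q + r + 1) * ((d - p : ℕ) + o) +
      ∑ j, mSign (ch j) (sides ch (d - p) j.castSucc) (offsets ch o j.castSucc)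

/-- The sign of several trees that stand side by side. -/
def layerSign {q : ℕ} (ch : Fin q → Stacking) (d o : ℕ) : ZMod 2 :=
  ∑ j, mSign (ch j) (sides ch d j.castSucc) (offsets ch o j.castSucc)

theorem mSign_box (p q r : ℕ) (ch : Fin q → Stacking) (d o : ℕ) :
    (box p q r ch).mSign d o = (p + q + r + 1) * ((d - p : ℕ) + o) + layerSign ch (d - p) o := rfl

theorem layerSign_succ {q : ℕ} (ch : Fin (q + 1) → Stacking) (d o : ℕ) :
    layerSign ch d o = (ch 0).mSign d o +
      layerSign (fun i => ch i.succ) ((ch 0).rdepth d) ((ch 0).endOff o) := by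
  rw [layerSign, Fin.sum_univ_succ]
  refine congrArg₂ (· + ·) rfl (Finset.sum_congr rfl fun j _ => ?_)
  rw [← Fin.succ_castSucc, sides_front, offsets_front]

theorem sizePar_append (a b : List (ℕ × ℕ × ℕ)) : sizePar (a ++ b) = sizePar a + sizePar b := by
  simp [sizePar]

theorem sizePar_layerSizes {q : ℕ} (ch : Fin q → Stacking) :
    sizePar (layerSizes ch) = ∑ j, sizePar (ch j).sizes := by
  induction q with
  | zero => simp [layerSizes_zero, sizePar]
  | succ q ih => rw [layerSizes_succ, sizePar_append, ih, Fin.sum_univ_succ]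

theorem mSign_add (S : Stacking) (d o n : ℕ) :
    S.mSign d (o + n) = S.mSign d o + n * sizePar S.sizes := by
  induction S generalizing d o with
  | unit => simp [mSign, sizes_unit, sizePar]
  | box p q r ch ih =>
    have : layerSign ch (d - p) (o + n) =
        layerSign ch (d - p) o + n * ∑ j, sizePar (ch j).sizes := by
      rw [layerSign, layerSign, Finset.mul_sum, ← Finset.sum_add_distrib]
      refine Finset.sum_congr rfl fun j _ => ?_
      rw [offsets_eq, offsets_eq ch o, Nat.add_right_comm, ih]
    rw [mSign_box, mSign_box, this, sizes_box, ← sizePar_layerSizes]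
    simp only [sizePar, List.map_cons, List.sum_cons]
    push_cast
    ring

theorem layerSign_add {q : ℕ} (ch : Fin q → Stacking) (d o n : ℕ) :
    layerSign ch d (o + n) = layerSign ch d o + n * sizePar (layerSizes ch) := by
  rw [sizePar_layerSizes, layerSign, layerSign, Finset.mul_sum, ← Finset.sum_add_distrib]
  refine Finset.sum_congr rfl fun j _ => ?_
  rw [offsets_eq, offsets_eq ch o, Nat.add_right_comm, mSign_add]

end Stacking

/-! ## Values of trees on words -/

section

variable {k : Type t} [Field k] {𝒰 : Type u} [Category.{v} 𝒰]
  {A : LinQuiver.{u, v, w, w', t} k 𝒰}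

open Simp Stacking

/-- The value of an element of the Gerstenhaber-Schack object. -/
noncomputable def appF (θ : GSObj A) {V W : 𝒰} (σ : Simp V W) {q : ℕ} (b : Fin (q + 1) → A.Ob W)
    (y : Fin q → HH A W) : HH A V :=
  emb (θ q V W σ b fun j => y j (b j.castSucc) (b j.succ))

/-- The value of a tree of elements of the Gerstenhaber-Schack object on a sequence of untyped
morphisms. -/
noncomputable def evO (θ : ℕ → GSObj A) {X : 𝒰} (b : ℕ → A.Ob X) (y : ℕ → HH A X) :
    Stacking → {V : 𝒰} → Simp V X → ℕ → ℕ → HH A V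
  | .unit, _, .nil _, _, o => y o
  | .unit, _, .cons _ _, _, _ => 0
  | .box p _ _ ch, _, τ, c, o =>
    appF (θ c) (τ.take p) (fun j => A.lower (outs ch (τ.drop p) j) (b (offsets ch o j)))
      fun j => evO θ b y (ch j) (outs ch (τ.drop p) j.castSucc) (c + 1 + cardBefore ch j)
        (offsets ch o j.castSucc)

theorem evO_box (θ : ℕ → GSObj A) {X : 𝒰} (b : ℕ → A.Ob X) (y : ℕ → HH A X) (p q r : ℕ)
    (ch : Fin q → Stacking) {V : 𝒰} (τ : Simp V X) (c o : ℕ) :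
    evO θ b y (.box p q r ch) τ c o =
      appF (θ c) (τ.take p) (fun j => A.lower (outs ch (τ.drop p) j) (b (offsets ch o j)))
        fun j => evO θ b y (ch j) (outs ch (τ.drop p) j.castSucc) (c + 1 + cardBefore ch j)
          (offsets ch o j.castSucc) := by
  rw [evO]

theorem evO_shift {θ θ' : ℕ → GSObj A} {X : 𝒰} {b b' : ℕ → A.Ob X} {y y' : ℕ → HH A X}
    (S : Stacking) {V : 𝒰} (τ : Simp V X) (c c' o o' : ℕ)
    (hθ : ∀ i < S.card, θ (c + i) = θ' (c' + i)) (hb : ∀ i ≤ S.inputs, b (o + i) = b' (o' + i))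
    (hy : ∀ i < S.inputs, y (o + i) = y' (o' + i)) :
    evO θ b y S τ c o = evO θ' b' y' S τ c' o' := by
  induction S generalizing V c c' o o' with
  | unit =>
    cases τ with
    | nil => exact hy 0 Nat.one_pos
    | cons => rfl
  | box p q r ch ih =>
    have hle : ∀ j, offsets ch 0 j ≤ (box p q r ch).inputs := fun j =>
      offsets_mono ch 0 (Fin.le_last j)
    have e1 : θ c = θ' c' := hθ 0 (by rw [card_box]; omega)
    have e2 : ∀ j, b (offsets ch o j) = b' (offsets ch o' j) := fun j => by
      rw [offsets_eq, offsets_eq ch o']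
      exact hb _ (hle j)
    rw [evO_box, evO_box, e1]
    simp only [e2]
    congr 1
    funext j
    have hj := cardBefore_add_le ch j
    have hj' := offsets_castSucc_add ch 0 j
    have hj'' := hle j.succ
    refine ih j _ _ _ _ _ (fun i hi => ?_) (fun i hi => ?_) (fun i hi => ?_)
    · have := hθ (1 + cardBefore ch j + i) (by rw [card_box]; omega)
      rwa [← add_assoc, ← add_assoc, ← add_assoc, ← add_assoc] at this
    · rw [offsets_eq, offsets_eq ch o', add_assoc, add_assoc]
      exact hb _ (by omega)
    · rw [offsets_eq, offsets_eq ch o', add_assoc, add_assoc]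
      exact hy _ (by omega)

/-- The values of several trees that stand side by side. -/
noncomputable def layerW (θ : ℕ → GSObj A) {X : 𝒰} (b : ℕ → A.Ob X) (y : ℕ → HH A X) {q : ℕ}
    (ch : Fin q → Stacking) {V : 𝒰} (ρ : Simp V X) (c o : ℕ) : Word A V :=
  List.ofFn fun j => (evO θ b y (ch j) (outs ch ρ j.castSucc) (c + cardBefore ch j)
    (offsets ch o j.castSucc), A.lower (outs ch ρ j.succ) (b (offsets ch o j.succ)))

theorem layerW_succ (θ : ℕ → GSObj A) {X : 𝒰} (b : ℕ → A.Ob X) (y : ℕ → HH A X) {q : ℕ}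
    (ch : Fin (q + 1) → Stacking) {V : 𝒰} (ρ : Simp V X) (c o : ℕ) :
    layerW θ b y ch ρ c o =
      (evO θ b y (ch 0) ρ c o, A.lower ((ch 0).out ρ) (b ((ch 0).endOff o))) ::
        layerW θ b y (fun i => ch i.succ) ((ch 0).out ρ) (c + (ch 0).card) ((ch 0).endOff o) := by
  rw [layerW, List.ofFn_succ, cardBefore_zero]
  refine congrArg₂ List.cons rfl ?_
  rw [layerW]
  refine congrArg List.ofFn (funext fun j => ?_)
  rw [cardBefore_succ, ← Fin.succ_castSucc, outs_front, outs_front, offsets_front, offsets_front,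
    add_assoc]

theorem valAt_ofFn {W : 𝒰} {q : ℕ} (f : Fin q → HH A W × A.Ob W) (j : Fin q) :
    valAt (List.ofFn f) j = (f j).1 := by
  induction q with
  | zero => exact j.elim0
  | succ q ih =>
    rw [List.ofFn_succ]
    cases j using Fin.cases with
    | zero => rfl
    | succ j => exact ih _ j

theorem objAt_ofFn_succ {W : 𝒰} {q : ℕ} (b : A.Ob W) (f : Fin q → HH A W × A.Ob W) (j : Fin q) :
    objAt b (List.ofFn f) (j + 1) = (f j).2 := by
  induction q generalizing b with
  | zero => exact j.elim0
  | succ q ih =>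
    rw [List.ofFn_succ]
    cases j using Fin.cases with
    | zero => exact objAt_zero _ _
    | succ j => exact ih _ _ j

theorem app_eq_appF (θ : GSObj A) {V W : 𝒰} (σ : Simp V W) {q q' : ℕ} (h : q = q')
    (b : ℕ → A.Ob W) (y : ℕ → HH A W) (b' : Fin (q' + 1) → A.Ob W) (y' : Fin q' → HH A W)
    (hb : ∀ j : Fin (q' + 1), b j = b' j) (hy : ∀ j : Fin q', y j = y' j) : app θ σ q b y = appF θ σ b' y' := by
  subst h
  have hb' : b' = fun j : Fin (q + 1) => b j := funext fun j => (hb j).symm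
  have hy' : y' = fun j : Fin q => y j := funext fun j => (hy j).symm
  subst hb' hy'
  rfl

theorem appL_layerW (θ : ℕ → GSObj A) {X : 𝒰} (b : ℕ → A.Ob X) (y : ℕ → HH A X) (p q r : ℕ)
    (ch : Fin q → Stacking) {V : 𝒰} (τ : Simp V X) (c o : ℕ) :
    appL (θ c) (τ.take p) (A.lower (τ.drop p) (b o)) (layerW θ b y ch (τ.drop p) (c + 1) o) =
      evO θ b y (.box p q r ch) τ c o := by
  rw [evO_box]
  refine app_eq_appF _ _ (q' := q) List.length_ofFn _ _ _ _ (fun j => ?_) fun j => valAt_ofFn _ j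
  cases j using Fin.cases with
  | zero => exact objAt_zero _ _
  | succ j => exact objAt_ofFn_succ _ _ j

theorem evO_endpoints (θ : ℕ → GSObj A) {X : 𝒰} (b : ℕ → A.Ob X) (y : ℕ → HH A X) {N : ℕ}
    (S : Stacking) {V : 𝒰} (τ : Simp V X) (c o : ℕ) (h : S.endOff o ≤ N) :
    evO θ b y S τ c o (A.lower τ (b o)) (A.lower (S.out τ) (b (S.endOff o))) =
      val θ (fun i : Fin (N + 1) => b i) (fun i => y i (b i) (b (i + 1))) S τ c o h := by
  induction S generalizing V c o with
  | unit => cases τ <;> rfl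
  | box p q r ch ih =>
    rw [evO_box, val]
    refine (emb_apply_cast (A.lower_take_drop p τ _) (A.lower_bdryAppend (τ.take p) _ _) _).trans ?_
    refine congrArg _ (congrArg _ (funext fun j => ?_))
    exact ih j _ _ _ (endOff_child_le ch o j h)

theorem emb_evO_endpoints (θ : ℕ → GSObj A) {X : 𝒰} (b : ℕ → A.Ob X) (y : ℕ → HH A X)
    {S : Stacking} (hS : S ≠ .unit) {V : 𝒰} (τ : Simp V X) (c o : ℕ) :
    emb (evO θ b y S τ c o (A.lower τ (b o)) (A.lower (S.out τ) (b (S.endOff o)))) =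
      evO θ b y S τ c o := by
  cases S with
  | unit => exact absurd rfl hS
  | box p q r ch =>
    rw [evO_box]
    refine (congrArg emb (emb_apply_cast (A.lower_take_drop p τ _)
      (A.lower_bdryAppend (τ.take p) _ _) _)).trans ?_
    exact emb_homCast _ _ _

theorem appL_act (θ : ℕ → GSObj A) (S : Stacking) (hS : S ≠ .unit) {V W : 𝒰} (σ : Simp V W)
    (ho : S.out σ = σ.bdry) (b : A.Ob W) (l : Word A W) (hl : l.length = S.inputs) :
    appL (A := A) (fun q _ _ σ a => S.act θ q σ a) σ b l =
      evO θ (objAt b l) (valAt l) S σ 0 0 := by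
  change app _ σ l.length _ _ = _
  rw [hl]
  change emb (S.act θ S.inputs σ (fun j => objAt b l j) fun j : Fin S.inputs =>
    valAt l j (objAt b l j) (objAt b l (j + 1))) = _
  rw [act, dif_pos ⟨rfl, ho⟩]
  refine (emb_homCast rfl _ (valMap θ S σ (fun j => objAt b l j) _)).trans ?_
  rw [← emb_evO_endpoints _ _ _ hS, evO_endpoints (N := S.inputs) _ _ _ _ _ _ _ le_rfl]
  rfl

end

section

variable {k : Type t} [Field k] {𝒰 : Type u} [Category.{v} 𝒰]
  {A : LinQuiver.{u, v, w, w', t} k 𝒰} {M : Type*} [AddCommGroup M] [Module k M]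
  {W : 𝒰} {St : Type*} {ι : Type*}

open Simp Stacking

theorem chain_congr_end (obj : St → A.Ob W) (Y : Tr A W St M) (q : ℕ) {K K' : St → Word A W → M}
    {s : St} (h : ∀ s' l, l.length = q → objAt (obj s) l q = obj s' → K s' l = K' s' l) :
    chain obj Y q K s = chain obj Y q K' s := by
  induction q generalizing K K' s with
  | zero => exact h s [] rfl rfl
  | succ q ih =>
    exact tr_congr Y (fun s' y => ih fun s'' l h1 h2 => h _ _ (congrArg (· + 1) h1) h2) s

theorem chain_add (obj : St → A.Ob W) (Y : Tr A W St M) (m n : ℕ) (K : St → Word A W → M) (s : St) :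
    chain obj Y (m + n) K s =
      chain obj Y m (fun s' l => chain obj Y n (fun s'' l' => K s'' (l ++ l')) s') s := by
  induction m generalizing K s with
  | zero => rw [Nat.zero_add]; rfl
  | succ m ih =>
    rw [Nat.add_right_comm]
    exact tr_congr Y (fun s' y => ih _ _) s

theorem objAt_append_left {W : 𝒰} (b : A.Ob W) (l l' : Word A W) (n : ℕ) (hn : n ≤ l.length) :
    objAt b (l ++ l') n = objAt b l n := by
  induction l generalizing b n with
  | nil =>
    obtain rfl : n = 0 := Nat.le_zero.1 hn
    simp
  | cons e l ih =>
    cases n with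
    | zero => rfl
    | succ n => exact ih _ _ (Nat.le_of_succ_le_succ hn)

theorem objAt_append_right {W : 𝒰} (b : A.Ob W) (l l' : Word A W) (n : ℕ) :
    objAt b (l ++ l') (l.length + n) = objAt (objAt b l l.length) l' n := by
  induction l generalizing b with
  | nil => simp
  | cons e l ih =>
    rw [List.length_cons, Nat.add_right_comm]
    exact ih _

theorem valAt_append_left {W : 𝒰} (l l' : Word A W) (n : ℕ) (hn : n < l.length) :
    valAt (l ++ l') n = valAt l n := by
  induction l generalizing n with
  | nil => simp at hn
  | cons e l ih =>
    cases n with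
    | zero => rfl
    | succ n => exact ih _ (Nat.lt_of_succ_lt_succ hn)

theorem valAt_append_right {W : 𝒰} (l l' : Word A W) (n : ℕ) :
    valAt (l ++ l') (l.length + n) = valAt l' n := by
  induction l with
  | nil => simp
  | cons e l ih =>
    rw [List.length_cons, Nat.add_right_comm]
    exact ih

theorem layerW_shift {θ θ' : ℕ → GSObj A} {X : 𝒰} {b b' : ℕ → A.Ob X} {y y' : ℕ → HH A X} {q : ℕ}
    (ch : Fin q → Stacking) {V : 𝒰} (τ : Simp V X) (c c' o o' : ℕ)
    (hθ : ∀ i < (layerSizes ch).length, θ (c + i) = θ' (c' + i))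
    (hb : ∀ i ≤ offsets ch 0 (Fin.last q), b (o + i) = b' (o' + i))
    (hy : ∀ i < offsets ch 0 (Fin.last q), y (o + i) = y' (o' + i)) :
    layerW θ b y ch τ c o = layerW θ' b' y' ch τ c' o' := by
  have hle : ∀ j, offsets ch 0 j ≤ offsets ch 0 (Fin.last q) := fun j =>
    offsets_mono ch 0 (Fin.le_last j)
  have e2 : ∀ j, b (offsets ch o j) = b' (offsets ch o' j) := fun j => by
    rw [offsets_eq, offsets_eq ch o']
    exact hb _ (hle j)
  rw [layerW, layerW]
  refine congrArg List.ofFn (funext fun j => ?_)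
  rw [e2]
  congr 1
  have hj := cardBefore_add_le ch j
  have hj' := offsets_castSucc_add ch 0 j
  have hj'' := hle j.succ
  rw [← length_layerSizes] at hj
  refine evO_shift _ _ _ _ _ _ (fun i hi => ?_) (fun i hi => ?_) (fun i hi => ?_)
  · rw [add_assoc, add_assoc]
    exact hθ _ (by omega)
  · rw [offsets_eq, offsets_eq ch o', add_assoc, add_assoc]
    exact hb _ (by omega)
  · rw [offsets_eq, offsets_eq ch o', add_assoc, add_assoc]
    exact hy _ (by omega)

namespace Family

variable (F : Family A M ι)

/-- The operator that comes with a box with `p` arrows. -/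
def op (i : ι) (p : ℕ) : Module.End k M := if p = 0 then F.T i else F.N i

/-- The parity of the operator that comes with a box with `p` arrows. -/
def opPar (i : ι) (p : ℕ) : ZMod 2 := if p = 0 then F.e i + 1 else F.e i

/-- The product of the operators of some boxes. -/
def wordOp : List (ℕ × ℕ × ℕ) → List ι → Module.End k M
  | b :: bs, i :: w => F.op i b.1 * wordOp bs w
  | _, _ => 1

/-- The word can be filled into boxes of the given sizes. -/
def Match (bs : List (ℕ × ℕ × ℕ)) (w : List ι) : Prop :=
  List.Forall₂ (fun b i => i ∈ F.lab b.1 ∧ F.ar i b.1 = some b.2.1) bs w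

/-- The sum over all words that can be filled into boxes of the given sizes. -/
def wordSum {N : Type*} [AddCommMonoid N] : List (ℕ × ℕ × ℕ) → (List ι → N) → N
  | [], f => f []
  | b :: bs, f => ∑ i ∈ F.lab b.1, if F.ar i b.1 = some b.2.1 then wordSum bs (fun w => f (i :: w)) else 0

/-- The elements that are given by a word. -/
noncomputable def word (w : List ι) (n : ℕ) : GSObj A := (w[n]?).elim 0 F.θ

theorem wordSum_congr {N : Type*} [AddCommMonoid N] (bs : List (ℕ × ℕ × ℕ)) {f g : List ι → N}
    (h : ∀ w, F.Match bs w → f w = g w) : F.wordSum bs f = F.wordSum bs g := by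
  induction bs generalizing f g with
  | nil => exact h [] .nil
  | cons b bs ih =>
    refine Finset.sum_congr rfl fun i hi' => ?_
    split_ifs with hi
    · exact ih fun w hw => h _ (.cons ⟨hi', hi⟩ hw)
    · rfl

theorem map_wordSum {N N' : Type*} [AddCommMonoid N] [AddCommMonoid N'] (φ : N →+ N')
    (bs : List (ℕ × ℕ × ℕ)) (f : List ι → N) :
    φ (F.wordSum bs f) = F.wordSum bs fun w => φ (f w) := by
  induction bs generalizing f with
  | nil => rfl
  | cons b bs ih =>
    refine (map_sum φ _ _).trans (Finset.sum_congr rfl fun i _ => ?_)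
    rw [apply_ite φ, map_zero, ih]

theorem wordSum_append {N : Type*} [AddCommMonoid N] (bs bs' : List (ℕ × ℕ × ℕ)) (f : List ι → N) :
    F.wordSum (bs ++ bs') f = F.wordSum bs fun w => F.wordSum bs' fun w' => f (w ++ w') := by
  induction bs generalizing f with
  | nil => rfl
  | cons b bs ih =>
    refine Finset.sum_congr rfl fun i _ => ?_
    exact congrArg (fun x => if F.ar i b.1 = some b.2.1 then x else 0) (ih fun w => f (i :: w))

theorem wordOp_append (bs bs' : List (ℕ × ℕ × ℕ)) (w w' : List ι) (h : bs.length = w.length) :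
    F.wordOp (bs ++ bs') (w ++ w') = F.wordOp bs w * F.wordOp bs' w' := by
  induction bs generalizing w with
  | nil =>
    cases w with
    | nil => simp [wordOp]
    | cons => simp at h
  | cons b bs ih =>
    cases w with
    | nil => simp at h
    | cons i w =>
      simp only [List.cons_append, wordOp]
      rw [ih w (by simpa using h), mul_assoc]

theorem word_append_left (w w' : List ι) (n : ℕ) (h : n < w.length) :
    F.word (w ++ w') n = F.word w n := by
  rw [word, word, List.getElem?_append_left h]

theorem word_append_right (w w' : List ι) (n : ℕ) :
    F.word (w ++ w') (w.length + n) = F.word w' n := by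
  rw [word, word, List.getElem?_append_right (Nat.le_add_right _ _), Nat.add_sub_cancel_left]

theorem word_cons_succ (i : ι) (w : List ι) (n : ℕ) : F.word (i :: w) (n + 1) = F.word w n := by
  rw [word, word, List.getElem?_cons_succ]

theorem word_cons_zero (i : ι) (w : List ι) : F.word (i :: w) 0 = F.θ i := rfl

variable {F}

theorem opPar_eq (hF : F.Par) {i : ι} {p q r : ℕ} (h' : i ∈ F.lab p) (h : F.ar i p = some q) (hr : r = min 1 p) :
    F.opPar i p = p + q + r + 1 := by
  rw [opPar, hF i p q h' h, hr]
  rcases p with - | p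
  · simp
  · simp only [Nat.succ_ne_zero, if_false]
    rw [Nat.min_eq_left (by omega)]
    push_cast
    linear_combination (-1) * two_eq_zero_zmod

theorem Good.comm_op {par : St → ZMod 2} {Y : Tr A W St M} (h : F.Good par Y) (i : ι) (p : ℕ) :
    Comm par Y (F.op i p) (F.opPar i p) 0 := by
  rw [op, opPar]
  split_ifs
  · exact h.commT i
  · exact h.commN i

theorem Good.comm_wordOp (hF : F.Par) {par : St → ZMod 2} {Y : Tr A W St M} (h : F.Good par Y)
    {bs : List (ℕ × ℕ × ℕ)} {w : List ι} (hw : F.Match bs w) (hbs : ∀ b ∈ bs, IsGSBox b) :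
    Comm par Y (F.wordOp bs w) (sizePar bs) 0 := by
  induction hw with
  | nil => exact comm_one par Y
  | @cons b i bs w hi _ ih =>
    have h1 := h.comm_op i b.1
    rw [opPar_eq hF hi.1 hi.2 (hbs b (by simp))] at h1
    have h2 := h1.mul (ih fun b hb => hbs b (by simp [hb]))
    rw [add_zero] at h2
    exact h2

theorem chain_wordSum (hF : F.Par) {obj : St → A.Ob W} {par : St → ZMod 2} {Y : Tr A W St M}
    (h : F.Good par Y) {bs : List (ℕ × ℕ × ℕ)} (hbs : ∀ b ∈ bs, IsGSBox b) (n : ℕ) (a : ZMod 2)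
    (G : List ι → St → Word A W → M) (s : St) :
    chain obj Y n (fun s' l => sg k (a + sizePar bs * par s') •
      F.wordSum bs fun w => F.wordOp bs w (G w s' l)) s =
    sg k (a + sizePar bs * (par s + n)) •
      F.wordSum bs fun w => F.wordOp bs w (chain obj Y n (G w) s) := by
  let ev : (St → Word A W → M) →+ M :=
    { toFun := fun K => chain obj Y n K s
      map_zero' := congrFun (map_zero (chain obj Y n)) s
      map_add' := fun K K' => congrFun (map_add (chain obj Y n) K K') s }
  have h1 : (fun s' l => sg k (a + sizePar bs * par s') •
      F.wordSum bs fun w => F.wordOp bs w (G w s' l)) = F.wordSum bs fun w => fun s' l =>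
        sg k (a + sizePar bs * par s') • F.wordOp bs w (G w s' l) := by
    funext s' l
    refine (map_wordSum F (DistribSMul.toAddMonoidHom M (sg k (a + sizePar bs * par s'))) bs
      _).trans ?_
    exact (map_wordSum F ((Pi.evalAddMonoidHom (fun _ => M) l).comp
      (Pi.evalAddMonoidHom (fun _ => Word A W → M) s')) bs (fun w s' l =>
        sg k (a + sizePar bs * par s') • F.wordOp bs w (G w s' l))).symm
  rw [h1]
  refine (map_wordSum F ev bs _).trans (Eq.trans ?_ (map_wordSum F (DistribSMul.toAddMonoidHom M
    (sg k (a + sizePar bs * (par s + n)))) bs _).symm)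
  refine F.wordSum_congr bs fun w hw => ?_
  change chain obj Y n _ s = sg k _ • F.wordOp bs w (chain obj Y n (G w) s)
  rw [CommW.chain obj (h.comm_wordOp hF hw hbs) n (G w) s, smul_tr]
  refine tr_congr _ (fun s' l => ?_) s
  rw [sg_smul_smul]
  congr 2
  linear_combination (- sizePar bs * (par s + n)) * two_eq_zero_zmod

variable (F)

/-- Boxes with `p` arrows and `q` inputs. -/
noncomputable def boxP (obj : St → A.Ob W) (par : St → ZMod 2) {V : 𝒰} (σ : Simp V W) (p q : ℕ)
    (C : WTr A W St M) : (St → HH A V → M) →ₗ[k] (St → M) :=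
  ∑ i ∈ F.lab p, if F.ar i p = some q then oneBox (F.θ i) (F.op i p) (F.opPar i p) obj par σ C else 0

theorem boxP_apply (obj : St → A.Ob W) (par : St → ZMod 2) {V : 𝒰} (σ : Simp V W) (p q : ℕ)
    (C : WTr A W St M) (κ s) : F.boxP obj par σ p q C κ s = ∑ i ∈ F.lab p, if F.ar i p = some q then
      sg k (F.opPar i p * par s) • F.op i p (C (fun s' l => κ s' (appL (F.θ i) σ (obj s) l)) s)
      else 0 := by
  rw [boxP, LinearMap.sum_apply, Finset.sum_apply]
  refine Finset.sum_congr rfl fun i _ => ?_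
  split_ifs <;> rfl

/-- A box with `p` arrows at the bottom. -/
noncomputable def bottom (obj : St → A.Ob W) (par : St → ZMod 2) (p q : ℕ)
    (C : ∀ V, WTr A V (Simp V W × St) M) (V : 𝒰) : Tr A V (Simp V W × St) M where
  toFun κ x := if p ≤ x.1.length then F.boxP (lev obj _) (lpar par _) (x.1.take p) p q (C _)
    (fun x' y => κ ((x.1.take p).bdryAppend x'.1, x'.2) y) (x.1.drop p, x.2) else 0
  map_add' κ κ' := by
    funext x
    rw [Pi.add_apply]
    split_ifs
    · exact congrFun (map_add (F.boxP (lev obj _) (lpar par _) (x.1.take p) p q (C _))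
        (fun x' y => κ ((x.1.take p).bdryAppend x'.1, x'.2) y) _) _
    · exact (add_zero _).symm
  map_smul' c κ := by
    funext x
    rw [Pi.smul_apply]
    split_ifs
    · exact congrFun (map_smul (F.boxP (lev obj _) (lpar par _) (x.1.take p) p q (C _)) c
        (fun x' y => κ ((x.1.take p).bdryAppend x'.1, x'.2) y)) _
    · exact (smul_zero _).symm

theorem bottom_apply (obj : St → A.Ob W) (par : St → ZMod 2) (p q : ℕ)
    (C : ∀ V, WTr A V (Simp V W × St) M) (V : 𝒰) (κ) (τ : Simp V W) (s : St) :
    F.bottom obj par p q C V κ (τ, s) = if p ≤ τ.length then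
      F.boxP (lev obj _) (lpar par _) (τ.take p) p q (C _)
      (fun x' y => κ ((τ.take p).bdryAppend x'.1, x'.2) y) (τ.drop p, s) else 0 := rfl

/-- All trees of a given shape. -/
noncomputable def tree (obj : St → A.Ob W) (par : St → ZMod 2) (Y : Tr A W St M) :
    Stacking → ∀ V, Tr A V (Simp V W × St) M
  | .unit, V => leaf Y V
  | .box p q _ ch, V =>
    F.bottom obj par p q (fun V' => chainF (lev obj V') q fun j => tree obj par Y (ch j) V') V

theorem tree_box (obj : St → A.Ob W) (par : St → ZMod 2) (Y : Tr A W St M) (p q r : ℕ)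
    (ch : Fin q → Stacking) (V : 𝒰) : F.tree obj par Y (.box p q r ch) V =
      F.bottom obj par p q
        (fun V' => chainF (lev obj V') q fun j => F.tree obj par Y (ch j) V') V := by
  rw [tree]

variable {F}

section

variable (hF : F.Par) {obj : St → A.Ob W} {par : St → ZMod 2} {Y : Tr A W St M} (h : F.Good par Y)
include hF h

open scoped Classical in
theorem layer_eq {V : 𝒰} {q : ℕ} (ch : Fin q → Stacking) (hch : ∀ j, (ch j).GS)
    (ih : ∀ j (κ : Simp V W × St → HH A V → M) τ s, F.tree obj par Y (ch j) V κ (τ, s) =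
      if (ch j).Admissible τ.length then
        sg k ((ch j).mSign τ.length 0 + sizePar (ch j).sizes * par s) •
          F.wordSum (ch j).sizes fun w => F.wordOp (ch j).sizes w (chain obj Y (ch j).inputs
            (fun s' l => κ ((ch j).out τ, s')
              (evO (F.word w) (objAt (obj s) l) (valAt l) (ch j) τ 0 0)) s)
      else 0)
    (K : Simp V W × St → Word A V → M) (ρ : Simp V W) (s : St) :
    chainF (lev obj V) q (fun j => F.tree obj par Y (ch j) V) K (ρ, s) =
      if ∀ j, (ch j).Admissible (sides ch ρ.length j.castSucc) then
        sg k (layerSign ch ρ.length 0 + sizePar (layerSizes ch) * par s) •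
          F.wordSum (layerSizes ch) fun w => F.wordOp (layerSizes ch) w
            (chain obj Y (offsets ch 0 (Fin.last q)) (fun s' l => K (outs ch ρ (Fin.last q), s')
              (layerW (F.word w) (objAt (obj s) l) (valAt l) ch ρ 0 0)) s)
      else 0 := by
  induction q generalizing ρ s K with
  | zero =>
    rw [if_pos fun j => j.elim0, layerSizes_zero]
    simp [layerSign, sizePar, wordSum, wordOp, layerW]
    rfl
  | succ q ihq =>
    have hadm : (∀ j, (ch j).Admissible (sides ch ρ.length j.castSucc)) ↔
        (ch 0).Admissible ρ.length ∧ ∀ j : Fin q, (ch j.succ).Admissible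
          (sides (fun i => ch i.succ) ((ch 0).rdepth ρ.length) j.castSucc) := by
      rw [Fin.forall_fin_succ]
      refine and_congr Iff.rfl (forall_congr' fun j => ?_)
      rw [← Fin.succ_castSucc, sides_front]
    change bindT _ _ _ _ _ = _
    rw [bindT_apply, ih 0]
    by_cases h0 : (ch 0).Admissible ρ.length
    swap
    · rw [if_neg h0, if_neg fun h' => h0 (hadm.1 h').1]
    rw [if_pos h0]
    have hlen := length_out (hch 0) ρ h0
    have hgs : ∀ b ∈ layerSizes fun i => ch i.succ, IsGSBox b := fun b hb => by
      obtain ⟨j, hj⟩ := mem_layerSizes.1 hb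
      exact hch _ b hj
    simp only [fun K s1 => ihq (fun j => ch j.succ) (fun j => hch _) (fun j => ih _) K
      ((ch 0).out ρ) s1]
    by_cases h1 : ∀ j : Fin q, (ch j.succ).Admissible
          (sides (fun i => ch i.succ) ((ch 0).rdepth ρ.length) j.castSucc)
    swap
    · rw [if_neg fun h' => h1 (hadm.1 h').2]
      simp only [hlen, if_neg h1]
      have : ∀ w, F.wordOp (ch 0).sizes w
          (chain obj Y (ch 0).inputs (fun _ _ => (0 : M)) s) = 0 := fun w =>
        (congrArg _ (congrFun (map_zero (chain obj Y (ch 0).inputs)) s)).trans (map_zero _)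
      simp only [this]
      rw [show F.wordSum (ch 0).sizes (fun _ => (0 : M)) = 0 from
        (map_wordSum F (0 : M →+ M) _ fun _ => 0).symm, smul_zero]
    rw [if_pos (hadm.2 ⟨h0, h1⟩)]
    simp only [hlen, if_pos h1]
    simp only [chain_wordSum hF h hgs]
    have hsg : layerSign ch ρ.length 0 + sizePar (layerSizes ch) * par s =
        ((ch 0).mSign ρ.length 0 + sizePar (ch 0).sizes * par s) +
        (layerSign (fun i => ch i.succ) ((ch 0).rdepth ρ.length) 0 +
          sizePar (layerSizes fun i => ch i.succ) * (par s + (ch 0).inputs)) := by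
      rw [layerSign_succ, layerSizes_succ, sizePar_append, endOff_eq, layerSign_add]
      ring
    rw [hsg, ← sg_smul_smul (_ + sizePar (ch 0).sizes * par s) (layerSign _ _ _ + _)]
    refine congrArg (sg k _ • ·) ?_
    rw [layerSizes_succ, wordSum_append]
    refine Eq.trans ?_ (map_wordSum F (DistribSMul.toAddMonoidHom M (sg k _)) _ _).symm
    refine F.wordSum_congr _ fun w hw => ?_
    rw [map_smul]
    refine congrArg (sg k _ • ·) ?_
    refine (map_wordSum F (F.wordOp (ch 0).sizes w).toAddMonoidHom _ _).trans ?_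
    refine F.wordSum_congr _ fun w' hw' => ?_
    rw [wordOp_append F _ _ _ _ hw.length_eq]
    refine congrArg (F.wordOp (ch 0).sizes w) (congrArg (F.wordOp _ w') ?_)
    have hn : offsets ch 0 (Fin.last (q + 1)) =
        (ch 0).inputs + offsets (fun i => ch i.succ) 0 (Fin.last q) := by
      rw [← Fin.succ_last, offsets_front, endOff_eq, offsets_eq, Nat.zero_add]
    rw [hn, chain_add]
    refine chain_congr_end obj Y _ fun s1 l1 hl1 he1 => ?_
    refine chain_congr_end obj Y _ fun s2 l2 hl2 he2 => ?_
    have hc : (ch 0).card = w.length := hw.length_eq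
    rw [← Fin.succ_last, outs_front, layerW_succ, endOff_eq, Nat.zero_add, Nat.zero_add]
    refine congrArg _ (congrArg₂ List.cons (Prod.ext ?_ ?_) ?_)
    · refine evO_shift _ _ _ _ _ _ (fun i hi => ?_) (fun i hi => ?_) fun i hi => ?_
      · rw [Nat.zero_add, word_append_left]; rwa [← hc]
      · rw [Nat.zero_add, objAt_append_left _ _ _ _ (hl1.symm ▸ hi)]
      · rw [Nat.zero_add, valAt_append_left _ _ _ (hl1.symm ▸ hi)]
    · change A.lower _ (obj s1) = A.lower _ _
      rw [objAt_append_left _ _ _ _ hl1.ge, he1]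
    · refine layerW_shift _ _ _ _ _ _ (fun i hi => ?_) (fun i hi => ?_) fun i hi => ?_
      · rw [hc, word_append_right, Nat.zero_add]
      · rw [← hl1, objAt_append_right, Nat.zero_add, hl1, he1]
      · rw [← hl1, valAt_append_right, Nat.zero_add]

open scoped Classical in
/-- All trees of a given shape, as a sum over the elements that can be filled in. -/
theorem tree_eq (S : Stacking) (hS : S.GS) {V : 𝒰} (κ : Simp V W × St → HH A V → M) (τ : Simp V W)
    (s : St) : F.tree obj par Y S V κ (τ, s) =
      if S.Admissible τ.length then
        sg k (S.mSign τ.length 0 + sizePar S.sizes * par s) •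
          F.wordSum S.sizes fun w => F.wordOp S.sizes w (chain obj Y S.inputs
            (fun s' l => κ (S.out τ, s')
              (evO (F.word w) (objAt (obj s) l) (valAt l) S τ 0 0)) s)
      else 0 := by
  induction S generalizing V s with
  | unit =>
    rw [sizes_unit, inputs_unit, tree]
    cases τ with
    | nil =>
      rw [if_pos (show unit.Admissible (nil W).length from rfl), leaf_nil]
      simp [mSign, sizePar, wordSum, wordOp]
      rfl
    | cons f τ => rw [if_neg (show ¬ unit.Admissible (cons f τ).length from Nat.succ_ne_zero _), leaf_cons]
  | box p q r ch ih =>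
    obtain ⟨hr, hch⟩ := gs_box.1 hS
    rw [tree_box, bottom_apply]
    have hadm : (box p q r ch).Admissible τ.length ↔ p ≤ τ.length ∧
        ∀ j, (ch j).Admissible (sides ch (τ.drop p).length j.castSucc) := by
      rw [length_drop]; rfl
    by_cases hp : p ≤ τ.length
    swap
    · rw [if_neg hp, if_neg fun h' => hp (hadm.1 h').1]
    rw [if_pos hp, boxP_apply]
    simp only [layer_eq hF h ch hch fun j κ τ s => ih j (hch j) κ τ s]
    by_cases ha : ∀ j, (ch j).Admissible (sides ch (τ.drop p).length j.castSucc)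
    swap
    · rw [if_neg fun h' => ha (hadm.1 h').2]
      simp [if_neg ha]
    rw [if_pos (hadm.2 ⟨hp, ha⟩)]
    simp only [if_pos ha]
    rw [sizes_box, wordSum, Finset.smul_sum]
    refine Finset.sum_congr rfl fun i hi' => ?_
    split_ifs with hi
    swap
    · rw [smul_zero]
    rw [map_smul, sg_smul_smul, opPar_eq hF hi' hi hr]
    have hsg : (p + q + r + 1 : ZMod 2) * lpar par _ (τ.drop p, s) +
        (layerSign ch (τ.drop p).length 0 + sizePar (layerSizes ch) * par s) =
        (box p q r ch).mSign τ.length 0 + sizePar ((p, q, r) :: layerSizes ch) * par s := by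
      rw [mSign_box, lpar, length_drop]
      simp only [sizePar, List.map_cons, List.sum_cons]
      push_cast
      ring
    rw [hsg]
    refine congrArg (sg k _ • ·) ?_
    refine (map_wordSum F (F.op i p).toAddMonoidHom _ _).trans (F.wordSum_congr _ fun w hw => ?_)
    refine congrArg (F.op i p) (congrArg (F.wordOp _ w) ?_)
    refine tr_congr _ (fun s' l => ?_) s
    rw [out]
    refine congrArg (κ _) ?_
    rw [← appL_layerW, word_cons_zero, objAt_zero]
    refine congrArg (appL _ _ _) (layerW_shift _ _ _ _ _ _ (fun i hi => ?_) (fun i hi => rfl)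
      fun i hi => rfl)
    rw [Nat.zero_add, Nat.zero_add, Nat.add_comm 1, word_cons_succ]

end

end Family

end

/-! ## The shapes of thin-quadratic stackings -/

namespace Stacking

/-- A box without arrows and with open inputs. -/
def corolla (q : ℕ) : Stacking := box 0 q 0 fun _ => unit

/-- A box with `p` arrows, with one box without arrows above it. -/
def twoBox (p q : ℕ) (j : Fin q) (q' : ℕ) : Stacking :=
  box p q (min 1 p) (Function.update (fun _ => unit) j (corolla q'))

/-- The trees of height at most `H` of boxes with at least one and at most `P` arrows, and with at
most `Q` inputs. -/
def nonThin (P Q : ℕ) : ℕ → Finset Stacking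
  | 0 => {unit}
  | H + 1 => Finset.cons unit
    (((Finset.Icc 1 P ×ˢ Finset.range (Q + 1)).sigma fun x =>
      Fintype.piFinset fun _ : Fin x.2 => nonThin P Q H).map
      ⟨fun x => box x.1.1 x.1.2 1 x.2, by
        rintro ⟨⟨p, q⟩, ch⟩ ⟨⟨p', q'⟩, ch'⟩ h
        simp only [box.injEq] at h
        obtain ⟨rfl, rfl, -, h⟩ := h
        cases h
        rfl⟩) (by simp)

theorem sum_nonThin_succ {N : Type*} [AddCommMonoid N] (P Q H : ℕ) (f : Stacking → N) :
    ∑ S ∈ nonThin P Q (H + 1), f S = f unit + ∑ p ∈ Finset.Icc 1 P, ∑ q ∈ Finset.range (Q + 1),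
      ∑ ch ∈ Fintype.piFinset fun _ : Fin q => nonThin P Q H, f (box p q 1 ch) := by
  rw [nonThin, Finset.sum_cons, Finset.sum_map, Finset.sum_sigma, Finset.sum_product]
  rfl

theorem corolla_injective : Function.Injective corolla := by
  intro q q' h
  simp only [corolla, box.injEq] at h
  exact h.2.1

theorem corolla_ne_unit (q : ℕ) : corolla q ≠ unit := by simp [corolla]

/-- The shapes with two boxes. -/
def quadB (Q p : ℕ) : Finset Stacking :=
  ((Finset.range (Q + 1)).sigma fun q => (Finset.univ : Finset (Fin q)) ×ˢ Finset.range (Q + 1)).map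
    ⟨fun x => twoBox p x.1 x.2.1 x.2.2, by
      rintro ⟨q, j, n⟩ ⟨q', j', n'⟩ h
      simp only [twoBox, box.injEq] at h
      obtain ⟨-, rfl, -, h⟩ := h
      have h := eq_of_heq h
      have h1 := congrFun h j
      rw [Function.update_self] at h1
      by_cases hj : j = j'
      · subst hj
        rw [Function.update_self] at h1
        rw [corolla_injective h1]
      · rw [Function.update_of_ne hj] at h1
        exact absurd h1 (corolla_ne_unit _)⟩

open scoped Classical in
/-- The shapes with a box without arrows at the bottom, and trees of other boxes above it. -/
noncomputable def quadC (Q p : ℕ) : Finset Stacking :=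
  (((Finset.range (Q + 1)).sigma fun q => Fintype.piFinset fun _ : Fin q => nonThin p Q p).map
    ⟨fun x => box 0 x.1 0 x.2, by
      rintro ⟨q, ch⟩ ⟨q', ch'⟩ h
      simp only [box.injEq] at h
      obtain ⟨-, rfl, -, h⟩ := h
      cases h
      rfl⟩).filter fun S => S.Admissible p ∧ S.rdepth p = 1

theorem sum_quadB {N : Type*} [AddCommMonoid N] (Q p : ℕ) (f : Stacking → N) :
    ∑ S ∈ quadB Q p, f S = ∑ q ∈ Finset.range (Q + 1), ∑ j : Fin q, ∑ q' ∈ Finset.range (Q + 1),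
      f (twoBox p q j q') := by
  rw [quadB, Finset.sum_map, Finset.sum_sigma]
  refine Finset.sum_congr rfl fun q _ => ?_
  rw [Finset.sum_product]
  rfl

open scoped Classical in
theorem sum_quadC {N : Type*} [AddCommMonoid N] (Q p : ℕ) (f : Stacking → N) :
    ∑ S ∈ quadC Q p, f S = ∑ q ∈ Finset.range (Q + 1),
      ∑ ch ∈ Fintype.piFinset fun _ : Fin q => nonThin p Q p,
        if (box 0 q 0 ch).Admissible p ∧ (box 0 q 0 ch).rdepth p = 1 then f (box 0 q 0 ch) else 0 := by
  rw [quadC, Finset.sum_filter, Finset.sum_map, Finset.sum_sigma]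
  rfl

open scoped Classical in
theorem disjoint_quad (Q : ℕ) {p : ℕ} (hp : 0 < p) : Disjoint (quadB Q p) (quadC Q p) := by
  rw [Finset.disjoint_left]
  intro S h h'
  obtain ⟨x, -, hx⟩ := Finset.mem_map.1 h
  obtain ⟨y, -, hy⟩ := Finset.mem_map.1 (Finset.mem_filter.1 h').1
  rw [← hy] at hx
  have h0 : p = 0 := (box.injEq .. ▸ hx).1
  omega

/-- The shapes of the thin-quadratic stackings with `p` arrows on the left and boxes with at most `Q`
inputs. -/
noncomputable def quad (Q p : ℕ) : Finset Stacking :=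
  if hp : 0 < p then (quadB Q p).disjUnion (quadC Q p) (disjoint_quad Q hp) else quadB Q 0

/-- Whether the bottom box has no arrows. -/
def rootThin : Stacking → ZMod 2
  | unit => 0
  | box p _ _ _ => if p = 0 then 1 else 0

theorem gs_corolla (q : ℕ) : (corolla q).GS := gs_box.2 ⟨rfl, fun _ => gs_unit⟩

theorem gs_twoBox (p q : ℕ) (j : Fin q) (q' : ℕ) : (twoBox p q j q').GS := by
  refine gs_box.2 ⟨rfl, fun i => ?_⟩
  by_cases hi : i = j
  · subst hi; rw [Function.update_self]; exact gs_corolla q'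
  · rw [Function.update_of_ne hi]; exact gs_unit

theorem gs_of_mem_nonThin {P Q H : ℕ} {S : Stacking} (h : S ∈ nonThin P Q H) : S.GS := by
  induction H generalizing S with
  | zero => rw [Finset.mem_singleton.1 h]; exact gs_unit
  | succ H ih =>
    rcases Finset.mem_cons.1 h with rfl | h
    · exact gs_unit
    · obtain ⟨⟨⟨p, q⟩, ch⟩, hx, rfl⟩ := Finset.mem_map.1 h
      obtain ⟨h1, h2⟩ := Finset.mem_sigma.1 hx
      refine gs_box.2 ⟨?_, fun j => ih (Fintype.mem_piFinset.1 h2 j)⟩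
      have := (Finset.mem_Icc.1 (Finset.mem_product.1 h1).1).1
      exact (Nat.min_eq_left this).symm

end Stacking

namespace Simp

variable {𝒰 : Type u} [Category.{v} 𝒰] {N : Type*} [AddCommGroup N]

theorem dec_eq_sum {V X : 𝒰} (τ : Simp V X) (g : ∀ W, Simp V W → Simp W X → N) :
    dec τ g = ∑ p ∈ Finset.range (τ.length + 1), g _ (τ.take p) (τ.drop p) := by
  induction τ with
  | nil => exact (Finset.sum_range_one fun p => g _ ((nil _).take p) ((nil _).drop p)).symm
  | cons f τ ih =>
    change g _ _ _ + dec τ _ = Finset.sum (Finset.range (τ.length + 1 + 1)) _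
    rw [Finset.sum_range_succ', ih, add_comm]
    rfl

theorem decPos_eq_sum {V X : 𝒰} (τ : Simp V X) (g : ∀ W, Simp V W → Simp W X → N) {P : ℕ}
    (hP : τ.length ≤ P) : decPos τ g = ∑ p ∈ Finset.Icc 1 P,
      if p ≤ τ.length then g _ (τ.take p) (τ.drop p) else 0 := by
  have h := (dec_eq τ g).symm.trans (dec_eq_sum τ g)
  rw [Finset.sum_range_succ', add_comm] at h
  rw [add_right_cancel h, ← Finset.sum_filter, Finset.range_eq_Ico,
    Finset.sum_Ico_add' (fun p => g _ (τ.take p) (τ.drop p)) 0 τ.length 1]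
  refine Finset.sum_congr ?_ fun _ _ => rfl
  ext p
  simp only [Finset.mem_Ico, Finset.mem_filter, Finset.mem_Icc]
  omega

theorem take_length {V X : 𝒰} (τ : Simp V X) (g : ∀ W, Simp V W → Simp W X → N) :
    g _ (τ.take τ.length) (τ.drop τ.length) = g X τ (nil X) := by
  induction τ with
  | nil => rfl
  | cons f τ ih => exact ih fun W a b => g W (cons f a) b

end Simp

section

variable {k : Type t} [Field k] {𝒰 : Type u} [Category.{v} 𝒰]
  {A : LinQuiver.{u, v, w, w', t} k 𝒰} {M : Type*} [AddCommGroup M] [Module k M]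
  {W : 𝒰} {St : Type*} {ι : Type*}

open Simp Stacking

theorem chainF_congr_tr (obj : St → A.Ob W) {q : ℕ} {Y Y' : Fin q → Tr A W St M}
    (h : ∀ j, Y j = Y' j) : chainF obj q Y = chainF obj q Y' := by
  rw [show Y = Y' from funext h]

theorem sum_piFinset_succ {N : Type*} [AddCommMonoid N] {I : Type*} (s : Finset I) (q : ℕ)
    (f : (Fin (q + 1) → I) → N) : ∑ x ∈ Fintype.piFinset fun _ : Fin (q + 1) => s, f x =
      ∑ a ∈ s, ∑ x ∈ Fintype.piFinset fun _ : Fin q => s, f (Fin.cons a x) := by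
  rw [← Finset.sum_product']
  refine Finset.sum_nbij' (fun x => (x 0, Fin.tail x)) (fun y => Fin.cons y.1 y.2) ?_ ?_ ?_ ?_ ?_
  · intro x hx
    rw [Fintype.mem_piFinset] at hx
    exact Finset.mem_product.2 ⟨hx 0, Fintype.mem_piFinset.2 fun j => hx j.succ⟩
  · intro y hy
    obtain ⟨h1, h2⟩ := Finset.mem_product.1 hy
    refine Fintype.mem_piFinset.2 fun j => ?_
    cases j using Fin.cases with
    | zero => exact h1
    | succ j => exact Fintype.mem_piFinset.1 h2 j
  · intro x _; exact Fin.cons_self_tail x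
  · intro y _; simp
  · intro x _; exact congrArg f (Fin.cons_self_tail x).symm

theorem chain_sum (obj : St → A.Ob W) {I : Type*} (s : Finset I) (Y : I → Tr A W St M) (q : ℕ) :
    chain obj (∑ i ∈ s, Y i) q =
      ∑ x ∈ Fintype.piFinset fun _ : Fin q => s, chainF obj q fun j => Y (x j) := by
  induction q with
  | zero => simp [chain, chainF]
  | succ q ih =>
    rw [sum_piFinset_succ, chain, ih]
    refine LinearMap.ext fun K => funext fun s' => ?_
    simp only [LinearMap.sum_apply, Finset.sum_apply, bindT_apply]
    refine Finset.sum_congr rfl fun a _ => ?_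
    let φ : (St → HH A W → M) →+ M :=
      { toFun := fun κ => Y a κ s'
        map_zero' := congrFun (map_zero (Y a)) s'
        map_add' := fun κ κ' => congrFun (map_add (Y a) κ κ') s' }
    refine Eq.trans ?_ (map_sum φ _ _)
    refine congrArg φ (funext fun s'' => funext fun y => ?_)
    rw [Finset.sum_apply, Finset.sum_apply]
    rfl

theorem dchain_eq_sum (obj : St → A.Ob W) (Y Y' : Tr A W St M) (q : ℕ) :
    dchain obj Y Y' q = ∑ j : Fin q, chainF obj q (Function.update (fun _ => Y) j Y') := by
  have hconst : ∀ q, chain obj Y q = chainF obj q fun _ => Y := by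
    intro q
    induction q with
    | zero => rfl
    | succ q ih => rw [chain, ih]; rfl
  induction q with
  | zero => rfl
  | succ q ih =>
    rw [Fin.sum_univ_succ, dchain, ih, hconst]
    refine congrArg₂ (· + ·) ?_ ?_
    · rw [chainF, Function.update_self]
      refine congrArg _ (chainF_congr_tr obj fun j => ?_)
      rw [Function.update_of_ne (Fin.succ_ne_zero j)]
    · refine Eq.trans (b := ∑ j : Fin q, bindT obj Y (chainF obj q
        (Function.update (fun _ => Y) j Y'))) ?_ (Finset.sum_congr rfl fun j _ => ?_)
      · let φ : WTr A W St M →+ WTr A W St M := AddMonoidHom.mk' (bindT obj Y)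
          (bindT_add_right obj Y)
        exact map_sum φ _ _
      · rw [chainF, Function.update_of_ne (Fin.succ_ne_zero j).symm]
        refine congrArg _ (chainF_congr_tr obj fun i => ?_)
        by_cases hi : i = j
        · subst hi; rw [Function.update_self, Function.update_self]
        · rw [Function.update_of_ne hi, Function.update_of_ne fun h => hi (Fin.succ_injective _ h)]

theorem chainF_update_sum (obj : St → A.Ob W) {I : Type*} (s : Finset I) {q : ℕ} (j : Fin q)
    (Y : Fin q → Tr A W St M) (Y' : I → Tr A W St M) :
    chainF obj q (Function.update Y j (∑ i ∈ s, Y' i)) =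
      ∑ i ∈ s, chainF obj q (Function.update Y j (Y' i)) := by
  induction q with
  | zero => exact j.elim0
  | succ q ih =>
    cases j using Fin.cases with
    | zero =>
      have h : ∀ Z : Tr A W St M, chainF obj (q + 1) (Function.update Y 0 Z) =
          bindT obj Z (chainF obj q fun j => Y j.succ) := fun Z => by
        rw [chainF, Function.update_self]
        refine congrArg _ (chainF_congr_tr obj fun j => ?_)
        rw [Function.update_of_ne (Fin.succ_ne_zero j)]
      simp only [h]
      refine LinearMap.ext fun K => funext fun s' => ?_
      simp only [LinearMap.sum_apply, Finset.sum_apply, bindT_apply]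
    | succ j =>
      have h : ∀ Z : Tr A W St M, chainF obj (q + 1) (Function.update Y j.succ Z) =
          bindT obj (Y 0) (chainF obj q (Function.update (fun j => Y j.succ) j Z)) := fun Z => by
        rw [chainF, Function.update_of_ne (Fin.succ_ne_zero j).symm]
        refine congrArg _ (chainF_congr_tr obj fun i => ?_)
        by_cases hi : i = j
        · subst hi; rw [Function.update_self, Function.update_self]
        · rw [Function.update_of_ne hi, Function.update_of_ne fun h => hi (Fin.succ_injective _ h)]
      simp only [h, ih]
      let φ : WTr A W St M →+ WTr A W St M := AddMonoidHom.mk' (bindT obj (Y 0))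
        (bindT_add_right obj (Y 0))
      exact map_sum φ _ _

/-! ### Transfers at a simplex without arrows -/

/-- At simplices without arrows, `G` is given by `G₀`. -/
def AtNil {X : Type*} (G : (Simp W W × St → X → M) →ₗ[k] (Simp W W × St → M))
    (G₀ : (St → X → M) →ₗ[k] (St → M)) : Prop :=
  ∀ κ s, G κ (nil W, s) = G₀ (fun s' y => κ (nil W, s') y) s

theorem AtNil.bindT {obj : St → A.Ob W} {Y : Tr A W (Simp W W × St) M} {Y₀ : Tr A W St M}
    {C : WTr A W (Simp W W × St) M} {C₀ : WTr A W St M} (hY : AtNil Y Y₀) (hC : AtNil C C₀) :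
    AtNil (bindT (lev obj W) Y C) (bindT obj Y₀ C₀) := by
  intro K s
  refine (hY _ s).trans (tr_congr Y₀ (fun s' y => hC _ s') s)

theorem AtNil.chainF {obj : St → A.Ob W} {q : ℕ} {Y : Fin q → Tr A W (Simp W W × St) M}
    {Y₀ : Fin q → Tr A W St M} (hY : ∀ j, AtNil (Y j) (Y₀ j)) :
    AtNil (chainF (lev obj W) q Y) (chainF obj q Y₀) := by
  induction q with
  | zero => exact fun _ _ => rfl
  | succ q ih => exact (hY 0).bindT (ih fun j => hY j.succ)

namespace Family

variable (F : Family A M ι)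

theorem atNil_boxP {obj : St → A.Ob W} {par : St → ZMod 2} {V : 𝒰} (σ : Simp V W) (p q : ℕ)
    {C : WTr A W (Simp W W × St) M} {C₀ : WTr A W St M} (hC : AtNil C C₀) :
    AtNil (F.boxP (lev obj W) (lpar par W) σ p q C) (F.boxP obj par σ p q C₀) := by
  intro κ s
  rw [boxP_apply, boxP_apply]
  refine Finset.sum_congr rfl fun i _ => ?_
  split_ifs
  · rw [hC]
    simp [lpar, length, lev, LinQuiver.lower]
  · rfl

theorem atNil_corolla (obj : St → A.Ob W) (par : St → ZMod 2) (Y : Tr A W St M) (q : ℕ) :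
    AtNil (F.tree obj par Y (corolla q) W) (F.boxP obj par (nil W) 0 q (chainF obj q fun _ => Y)) := by
  intro κ s
  rw [corolla, tree_box, bottom_apply, if_pos (Nat.zero_le _)]
  exact F.atNil_boxP (nil W) 0 q (AtNil.chainF fun j κ s => by rw [tree]; rfl) _ s

theorem boxP_add (obj : St → A.Ob W) (par : St → ZMod 2) {V : 𝒰} (σ : Simp V W) (p q : ℕ)
    (C C' : WTr A W St M) : F.boxP obj par σ p q (C + C') =
      F.boxP obj par σ p q C + F.boxP obj par σ p q C' := by
  refine LinearMap.ext fun κ => funext fun s => ?_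
  rw [LinearMap.add_apply, Pi.add_apply, boxP_apply, boxP_apply, boxP_apply,
    ← Finset.sum_add_distrib]
  refine Finset.sum_congr rfl fun i _ => ?_
  split_ifs
  · rw [LinearMap.add_apply, Pi.add_apply, map_add, smul_add]
  · rw [add_zero]

theorem boxP_sum (obj : St → A.Ob W) (par : St → ZMod 2) {V : 𝒰} (σ : Simp V W) (p q : ℕ)
    {I : Type*} (s : Finset I) (C : I → WTr A W St M) :
    F.boxP obj par σ p q (∑ i ∈ s, C i) = ∑ i ∈ s, F.boxP obj par σ p q (C i) :=
  map_sum (AddMonoidHom.mk' (F.boxP obj par σ p q) (F.boxP_add obj par σ p q)) _ _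

/-- No box with at most `P` arrows has more than `Q` inputs. -/
def Bounded (P Q : ℕ) : Prop := ∀ p ≤ P, ∀ i ∈ F.lab p, ∀ q, F.ar i p = some q → q ≤ Q

variable {F}

theorem sum_elim_eq {P Q : ℕ} (hQ : F.Bounded P Q) {p : ℕ} (hp : p ≤ P) (f : ι → ℕ → M) :
    ∑ i ∈ F.lab p, (F.ar i p).elim 0 (f i) =
      ∑ q ∈ Finset.range (Q + 1), ∑ i ∈ F.lab p, if F.ar i p = some q then f i q else 0 := by
  rw [Finset.sum_comm]
  refine Finset.sum_congr rfl fun i hi => ?_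
  cases h : F.ar i p with
  | none => simp
  | some q =>
    have := hQ p hp i hi q h
    simp only [Option.some.injEq, Option.elim_some]
    rw [Finset.sum_ite_eq, if_pos (by simp; omega)]

theorem boxN_eq_sum {P Q : ℕ} (hQ : F.Bounded P Q) (obj : St → A.Ob W) (par : St → ZMod 2) {V : 𝒰}
    (σ : Simp V W) {p : ℕ} (hσ : σ.length = p) (h0 : 0 < p) (hP : p ≤ P) (C : ℕ → WTr A W St M)
    (κ s) : F.boxN obj par σ C κ s = ∑ q ∈ Finset.range (Q + 1), F.boxP obj par σ p q (C q) κ s := by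
  rw [boxN_apply, hσ, sum_elim_eq hQ hP]
  refine Finset.sum_congr rfl fun q _ => ?_
  rw [boxP_apply]
  simp only [op, opPar, if_neg h0.ne']
  rfl

theorem boxT_eq_sum {P Q : ℕ} (hQ : F.Bounded P Q) (obj : St → A.Ob W) (par : St → ZMod 2)
    (C : ℕ → WTr A W St M) (κ s) :
    F.boxT obj par C κ s = ∑ q ∈ Finset.range (Q + 1), F.boxP obj par (nil W) 0 q (C q) κ s := by
  rw [boxT_apply, sum_elim_eq hQ (Nat.zero_le P)]
  refine Finset.sum_congr rfl fun q _ => ?_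
  rw [boxP_apply]
  rfl

theorem Z_eq_sum {P Q : ℕ} (hQ : F.Bounded P Q) (obj : St → A.Ob W) (par : St → ZMod 2)
    (Y : Tr A W St M) (H : ℕ) (V : 𝒰) (κ) (τ : Simp V W) (s : St) (hτ : τ.length ≤ H)
    (hP : τ.length ≤ P) :
    F.Z obj par Y V κ (τ, s) = ∑ S ∈ nonThin P Q H, F.tree obj par Y S V κ (τ, s) := by
  induction H generalizing V s with
  | zero =>
    cases τ with
    | nil =>
      rw [nonThin, Finset.sum_singleton, tree]
      rfl
    | cons => simp [length] at hτ
  | succ H ih =>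
    rw [sum_nonThin_succ, Z_eq, recB_apply, decPos_eq_sum τ _ hP]
    refine congrArg₂ (· + ·) (by rw [tree]) (Finset.sum_congr rfl fun p hp => ?_)
    obtain ⟨hp1, hp2⟩ := Finset.mem_Icc.1 hp
    by_cases hpτ : p ≤ τ.length
    swap
    · rw [if_neg hpτ]
      refine (Finset.sum_eq_zero fun q _ => Finset.sum_eq_zero fun ch _ => ?_).symm
      rw [tree_box, bottom_apply, if_neg hpτ]
    rw [if_pos hpτ, boxN_eq_sum hQ _ _ _ (length_take τ p hpτ) hp1 hp2]
    refine Finset.sum_congr rfl fun q _ => ?_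
    have hd : (τ.drop p).length ≤ H ∧ (τ.drop p).length ≤ P := by
      rw [length_drop]; omega
    have h1 : ∀ (g : Word A (mid p τ) → HH A V), chain (lev obj _) (F.Z obj par Y _) q
        (fun x' l => κ ((τ.take p).bdryAppend x'.1, x'.2) (g l)) (τ.drop p, s) =
        (∑ ch ∈ Fintype.piFinset fun _ : Fin q => nonThin P Q H, chainF (lev obj _) q fun j =>
          F.tree obj par Y (ch j) _)
        (fun x' l => κ ((τ.take p).bdryAppend x'.1, x'.2) (g l)) (τ.drop p, s) := by
      intro g
      rw [← chain_sum (lev obj (mid p τ)) (nonThin P Q H) (fun S => F.tree obj par Y S (mid p τ))]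
      symm
      refine chain_agree (n := (τ.drop p).length) (fun κ τ' s' h' => ?_) (shrink_Z F obj par Y _) q
        _ _ _ le_rfl
      rw [LinearMap.sum_apply, Finset.sum_apply]
      exact (ih _ κ τ' s' (h'.trans hd.1) (h'.trans hd.2)).symm
    have h2 : F.boxP (lev obj _) (lpar par _) (τ.take p) p q (chain (lev obj _)
          (F.Z obj par Y (mid p τ)) q) (fun x' y => κ ((τ.take p).bdryAppend x'.1, x'.2) y)
          (τ.drop p, s) =
        F.boxP (lev obj _) (lpar par _) (τ.take p) p q
          (∑ ch ∈ Fintype.piFinset fun _ : Fin q => nonThin P Q H, chainF (lev obj _) q fun j =>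
            F.tree obj par Y (ch j) _) (fun x' y => κ ((τ.take p).bdryAppend x'.1, x'.2) y)
          (τ.drop p, s) := by
      rw [boxP_apply, boxP_apply]
      simp only [h1]
    rw [h2, boxP_sum, LinearMap.sum_apply, Finset.sum_apply]
    refine Finset.sum_congr rfl fun ch _ => ?_
    rw [tree_box, bottom_apply, if_pos hpτ]

end Family

end

section

variable {k : Type t} [Field k] {𝒰 : Type u} [Category.{v} 𝒰]
  {A : LinQuiver.{u, v, w, w', t} k 𝒰} {M : Type*} [AddCommGroup M] [Module k M]
  {W : 𝒰} {St : Type*} {ι : Type*}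

open Simp Stacking

theorem chain_eq_chainF (obj : St → A.Ob W) (Y : Tr A W St M) (q : ℕ) :
    chain obj Y q = chainF obj q fun _ => Y := by
  induction q with
  | zero => rfl
  | succ q ih => rw [chain, ih]; rfl

namespace Stacking

theorem sides_unit {q : ℕ} (d : ℕ) (j : Fin (q + 1)) : sides (fun _ : Fin q => unit) d j = d := by
  induction j using Fin.induction with
  | zero => rfl
  | succ j ih => rw [sides_succ, ih]; rfl

theorem rdepth_corolla (q d : ℕ) : (corolla q).rdepth d = d := by
  rw [corolla, rdepth_box, sides_unit]; simp

theorem admissible_corolla (q d : ℕ) : (corolla q).Admissible d ↔ (q = 0 ∨ d = 0) := by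
  change (0 ≤ d ∧ ∀ j : Fin q, sides (fun _ => unit) (d - 0) j.castSucc = 0) ↔ _
  simp only [sides_unit, Nat.zero_le, true_and, Nat.sub_zero]
  constructor
  · intro h
    rcases Nat.eq_zero_or_pos q with h0 | h0
    · exact Or.inl h0
    · exact Or.inr (h ⟨0, h0⟩)
  · rintro (rfl | h)
    · exact fun j => j.elim0
    · exact fun _ => h

theorem sides_update (q : ℕ) (j : Fin q) (q' : ℕ) (d : ℕ) (i : Fin (q + 1)) :
    sides (Function.update (fun _ => unit) j (corolla q')) d i = d := by
  induction i using Fin.induction with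
  | zero => rfl
  | succ i ih =>
    rw [sides_succ, ih]
    by_cases h : i = j
    · subst h; rw [Function.update_self, rdepth_corolla]
    · rw [Function.update_of_ne h]; rfl

theorem admissible_twoBox (p q : ℕ) (j : Fin q) (q' : ℕ) : (twoBox p q j q').Admissible p := by
  refine ⟨le_rfl, fun i => ?_⟩
  rw [sides_update, Nat.sub_self]
  by_cases h : i = j
  · subst h; rw [Function.update_self, admissible_corolla]; exact Or.inr rfl
  · rw [Function.update_of_ne h]; rfl

theorem rdepth_twoBox (p q : ℕ) (j : Fin q) (q' : ℕ) : (twoBox p q j q').rdepth p = min 1 p := by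
  rw [twoBox, rdepth_box, sides_update, Nat.sub_self, Nat.add_zero]

theorem rootThin_twoBox {p : ℕ} (hp : 0 < p) (q : ℕ) (j : Fin q) (q' : ℕ) :
    rootThin (twoBox p q j q') = 0 := if_neg hp.ne'

theorem rootThin_twoBox_zero (q : ℕ) (j : Fin q) (q' : ℕ) :
    rootThin (twoBox 0 q j q') = 1 := by simp [rootThin, twoBox]

end Stacking

namespace Family

variable {F : Family A M ι}

theorem boxP_chain_Z {P Q : ℕ} (hQ : F.Bounded P Q) (obj : St → A.Ob W) (par : St → ZMod 2)
    (Y : Tr A W St M) {V V' : 𝒰} (σ : Simp V' V) (p q : ℕ) (κ) (τ : Simp V W) (s : St)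
    (hP : τ.length ≤ P) :
    F.boxP (lev obj _) (lpar par _) σ p q (chain (lev obj _) (F.Z obj par Y V) q) κ (τ, s) =
      ∑ ch ∈ Fintype.piFinset fun _ : Fin q => nonThin P Q P,
        F.boxP (lev obj _) (lpar par _) σ p q (chainF (lev obj _) q fun j =>
          F.tree obj par Y (ch j) V) κ (τ, s) := by
  have h1 : ∀ K, chain (lev obj _) (F.Z obj par Y _) q K (τ, s) =
      (∑ ch ∈ Fintype.piFinset fun _ : Fin q => nonThin P Q P, chainF (lev obj _) q fun j =>
        F.tree obj par Y (ch j) _) K (τ, s) := by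
    intro K
    rw [← chain_sum (lev obj V) (nonThin P Q P) (fun S => F.tree obj par Y S V)]
    symm
    refine chain_agree (n := τ.length) (fun κ τ' s' h' => ?_) (shrink_Z F obj par Y _) q
      _ _ _ le_rfl
    rw [LinearMap.sum_apply, Finset.sum_apply]
    exact (Z_eq_sum hQ obj par Y P V κ τ' s' (h'.trans hP) (h'.trans hP)).symm
  have h2 : F.boxP (lev obj _) (lpar par _) σ p q (chain (lev obj _) (F.Z obj par Y V) q) κ (τ, s) =
      F.boxP (lev obj _) (lpar par _) σ p q (∑ ch ∈ Fintype.piFinset fun _ : Fin q => nonThin P Q P,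
        chainF (lev obj _) q fun j => F.tree obj par Y (ch j) V) κ (τ, s) := by
    rw [boxP_apply, boxP_apply]
    simp only [h1]
  rw [h2, boxP_sum, LinearMap.sum_apply, Finset.sum_apply]

variable (F) in
/-- All trees of the shape `S` without a vertical side on the right, except possibly one arrow. -/
noncomputable def term (obj : St → A.Ob W) (par : St → ZMod 2) (Y : Tr A W St M) (S : Stacking)
    {V : 𝒰} (σ : Simp V W) (κ : St → HH A V → M) (s : St) : M :=
  sg k (rootThin S + S.mSign σ.length 0 + sizePar S.sizes * par s) •
    F.wordSum S.sizes fun w => F.wordOp S.sizes w (chain obj Y S.inputs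
      (fun s' l => κ s' (evO (F.word w) (objAt (obj s) l) (valAt l) S σ 0 0)) s)

theorem tHat_eq_sum {P Q : ℕ} (hQ : F.Bounded P Q) (obj : St → A.Ob W) (par : St → ZMod 2)
    (Y : Tr A W St M) : F.tHat obj par Y =
      ∑ q ∈ Finset.range (Q + 1), F.boxP obj par (nil W) 0 q (chainF obj q fun _ => Y) := by
  refine LinearMap.ext fun κ => funext fun s => ?_
  rw [LinearMap.sum_apply, Finset.sum_apply, tHat, boxT_eq_sum hQ]
  simp only [chain_eq_chainF]

theorem boxP_dchain {P Q : ℕ} (hQ : F.Bounded P Q) (obj : St → A.Ob W) (par : St → ZMod 2)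
    (Y : Tr A W St M) {V : 𝒰} (σ : Simp V W) (q : ℕ) (κ s) :
    F.boxP obj par σ σ.length q (dchain obj Y (F.tHat obj par Y) q) κ s =
      ∑ j : Fin q, ∑ q' ∈ Finset.range (Q + 1),
        F.tree obj par Y (twoBox σ.length q j q') V (fun x y => κ x.2 y) (σ, s) := by
  rw [dchain_eq_sum, boxP_sum, LinearMap.sum_apply, Finset.sum_apply]
  refine Finset.sum_congr rfl fun j _ => ?_
  rw [tHat_eq_sum hQ, chainF_update_sum, boxP_sum, LinearMap.sum_apply, Finset.sum_apply]
  refine Finset.sum_congr rfl fun q' _ => ?_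
  rw [twoBox, tree_box, bottom_apply, if_pos le_rfl]
  refine Eq.trans ?_ (take_length σ fun W' a b => F.boxP (lev obj W') (lpar par W') a σ.length q
    (chainF (lev obj W') q fun i => F.tree obj par Y
      (Function.update (fun _ => unit) j (corolla q') i) W') (fun x' y => κ x'.2 y) (b, s)).symm
  refine (F.atNil_boxP (obj := obj) (par := par) σ σ.length q
    (C := chainF (lev obj W) q fun i => F.tree obj par Y
      (Function.update (fun _ => unit) j (corolla q') i) W)
    (C₀ := chainF obj q (Function.update (fun _ => Y) j
      (F.boxP obj par (nil W) 0 q' (chainF obj q' fun _ => Y))))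
    (AtNil.chainF fun i => ?_) (fun x' y => κ x'.2 y) s).symm
  by_cases hi : i = j
  · subst hi
    rw [Function.update_self, Function.update_self]
    exact F.atNil_corolla obj par Y q'
  · rw [Function.update_of_ne hi, Function.update_of_ne hi]
    exact fun κ s => by rw [tree]; rfl

section

variable (hF : F.Par) {obj : St → A.Ob W} {par : St → ZMod 2} {Y : Tr A W St M} (h : F.Good par Y)
include hF h

theorem tree_twoBox {V : 𝒰} (σ : Simp V W) (q : ℕ) (j : Fin q) (q' : ℕ) (κ s) :
    F.tree obj par Y (twoBox σ.length q j q') V (fun x y => κ x.2 y) (σ, s) =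
      sg k (rootThin (twoBox σ.length q j q')) • F.term obj par Y (twoBox σ.length q j q') σ κ s := by
  rw [tree_eq hF h _ (gs_twoBox _ _ _ _), if_pos (admissible_twoBox _ _ _ _), term, sg_smul_smul]
  congr 2
  linear_combination (-rootThin (twoBox σ.length q j q')) * two_eq_zero_zmod

theorem QT_eq_sum {P Q : ℕ} (hQ : F.Bounded P Q) (κ s) :
    F.QT obj par Y κ s = ∑ S ∈ quad Q 0, F.term obj par Y S (nil W) κ s := by
  rw [quad, dif_neg (lt_irrefl 0), sum_quadB, QT, ttHat, boxT_eq_sum hQ, ← Finset.sum_neg_distrib]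
  refine Finset.sum_congr rfl fun q _ => ?_
  refine (congrArg Neg.neg (boxP_dchain hQ obj par Y (nil W) q κ s)).trans ?_
  simp only [← Finset.sum_neg_distrib]
  refine Finset.sum_congr rfl fun j _ => Finset.sum_congr rfl fun q' _ => ?_
  rw [tree_twoBox hF h]
  change -(sg k (rootThin (twoBox 0 q j q')) • F.term obj par Y (twoBox 0 q j q') (nil W) κ s) = _
  rw [rootThin_twoBox_zero, sg_one, neg_one_smul, neg_neg]

open scoped Classical in
theorem QN_eq_sum {V : 𝒰} (σ : Simp V W) {Q : ℕ} (hQ : F.Bounded σ.length Q) (hσ : 0 < σ.length)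
    (κ s) : F.QN obj par Y σ κ s = ∑ S ∈ quad Q σ.length, F.term obj par Y S σ κ s := by
  rw [quad, dif_pos hσ, Finset.sum_disjUnion, sum_quadB, sum_quadC, QN, sub_eq_add_neg]
  refine congrArg₂ (· + ·) ?_ ?_
  · rw [boxN_eq_sum hQ obj par σ rfl hσ le_rfl]
    refine Finset.sum_congr rfl fun q _ => ?_
    rw [boxP_dchain hQ]
    refine Finset.sum_congr rfl fun j _ => Finset.sum_congr rfl fun q' _ => ?_
    rw [tree_twoBox hF h, rootThin_twoBox hσ, sg_zero, one_smul]
  · rw [tHat, boxT_eq_sum hQ, ← Finset.sum_neg_distrib]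
    refine Finset.sum_congr rfl fun q _ => ?_
    rw [boxP_chain_Z hQ obj par Y (nil V) 0 q _ σ s le_rfl, ← Finset.sum_neg_distrib]
    refine Finset.sum_congr rfl fun ch hch => ?_
    have hGS : (box 0 q 0 ch).GS := gs_box.2 ⟨rfl, fun j =>
      gs_of_mem_nonThin (Fintype.mem_piFinset.1 hch j)⟩
    have h1 : F.boxP (lev obj V) (lpar par V) (nil V) 0 q (chainF (lev obj V) q fun j =>
        F.tree obj par Y (ch j) V) (fun p y => if p.1.length = 1 then κ p.2 y else 0) (σ, s) =
        F.tree obj par Y (box 0 q 0 ch) V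
          (fun p y => if p.1.length = 1 then κ p.2 y else 0) (σ, s) := by
      rw [tree_box, bottom_apply, if_pos (Nat.zero_le _)]
      rfl
    rw [h1, tree_eq hF h _ hGS]
    by_cases ha : (box 0 q 0 ch).Admissible σ.length
    swap
    · rw [if_neg ha, if_neg fun h' => ha h'.1, neg_zero]
    rw [if_pos ha]
    simp only [length_out hGS σ ha]
    by_cases hr : (box 0 q 0 ch).rdepth σ.length = 1
    · simp only [if_pos hr]
      rw [if_pos ⟨ha, hr⟩, term, show rootThin (box 0 q 0 ch) = 1 by simp [rootThin], add_assoc,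
        add_comm 1, sg_add_one]
    · simp only [if_neg hr]
      rw [if_neg fun h' => hr h'.2]
      have : ∀ w, F.wordOp (box 0 q 0 ch).sizes w
          (chain obj Y (box 0 q 0 ch).inputs (fun _ _ => (0 : M)) s) = 0 := fun w =>
        (congrArg _ (congrFun (map_zero (chain obj Y _)) s)).trans (map_zero _)
      simp only [this]
      rw [show F.wordSum (box 0 q 0 ch).sizes (fun _ => (0 : M)) = 0 from
        (map_wordSum F (0 : M →+ M) _ fun _ => 0).symm, smul_zero, neg_zero]

end

end Family

end

/-! ## Counting boxes -/

namespace Stacking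

/-- The number of boxes without arrows. -/
def thinCard (S : Stacking) : ℕ := S.sizes.countP fun b => b.1 = 0

theorem thinCard_unit : unit.thinCard = 0 := by simp [thinCard, sizes_unit]

theorem countP_layerSizes {q : ℕ} (ch : Fin q → Stacking) :
    (layerSizes ch).countP (fun b => b.1 = 0) = ∑ j, (ch j).thinCard := by
  induction q with
  | zero => simp [layerSizes_zero]
  | succ q ih => rw [layerSizes_succ, List.countP_append, ih, Fin.sum_univ_succ]; rfl

theorem thinCard_box (p q r : ℕ) (ch : Fin q → Stacking) :
    (box p q r ch).thinCard = (if p = 0 then 1 else 0) + ∑ j, (ch j).thinCard := by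
  rw [thinCard, sizes_box, List.countP_cons, countP_layerSizes, Nat.add_comm]
  simp

/-- The total number of arrows of the boxes on the left, minus the number of arrows on the right. -/
theorem sum_size_sub (S : Stacking) (d : ℕ) (h : S.Admissible d) :
    (S.sizes.map fun b => (b.1 : ℤ) - b.2.2).sum = d - S.rdepth d := by
  induction S generalizing d with
  | unit => simp [sizes_unit, rdepth]
  | box p q r ch ih =>
    obtain ⟨hp, ha⟩ := h
    have h1 : ((layerSizes ch).map fun b => (b.1 : ℤ) - b.2.2).sum =
        ∑ j, (((ch j).sizes.map fun b => (b.1 : ℤ) - b.2.2).sum) := by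
      simp [layerSizes, List.sum_flatten, List.map_flatten, List.map_ofFn, List.sum_ofFn,
        Function.comp_def]
    have h2 : ∀ j : Fin (q + 1), (∑ i : Fin q, if i.castSucc < j then
        ((sides ch (d - p) i.castSucc : ℤ) - sides ch (d - p) i.succ) else 0) =
        sides ch (d - p) 0 - sides ch (d - p) j := by
      intro j
      induction j using Fin.induction with
      | zero => simp
      | succ j hj =>
        have : ∀ i : Fin q, (if i.castSucc < j.succ then
            ((sides ch (d - p) i.castSucc : ℤ) - sides ch (d - p) i.succ) else 0) =
            (if i.castSucc < j.castSucc then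
            ((sides ch (d - p) i.castSucc : ℤ) - sides ch (d - p) i.succ) else 0) +
            if i = j then ((sides ch (d - p) i.castSucc : ℤ) - sides ch (d - p) i.succ) else 0 := by
          intro i
          simp only [Fin.castSucc_lt_succ_iff, Fin.castSucc_lt_castSucc_iff]
          rcases lt_trichotomy i j with h | h | h
          · simp [h, h.le, h.ne]
          · simp [h]
          · simp [h.not_ge, h.not_gt, h.ne']
        simp only [this, Finset.sum_add_distrib, hj]
        simp
    have h3 := h2 (Fin.last q)
    simp only [Fin.castSucc_lt_last, if_true] at h3
    rw [sizes_box, List.map_cons, List.sum_cons, h1, rdepth_box,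
      Finset.sum_congr rfl fun j _ => ih j _ (ha j)]
    simp only [← sides_succ]
    rw [h3]
    change (p : ℤ) - r + (((d - p : ℕ) : ℤ) - _) = _
    push_cast [hp]
    ring

/-- The total number of inputs of the boxes that are not open. -/
theorem sum_inputs_sub (S : Stacking) :
    (S.sizes.map fun b => (b.2.1 : ℤ) - 1).sum = S.inputs - 1 := by
  induction S with
  | unit => simp [sizes_unit, inputs_unit]
  | box p q r ch ih =>
    have h1 : ((layerSizes ch).map fun b => (b.2.1 : ℤ) - 1).sum =
        ∑ j, (((ch j).sizes.map fun b => (b.2.1 : ℤ) - 1).sum) := by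
      simp [layerSizes, List.sum_flatten, List.map_flatten, List.map_ofFn, List.sum_ofFn,
        Function.comp_def]
    have h2 : offsets ch 0 (Fin.last q) = ∑ j, (ch j).inputs := by
      clear ih h1
      induction q with
      | zero => rfl
      | succ q ih =>
        rw [← Fin.succ_last, offsets_front, offsets_eq, ih, endOff_eq, Fin.sum_univ_succ,
          Nat.zero_add]
    rw [sizes_box, List.map_cons, List.sum_cons, h1, inputs_box, h2,
      Finset.sum_congr rfl fun j _ => ih j]
    simp

theorem sizePar_eq (S : Stacking) (d : ℕ) (h : S.Admissible d) :
    sizePar S.sizes = d + S.rdepth d + S.inputs + 1 := by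
  have h1 := congrArg (Int.cast : ℤ → ZMod 2) (S.sum_size_sub d h)
  have h2 := congrArg (Int.cast : ℤ → ZMod 2) S.sum_inputs_sub
  have h3 : ∀ bs : List (ℕ × ℕ × ℕ), sizePar bs =
      (((bs.map fun b => (b.1 : ℤ) - b.2.2).sum : ℤ) : ZMod 2) +
        (((bs.map fun b => (b.2.1 : ℤ) - 1).sum : ℤ) : ZMod 2) := by
    intro bs
    induction bs with
    | nil => simp [sizePar]
    | cons b bs ih =>
      simp only [sizePar, List.map_cons, List.sum_cons] at ih ⊢
      rw [ih]
      push_cast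
      linear_combination (b.2.2 + 1 : ZMod 2) * two_eq_zero_zmod
  rw [h3, h1, h2]
  push_cast
  linear_combination (-(S.rdepth d) - 1 : ZMod 2) * two_eq_zero_zmod

/-- The shapes of the thin-quadratic stackings. -/
structure TQ (S : Stacking) (p : ℕ) : Prop where
  gs : S.GS
  adm : S.Admissible p
  rdepth : S.rdepth p = min 1 p
  thin : S.thinCard = if p = 0 then 2 else 1

theorem thinCard_corolla (q : ℕ) : (corolla q).thinCard = 1 := by
  rw [corolla, thinCard_box]
  simp [thinCard_unit]

theorem thinCard_of_mem_nonThin {P Q H : ℕ} {S : Stacking} (h : S ∈ nonThin P Q H) :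
    S.thinCard = 0 := by
  induction H generalizing S with
  | zero => rw [Finset.mem_singleton.1 h]; exact thinCard_unit
  | succ H ih =>
    rcases Finset.mem_cons.1 h with rfl | h
    · exact thinCard_unit
    · obtain ⟨⟨⟨p, q⟩, ch⟩, hx, rfl⟩ := Finset.mem_map.1 h
      obtain ⟨h1, h2⟩ := Finset.mem_sigma.1 hx
      have := (Finset.mem_Icc.1 (Finset.mem_product.1 h1).1).1
      change (box p q 1 ch).thinCard = 0
      rw [thinCard_box, if_neg (by simp at this; omega), zero_add]
      exact Finset.sum_eq_zero fun j _ => ih (Fintype.mem_piFinset.1 h2 j)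

theorem tq_twoBox (p q : ℕ) (j : Fin q) (q' : ℕ) : (twoBox p q j q').TQ p where
  gs := gs_twoBox p q j q'
  adm := admissible_twoBox p q j q'
  rdepth := rdepth_twoBox p q j q'
  thin := by
    rw [twoBox, thinCard_box, Finset.sum_eq_single j, Function.update_self, thinCard_corolla]
    · split_ifs <;> rfl
    · intro i _ hi
      rw [Function.update_of_ne hi, thinCard_unit]
    · simp

open scoped Classical in
theorem tq_of_mem_quad {Q p : ℕ} {S : Stacking} (h : S ∈ quad Q p) : S.TQ p := by
  have hB : ∀ {p}, S ∈ quadB Q p → S.TQ p := fun h => by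
    obtain ⟨x, -, rfl⟩ := Finset.mem_map.1 h
    exact tq_twoBox _ _ _ _
  rw [quad] at h
  split_ifs at h with hp
  · rcases Finset.mem_disjUnion.1 h with h | h
    · exact hB h
    · obtain ⟨h, h1, h2⟩ := Finset.mem_filter.1 h
      obtain ⟨⟨q, ch⟩, hx, rfl⟩ := Finset.mem_map.1 h
      have hch := fun j => Fintype.mem_piFinset.1 (Finset.mem_sigma.1 hx).2 j
      refine ⟨gs_box.2 ⟨rfl, fun j => gs_of_mem_nonThin (hch j)⟩, h1,
        h2.trans (Nat.min_eq_left hp).symm, ?_⟩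
      change (box 0 q 0 ch).thinCard = _
      rw [thinCard_box, if_pos rfl, if_neg hp.ne',
        Finset.sum_eq_zero fun j _ => thinCard_of_mem_nonThin (hch j), add_zero]
  · obtain rfl : p = 0 := by omega
    exact hB h

theorem TQ.ne_unit {S : Stacking} {p : ℕ} (h : S.TQ p) : S ≠ unit := by
  rintro rfl
  have := h.thin
  rw [thinCard_unit] at this
  split_ifs at this

variable {𝒰 : Type u} [Category.{v} 𝒰]

theorem bdry_out (S : Stacking) {V X : 𝒰} (σ : Simp V X) : (S.out σ).bdry = σ.bdry := by
  induction S generalizing V with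
  | unit => rfl
  | box p q r ch ih =>
    have h : ∀ j, (outs ch (σ.drop p) j).bdry = (σ.drop p).bdry := by
      intro j
      induction j using Fin.induction with
      | zero => rfl
      | succ j hj => rw [outs_succ, ih, hj]
    rw [out]
    exact (Simp.bdry_bdryAppend (σ.take p) (h (Fin.last q))).trans
      (congrArg Simp.bdry (append_take_drop σ p))

theorem _root_.LaxPrestack.Simp.bdry_of_length {V X : 𝒰} (σ : Simp V X) (h : σ.length ≤ 1) :
    σ.bdry = σ := by
  cases σ with
  | nil => rfl
  | cons f σ =>
    cases σ with
    | nil => rfl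
    | cons g σ => simp [Simp.length] at h

theorem TQ.out_eq {S : Stacking} {V X : 𝒰} {σ : Simp V X} (h : S.TQ σ.length) :
    S.out σ = σ.bdry := by
  rw [← bdry_out S σ, Simp.bdry_of_length]
  rw [length_out h.gs σ h.adm, h.rdepth]
  exact min_le_left _ _

end Stacking

section

variable {k : Type t} [Field k] {𝒰 : Type u} [Category.{v} 𝒰]
  {A : LinQuiver.{u, v, w, w', t} k 𝒰} {M : Type*} [AddCommGroup M] [Module k M]
  {W : 𝒰} {St : Type*} {ι : Type*}

open Simp Stacking

namespace Family

variable (F : Family A M ι)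

theorem exists_bounded (P : ℕ) : ∃ Q, F.Bounded P Q := by
  refine ⟨(Finset.range (P + 1)).sup fun p => (F.lab p).sup fun i => (F.ar i p).getD 0, ?_⟩
  intro p hp i hi q hq
  refine le_trans ?_ (Finset.le_sup (f := fun p => (F.lab p).sup fun i => (F.ar i p).getD 0)
    (Finset.mem_range.2 (Nat.lt_succ_of_le hp)))
  refine le_trans ?_ (Finset.le_sup (f := fun i => (F.ar i p).getD 0) hi)
  simp [hq]

/-- The words that can be filled into boxes of the given sizes. -/
def words : List (ℕ × ℕ × ℕ) → Finset (List ι)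
  | [] => {[]}
  | b :: bs => (((F.lab b.1).filter fun i => F.ar i b.1 = some b.2.1) ×ˢ words bs).map
      ⟨fun x => x.1 :: x.2, fun x y h => by
        simp only [List.cons.injEq] at h
        exact Prod.ext h.1 h.2⟩

theorem sum_words {N : Type*} [AddCommMonoid N] (bs : List (ℕ × ℕ × ℕ)) (f : List ι → N) :
    ∑ w ∈ F.words bs, f w = F.wordSum bs f := by
  induction bs generalizing f with
  | nil => exact Finset.sum_singleton _ _
  | cons b bs ih =>
    rw [words, Finset.sum_map, Finset.sum_product, Finset.sum_filter, wordSum]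
    refine Finset.sum_congr rfl fun i _ => ?_
    split_ifs
    · exact ih fun w => f (i :: w)
    · rfl

theorem mem_words {bs : List (ℕ × ℕ × ℕ)} {w : List ι} : w ∈ F.words bs ↔ F.Match bs w := by
  induction bs generalizing w with
  | nil => simp [words, Match]
  | cons b bs ih =>
    simp only [words, Finset.mem_map, Finset.mem_product, Finset.mem_filter, Prod.exists, Match]
    constructor
    · rintro ⟨i, w, ⟨hi, hw⟩, rfl⟩
      exact .cons hi (ih.1 hw)
    · rintro (_ | ⟨hi, hw⟩)
      exact ⟨_, _, ⟨hi, ih.2 hw⟩, rfl⟩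

/-- The family of all thin-quadratic stackings that are filled with elements of a family. -/
noncomputable def composites (Q : ℕ → ℕ) : Family A M (ℕ × (_ : Stacking) × List ι) where
  θ x := fun q _ _ σ a => x.2.1.act (F.word x.2.2) q σ a
  lab p := ((quad (Q p) p).sigma fun S => F.words S.sizes).map ⟨fun x => (p, x), fun x y h => by
    simpa using h⟩
  ar x _ := some x.2.1.inputs
  e x := x.1 + x.2.1.inputs
  N x := sg k (rootThin x.2.1 + x.2.1.mSign x.1 0) • F.wordOp x.2.1.sizes x.2.2
  T x := sg k (rootThin x.2.1 + x.2.1.mSign x.1 0) • F.wordOp x.2.1.sizes x.2.2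

variable {F}

theorem mem_lab_composites {Q : ℕ → ℕ} {p : ℕ} {x : ℕ × (_ : Stacking) × List ι} :
    x ∈ (F.composites Q).lab p ↔
      x.1 = p ∧ x.2.1 ∈ quad (Q p) p ∧ F.Match x.2.1.sizes x.2.2 := by
  obtain ⟨p', S, w⟩ := x
  simp only [composites, Finset.mem_map, Finset.mem_sigma, mem_words]
  constructor
  · rintro ⟨⟨S', w'⟩, h, h'⟩
    cases h'
    exact ⟨rfl, h⟩
  · rintro ⟨rfl, h⟩
    exact ⟨⟨S, w⟩, h, rfl⟩

theorem par_composites (Q : ℕ → ℕ) : (F.composites Q).Par := by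
  intro x p q hx hq
  obtain ⟨h, -⟩ := mem_lab_composites.1 hx
  cases hq
  change (x.1 + x.2.1.inputs : ZMod 2) = _
  rw [h]

theorem sum_lab_composites {N : Type*} [AddCommMonoid N] (Q : ℕ → ℕ) (p : ℕ)
    (f : ℕ × (_ : Stacking) × List ι → N) : ∑ x ∈ (F.composites Q).lab p, f x =
      ∑ S ∈ quad (Q p) p, F.wordSum S.sizes fun w => f (p, ⟨S, w⟩) := by
  rw [composites, Finset.sum_map, Finset.sum_sigma]
  exact Finset.sum_congr rfl fun S _ => F.sum_words _ _

theorem oneBox_composites {Q : ℕ → ℕ} {obj : St → A.Ob W} {par : St → ZMod 2} {Y : Tr A W St M}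
    {V : 𝒰} (σ : Simp V W) {S : Stacking} (hS : S.TQ σ.length) (w : List ι) (κ s) :
    oneBox ((F.composites Q).θ (σ.length, ⟨S, w⟩)) ((F.composites Q).N (σ.length, ⟨S, w⟩))
      (sizePar S.sizes) obj par σ (chain obj Y S.inputs) κ s =
    sg k (rootThin S + S.mSign σ.length 0 + sizePar S.sizes * par s) •
      F.wordOp S.sizes w (chain obj Y S.inputs
        (fun s' l => κ s' (evO (F.word w) (objAt (obj s) l) (valAt l) S σ 0 0)) s) := by
  have h : chain obj Y S.inputs (fun s' l => κ s'
      (appL ((F.composites Q).θ (σ.length, ⟨S, w⟩)) σ (obj s) l)) s =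
      chain obj Y S.inputs
        (fun s' l => κ s' (evO (F.word w) (objAt (obj s) l) (valAt l) S σ 0 0)) s := by
    refine chain_congr_end obj Y _ fun s' l hl _ => congrArg (κ s') ?_
    exact appL_act (F.word w) S hS.ne_unit σ hS.out_eq (obj s) l hl
  rw [oneBox_apply, h, composites, LinearMap.smul_apply, sg_smul_smul, add_comm (sizePar _ * _)]

theorem collects_composites.{x, y} {k : Type t} [Field k] {𝒰 : Type u} [Category.{v} 𝒰]
    {A : LinQuiver.{u, v, w, w', t} k 𝒰} {M : Type y} [AddCommGroup M] [Module k M]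
    {ι : Type*} {F : Family A M ι} (hF : F.Par) {Q : ℕ → ℕ} (hQ : ∀ p, F.Bounded p (Q p)) :
    Collects.{u, v, w, w', t, x} F (F.composites Q) := by
  intro W St obj par Y h
  refine ⟨fun V σ κ s hσ => ?_, fun κ s => ?_⟩
  · rw [QN_eq_sum hF h σ (hQ _) hσ, boxN_apply, sum_lab_composites]
    refine Finset.sum_congr rfl fun S hS => ?_
    have hS := tq_of_mem_quad hS
    refine Eq.trans ?_ (map_wordSum F (DistribSMul.toAddMonoidHom M (sg k _)) _ _).symm
    refine F.wordSum_congr _ fun w _ => ?_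
    refine Eq.trans ?_ (oneBox_composites (Q := Q) σ hS w κ s)
    have he : (F.composites Q).e (σ.length, ⟨S, w⟩) = sizePar S.sizes := by
      rw [sizePar_eq S _ hS.adm, hS.rdepth, Nat.min_eq_left hσ]
      change ((σ.length : ZMod 2) + S.inputs) = _
      push_cast
      linear_combination (-1) * two_eq_zero_zmod
    rw [← he]
    rfl
  · rw [QT_eq_sum hF h (hQ 0), boxT_apply, sum_lab_composites]
    refine Finset.sum_congr rfl fun S hS => ?_
    have hS := tq_of_mem_quad hS
    refine Eq.trans ?_ (map_wordSum F (DistribSMul.toAddMonoidHom M (sg k _)) _ _).symm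
    refine F.wordSum_congr _ fun w _ => ?_
    refine Eq.trans ?_ (oneBox_composites (Q := Q) (nil W) hS w κ s)
    have he : (F.composites Q).e (0, ⟨S, w⟩) + 1 = sizePar S.sizes := by
      rw [sizePar_eq S _ hS.adm, hS.rdepth]
      change (((0 : ℕ) : ZMod 2) + S.inputs) + 1 = _
      simp
    rw [← he]
    rfl

theorem wordOp_eta {η : Module.End k M} (hη : F.Rel η 0 1) (bs : List (ℕ × ℕ × ℕ)) (w : List ι)
    (h : bs.length = w.length) (m : M) : F.wordOp bs w (η m) =
      sg k (bs.countP (fun b => b.1 = 0) : ℕ) • η (F.wordOp bs w m) := by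
  induction bs generalizing w with
  | nil => simp [wordOp]
  | cons b bs ih =>
    cases w with
    | nil => simp at h
    | cons i w =>
      rw [wordOp, Module.End.mul_apply, ih w (by simpa using h), map_smul, Module.End.mul_apply,
        List.countP_cons, op]
      by_cases hb : b.1 = 0
      · have := LinearMap.congr_fun (hη.relT i) (F.wordOp bs w m)
        simp only [zero_mul, zero_add, Module.End.mul_apply, LinearMap.smul_apply] at this
        simp only [hb, if_true, decide_true]
        push_cast
        rw [sg_add, mul_smul]
        congr 1
        rw [this, smul_smul, sg_mul_self, one_smul]
      · have := LinearMap.congr_fun (hη.relN i) (F.wordOp bs w m)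
        simp only [zero_mul, sg_zero, one_smul, Module.End.mul_apply] at this
        simp only [hb, if_false, decide_false]
        rw [← this]
        simp

theorem deform_composites {η : Module.End k M} {Q : ℕ → ℕ} (hF : F.Rels) (h0 : η * η = 0)
    (hη : F.Rel η 0 1) : Deform F (F.composites Q) η where
  rels := hF
  sq := h0
  rel := hη
  relN p hp x hx m := by
    obtain ⟨-, h1, h2⟩ := mem_lab_composites.1 hx
    change sg k _ • F.wordOp _ _ (η m) = - η (sg k _ • _)
    rw [wordOp_eta hη _ _ h2.length_eq, show List.countP _ _ = thinCard _ from rfl,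
      (tq_of_mem_quad h1).thin, if_neg hp.ne', map_smul, Nat.cast_one, sg_one, neg_one_smul,
      smul_neg]
  relT x hx m := by
    obtain ⟨-, h1, h2⟩ := mem_lab_composites.1 hx
    change sg k _ • F.wordOp _ _ (η m) = η (sg k _ • _)
    rw [wordOp_eta hη _ _ h2.length_eq, show List.countP _ _ = thinCard _ from rfl,
      (tq_of_mem_quad h1).thin, if_pos rfl, map_smul,
      show ((2 : ℕ) : ZMod 2) = 0 from two_eq_zero_zmod, sg_zero, one_smul]

theorem par_ext {ι' : Type*} {G : Family A M ι'} (hF : F.Par) (hG : G.Par) (η : Module.End k M) :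
    (F.ext G η).Par := by
  rintro (i | i) p q hi hq
  · exact hF i p q (Finset.inl_mem_disjSum.1 hi) hq
  · exact hG i p q (Finset.inr_mem_disjSum.1 hi) hq

end Family

end

namespace Stacking

/-! ## The classification of the shapes -/

theorem isGSBox_thin {b : ℕ × ℕ × ℕ} (h : IsGSBox b) (h0 : b.1 = 0) : b.2.2 = 0 := by
  rw [h, h0]; rfl

theorem isGSBox_nonThin {b : ℕ × ℕ × ℕ} (h : IsGSBox b) (h0 : b.1 ≠ 0) : b.2.2 = 1 := by
  rw [h]; omega

theorem rdepth_le {S : Stacking} (hS : S.GS) {d : ℕ} (h : S.Admissible d) : S.rdepth d ≤ d := by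
  have h1 := S.sum_size_sub d h
  have h2 : 0 ≤ (S.sizes.map fun b => (b.1 : ℤ) - b.2.2).sum := by
    refine List.sum_nonneg fun x hx => ?_
    obtain ⟨b, hb, rfl⟩ := List.mem_map.1 hx
    have : b.2.2 = min 1 b.1 := hS b hb
    change 0 ≤ (b.1 : ℤ) - b.2.2
    omega
  omega

theorem sides_le {q : ℕ} {ch : Fin q → Stacking} (hch : ∀ j, (ch j).GS) {d : ℕ}
    (h : ∀ j, (ch j).Admissible (sides ch d j.castSucc)) (j : Fin (q + 1)) : sides ch d j ≤ d := by
  induction j using Fin.induction with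
  | zero => exact le_rfl
  | succ j hj => exact (rdepth_le (hch j) (h j)).trans hj

theorem rdepth_eq_zero {S : Stacking} (hS : S.GS) {d : ℕ} (h : S.Admissible d)
    (h0 : S.rdepth d = 0) : d = 0 := by
  induction S generalizing d with
  | unit => exact h0
  | box p q r ch ih =>
    obtain ⟨hr, hch⟩ := gs_box.1 hS
    rw [rdepth_box] at h0
    have hs : ∀ j, sides ch (d - p) j = 0 := by
      intro j
      induction j using Fin.reverseInduction with
      | last => omega
      | cast j hj => exact ih j (hch j) (h.2 j) hj
    have := hs 0
    change d - p = 0 at this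
    have := h.1
    omega

theorem thinCard_of_admissible_zero {S : Stacking} (hS : S.GS) (h : S.Admissible 0) :
    S.thinCard = S.card ∧ S.rdepth 0 = 0 := by
  refine ⟨?_, Nat.le_zero.1 (rdepth_le hS h)⟩
  induction S with
  | unit => simp [thinCard, card, sizes_unit]
  | box p q r ch ih =>
    obtain ⟨hr, hch⟩ := gs_box.1 hS
    rw [thinCard_box, card_box, if_pos (Nat.le_zero.1 h.1)]
    refine congrArg (1 + ·) (Finset.sum_congr rfl fun j _ => ih j (hch j) ?_)
    have := h.2 j
    rwa [Nat.le_zero.1 ((sides_le hch h.2 j.castSucc).trans (Nat.sub_le 0 p))] at this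

theorem card_eq_zero {S : Stacking} : S.card = 0 ↔ S = unit := by
  cases S with
  | unit => simp [card, sizes_unit]
  | box p q r ch => simp [card_box]

theorem eq_corolla {S : Stacking} (hS : S.GS) (h : S.Admissible 0) (h1 : S.card = 1) :
    ∃ q, S = corolla q := by
  cases S with
  | unit => simp [card, sizes_unit] at h1
  | box p q r ch =>
    obtain ⟨hr, -⟩ := gs_box.1 hS
    obtain rfl : p = 0 := Nat.le_zero.1 h.1
    obtain rfl : r = 0 := hr
    rw [card_box] at h1
    have h2 : ∑ j, (ch j).card = 0 := by omega
    have h3 : ch = fun _ => unit := funext fun j =>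
      card_eq_zero.1 (Finset.sum_eq_zero_iff.1 h2 j (Finset.mem_univ j))
    exact ⟨q, by rw [h3]; rfl⟩

theorem exists_update {q : ℕ} {ch : Fin q → Stacking} (hch : ∀ j, (ch j).GS)
    (h : ∀ j, (ch j).Admissible 0) (h1 : ∑ j, (ch j).card = 1) :
    ∃ j q', ch = Function.update (fun _ => unit) j (corolla q') := by
  obtain ⟨j, -, hj⟩ : ∃ j ∈ Finset.univ, (ch j).card ≠ 0 := by
    by_contra hn
    push Not at hn
    rw [Finset.sum_eq_zero hn] at h1
    exact absurd h1 (by decide)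
  have h2 : (ch j).card + ∑ i ∈ Finset.univ.erase j, (ch i).card = 1 := by
    exact (Finset.add_sum_erase Finset.univ (fun i => (ch i).card) (Finset.mem_univ j)).trans h1
  obtain ⟨q', hq⟩ := eq_corolla (hch j) (h j) (by omega)
  refine ⟨j, q', funext fun i => ?_⟩
  by_cases hi : i = j
  · subst hi; rw [Function.update_self, hq]
  · rw [Function.update_of_ne hi]
    have h3 : ∑ i ∈ Finset.univ.erase j, (ch i).card = 0 := by omega
    exact card_eq_zero.1 (Finset.sum_eq_zero_iff.1 h3 i (Finset.mem_erase.2 ⟨hi, Finset.mem_univ i⟩))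

theorem unit_mem_nonThin (P Q H : ℕ) : unit ∈ nonThin P Q H := by
  cases H with
  | zero => exact Finset.mem_singleton_self _
  | succ H => exact Finset.mem_cons_self _ _

theorem mem_nonThin {P Q H d : ℕ} {S : Stacking} (hS : S.GS) (h : S.Admissible d)
    (ht : S.thinCard = 0) (hQ : ∀ b ∈ S.sizes, b.2.1 ≤ Q) (hP : d ≤ P) (hH : d ≤ H) :
    S ∈ nonThin P Q H := by
  induction S generalizing d H with
  | unit => exact unit_mem_nonThin P Q H
  | box p q r ch ih =>
    obtain ⟨hr, hch⟩ := gs_box.1 hS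
    rw [thinCard_box] at ht
    have hp : p ≠ 0 := fun h0 => by rw [if_pos h0] at ht; omega
    obtain rfl : r = 1 := by rw [hr]; omega
    have hpd := h.1
    have hs : ∑ j, (ch j).thinCard = 0 := by omega
    obtain ⟨H, rfl⟩ : ∃ H', H = H' + 1 := ⟨H - 1, by omega⟩
    refine Finset.mem_cons.2 (Or.inr (Finset.mem_map.2 ⟨⟨(p, q), ch⟩, Finset.mem_sigma.2
      ⟨Finset.mem_product.2 ⟨Finset.mem_Icc.2 ⟨Nat.pos_of_ne_zero hp, hpd.trans hP⟩,
        Finset.mem_range.2 (Nat.lt_succ_of_le (hQ (p, q, 1) ?_))⟩, ?_⟩, rfl⟩))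
    · rw [sizes_box]; exact List.mem_cons_self
    · refine Fintype.mem_piFinset.2 fun j => ih j (hch j) (h.2 j) ?_ (fun b hb => hQ b ?_) ?_ ?_
      · exact Finset.sum_eq_zero_iff.1 hs j (Finset.mem_univ j)
      · rw [sizes_box]
        exact List.mem_cons_of_mem _ (mem_layerSizes.2 ⟨j, hb⟩)
      · have := sides_le hch h.2 j.castSucc
        omega
      · have := sides_le hch h.2 j.castSucc
        omega

/-- The thin-quadratic shapes whose bottom box has arrows or whose result has none have two boxes. -/
theorem TQ.eq_twoBox {p p' q r : ℕ} {ch : Fin q → Stacking} (h : (box p' q r ch).TQ p)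
    (h0 : p = 0 ∨ p' ≠ 0) : ∃ j q', p' = p ∧ box p' q r ch = twoBox p q j q' := by
  obtain ⟨hr, hch⟩ := gs_box.1 h.gs
  have hp := h.adm.1
  have h1 := h.rdepth
  have h2 := h.thin
  rw [rdepth_box] at h1
  rw [thinCard_box] at h2
  have hs0 : p - p' = 0 := by
    have hs : ∀ j, sides ch (p - p') j = 0 := by
      intro j
      induction j using Fin.reverseInduction with
      | last =>
        rcases h0 with h0 | h0
        · subst h0; omega
        · have : p ≠ 0 := by omega
          omega
      | cast j hj => exact rdepth_eq_zero (hch j) (h.adm.2 j) hj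
    exact hs 0
  obtain rfl : p' = p := by omega
  have hadm : ∀ j, (ch j).Admissible 0 := fun j => by
    have := h.adm.2 j
    rwa [Nat.le_zero.1 ((sides_le hch h.adm.2 j.castSucc).trans hs0.le)] at this
  have hc : ∑ j, (ch j).card = 1 := by
    rw [← Finset.sum_congr rfl fun j _ => (thinCard_of_admissible_zero (hch j) (hadm j)).1]
    split_ifs at h2 <;> omega
  obtain ⟨j, q', rfl⟩ := exists_update hch hadm hc
  exact ⟨j, q', rfl, by rw [twoBox, hr]⟩

open scoped Classical in
theorem TQ.mem_quad {S : Stacking} {p Q : ℕ} (h : S.TQ p) (hQ : ∀ b ∈ S.sizes, b.2.1 ≤ Q) :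
    S ∈ quad Q p := by
  cases S with
  | unit => exact absurd rfl h.ne_unit
  | box p' q r ch =>
    have hB : (p = 0 ∨ p' ≠ 0) → box p' q r ch ∈ quadB Q p := fun h0 => by
      obtain ⟨j, q', rfl, h1⟩ := h.eq_twoBox h0
      rw [h1]
      have hq := hQ (p', q, r) (by rw [sizes_box]; exact List.mem_cons_self)
      have hq' := hQ (0, q', 0) (by
        rw [h1, twoBox, sizes_box]
        refine List.mem_cons_of_mem _ (mem_layerSizes.2 ⟨j, ?_⟩)
        rw [Function.update_self, corolla, sizes_box]
        exact List.mem_cons_self)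
      exact Finset.mem_map.2 ⟨⟨q, j, q'⟩, Finset.mem_sigma.2 ⟨Finset.mem_range.2
        (Nat.lt_succ_of_le hq), Finset.mem_product.2 ⟨Finset.mem_univ _, Finset.mem_range.2
        (Nat.lt_succ_of_le hq')⟩⟩, rfl⟩
    rw [quad]
    split_ifs with hp
    · rw [Finset.mem_disjUnion]
      by_cases hp' : p' = 0
      swap
      · exact Or.inl (hB (Or.inr hp'))
      right
      subst hp'
      obtain ⟨hr, hch⟩ := gs_box.1 h.gs
      obtain rfl : r = 0 := hr
      have h2 := h.thin
      rw [thinCard_box, if_pos rfl, if_neg hp.ne'] at h2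
      have hs : ∑ j, (ch j).thinCard = 0 := by omega
      have h3 := h.rdepth
      rw [Nat.min_eq_left hp] at h3
      refine Finset.mem_filter.2 ⟨Finset.mem_map.2 ⟨⟨q, ch⟩, Finset.mem_sigma.2
        ⟨Finset.mem_range.2 (Nat.lt_succ_of_le (hQ (0, q, 0) ?_)), ?_⟩, rfl⟩, h.adm, h3⟩
      · rw [sizes_box]; exact List.mem_cons_self
      · refine Fintype.mem_piFinset.2 fun j => mem_nonThin (hch j) (h.adm.2 j)
          (Finset.sum_eq_zero_iff.1 hs j (Finset.mem_univ j)) (fun b hb => hQ b ?_)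
          (sides_le hch h.adm.2 _) (sides_le hch h.adm.2 _)
        rw [sizes_box]
        exact List.mem_cons_of_mem _ (mem_layerSizes.2 ⟨j, hb⟩)
    · obtain rfl : p = 0 := by omega
      exact hB (Or.inl rfl)

/-! ## Signs -/

theorem td_eq {b : ℕ × ℕ × ℕ} (h : IsGSBox b) :
    td b = ((b.1 : ℤ) - b.2.2) + ((b.2.1 : ℤ) - 1) + if b.1 = 0 then 0 else 1 := by
  rw [td]
  by_cases h0 : b.1 = 0
  · rw [if_pos ⟨h0, isGSBox_thin h h0⟩, if_pos h0, isGSBox_thin h h0, h0]; simp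
  · rw [if_neg fun h' => h0 h'.1, if_neg h0]; ring

theorem sum_td {S : Stacking} (hS : S.GS) {d : ℕ} (h : S.Admissible d) : (S.sizes.map td).sum =
    (d - S.rdepth d) + (S.inputs - 1) + (S.card - S.thinCard) := by
  rw [← S.sum_size_sub d h, ← S.sum_inputs_sub, card, thinCard]
  have hS : ∀ b ∈ S.sizes, IsGSBox b := hS
  generalize S.sizes = bs at hS
  induction bs with
  | nil => simp
  | cons b bs ih =>
    simp only [List.map_cons, List.sum_cons, List.length_cons, List.countP_cons]
    rw [ih fun b hb => hS b (List.mem_cons_of_mem _ hb), td_eq (hS b List.mem_cons_self)]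
    by_cases h0 : b.1 = 0
    · simp only [h0, if_true, decide_true]; push_cast; ring
    · simp only [h0, if_false, decide_false]; push_cast; ring

theorem TQ.degree_eq {S : Stacking} {p : ℕ} (h : S.TQ p) : S.degree p = 2 - S.card := by
  rw [degree, sum_td h.gs h.adm, result, td, h.rdepth, h.thin]
  rcases Nat.eq_zero_or_pos p with rfl | hp
  · simp
  · rw [if_neg (fun h' => hp.ne' h'.1), if_neg hp.ne', Nat.min_eq_left hp]
    push_cast
    ring

/-- The sum over all pairs of different entries of a list. -/
def pairSum {β R : Type*} [CommRing R] (f g : β → R) : List β → R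
  | [] => 0
  | b :: bs => f b * (bs.map g).sum + pairSum f g bs

theorem pairSum_append {β R : Type*} [CommRing R] (f g : β → R) (a b : List β) :
    pairSum f g (a ++ b) = pairSum f g a + (a.map f).sum * (b.map g).sum + pairSum f g b := by
  induction a with
  | nil => simp [pairSum]
  | cons x a ih =>
    simp only [List.cons_append, pairSum, ih, List.map_append, List.sum_append, List.map_cons,
      List.sum_cons]
    ring

theorem pairSum_eq {β R : Type*} [CommRing R] (f g : β → R) (l : List β) : pairSum f g l =
    ∑ i : Fin l.length, ∑ j : Fin l.length, if i < j then f (l.get i) * g (l.get j) else 0 := by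
  induction l with
  | nil => simp [pairSum]
  | cons b l ih =>
    rw [pairSum, ih]
    refine Eq.trans ?_ (Fin.sum_univ_succ (n := l.length) _).symm
    refine congrArg₂ (· + ·) ?_ (Finset.sum_congr rfl fun i _ => ?_)
    · refine Eq.trans ?_ (Fin.sum_univ_succ (n := l.length) _).symm
      simp only [lt_irrefl, if_false, zero_add, Fin.succ_pos, if_true]
      change _ = ∑ i : Fin l.length, f b * g (l.get i)
      rw [← Finset.mul_sum]
      refine congrArg (f b * ·) ?_
      rw [← List.sum_ofFn]
      refine congrArg List.sum ?_
      refine List.ext_getElem (by simp) fun i h1 h2 => by simp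
    · refine Eq.trans ?_ (Fin.sum_univ_succ (n := l.length) _).symm
      simp only [Fin.succ_lt_succ_iff, Fin.not_lt_zero, if_false, zero_add]
      rfl

end Stacking

namespace Stacking

theorem zmod_two_sq (a : ZMod 2) : a * a = a := by revert a; decide

/-- A summation by parts, for the vertical sides and the inputs of a layer. -/
theorem layer_identity {q : ℕ} (s off : Fin (q + 1) → ZMod 2) (Q P : Fin q → ZMod 2)
    (h0 : off 0 = 0) (hoff : ∀ j : Fin q, off j.succ = off j.castSucc + Q j + 1)
    (hP : ∀ j : Fin q, P j = Q j + s j.castSucc + s j.succ) :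
    off (Fin.last q) + ∑ i, P i = q + s 0 + s (Fin.last q) ∧
    ∑ j, Q j * ((j : ℕ) + s 0 + s j.castSucc) + ∑ j : Fin q, s j.castSucc * s j.succ +
        ∑ j : Fin q, off j.castSucc * P j + ∑ j, ∑ i, (if i < j then P i * P j else 0) =
      (q + 1) * s (Fin.last q) + s 0 * s (Fin.last q) := by
  induction q with
  | zero =>
    simp only [Finset.univ_eq_empty, Finset.sum_empty, Nat.cast_zero]
    refine ⟨?_, ?_⟩
    · rw [show Fin.last 0 = 0 from rfl, h0]
      linear_combination (-s 0) * two_eq_zero_zmod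
    · rw [show Fin.last 0 = 0 from rfl, zmod_two_sq]
      linear_combination (-s 0) * two_eq_zero_zmod
  | succ q ih =>
    obtain ⟨ih1, ih2⟩ := ih (fun j => s j.castSucc) (fun j => off j.castSucc) (fun j => Q j.castSucc)
      (fun j => P j.castSucc) h0 (fun j => hoff j.castSucc) (fun j => hP j.castSucc)
    have hl : ∀ f : Fin (q + 1 + 1) → ZMod 2, f (Fin.last (q + 1)) = f (Fin.last q).succ := fun _ => rfl
    have hpair : ∑ j : Fin (q + 1), ∑ i : Fin (q + 1), (if i < j then P i * P j else 0) =
        ∑ j : Fin q, ∑ i : Fin q, (if i < j then P i.castSucc * P j.castSucc else 0) +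
          (∑ i : Fin q, P i.castSucc) * P (Fin.last q) := by
      rw [Fin.sum_univ_castSucc, Finset.sum_mul]
      refine congrArg₂ (· + ·) (Finset.sum_congr rfl fun j _ => ?_) ?_
      · rw [Fin.sum_univ_castSucc, if_neg (Fin.castSucc_lt_last j).not_gt, add_zero]
        rfl
      · rw [Fin.sum_univ_castSucc, if_neg (lt_irrefl _), add_zero]
        refine Finset.sum_congr rfl fun i _ => if_pos (Fin.castSucc_lt_last i)
    refine ⟨?_, ?_⟩
    · rw [Fin.sum_univ_castSucc, hl off, hoff, hP, ← hl s]
      push_cast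
      rw [show (Fin.castSucc (0 : Fin (q + 1))) = 0 from rfl] at ih1
      linear_combination ih1 + (Q (Fin.last q) + s (Fin.last q).castSucc) * two_eq_zero_zmod
    · rw [hpair]
      simp only [Fin.sum_univ_castSucc (n := q)]
      have hPl := hP (Fin.last q)
      simp only [Fin.val_castSucc, Fin.val_last, Fin.succ_castSucc, ← hl] at ih2 hPl ⊢
      push_cast
      rw [show (Fin.castSucc (0 : Fin (q + 1))) = 0 from rfl] at ih1 ih2
      linear_combination ih2 + P (Fin.last q) * ih1 +
        (q + s 0 + s (Fin.last q).castSucc) * hPl + zmod_two_sq (s (Fin.last q).castSucc) +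
        (Q (Fin.last q) * (q + s 0 + s (Fin.last q).castSucc) +
          s (Fin.last q).castSucc * s (Fin.last (q + 1))
          + s (Fin.last q).castSucc * (q + s 0) + s (Fin.last q).castSucc
          - s (Fin.last (q + 1))) * two_eq_zero_zmod

/-- The parity of a box. -/
def boxPar (b : ℕ × ℕ × ℕ) : ZMod 2 := b.1 + b.2.1 + b.2.2 + 1

theorem sizePar_eq_sum (bs : List (ℕ × ℕ × ℕ)) : sizePar bs = (bs.map boxPar).sum := rfl

theorem pairSum_layerSizes {q : ℕ} (ch : Fin q → Stacking) :
    pairSum boxPar boxPar (layerSizes ch) = ∑ j, pairSum boxPar boxPar (ch j).sizes +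
      ∑ j, ∑ i, if i < j then sizePar (ch i).sizes * sizePar (ch j).sizes else 0 := by
  induction q with
  | zero => simp [layerSizes_zero, pairSum]
  | succ q ih =>
    rw [layerSizes_succ, pairSum_append, ih, Fin.sum_univ_succ]
    have : ∑ j : Fin (q + 1), ∑ i : Fin (q + 1),
        (if i < j then sizePar (ch i).sizes * sizePar (ch j).sizes else 0) =
        sizePar (ch 0).sizes * ∑ j : Fin q, sizePar (ch j.succ).sizes +
        ∑ j : Fin q, ∑ i : Fin q,
          if i < j then sizePar (ch i.succ).sizes * sizePar (ch j.succ).sizes else 0 := by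
      rw [Fin.sum_univ_succ, Finset.sum_eq_zero (fun i _ => if_neg (Fin.not_lt_zero i)), zero_add,
        Finset.mul_sum, ← Finset.sum_add_distrib]
      refine Finset.sum_congr rfl fun j _ => ?_
      rw [Fin.sum_univ_succ, if_pos (Fin.succ_pos j)]
      simp only [Fin.succ_lt_succ_iff]
    rw [this, ← sizePar_eq_sum, ← sizePar_eq_sum, sizePar_layerSizes fun i => ch i.succ]
    ring

theorem dExp_cast {S : Stacking} (hS : S.GS) (d : ℕ) (h : S.Admissible d) :
    ((S.dExp d : ℤ) : ZMod 2) = S.mSign d 0 + pairSum boxPar boxPar S.sizes + d * S.rdepth d +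
      (S.sizes.map fun b => (b.1 : ZMod 2)).sum := by
  induction S generalizing d with
  | unit =>
    obtain rfl : d = 0 := h
    simp [dExp, mSign, sizes_unit, pairSum]
  | box p q r ch ih =>
    obtain ⟨hr, hch⟩ := gs_box.1 hS
    obtain ⟨hp, ha⟩ := h
    have hP : ∀ j, sizePar (ch j).sizes = ((ch j).inputs + 1 : ZMod 2) +
        (sides ch (d - p) j.castSucc : ℕ) + (sides ch (d - p) j.succ : ℕ) := fun j => by
      rw [sizePar_eq _ _ (ha j), ← sides_succ]; ring
    obtain ⟨i1, i2⟩ := layer_identity (fun j => ((sides ch (d - p) j : ℕ) : ZMod 2))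
      (fun j => ((offsets ch 0 j : ℕ) : ZMod 2)) (fun j => ((ch j).inputs + 1 : ZMod 2))
      (fun j => sizePar (ch j).sizes) rfl (fun j => by
        rw [← offsets_castSucc_add]
        push_cast
        linear_combination (-1) * two_eq_zero_zmod) hP
    have hlayer : ((layerSizes ch).map fun b => (b.1 : ZMod 2)).sum =
        ∑ j, (((ch j).sizes.map fun b => (b.1 : ZMod 2)).sum) := by
      simp [layerSizes, List.sum_flatten, List.map_flatten, List.map_ofFn, List.sum_ofFn,
        Function.comp_def]
    have hm : layerSign ch (d - p) 0 = ∑ j, (ch j).mSign (sides ch (d - p) j.castSucc) 0 +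
        ∑ j : Fin q, (offsets ch 0 j.castSucc : ZMod 2) * sizePar (ch j).sizes := by
      rw [layerSign, ← Finset.sum_add_distrib]
      refine Finset.sum_congr rfl fun j _ => ?_
      conv_lhs => rw [← Nat.zero_add (offsets ch 0 j.castSucc)]
      exact mSign_add _ _ _ _
    rw [mSign_box, sizes_box, pairSum, List.map_cons, List.sum_cons, pairSum_layerSizes, hlayer, hm,
      rdepth_box, ← sizePar_eq_sum, sizePar_layerSizes]
    have hd : ((box p q r ch).dExp d : ZMod 2) =
        ((sides ch (d - p) 0 : ℕ) + (sides ch (d - p) (Fin.last q) : ℕ) : ZMod 2) * r +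
        ∑ j : Fin q, ((ch j).inputs + 1 : ZMod 2) * (q + (j : ℕ) + 1 + p + r +
          (sides ch (d - p) 0 : ℕ) + (sides ch (d - p) j.castSucc : ℕ)) +
        ∑ j, ((ch j).dExp (sides ch (d - p) j.castSucc) : ZMod 2) := by
      rw [dExp]
      push_cast
      rw [add_assoc (_ * (r : ZMod 2)), ← Finset.sum_add_distrib]
      refine congrArg₂ (· + ·) (congrArg₂ (· + ·) rfl (Finset.sum_congr rfl fun j _ => ?_)) rfl
      linear_combination (-((ch j).inputs + 1 : ZMod 2) * ((j : ℕ) + 1 + r +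
        (sides ch (d - p) j.castSucc : ℕ)) - (q - j - 1 + p - r + (sides ch (d - p) 0 : ℕ) -
        (sides ch (d - p) j.castSucc : ℕ))) * two_eq_zero_zmod
    have hs : (sides ch (d - p) 0 : ZMod 2) = d + p := by
      change ((d - p : ℕ) : ZMod 2) = d + p
      rw [Nat.cast_sub hp]
      linear_combination (-p) * two_eq_zero_zmod
    have hs' : ((d - p : ℕ) : ZMod 2) = (sides ch (d - p) 0 : ℕ) := rfl
    have hQ : ∑ j : Fin q, ((ch j).inputs + 1 : ZMod 2) * (q + (j : ℕ) + 1 + p + r +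
          (sides ch (d - p) 0 : ℕ) + (sides ch (d - p) j.castSucc : ℕ)) =
        (q + 1 + p + r) * ∑ j : Fin q, ((ch j).inputs + 1 : ZMod 2) +
        ∑ j : Fin q, ((ch j).inputs + 1 : ZMod 2) * ((j : ℕ) +
          (sides ch (d - p) 0 : ℕ) + (sides ch (d - p) j.castSucc : ℕ)) := by
      rw [Finset.mul_sum, ← Finset.sum_add_distrib]
      exact Finset.sum_congr rfl fun j _ => by ring
    have hsum : ∑ j, sizePar (ch j).sizes = ∑ j : Fin q, ((ch j).inputs + 1 : ZMod 2) +
        ((sides ch (d - p) 0 : ℕ) + (sides ch (d - p) (Fin.last q) : ℕ)) := by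
      have : ∀ n (s : Fin (n + 1) → ZMod 2), ∑ j : Fin n, (s j.castSucc + s j.succ) =
          s 0 + s (Fin.last n) := by
        intro n s
        induction n with
        | zero =>
          rw [show Fin.last 0 = 0 from rfl]
          simp only [Finset.univ_eq_empty, Finset.sum_empty]
          linear_combination (-s 0) * two_eq_zero_zmod
        | succ n ih =>
          rw [Fin.sum_univ_castSucc]
          have := ih fun j => s j.castSucc
          simp only [Fin.castSucc_zero] at this
          simp only [Fin.succ_castSucc, this, Fin.succ_last]
          linear_combination (s (Fin.last n).castSucc) * two_eq_zero_zmod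
      rw [← this q fun j => ((sides ch (d - p) j : ℕ) : ZMod 2), ← Finset.sum_add_distrib]
      exact Finset.sum_congr rfl fun j _ => (hP j).trans (add_assoc _ _ _)
    have hI : ∑ j, ((ch j).dExp (sides ch (d - p) j.castSucc) : ZMod 2) =
        ∑ j, (ch j).mSign (sides ch (d - p) j.castSucc) 0 +
        ∑ j, pairSum boxPar boxPar (ch j).sizes +
        ∑ j : Fin q, (sides ch (d - p) j.castSucc : ZMod 2) * (sides ch (d - p) j.succ : ℕ) +
        ∑ j, ((ch j).sizes.map fun b => (b.1 : ZMod 2)).sum := by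
      simp only [← Finset.sum_add_distrib]
      exact Finset.sum_congr rfl fun j _ => ih j (hch j) _ (ha j)
    have hpr : (p : ZMod 2) * (r + 1) = 0 := by
      rw [hr]
      rcases p with - | p
      · simp
      · rw [Nat.min_eq_left (by omega)]
        push_cast
        linear_combination (p + 1 : ZMod 2) * two_eq_zero_zmod
    rw [hd, hQ, hI, hsum, hs', boxPar]
    simp only at i2 ⊢
    push_cast
    rw [hs] at i2 ⊢
    have h1 := zmod_two_sq (d + p : ZMod 2)
    generalize (sides ch (d - p) (Fin.last q) : ZMod 2) = sq at *
    generalize (∑ j : Fin q, ((ch j).inputs + 1 : ZMod 2)) = Qs at *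
    generalize ∑ j : Fin q, ((ch j).inputs + 1 : ZMod 2) * ((j : ℕ) +
          (d + p) + (sides ch (d - p) j.castSucc : ℕ)) = X1 at *
    generalize ∑ j : Fin q, (sides ch (d - p) j.castSucc : ZMod 2) *
      (sides ch (d - p) j.succ : ℕ) = X2 at *
    generalize ∑ j : Fin q, (offsets ch 0 j.castSucc : ZMod 2) * sizePar (ch j).sizes = X3 at *
    generalize (∑ j, ∑ i, if i < j then sizePar (ch i).sizes * sizePar (ch j).sizes else 0) = X4 at *
    linear_combination i2 + hpr + (-(X3 + X4) - (d + d * p + d * r + d * q + 2 * p + p * r + p * q + p ^ 2)) * two_eq_zero_zmod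

end Stacking

namespace Stacking

section

variable {β R : Type*} [CommRing R]

theorem pairSum_congr {f f' g g' : β → R} {l : List β} (hf : ∀ b ∈ l, f b = f' b)
    (hg : ∀ b ∈ l, g b = g' b) : pairSum f g l = pairSum f' g' l := by
  induction l with
  | nil => rfl
  | cons b l ih =>
    have h : l.map g = l.map g' := List.map_congr_left fun b hb => hg b (List.mem_cons_of_mem _ hb)
    rw [pairSum, pairSum, hf b List.mem_cons_self, h,
      ih (fun b hb => hf b (List.mem_cons_of_mem _ hb)) fun b hb => hg b (List.mem_cons_of_mem _ hb)]

theorem pairSum_add_left (f f' g : β → R) (l : List β) :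
    pairSum (fun b => f b + f' b) g l = pairSum f g l + pairSum f' g l := by
  induction l with
  | nil => simp [pairSum]
  | cons b l ih => rw [pairSum, pairSum, pairSum, ih]; ring

theorem pairSum_add_right (f g g' : β → R) (l : List β) :
    pairSum f (fun b => g b + g' b) l = pairSum f g l + pairSum f g' l := by
  induction l with
  | nil => simp [pairSum]
  | cons b l ih => rw [pairSum, pairSum, pairSum, ih, List.sum_map_add]; ring

theorem pairSum_zero_left (g : β → R) (l : List β) : pairSum (fun _ => 0) g l = 0 := by
  induction l with
  | nil => rfl
  | cons b l ih => rw [pairSum, ih]; ring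

theorem sum_map_one (l : List β) : (l.map fun _ => (1 : R)).sum = l.length := by
  simp

end

theorem layerSizes_update {q : ℕ} (j : Fin q) (S : Stacking) :
    layerSizes (Function.update (fun _ => unit) j S) = S.sizes := by
  induction q with
  | zero => exact j.elim0
  | succ q ih =>
    rw [layerSizes_succ]
    cases j using Fin.cases with
    | zero =>
      rw [Function.update_self]
      have h : (fun i : Fin q => Function.update (fun _ => unit) 0 S i.succ) = fun _ => unit :=
        funext fun i => Function.update_of_ne (Fin.succ_ne_zero i) _ _
      rw [h]
      simp [layerSizes, sizes_unit]
    | succ j =>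
      rw [Function.update_of_ne (Fin.succ_ne_zero j).symm, sizes_unit, List.nil_append, ← ih j]
      refine congrArg _ (funext fun i => ?_)
      by_cases hi : i = j
      · subst hi; rw [Function.update_self, Function.update_self]
      · rw [Function.update_of_ne hi, Function.update_of_ne fun h => hi (Fin.succ_injective _ h)]

theorem sizes_twoBox (p q : ℕ) (j : Fin q) (q' : ℕ) :
    (twoBox p q j q').sizes = [(p, q, min 1 p), (0, q', 0)] := by
  rw [twoBox, sizes_box, layerSizes_update, corolla, sizes_box]
  simp [layerSizes, sizes_unit]

/-- One for the boxes with arrows. -/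
def nonThinInd (b : ℕ × ℕ × ℕ) : ZMod 2 := if b.1 = 0 then 0 else 1

/-- One for the boxes without arrows. -/
def thinInd (b : ℕ × ℕ × ℕ) : ZMod 2 := if b.1 = 0 then 1 else 0

/-- The total parity of the boxes after the boxes without arrows. -/
def thinSign (bs : List (ℕ × ℕ × ℕ)) : ZMod 2 :=
  pairSum thinInd (fun b => (b.1 : ZMod 2) + b.2.1) bs

theorem thinInd_eq (b : ℕ × ℕ × ℕ) : thinInd b = 1 + nonThinInd b := by
  rw [thinInd, nonThinInd]
  split_ifs <;> decide

theorem pairSum_nonThinInd (bs : List (ℕ × ℕ × ℕ)) :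
    (bs.map nonThinInd).sum = (bs.countP fun b => b.1 ≠ 0 : ℕ) ∧
    pairSum nonThinInd nonThinInd bs = ((bs.countP fun b => b.1 ≠ 0).choose 2 : ℕ) := by
  induction bs with
  | nil => simp [pairSum]
  | cons b bs ih =>
    rw [pairSum, List.map_cons, List.sum_cons, ih.1, ih.2, List.countP_cons]
    by_cases h : b.1 = 0
    · simp [h, nonThinInd]
    · simp only [h, nonThinInd, if_false, ne_eq, not_false_eq_true, decide_true, if_true]
      rw [Nat.choose_succ_succ', Nat.choose_one_right]
      push_cast
      exact ⟨add_comm _ _, by ring⟩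

theorem countP_add_thinCard (S : Stacking) :
    (S.sizes.countP fun b => b.1 ≠ 0) + S.thinCard = S.card := by
  have := List.length_eq_countP_add_countP (fun b : ℕ × ℕ × ℕ => b.1 = 0) (l := S.sizes)
  rw [card, thinCard, this, Nat.add_comm]
  simp

theorem boxPar_eq {b : ℕ × ℕ × ℕ} (h : IsGSBox b) : boxPar b = (td b : ℤ) + nonThinInd b := by
  rw [td_eq h, boxPar, nonThinInd]
  by_cases h0 : b.1 = 0
  · simp only [h0, if_true]; push_cast
    linear_combination (b.2.2 + 1 : ZMod 2) * two_eq_zero_zmod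
  · simp only [h0, if_false]; push_cast
    linear_combination (b.2.2 : ZMod 2) * two_eq_zero_zmod

theorem par_eq {b : ℕ × ℕ × ℕ} (h : IsGSBox b) : (b.1 : ZMod 2) + b.2.1 = (td b : ℤ) + 1 := by
  rw [td_eq h]
  by_cases h0 : b.1 = 0
  · simp only [h0, if_true, isGSBox_thin h h0]; push_cast; ring
  · simp only [h0, if_false, isGSBox_nonThin h h0]; push_cast
    ring

theorem isNonThin_iff {b : ℕ × ℕ × ℕ} (h : IsGSBox b) : IsNonThin b ↔ b.1 ≠ 0 := by
  by_cases h0 : b.1 = 0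
  · have := isGSBox_thin h h0
    simp [IsNonThin, IsThin, h0, this]
  · have := isGSBox_nonThin h h0
    simp [IsNonThin, IsThin, IsSemiThin, h0, this]

theorem tdExp_cast {S : Stacking} (hS : S.GS) (p : ℕ) : (S.tdExp p : ZMod 2) =
    (S.dExp p : ℤ) + S.card + pairSum (fun b => ((td b : ℤ) : ZMod 2)) nonThinInd S.sizes := by
  rw [tdExp, pairSum_eq]
  push_cast
  refine congrArg _ (Finset.sum_congr rfl fun i _ => ?_)
  rw [Finset.card_filter, Nat.cast_sum, Finset.mul_sum]
  refine Finset.sum_congr rfl fun j _ => ?_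
  have := isNonThin_iff (hS _ (List.get_mem S.sizes j))
  generalize S.sizes.get j = b at this
  rw [nonThinInd]
  by_cases hij : i < j <;> by_cases h0 : b.1 = 0 <;> simp [hij, h0, this]

theorem actExp_cast (S : Stacking) (p : ℕ) : (S.actExp p : ZMod 2) =
    (S.degree p * (S.degree p + 1) / 2 : ℤ) + (S.degree p : ℤ) * (td (S.result p) : ℤ) +
      pairSum (fun b => ((td b : ℤ) : ZMod 2)) (fun b => ((td b : ℤ) : ZMod 2)) S.sizes := by
  rw [actExp, pairSum_eq]
  push_cast
  rfl

theorem choose_sign {n : ℕ} (hn : 1 ≤ n) : (((n - 1).choose 2 : ℕ) : ZMod 2) +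
    (((2 - n : ℤ) * (2 - n + 1) / 2 : ℤ) : ZMod 2) = n := by
  obtain ⟨m, rfl⟩ : ∃ m, n = m + 1 := ⟨n - 1, by omega⟩
  have h2 : ((m.choose 2 : ℕ) : ℤ) * 2 = m * (m - 1) := by
    induction m with
    | zero => simp
    | succ m ih =>
      rw [Nat.choose_succ_succ', Nat.choose_one_right]
      push_cast
      linear_combination ih (by omega)
  have h3 : (2 - (m + 1 : ℕ) : ℤ) * (2 - (m + 1 : ℕ) + 1) / 2 = (m.choose 2 : ℕ) - m + 1 := by
    refine Int.ediv_eq_of_eq_mul_left (by decide) ?_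
    push_cast
    linear_combination -h2
  rw [h3, Nat.add_sub_cancel]
  push_cast
  linear_combination (((m.choose 2 : ℕ) : ZMod 2) - m) * two_eq_zero_zmod

theorem TQ.rootThin_eq {S : Stacking} {p : ℕ} (h : S.TQ p) (hp : 0 < p) :
    rootThin S + pairSum thinInd (fun _ => 1) S.sizes + S.card = 0 := by
  cases S with
  | unit => exact absurd rfl h.ne_unit
  | box p' q r ch =>
    by_cases h0 : p' = 0
    · subst h0
      have ht := h.thin
      rw [thinCard, sizes_box, List.countP_cons, if_neg hp.ne', if_pos (by simp)] at ht
      have h1 : ∀ b ∈ layerSizes ch, thinInd b = 0 := fun b hb => by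
        have := List.countP_eq_zero.1 (Nat.succ_injective ht) b hb
        rw [thinInd, if_neg (by simpa using this)]
      rw [card, sizes_box, pairSum, pairSum_congr h1 fun _ _ => rfl, pairSum_zero_left, sum_map_one,
        List.length_cons]
      simp only [rootThin, thinInd, if_true]
      push_cast
      linear_combination ((layerSizes ch).length + 1 : ZMod 2) * two_eq_zero_zmod
    · obtain ⟨j, q', rfl, h1⟩ := h.eq_twoBox (Or.inr h0)
      rw [h1, rootThin_twoBox hp, card, sizes_twoBox]
      simp only [pairSum, thinInd, hp.ne', if_false, List.map_nil, List.sum_nil, List.length_cons,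
        List.length_nil]
      push_cast
      linear_combination two_eq_zero_zmod

theorem TQ.rootThin_eq_zero {S : Stacking} (h : S.TQ 0) :
    rootThin S + pairSum thinInd (fun _ => 1) S.sizes = 0 ∧ S.card = 2 := by
  cases S with
  | unit => exact absurd rfl h.ne_unit
  | box p' q r ch =>
    obtain ⟨j, q', rfl, h1⟩ := h.eq_twoBox (Or.inl rfl)
    rw [h1, rootThin_twoBox_zero, card, sizes_twoBox]
    simp [pairSum, thinInd]
    decide

theorem sum_fst {S : Stacking} (hS : S.GS) {d : ℕ} (h : S.Admissible d) :
    (S.sizes.map fun b => (b.1 : ZMod 2)).sum = d + S.rdepth d + (S.card - S.thinCard : ℕ) := by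
  have h1 := congrArg (Int.cast : ℤ → ZMod 2) (S.sum_size_sub d h)
  rw [← countP_add_thinCard, Nat.add_sub_cancel]
  have h2 : (S.sizes.map fun b => (b.1 : ZMod 2)).sum =
      ((S.sizes.map fun b => (b.1 : ℤ) - b.2.2).sum : ℤ) + (S.sizes.map nonThinInd).sum := by
    have hS : ∀ b ∈ S.sizes, IsGSBox b := hS
    generalize S.sizes = bs at hS
    induction bs with
    | nil => simp
    | cons b bs ih =>
      simp only [List.map_cons, List.sum_cons]
      rw [ih fun b hb => hS b (List.mem_cons_of_mem _ hb), nonThinInd]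
      by_cases h0 : b.1 = 0
      · rw [isGSBox_thin (hS b List.mem_cons_self) h0, if_pos h0, h0]
        push_cast
        ring
      · rw [isGSBox_nonThin (hS b List.mem_cons_self) h0, if_neg h0]
        push_cast
        ring
  rw [h2, h1, (pairSum_nonThinInd _).1]
  push_cast
  linear_combination (-S.rdepth d : ZMod 2) * two_eq_zero_zmod

/-- The sign of a thin-quadratic stacking. -/
theorem TQ.sign {S : Stacking} {p : ℕ} (h : S.TQ p) : ((S.tdExp p + S.actExp p : ℤ) : ZMod 2) +
    pairSum (fun _ => 1) (fun b => ((td b : ℤ) : ZMod 2)) S.sizes =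
    rootThin S + S.mSign p 0 + thinSign S.sizes + S.card +
      S.card * (S.sizes.map fun b => ((td b : ℤ) : ZMod 2)).sum := by
  set T : ℕ × ℕ × ℕ → ZMod 2 := fun b => ((td b : ℤ) : ZMod 2) with hT
  have hmap : (S.sizes.map T).sum = (((S.sizes.map td).sum : ℤ) : ZMod 2) := by
    generalize S.sizes = bs
    induction bs with
    | nil => simp
    | cons b bs ih => simp only [List.map_cons, List.sum_cons, ih]; push_cast; rfl
  have h1 : pairSum boxPar boxPar S.sizes = pairSum T T S.sizes + pairSum T nonThinInd S.sizes +
      pairSum nonThinInd T S.sizes + pairSum nonThinInd nonThinInd S.sizes := by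
    rw [pairSum_congr (f' := fun b => T b + nonThinInd b) (g' := fun b => T b + nonThinInd b)
      (fun b hb => boxPar_eq (h.gs b hb)) fun b hb => boxPar_eq (h.gs b hb),
      pairSum_add_left, pairSum_add_right, pairSum_add_right]
    ring
  have h2 : thinSign S.sizes = pairSum (fun _ => 1) T S.sizes + pairSum nonThinInd T S.sizes +
      pairSum thinInd (fun _ => 1) S.sizes := by
    rw [thinSign, pairSum_congr (f' := thinInd) (g' := fun b => T b + 1) (fun b _ => rfl)
      (fun b hb => par_eq (h.gs b hb)), pairSum_add_right,
      pairSum_congr (f := thinInd) (g := T) (f' := fun b => 1 + nonThinInd b) (g' := T)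
        (fun b _ => thinInd_eq b) (fun _ _ => rfl), pairSum_add_left]
  have hnu := (pairSum_nonThinInd S.sizes).2
  have hc := countP_add_thinCard S
  have hdeg := h.degree_eq
  have hsum := sum_td h.gs h.adm
  have hf := sum_fst h.gs h.adm
  rw [Int.cast_add, tdExp_cast h.gs, actExp_cast, dExp_cast h.gs p h.adm, h1, h2, hmap, hsum, hdeg,
    hnu, hf, result, td]
  simp only
  rw [h.rdepth, h.thin]
  rw [h.thin] at hc
  rcases Nat.eq_zero_or_pos p with rfl | hp
  · obtain ⟨h3, h4⟩ := h.rootThin_eq_zero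
    rw [if_pos rfl, h4] at hc ⊢
    have h5 : (S.sizes.countP fun b => b.1 ≠ 0) = 0 := by omega
    rw [h5]
    simp only [Nat.min_zero, and_self, if_true]
    norm_num
    linear_combination (-1) * h3 + (pairSum T nonThinInd S.sizes + pairSum T T S.sizes
      - S.inputs + 1) * two_eq_zero_zmod
  · have h3 := h.rootThin_eq hp
    have hn : 1 ≤ S.card := by rw [if_neg hp.ne'] at hc; omega
    have h4 := choose_sign hn
    rw [if_neg hp.ne'] at hc ⊢
    have h5 : (S.sizes.countP fun b => b.1 ≠ 0) = S.card - 1 := by omega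
    rw [h5, Nat.min_eq_left hp, if_neg fun h' => hp.ne' h'.1, Nat.cast_sub hn]
    push_cast at h4 ⊢
    linear_combination h4 - h3 - zmod_two_sq (S.card : ZMod 2) +
      (pairSum T nonThinInd S.sizes + pairSum T T S.sizes - 1 + 2 * p - p * S.card + 3 * S.card -
        S.card * S.inputs + S.inputs) * two_eq_zero_zmod

end Stacking

namespace Stacking

/-! ## The horizontal graph of a thin-quadratic stacking -/

/-- The box with number `i` has arrows, if the boxes are numbered from `c` on. -/
def NonThinAt (S : Stacking) (c i : ℕ) : Prop := ∃ n b, i = c + n ∧ S.sizes[n]? = some b ∧ b.1 ≠ 0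

theorem layerSizes_getElem? {q : ℕ} (ch : Fin q → Stacking) (n : ℕ) (b : ℕ × ℕ × ℕ) :
    (layerSizes ch)[n]? = some b ↔
      ∃ j n', n = cardBefore ch j + n' ∧ (ch j).sizes[n']? = some b := by
  induction q generalizing n with
  | zero => simp [layerSizes_zero]
  | succ q ih =>
    rw [layerSizes_succ, Fin.exists_fin_succ]
    simp only [cardBefore_zero, cardBefore_succ, Nat.zero_add]
    rcases lt_or_ge n (ch 0).sizes.length with h | h
    · rw [List.getElem?_append_left h]
      constructor
      · exact fun h' => Or.inl ⟨n, rfl, h'⟩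
      · rintro (⟨n', rfl, h'⟩ | ⟨j, n', h1, -⟩)
        · exact h'
        · simp only [card] at h1; omega
    · rw [List.getElem?_append_right h, ih]
      constructor
      · rintro ⟨j, n', h1, h2⟩
        refine Or.inr ⟨j, n', ?_, h2⟩
        simp only [card] at h1 ⊢
        omega
      · rintro (⟨n', rfl, h'⟩ | ⟨j, n', h1, h2⟩)
        · rw [List.getElem?_eq_none h] at h'; cases h'
        · refine ⟨j, n', ?_, h2⟩
          simp only [card] at h1 ⊢
          omega

theorem nonThinAt_box {p q r : ℕ} {ch : Fin q → Stacking} {c i : ℕ} :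
    (box p q r ch).NonThinAt c i ↔
      (i = c ∧ p ≠ 0) ∨ ∃ j, (ch j).NonThinAt (c + 1 + cardBefore ch j) i := by
  simp only [NonThinAt, sizes_box]
  constructor
  · rintro ⟨n, b, rfl, h1, h2⟩
    rcases n with - | n
    · simp only [List.getElem?_cons_zero, Option.some.injEq] at h1
      subst h1
      exact Or.inl ⟨rfl, h2⟩
    · rw [List.getElem?_cons_succ, layerSizes_getElem?] at h1
      obtain ⟨j, n', rfl, h1⟩ := h1
      exact Or.inr ⟨j, n', b, by ring, h1, h2⟩
  · rintro (⟨rfl, h⟩ | ⟨j, n', b, rfl, h1, h2⟩)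
    · exact ⟨0, (p, q, r), rfl, rfl, h⟩
    · refine ⟨cardBefore ch j + n' + 1, b, by ring, ?_, h2⟩
      rw [List.getElem?_cons_succ, layerSizes_getElem?]
      exact ⟨j, n', rfl, h1⟩

/-- What the horizontal graph looks like: boxes and wires from `D` and `ws` are connected among
each other, and each of them is connected to one of the outgoing wires. -/
structure Flow (D : ℕ → Prop) (ws : List (ℕ ⊕ ℕ))
    (g : List ((ℕ ⊕ ℕ) × (ℕ ⊕ ℕ)) × List (ℕ ⊕ ℕ)) : Prop where
  out : ∀ y ∈ g.2, y ∈ ws ∨ ∃ i, D i ∧ y = Sum.inr i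
  left : ∀ e ∈ g.1, e.1 ∈ ws ∨ ∃ i, D i ∧ e.1 = Sum.inr i
  right : ∀ e ∈ g.1, ∃ i, D i ∧ e.2 = Sum.inr i
  wire : ∀ s : Setoid (ℕ ⊕ ℕ), (∀ e ∈ g.1, s e.1 e.2) → ∀ x ∈ ws, ∃ y ∈ g.2, s x y
  box : ∀ s : Setoid (ℕ ⊕ ℕ), (∀ e ∈ g.1, s e.1 e.2) → ∀ i, D i → ∃ y ∈ g.2, s (Sum.inr i) y

theorem Flow.trans {D D' : ℕ → Prop} {ws : List (ℕ ⊕ ℕ)}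
    {g g' : List ((ℕ ⊕ ℕ) × (ℕ ⊕ ℕ)) × List (ℕ ⊕ ℕ)} (h : Flow D ws g) (h' : Flow D' g.2 g') :
    Flow (fun i => D i ∨ D' i) ws (g.1 ++ g'.1, g'.2) where
  out y hy := by
    rcases h'.out y hy with h1 | ⟨i, h1, h2⟩
    · rcases h.out y h1 with h3 | ⟨i, h3, h4⟩
      · exact Or.inl h3
      · exact Or.inr ⟨i, Or.inl h3, h4⟩
    · exact Or.inr ⟨i, Or.inr h1, h2⟩
  left e he := by
    rcases List.mem_append.1 he with he | he
    · rcases h.left e he with h3 | ⟨i, h3, h4⟩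
      · exact Or.inl h3
      · exact Or.inr ⟨i, Or.inl h3, h4⟩
    · rcases h'.left e he with h1 | ⟨i, h1, h2⟩
      · rcases h.out _ h1 with h3 | ⟨i, h3, h4⟩
        · exact Or.inl h3
        · exact Or.inr ⟨i, Or.inl h3, h4⟩
      · exact Or.inr ⟨i, Or.inr h1, h2⟩
  right e he := by
    rcases List.mem_append.1 he with he | he
    · obtain ⟨i, h1, h2⟩ := h.right e he
      exact ⟨i, Or.inl h1, h2⟩
    · obtain ⟨i, h1, h2⟩ := h'.right e he
      exact ⟨i, Or.inr h1, h2⟩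
  wire s hs x hx := by
    obtain ⟨y, hy, hxy⟩ := h.wire s (fun e he => hs e (List.mem_append_left _ he)) x hx
    obtain ⟨z, hz, hyz⟩ := h'.wire s (fun e he => hs e (List.mem_append_right _ he)) y hy
    exact ⟨z, hz, s.trans hxy hyz⟩
  box s hs i hi := by
    rcases hi with hi | hi
    · obtain ⟨y, hy, hxy⟩ := h.box s (fun e he => hs e (List.mem_append_left _ he)) i hi
      obtain ⟨z, hz, hyz⟩ := h'.wire s (fun e he => hs e (List.mem_append_right _ he)) y hy
      exact ⟨z, hz, s.trans hxy hyz⟩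
    · exact h'.box s (fun e he => hs e (List.mem_append_right _ he)) i hi

theorem Flow.congr {D D' : ℕ → Prop} {ws : List (ℕ ⊕ ℕ)}
    {g : List ((ℕ ⊕ ℕ) × (ℕ ⊕ ℕ)) × List (ℕ ⊕ ℕ)} (h : Flow D ws g) (hD : ∀ i, D i ↔ D' i) :
    Flow D' ws g := by
  rwa [show D' = D from funext fun i => propext (hD i).symm]

theorem hgraph_flow {S : Stacking} (hS : S.GS) (c : ℕ) (ws : List (ℕ ⊕ ℕ))
    (h : S.Admissible ws.length) :
    Flow (S.NonThinAt c) ws (S.hgraph c ws) ∧ (S.hgraph c ws).2.length = S.rdepth ws.length := by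
  induction S generalizing c ws with
  | unit =>
    have hN : ∀ i, ¬ unit.NonThinAt c i := by
      rintro i ⟨n, b, -, h1, -⟩
      simp [sizes_unit] at h1
    rw [hgraph]
    exact ⟨⟨fun y hy => Or.inl hy, fun e he => by simp at he, fun e he => by simp at he,
      fun s _ x hx => ⟨x, hx, s.refl x⟩, fun s _ i hi => absurd hi (hN i)⟩, rfl⟩
  | box p q r ch ih =>
    obtain ⟨hr, hch⟩ := gs_box.1 hS
    obtain ⟨hp, ha⟩ := h
    let above : Fin (q + 1) → List ((ℕ ⊕ ℕ) × (ℕ ⊕ ℕ)) × List (ℕ ⊕ ℕ) :=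
      scan (fun j (s : List ((ℕ ⊕ ℕ) × (ℕ ⊕ ℕ)) × List (ℕ ⊕ ℕ)) =>
        (s.1 ++ (hgraph (ch j) (c + 1 + cardBefore ch j) s.2).1,
          (hgraph (ch j) (c + 1 + cardBefore ch j) s.2).2)) ([], ws.drop p)
    have hab : ∀ j, Flow (fun i => ∃ l : Fin q, l.castSucc < j ∧
        (ch l).NonThinAt (c + 1 + cardBefore ch l) i) (ws.drop p) (above j) ∧
        (above j).2.length = sides ch (ws.length - p) j := by
      intro j
      induction j using Fin.induction with
      | zero =>
        refine ⟨⟨fun y hy => Or.inl hy, fun e he => by simp [above, scan_zero] at he,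
          fun e he => by simp [above, scan_zero] at he,
          fun s _ x hx => ⟨x, hx, s.refl x⟩, fun s _ i hi => ?_⟩, List.length_drop⟩
        obtain ⟨l, hl, -⟩ := hi
        exact absurd hl (Fin.not_lt_zero _)
      | succ j hj =>
        have hb := ha j
        rw [← hj.2] at hb
        obtain ⟨h1, h2⟩ := ih j (hch j) (c + 1 + cardBefore ch j) (above j.castSucc).2 hb
        refine ⟨(hj.1.trans h1).congr fun i => ?_, ?_⟩
        · constructor
          · rintro (⟨l, hl, h3⟩ | h3)
            · exact ⟨l, hl.trans j.castSucc_lt_succ, h3⟩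
            · exact ⟨j, j.castSucc_lt_succ, h3⟩
          · rintro ⟨l, hl, h3⟩
            rcases (Fin.castSucc_lt_succ_iff.1 hl).lt_or_eq with h4 | rfl
            · exact Or.inl ⟨l, Fin.castSucc_lt_castSucc_iff.2 h4, h3⟩
            · exact Or.inr h3
        · rw [sides_succ, ← hj.2]
          exact h2
    obtain ⟨hF, hL⟩ := hab (Fin.last q)
    have hg : (box p q r ch).hgraph c ws = ((ws.take p).map (fun x => (x, Sum.inr c)) ++
        (above (Fin.last q)).1, List.replicate r (Sum.inr c) ++ (above (Fin.last q)).2) := by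
      rw [hgraph]
    rw [hg]
    have hsplit : ∀ x ∈ ws, x ∈ ws.take p ∨ x ∈ ws.drop p := fun x hx => by
      rwa [← List.mem_append, List.take_append_drop]
    have hD : ∀ i, (box p q r ch).NonThinAt c i ↔ (i = c ∧ p ≠ 0) ∨ ∃ l : Fin q,
        l.castSucc < Fin.last q ∧ (ch l).NonThinAt (c + 1 + cardBefore ch l) i := fun i => by
      rw [nonThinAt_box]
      simp [Fin.castSucc_lt_last]
    have hc : p ≠ 0 → Sum.inr c ∈ List.replicate r (Sum.inr c : ℕ ⊕ ℕ) := fun h0 => by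
      rw [List.mem_replicate]
      exact ⟨by rw [hr]; omega, rfl⟩
    refine ⟨⟨fun y hy => ?_, fun e he => ?_, fun e he => ?_, fun s hs x hx => ?_,
      fun s hs i hi => ?_⟩, ?_⟩
    · rcases List.mem_append.1 hy with hy | hy
      · obtain ⟨h1, rfl⟩ := List.mem_replicate.1 hy
        exact Or.inr ⟨c, (hD c).2 (Or.inl ⟨rfl, by rintro rfl; exact h1 hr⟩), rfl⟩
      · rcases hF.out y hy with h1 | ⟨i, h1, h2⟩
        · exact Or.inl (List.mem_of_mem_drop h1)
        · exact Or.inr ⟨i, (hD i).2 (Or.inr h1), h2⟩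
    · rcases List.mem_append.1 he with he | he
      · obtain ⟨x, hx, rfl⟩ := List.mem_map.1 he
        exact Or.inl (List.mem_of_mem_take hx)
      · rcases hF.left e he with h1 | ⟨i, h1, h2⟩
        · exact Or.inl (List.mem_of_mem_drop h1)
        · exact Or.inr ⟨i, (hD i).2 (Or.inr h1), h2⟩
    · rcases List.mem_append.1 he with he | he
      · obtain ⟨x, hx, rfl⟩ := List.mem_map.1 he
        exact ⟨c, (hD c).2 (Or.inl ⟨rfl, by rintro rfl; simp at hx⟩), rfl⟩
      · obtain ⟨i, h1, h2⟩ := hF.right e he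
        exact ⟨i, (hD i).2 (Or.inr h1), h2⟩
    · rcases hsplit x hx with hx | hx
      · refine ⟨Sum.inr c, List.mem_append_left _ (hc (by rintro rfl; simp at hx)), ?_⟩
        exact hs (x, Sum.inr c) (List.mem_append_left _ (List.mem_map.2 ⟨x, hx, rfl⟩))
      · obtain ⟨y, hy, hxy⟩ := hF.wire s (fun e he => hs e (List.mem_append_right _ he)) x hx
        exact ⟨y, List.mem_append_right _ hy, hxy⟩
    · rcases (hD i).1 hi with ⟨rfl, h0⟩ | h1
      · exact ⟨Sum.inr i, List.mem_append_left _ (hc h0), s.refl _⟩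
      · obtain ⟨y, hy, hxy⟩ := hF.box s (fun e he => hs e (List.mem_append_right _ he)) i h1
        exact ⟨y, List.mem_append_right _ hy, hxy⟩
    · rw [rdepth_box, List.length_append, List.length_replicate, hL]

section

variable {S : Stacking} {p : ℕ}

/-- The name of a vertex of the horizontal graph. -/
def vertexName (S : Stacking) (p : ℕ) (x : Fin p ⊕ Fin S.card) : ℕ ⊕ ℕ := Sum.map Fin.val Fin.val x

theorem vertexName_injective : Function.Injective (S.vertexName p) :=
  Sum.map_injective.2 ⟨Fin.val_injective, Fin.val_injective⟩

theorem NonThinAt.lt {i : ℕ} (h : S.NonThinAt 0 i) : i < S.card := by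
  obtain ⟨n, b, rfl, h1, -⟩ := h
  rw [Nat.zero_add]
  exact (List.getElem?_eq_some_iff.1 h1).1

theorem TQ.flow (h : S.TQ p) : Flow (S.NonThinAt 0) (List.ofFn fun i : Fin p => Sum.inl i.val)
    (S.hgraph 0 (List.ofFn fun i : Fin p => Sum.inl i.val)) ∧
    (S.hgraph 0 (List.ofFn fun i : Fin p => Sum.inl i.val)).2.length = min 1 p := by
  have h1 := hgraph_flow h.gs 0 (List.ofFn fun i : Fin p => Sum.inl i.val)
    (by rw [List.length_ofFn]; exact h.adm)
  rwa [List.length_ofFn, h.rdepth] at h1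

theorem TQ.isolated (h : S.TQ p) {i : Fin S.card} (hi : ¬ S.NonThinAt 0 i)
    {x : Fin p ⊕ Fin S.card} (hx : (S.horizontalGraph p).Reachable (Sum.inr i) x) :
    x = Sum.inr i := by
  obtain ⟨hF, -⟩ := h.flow
  obtain ⟨w⟩ := hx
  cases w with
  | nil => rfl
  | cons hadj _ =>
    exfalso
    rw [horizontalGraph, SimpleGraph.fromRel_adj] at hadj
    obtain ⟨-, h1 | h1⟩ := hadj
    · rcases hF.left _ h1 with h2 | ⟨n, h2, h3⟩
      · simp at h2
      · simp only [Sum.map_inr, Sum.inr.injEq] at h3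
        exact hi (h3 ▸ h2)
    · obtain ⟨n, h2, h3⟩ := hF.right _ h1
      simp only [Sum.map_inr, Sum.inr.injEq] at h3
      exact hi (h3 ▸ h2)

theorem TQ.connected (h : S.TQ p) (hp : 0 < p) {x y : Fin p ⊕ Fin S.card}
    (hx : ∀ i, x = Sum.inr i → S.NonThinAt 0 i) (hy : ∀ i, y = Sum.inr i → S.NonThinAt 0 i) :
    (S.horizontalGraph p).connectedComponentMk x = (S.horizontalGraph p).connectedComponentMk y := by
  classical
  obtain ⟨hF, hL⟩ := h.flow
  let comp : ℕ ⊕ ℕ → Option (S.horizontalGraph p).ConnectedComponent := fun n =>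
    if h : ∃ v, S.vertexName p v = n then some ((S.horizontalGraph p).connectedComponentMk h.choose)
    else none
  have hcomp : ∀ v, comp (S.vertexName p v) = some ((S.horizontalGraph p).connectedComponentMk v) := by
    intro v
    have hv : ∃ v', S.vertexName p v' = S.vertexName p v := ⟨v, rfl⟩
    change (if h : _ then _ else _) = _
    rw [dif_pos hv, vertexName_injective hv.choose_spec]
  have hname : ∀ n, ((n ∈ List.ofFn fun i : Fin p => (Sum.inl i.val : ℕ ⊕ ℕ)) ∨
      ∃ i, S.NonThinAt 0 i ∧ n = Sum.inr i) → ∃ v, S.vertexName p v = n := by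
    rintro n (h1 | ⟨i, h1, rfl⟩)
    · obtain ⟨i, rfl⟩ := List.mem_ofFn.1 h1
      exact ⟨Sum.inl i, rfl⟩
    · exact ⟨Sum.inr ⟨i, h1.lt⟩, rfl⟩
  have hedge : ∀ e ∈ (S.hgraph 0 (List.ofFn fun i : Fin p => Sum.inl i.val)).1,
      Setoid.ker comp e.1 e.2 := by
    intro e he
    obtain ⟨v, hv⟩ := hname _ (hF.left e he)
    obtain ⟨v', hv'⟩ := hname _ (Or.inr (hF.right e he))
    rw [Setoid.ker_def, ← hv, ← hv', hcomp, hcomp]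
    by_cases hvv : v = v'
    · rw [hvv]
    refine congrArg some (SimpleGraph.ConnectedComponent.sound (SimpleGraph.Adj.reachable ?_))
    rw [horizontalGraph, SimpleGraph.fromRel_adj]
    refine ⟨hvv, Or.inl ?_⟩
    change (S.vertexName p v, S.vertexName p v') ∈ _
    rw [hv, hv']
    exact he
  rw [Nat.min_eq_left hp, List.length_eq_one_iff] at hL
  obtain ⟨y0, hy0⟩ := hL
  have key : ∀ x : Fin p ⊕ Fin S.card, (∀ i, x = Sum.inr i → S.NonThinAt 0 i) →
      comp (S.vertexName p x) = comp y0 := by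
    rintro (i | i) hx
    · obtain ⟨y, hy, h1⟩ := hF.wire _ hedge (Sum.inl i.val) (List.mem_ofFn.2 ⟨i, rfl⟩)
      rw [hy0, List.mem_singleton] at hy
      exact hy ▸ h1
    · obtain ⟨y, hy, h1⟩ := hF.box _ hedge i (hx i rfl)
      rw [hy0, List.mem_singleton] at hy
      exact hy ▸ h1
  have h1 := (key x hx).trans (key y hy).symm
  rw [hcomp, hcomp] at h1
  exact Option.some_injective _ h1

theorem exists_unique_of_countP {β : Type*} (P : β → Bool) (l : List β) (h : l.countP P = 1) :
    ∃ n < l.length, ∀ m b, l[m]? = some b → (P b = true ↔ m = n) := by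
  induction l with
  | nil => simp at h
  | cons a l ih =>
    rw [List.countP_cons] at h
    by_cases ha : P a = true
    · rw [if_pos ha] at h
      have h0 := List.countP_eq_zero.1 (Nat.succ_injective h)
      refine ⟨0, Nat.succ_pos _, fun m b hm => ?_⟩
      rcases m with - | m
      · simp only [List.getElem?_cons_zero, Option.some.injEq] at hm
        simp [← hm, ha]
      · rw [List.getElem?_cons_succ] at hm
        simp [h0 b (List.mem_of_getElem? hm)]
    · rw [if_neg ha] at h
      obtain ⟨n, hn, h1⟩ := ih h
      refine ⟨n + 1, Nat.succ_lt_succ hn, fun m b hm => ?_⟩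
      rcases m with - | m
      · simp only [List.getElem?_cons_zero, Option.some.injEq] at hm
        simp [← hm, ha]
      · rw [List.getElem?_cons_succ] at hm
        simp [h1 m b hm]

theorem TQ.components (h : S.TQ p) : Nat.card (S.horizontalGraph p).ConnectedComponent = 2 := by
  rw [Nat.card_eq_two_iff]
  rcases Nat.eq_zero_or_pos p with rfl | hp
  · have hthin : ∀ i, ¬ S.NonThinAt 0 i := by
      rintro i ⟨n, b, -, h1, h2⟩
      have h3 := (thinCard_of_admissible_zero h.gs h.adm).1
      rw [thinCard, card, List.countP_eq_length] at h3
      exact h2 (by simpa using h3 b (List.mem_of_getElem? h1))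
    have hc := h.rootThin_eq_zero.2
    refine ⟨(S.horizontalGraph 0).connectedComponentMk (Sum.inr ⟨0, by omega⟩),
      (S.horizontalGraph 0).connectedComponentMk (Sum.inr ⟨1, by omega⟩), fun h1 => ?_, ?_⟩
    · have := h.isolated (hthin _) (SimpleGraph.ConnectedComponent.exact h1)
      simp at this
    · refine Set.eq_univ_of_forall fun C => ?_
      induction C using SimpleGraph.ConnectedComponent.ind with
      | h x =>
        rcases x with x | ⟨i, hi⟩
        · exact x.elim0
        · have : i = 0 ∨ i = 1 := by omega
          rcases this with rfl | rfl
          · exact Or.inl rfl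
          · exact Or.inr rfl
  · have ht := h.thin
    rw [if_neg hp.ne'] at ht
    obtain ⟨n, hn, h1⟩ := exists_unique_of_countP _ _ ht
    have hN : ∀ i < S.card, S.NonThinAt 0 i ↔ i ≠ n := by
      intro i hi
      have hi' : S.sizes[i]? = some S.sizes[i] := List.getElem?_eq_getElem hi
      have h2 := h1 i _ hi'
      simp only [decide_eq_true_eq] at h2
      constructor
      · rintro ⟨m, b, hm, h3, h4⟩ rfl
        rw [Nat.zero_add] at hm
        subst hm
        have h5 := h1 i b h3
        simp [h4] at h5
      · intro h3
        exact ⟨i, _, (Nat.zero_add i).symm, hi', fun h4 => h3 (h2.1 h4)⟩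
    have hn' : ¬ S.NonThinAt 0 n := fun h' => (hN n hn).1 h' rfl
    refine ⟨(S.horizontalGraph p).connectedComponentMk (Sum.inr ⟨n, hn⟩),
      (S.horizontalGraph p).connectedComponentMk (Sum.inl ⟨0, hp⟩), fun h2 => ?_, ?_⟩
    · have := h.isolated (i := ⟨n, hn⟩) hn' (SimpleGraph.ConnectedComponent.exact h2)
      simp at this
    · refine Set.eq_univ_of_forall fun C => ?_
      induction C using SimpleGraph.ConnectedComponent.ind with
      | h x =>
        by_cases hx : x = Sum.inr ⟨n, hn⟩
        · exact Or.inl (congrArg _ hx)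
        · refine Or.inr (h.connected hp (fun i hi => ?_) fun i hi => by cases hi)
          refine (hN i i.2).2 fun h3 => hx ?_
          rw [hi]
          exact congrArg Sum.inr (Fin.ext h3)

theorem TQ.isThinQuadratic (h : S.TQ p) : S.IsThinQuadratic S.card p S.inputs where
  card_eq := rfl
  admissible := h.adm
  inputs_eq := rfl
  degree_eq := h.degree_eq
  components := h.components
  not_semiThin b hb := by
    by_cases h0 : b.1 = 0
    · have := isGSBox_thin (h.gs b hb) h0
      simp [IsSemiThin, IsThin, h0, this]
    · have := isGSBox_nonThin (h.gs b hb) h0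
      simp [IsSemiThin, h0, this]
  isGSBox := h.gs
  isGSBox_result := h.rdepth

theorem IsThinQuadratic.tq {n q : ℕ} (h : S.IsThinQuadratic n p q) : S.TQ p where
  gs := h.isGSBox
  adm := h.admissible
  rdepth := h.isGSBox_result
  thin := by
    have h1 := h.degree_eq
    have h2 : S.rdepth p = min 1 p := h.isGSBox_result
    rw [degree, sum_td h.isGSBox h.admissible, result, td, h2, h.card_eq] at h1
    rcases Nat.eq_zero_or_pos p with rfl | hp
    · simp at h1
      rw [if_pos rfl]
      omega
    · rw [if_neg (fun h' => hp.ne' h'.1), Nat.min_eq_left hp] at h1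
      rw [if_neg hp.ne']
      push_cast at h1
      omega

theorem isThinQuadratic_iff {n q : ℕ} :
    S.IsThinQuadratic n p q ↔ S.TQ p ∧ S.card = n ∧ S.inputs = q := by
  constructor
  · exact fun h => ⟨h.tq, h.card_eq, h.inputs_eq⟩
  · rintro ⟨h, rfl, rfl⟩
    exact h.isThinQuadratic

end

end Stacking

/-! ## Stackings act by multilinear maps -/

namespace Stacking

theorem getElem?_layerSizes {q : ℕ} (ch : Fin q → Stacking) (j : Fin q) (i : ℕ)
    (hi : i < (ch j).card) : (layerSizes ch)[cardBefore ch j + i]? = (ch j).sizes[i]? := by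
  induction q with
  | zero => exact j.elim0
  | succ q ih =>
    rw [layerSizes_succ]
    cases j using Fin.cases with
    | zero => rw [cardBefore_zero, Nat.zero_add, List.getElem?_append_left hi]
    | succ j =>
      rw [cardBefore_succ, add_assoc, List.getElem?_append_right (Nat.le_add_right (ch 0).card _)]
      change (layerSizes fun i => ch i.succ)[(ch 0).card + _ - (ch 0).card]? = _
      rw [Nat.add_sub_cancel_left]
      exact ih (fun i => ch i.succ) j hi

theorem exists_cardBefore {q : ℕ} (ch : Fin q → Stacking) (i : ℕ) (hi : i < ∑ j, (ch j).card) :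
    ∃ j, ∃ i' < (ch j).card, i = cardBefore ch j + i' := by
  induction q generalizing i with
  | zero => simp at hi
  | succ q ih =>
    by_cases h : i < (ch 0).card
    · exact ⟨0, i, h, by rw [cardBefore_zero, Nat.zero_add]⟩
    · rw [Fin.sum_univ_succ] at hi
      obtain ⟨j, i', h1, h2⟩ := ih (fun i => ch i.succ) (i - (ch 0).card) (by omega)
      exact ⟨j.succ, i', h1, by rw [cardBefore_succ]; omega⟩

theorem cardBefore_add_card_le {q : ℕ} (ch : Fin q → Stacking) {i j : Fin q} (h : i < j) :
    cardBefore ch i + (ch i).card ≤ cardBefore ch j := by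
  have e : (ch i).card = ∑ l : Fin q, if l = i then (ch l).card else 0 := by simp
  rw [cardBefore, e, cardBefore, ← Finset.sum_add_distrib]
  refine Finset.sum_le_sum fun l _ => ?_
  by_cases hl : l = i
  · subst hl; simp [h]
  · by_cases h' : l < i
    · simp [hl, h', h'.trans h]
    · simp [hl, h']

section

variable {k : Type t} [Field k] {𝒰 : Type u} [Category.{v} 𝒰]
  {A : LinQuiver.{u, v, w, w', t} k 𝒰}

/-- The `C^{p,q}`-component of `x` vanishes. -/
def _root_.LaxPrestack.VanishesAt (x : GSObj A) (p q : ℕ) : Prop :=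
  ∀ (V X : 𝒰) (σ : Simp V X) (a : Fin (q + 1) → A.Ob X), σ.length = p → x q V X σ a = 0

theorem _root_.LaxPrestack.gsObj_add_apply (x y : GSObj A) (q : ℕ) {V X : 𝒰} (σ : Simp V X)
    (a : Fin (q + 1) → A.Ob X) : (x + y) q V X σ a = x q V X σ a + y q V X σ a := rfl

theorem _root_.LaxPrestack.gsObj_smul_apply (c : k) (x : GSObj A) (q : ℕ) {V X : 𝒰} (σ : Simp V X)
    (a : Fin (q + 1) → A.Ob X) : (c • x) q V X σ a = c • x q V X σ a := rfl

theorem val_congr_fill {θ θ' : ℕ → GSObj A} {X : 𝒰} {N : ℕ} (a : Fin (N + 1) → A.Ob X)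
    (x : ∀ i : Fin N, A.Hom (a i.castSucc) (a i.succ)) (S : Stacking) {V : 𝒰} (τ : Simp V X)
    (c o : ℕ) (h : S.endOff o ≤ N) (hθ : ∀ i < S.card, θ (c + i) = θ' (c + i)) :
    val θ a x S τ c o h = val θ' a x S τ c o h := by
  induction S generalizing V c o with
  | unit => cases τ <;> rfl
  | box p q r ch ih =>
    have e1 : θ c = θ' c := hθ 0 (by rw [card_box]; omega)
    rw [val, val, e1]
    refine congrArg _ (congrArg _ (funext fun j => congrArg _ ?_))
    have hj := cardBefore_add_le ch j
    refine ih j _ _ _ _ fun i hi => ?_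
    have := hθ (1 + cardBefore ch j + i) (by rw [card_box]; omega)
    rwa [← add_assoc, ← add_assoc] at this

theorem _root_.LaxPrestack.comp_eq_zero {M M' M'' : Type*} [AddCommGroup M] [AddCommGroup M']
    [AddCommGroup M''] [Module k M] [Module k M'] [Module k M''] (g : M' →ₗ[k] M'') (f : M →ₗ[k] M')
    (y : M) (h : f y = 0) : (g ∘ₗ f) y = 0 := by
  rw [LinearMap.comp_apply, h, map_zero]

theorem val_slot (θ : ℕ → GSObj A) {X : 𝒰} {N : ℕ} (a : Fin (N + 1) → A.Ob X)
    (x : ∀ i : Fin N, A.Hom (a i.castSucc) (a i.succ)) (S : Stacking) (hS : S.GS) {V : 𝒰}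
    (τ : Simp V X) (hτ : S.Admissible τ.length) (c o : ℕ) (h : S.endOff o ≤ N) (t : ℕ)
    {b : ℕ × ℕ × ℕ} (ht : S.sizes[t]? = some b) :
    ∃ f : GSObj A →ₗ[k] A.Hom _ _,
      (∀ y, val (Function.update θ (c + t) y) a x S τ c o h = f y) ∧
        ∀ y, VanishesAt y b.1 b.2.1 → f y = 0 := by
  induction S generalizing V c o t with
  | unit => simp [sizes_unit] at ht
  | box p q r ch ih =>
    obtain ⟨hp, ha⟩ := hτ
    rcases t with - | t
    · rw [sizes_box, List.getElem?_cons_zero] at ht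
      obtain rfl := Option.some_injective _ ht
      let g : GSObj A →ₗ[k] A.Hom _ _ :=
        { toFun := fun y => y q _ _ (τ.take p)
            (fun j => A.lower (outs ch (τ.drop p) j) (a ⟨offsets ch o j,
              Nat.lt_succ_of_le ((offsets_mono ch o (Fin.le_last j)).trans h)⟩))
            (fun j => A.homCast rfl (lower_outs_succ ch (τ.drop p) o j a _ _)
              (val θ a x (ch j) (outs ch (τ.drop p) j.castSucc) (c + 1 + cardBefore ch j)
                (offsets ch o j.castSucc) (endOff_child_le ch o j h)))
          map_add' := fun _ _ => rfl
          map_smul' := fun _ _ => rfl }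
      refine ⟨(A.homCast (A.lower_take_drop p τ _) (A.lower_bdryAppend (τ.take p) _ _)).comp g,
        fun y => ?_, fun y hy => ?_⟩
      · have e1 : Function.update θ (c + 0) y c = y := Function.update_self _ _ _
        rw [val]
        refine congrArg _ ((congrArg (fun z : GSObj A => z q _ _ (τ.take p) _ _) e1).trans ?_)
        refine congrArg (y q _ _ (τ.take p) _) (funext fun j => congrArg _ ?_)
        exact val_congr_fill a x _ _ _ _ _ fun i _ => Function.update_of_ne (by omega) _ _
      · refine comp_eq_zero _ g y ?_
        exact DFunLike.congr_fun (hy _ _ (τ.take p) _ (length_take τ p hp)) _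
    · rw [sizes_box, List.getElem?_cons_succ] at ht
      have ht' : t < ∑ j, (ch j).card := by
        rw [← length_layerSizes]
        exact (List.getElem?_eq_some_iff.1 ht).1
      obtain ⟨j, i, hi, rfl⟩ := exists_cardBefore ch t ht'
      rw [getElem?_layerSizes ch j i hi] at ht
      have hch := (gs_box.1 hS).2
      rw [← length_drop τ p] at ha
      have haj := ha j
      rw [← length_outs hch (τ.drop p) ha] at haj
      obtain ⟨f, hf, hf0⟩ := ih j (hch j) (outs ch (τ.drop p) j.castSucc) haj
        (c + 1 + cardBefore ch j) (offsets ch o j.castSucc) (endOff_child_le ch o j h) i ht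
      refine ⟨(A.homCast (A.lower_take_drop p τ _) (A.lower_bdryAppend (τ.take p) _ _)).comp
        (((θ c q _ _ (τ.take p) fun j => A.lower (outs ch (τ.drop p) j) (a ⟨offsets ch o j,
            Nat.lt_succ_of_le ((offsets_mono ch o (Fin.le_last j)).trans h)⟩)).toLinearMap
          (fun j => A.homCast rfl (lower_outs_succ ch (τ.drop p) o j a _ _)
            (val θ a x (ch j) (outs ch (τ.drop p) j.castSucc) (c + 1 + cardBefore ch j)
              (offsets ch o j.castSucc) (endOff_child_le ch o j h))) j).comp
          (A.homCast rfl (lower_outs_succ ch (τ.drop p) o j a _ _))) ∘ₗ f,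
        fun y => ?_, fun y hy => ?_⟩
      · rw [val, Function.update_of_ne (by omega)]
        refine congrArg _ (congrArg _ ?_)
        funext l
        by_cases hl : l = j
        · subst hl
          rw [Function.update_self]
          refine congrArg _ ((congrArg (fun n => val (Function.update θ n y) a x (ch l) _ _ _ _) ?_).trans (hf y))
          omega
        · rw [Function.update_of_ne hl]
          refine congrArg _ (val_congr_fill a x _ _ _ _ _ fun i' hi' => ?_)
          refine Function.update_of_ne ?_ _ _
          rcases lt_or_gt_of_ne hl with hlt | hlt
          · have := cardBefore_add_card_le ch hlt
            omega
          · have := cardBefore_add_card_le ch hlt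
            omega
      · exact comp_eq_zero _ f y (hf0 y hy)

theorem act_apply (θ : ℕ → GSObj A) (S : Stacking) {V X : 𝒰} (σ : Simp V X)
    (h : S.out σ = σ.bdry) (a : Fin (S.inputs + 1) → A.Ob X)
    (x : ∀ i : Fin S.inputs, A.Hom (a i.castSucc) (a i.succ)) :
    S.act θ S.inputs σ a x = A.homCast rfl
      ((congrArg (fun τ => A.lower τ _) h).trans (A.lower_bdry σ _)) (val θ a x S σ 0 0 le_rfl) := by
  rw [act, dif_pos ⟨rfl, h⟩]
  rfl

theorem act_of_ne (θ : ℕ → GSObj A) {S : Stacking} {q : ℕ} (hq : S.inputs ≠ q) {V X : 𝒰}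
    (σ : Simp V X) (a : Fin (q + 1) → A.Ob X) : S.act θ q σ a = 0 := by
  rw [act, dif_neg fun h => hq h.1]

/-- The element of the Gerstenhaber-Schack object that results from filling a stacking. -/
noncomputable def fill (S : Stacking) (θ : ℕ → GSObj A) : GSObj A := fun q _ _ σ a => S.act θ q σ a

theorem act_slot (θ : ℕ → GSObj A) {S : Stacking} (hS : S.GS) (q : ℕ) {V X : 𝒰} (σ : Simp V X)
    (hσ : S.Admissible σ.length) (a : Fin (q + 1) → A.Ob X) (t : ℕ) {b : ℕ × ℕ × ℕ}
    (ht : S.sizes[t]? = some b) : ∃ f : GSObj A →ₗ[k] MultilinearMap k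
        (fun i : Fin q => A.Hom (a i.castSucc) (a i.succ))
        (A.Hom (A.lower σ (a 0)) (A.upper σ (a (Fin.last q)))),
      (∀ y, S.act (Function.update θ t y) q σ a = f y) ∧
        ∀ y, VanishesAt y b.1 b.2.1 → f y = 0 := by
  by_cases h : S.inputs = q ∧ S.out σ = σ.bdry
  · obtain ⟨rfl, h⟩ := h
    have e : ∀ y x, S.act (Function.update θ t y) S.inputs σ a x = A.homCast rfl
        ((congrArg (fun τ => A.lower τ _) h).trans (A.lower_bdry σ _))
          (val (Function.update θ (0 + t) y) a x S σ 0 0 le_rfl) := fun y x => by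
      rw [act_apply _ _ _ h, Nat.zero_add]
    choose f hf hf0 using fun x => val_slot θ a x S hS σ hσ 0 0 le_rfl t ht
    refine ⟨{ toFun := fun y => S.act (Function.update θ t y) S.inputs σ a
              map_add' := fun y z => ?_
              map_smul' := fun c y => ?_ }, fun y => rfl, fun y hy => ?_⟩
    · refine MultilinearMap.ext fun x => ?_
      refine (e _ _).trans (Eq.trans ?_ (congrArg₂ (· + ·) (e y x) (e z x)).symm)
      rw [hf, hf, hf, map_add, map_add]
      rfl
    · refine MultilinearMap.ext fun x => ?_
      refine (e _ _).trans (Eq.trans ?_ (congrArg (c • ·) (e y x)).symm)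
      rw [hf, hf, map_smul, map_smul]
      rfl
    · refine MultilinearMap.ext fun x => ?_
      change S.act (Function.update θ t y) S.inputs σ a x = 0
      rw [e, hf, hf0 _ _ hy, map_zero]
      rfl
  · exact ⟨0, fun y => by rw [act, dif_neg h]; rfl, fun _ _ => rfl⟩

end

end Stacking

section

variable {k : Type t} [Field k] {𝒰 : Type u} [Category.{v} 𝒰]
  {A : LinQuiver.{u, v, w, w', t} k 𝒰} {M : Type*} [AddCommGroup M] [Module k M]

/-- The linear map depends only on the `C^{p,q}`-component of its argument. -/
def LocalAt (φ : GSObj A →ₗ[k] M) (p q : ℕ) : Prop := ∀ x, VanishesAt x p q → φ x = 0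

/-- The function on lists of elements is linear in each entry, and depends only on the component of
the given size of each entry. -/
def MultiAt : List (ℕ × ℕ × ℕ) → (List (GSObj A) → M) → Prop
  | [], _ => True
  | b :: bs, Φ => (∀ l, l.length = bs.length → ∃ φ : GSObj A →ₗ[k] M, LocalAt φ b.1 b.2.1 ∧
      ∀ x, Φ (x :: l) = φ x) ∧ ∀ x, MultiAt bs fun l => Φ (x :: l)

/-- The sequence `l₀, l₁, …, 0, 0, …`. -/
noncomputable def seq (l : List (GSObj A)) (n : ℕ) : GSObj A := (l[n]?).getD 0

theorem seq_append_update (l : List (GSObj A)) (x y : GSObj A) (l' : List (GSObj A)) :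
    seq (l ++ x :: l') = Function.update (seq (l ++ y :: l')) l.length x := by
  funext n
  rcases lt_trichotomy n l.length with h | rfl | h
  · rw [Function.update_of_ne h.ne, seq, seq, List.getElem?_append_left h, List.getElem?_append_left h]
  · rw [Function.update_self, seq, List.getElem?_append_right le_rfl, Nat.sub_self]
    rfl
  · rw [Function.update_of_ne h.ne', seq, seq, List.getElem?_append_right h.le,
      List.getElem?_append_right h.le]
    obtain ⟨m, rfl⟩ := Nat.exists_eq_add_of_lt h
    rw [show l.length + m + 1 - l.length = m + 1 by omega]
    rfl

theorem multiAt_of_slot {bs : List (ℕ × ℕ × ℕ)} {Φ : (ℕ → GSObj A) → M} (h : ∀ θ t b, bs[t]? = some b →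
    ∃ φ : GSObj A →ₗ[k] M, LocalAt φ b.1 b.2.1 ∧ ∀ x, Φ (Function.update θ t x) = φ x)
    (l : List (GSObj A)) (bs' r : List (ℕ × ℕ × ℕ)) (hb : bs = bs' ++ r)
    (hl : bs'.length = l.length) : MultiAt (k := k) r fun l' => Φ (seq (l ++ l')) := by
  induction r generalizing l bs' with
  | nil => trivial
  | cons b r ih =>
    refine ⟨fun l' _ => ?_, fun x => ?_⟩
    · obtain ⟨φ, h1, h2⟩ := h (seq (l ++ 0 :: l')) l.length b (by
        rw [hb, List.getElem?_append_right hl.le, hl, Nat.sub_self]; rfl)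
      exact ⟨φ, h1, fun x => by rw [← h2, ← seq_append_update]⟩
    · simpa using ih (l ++ [x]) (bs' ++ [b]) (by rw [hb]; simp) (by simp [hl])

theorem Stacking.multiAt_fill {S : Stacking} {p q : ℕ} (hS : S.GS) (hp : S.Admissible p)
    {φ : GSObj A →ₗ[k] M} (hφ : LocalAt φ p q) :
    MultiAt (k := k) S.sizes fun l => φ (S.fill (seq l)) := by
  refine multiAt_of_slot (Φ := fun θ => φ (S.fill θ)) (fun θ t b ht => ?_) [] [] _ rfl rfl
  let x (y : GSObj A) : GSObj A := fun q' V X σ a => if σ.length = p then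
    S.act (Function.update θ t y) q' σ a else 0
  have h1 : ∀ y, φ (S.fill (Function.update θ t y)) = φ (x y) := fun y => by
    rw [← sub_eq_zero, ← map_sub]
    refine hφ _ fun V X σ a h => ?_
    change S.act _ q σ a - (if σ.length = p then _ else _) = 0
    rw [if_pos h, sub_self]
  have h2 : ∀ (q' : ℕ) {V X : 𝒰} (σ : Simp V X) (a : Fin (q' + 1) → A.Ob X), σ.length = p → _ :=
    fun q' V X σ a h => S.act_slot θ hS q' σ (h ▸ hp) a t ht
  refine ⟨φ ∘ₗ { toFun := x, map_add' := fun y z => ?_, map_smul' := fun c y => ?_ },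
    fun y hy => ?_, h1⟩
  · funext q' V X σ a
    change x (y + z) q' V X σ a = x y q' V X σ a + x z q' V X σ a
    simp only [x]
    split_ifs with h
    · obtain ⟨f, hf, -⟩ := h2 q' σ a h
      rw [hf, hf, hf, map_add]
    · rw [add_zero]
  · funext q' V X σ a
    change x (c • y) q' V X σ a = c • x y q' V X σ a
    simp only [x]
    split_ifs with h
    · obtain ⟨f, hf, -⟩ := h2 q' σ a h
      rw [hf, hf, map_smul]
    · rw [smul_zero]
  · refine comp_eq_zero _ _ _ ?_
    funext q' V X σ a
    change x y q' V X σ a = 0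
    simp only [x]
    split_ifs with h
    · obtain ⟨f, hf, hf0⟩ := h2 q' σ a h
      rw [hf, hf0 y hy]
    · rfl

namespace Family

variable {ι ι' : Type*} (F : Family A M ι) (F' : Family A M ι')

theorem word_eq_seq (w : List ι) : F.word w = seq (w.map F.θ) := by
  funext n
  rw [word, seq, List.getElem?_map]
  cases w[n]? <;> rfl

/-- The sum over all boxes of a given size. -/
noncomputable def boxSum (p q : ℕ) (φ : GSObj A →ₗ[k] M) : M :=
  ∑ i ∈ F.lab p, if F.ar i p = some q then F.op i p (φ (F.θ i)) else 0

theorem exists_wordSum_linear (bs : List (ℕ × ℕ × ℕ)) (Φ : GSObj A → List (GSObj A) → M) (p q : ℕ)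
    (h : ∀ l, l.length = bs.length → ∃ φ : GSObj A →ₗ[k] M, LocalAt φ p q ∧ ∀ x, Φ x l = φ x) :
    ∃ φ : GSObj A →ₗ[k] M, LocalAt φ p q ∧
      ∀ x, F.wordSum bs (fun w => F.wordOp bs w (Φ x (w.map F.θ))) = φ x := by
  classical
  have h' : ∀ w : List ι, ∃ φ : GSObj A →ₗ[k] M, LocalAt φ p q ∧
      ∀ x, w.length = bs.length → Φ x (w.map F.θ) = φ x := fun w => by
    by_cases hw : w.length = bs.length
    · obtain ⟨φ, h1, h2⟩ := h (w.map F.θ) (by simpa using hw)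
      exact ⟨φ, h1, fun x _ => h2 x⟩
    · exact ⟨0, fun _ _ => rfl, fun x h => absurd h hw⟩
  choose φ h1 h2 using h'
  refine ⟨∑ w ∈ F.words bs, F.wordOp bs w ∘ₗ φ w, fun x hx => ?_, fun x => ?_⟩
  · rw [LinearMap.sum_apply]
    exact Finset.sum_eq_zero fun w _ => comp_eq_zero _ _ _ (h1 w x hx)
  · rw [LinearMap.sum_apply, ← sum_words]
    refine Finset.sum_congr rfl fun w hw => ?_
    rw [h2 w x ((mem_words F).1 hw).length_eq.symm]
    rfl

theorem wordSum_cons_apply (b : ℕ × ℕ × ℕ) (bs : List (ℕ × ℕ × ℕ)) (Φ : List (GSObj A) → M) :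
    F.wordSum (b :: bs) (fun w => F.wordOp (b :: bs) w (Φ (w.map F.θ))) =
      ∑ i ∈ F.lab b.1, if F.ar i b.1 = some b.2.1 then F.op i b.1 (F.wordSum bs fun w =>
        F.wordOp bs w (Φ (F.θ i :: w.map F.θ))) else 0 := by
  refine Finset.sum_congr rfl fun i _ => ?_
  refine congrArg (fun x => if F.ar i b.1 = some b.2.1 then x else 0) ?_
  exact (F.map_wordSum (F.op i b.1).toAddMonoidHom bs _).symm

variable {F F'}

/-- Sums over all words agree for two families if the sums over all boxes do. -/
theorem wordSum_exchange {bs : List (ℕ × ℕ × ℕ)} (h : ∀ b ∈ bs, ∀ φ : GSObj A →ₗ[k] M,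
      LocalAt φ b.1 b.2.1 → F.boxSum b.1 b.2.1 φ = F'.boxSum b.1 b.2.1 φ)
    {Φ : List (GSObj A) → M} (hΦ : MultiAt (k := k) bs Φ) :
    F.wordSum bs (fun w => F.wordOp bs w (Φ (w.map F.θ))) =
      F'.wordSum bs fun w => F'.wordOp bs w (Φ (w.map F'.θ)) := by
  induction bs generalizing Φ with
  | nil => rfl
  | cons b bs ih =>
    obtain ⟨h1, h2⟩ := hΦ
    have ih' := fun x => ih (fun b hb => h b (List.mem_cons_of_mem _ hb)) (h2 x)
    obtain ⟨φ, h3, h4⟩ := F'.exists_wordSum_linear bs (fun x l => Φ (x :: l)) _ _ h1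
    rw [wordSum_cons_apply, wordSum_cons_apply]
    simp only [ih', h4]
    exact h b List.mem_cons_self φ h3

end Family

end

/-! ## Koszul signs -/

section

variable {k : Type t} [Field k] {M : Type*} [AddCommGroup M] [Module k M]

theorem negOnePow_smul (a : ℤ) (x : M) : a.negOnePow • x = sg k (a : ZMod 2) • x := by
  rcases Int.even_or_odd a with h | h
  · rw [Int.negOnePow_even _ h, (ZMod.intCast_eq_zero_iff_even).2 h, sg_zero, one_smul, one_smul]
  · rw [Int.negOnePow_odd _ h, (ZMod.intCast_eq_one_iff_odd).2 h, sg_one, neg_one_smul, Units.neg_smul, one_smul]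

theorem neg_one_pow_eq_sg (n : ℕ) : (-1 : k) ^ n = sg k (n : ZMod 2) := by
  rcases Nat.even_or_odd n with h | h
  · rw [h.neg_one_pow, (ZMod.natCast_eq_zero_iff_even).2 h, sg_zero]
  · rw [h.neg_one_pow, (ZMod.natCast_eq_one_iff_odd).2 h, sg_one]

theorem negOnePow_sum {β : Type*} (s : Finset β) (f : β → ℤ) :
    (∑ i ∈ s, f i).negOnePow = ∏ i ∈ s, (f i).negOnePow := by
  classical
  induction s using Finset.induction_on with
  | empty => simp
  | insert i s hi ih => rw [Finset.sum_insert hi, Finset.prod_insert hi, Int.negOnePow_add, ih]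

/-- The Koszul sign of a list of elements of parities `e`, relative to the sorted list. -/
def kz {κ : Type*} [LinearOrder κ] (e : κ → ZMod 2) : List κ → ZMod 2
  | [] => 0
  | x :: l => e x * ((l.filter (· < x)).map e).sum + kz e l

theorem kz_of_sorted {κ : Type*} [LinearOrder κ] (e : κ → ZMod 2) {l : List κ}
    (h : l.Pairwise (· < ·)) : kz e l = 0 := by
  induction h with
  | nil => rfl
  | @cons x l h _ ih =>
    rw [kz, ih, List.filter_eq_nil_iff.2 fun y hy => by simpa using (h y hy).le]
    simp

theorem kz_ofFn {κ : Type*} [LinearOrder κ] (e : κ → ZMod 2) {n : ℕ} (f : Fin n → κ) :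
    kz e (List.ofFn f) = ∑ i, ∑ j, if i < j ∧ f j < f i then e (f i) * e (f j) else 0 := by
  have h : ∀ {n : ℕ} (f : Fin n → κ) x, (((List.ofFn f).filter (· < x)).map e).sum =
      ∑ j, if f j < x then e (f j) else 0 := fun {n} f x => by
    induction n with
    | zero => simp
    | succ n ih =>
      rw [List.ofFn_succ, Fin.sum_univ_succ, List.filter_cons]
      by_cases hx : f 0 < x
      · simp only [hx, decide_true, if_true, List.map_cons, List.sum_cons, ih]
      · simp only [hx, decide_false, if_false, ih, Bool.false_eq_true, zero_add]
  induction n with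
  | zero => simp [kz]
  | succ n ih =>
    rw [List.ofFn_succ, kz, h, ih, Fin.sum_univ_succ, Finset.mul_sum]
    refine congrArg₂ (· + ·) ?_ (Finset.sum_congr rfl fun i _ => ?_)
    · rw [Fin.sum_univ_succ]
      simp
    · rw [Fin.sum_univ_succ]
      simp

/-- The sign of a permutation of homogeneous elements, in terms of the shifted degrees. -/
theorem sign_mul_koszul {n : ℕ} (π : Equiv.Perm (Fin n)) (d : Fin n → ℤ) (x : M) :
    (Equiv.Perm.sign π * koszul π fun i => d (π i)) • x =
      sg k (kz (fun i => ((d i + 1 : ℤ) : ZMod 2)) (List.ofFn π) +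
        ∑ i : Fin n, (i.val : ZMod 2) * (d (π i) : ℤ) + ∑ i : Fin n, (i.val : ZMod 2) * (d i : ℤ)) •
        x := by
  have h1 : Equiv.Perm.sign π * (koszul π fun i => d (π i)) =
      (∑ i : Fin n, ∑ j : Fin n, if i < j ∧ π j < π i then 1 + d (π i) * d (π j) else 0).negOnePow := by
    have : Equiv.Perm.sign π = ∏ i : Fin n, ∏ j : Fin n, if i < j ∧ π j < π i then (-1 : ℤˣ) else 1 := by
      rw [Equiv.Perm.sign_eq_prod_prod_Ioi]
      refine Finset.prod_congr rfl fun i _ => ?_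
      rw [← Finset.prod_filter_mul_prod_filter_not Finset.univ (fun j => i < j)
        (fun j => if i < j ∧ π j < π i then (-1 : ℤˣ) else 1), Finset.prod_congr
        (g := fun _ => 1) (s₁ := Finset.univ.filter fun j => ¬ i < j) rfl fun j hj =>
          if_neg fun h => (Finset.mem_filter.1 hj).2 h.1, Finset.prod_const_one, mul_one]
      refine Finset.prod_congr (by ext; simp) fun j hj => ?_
      have hij := (Finset.mem_filter.1 hj).2
      rcases lt_trichotomy (π i) (π j) with h | h | h
      · rw [if_pos h, if_neg fun h' => h.not_gt h'.2]
      · exact absurd (π.injective h) hij.ne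
      · rw [if_neg h.not_gt, if_pos ⟨hij, h⟩]
    rw [this, koszul, negOnePow_sum, ← Finset.prod_mul_distrib]
    refine Finset.prod_congr rfl fun i _ => ?_
    rw [negOnePow_sum, ← Finset.prod_mul_distrib]
    refine Finset.prod_congr rfl fun j _ => ?_
    split_ifs
    · rw [Int.negOnePow_add, Int.negOnePow_one]
    · simp
  have h2 : ∑ i : Fin n, (i.val : ZMod 2) * (d i : ℤ) =
      ∑ i : Fin n, ((π i).val : ZMod 2) * (d (π i) : ℤ) :=
    (Equiv.sum_comp π fun i : Fin n => (i.val : ZMod 2) * (d i : ℤ)).symm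
  have h3 : ∀ i : Fin n, ((i.val : ZMod 2) = ∑ j, if j < i then 1 else 0) ∧
      (((π i).val : ZMod 2) = ∑ j, if π j < π i then 1 else 0) := fun i => by
    have : ∀ i : Fin n, (i.val : ZMod 2) = ∑ j, if j < i then 1 else 0 := fun i => by
      rw [Finset.sum_boole, Finset.filter_gt_eq_Iio, Fin.card_Iio]
    refine ⟨this i, (this (π i)).trans ?_⟩
    exact (Equiv.sum_comp π fun j => if j < π i then (1 : ZMod 2) else 0).symm
  rw [h1, negOnePow_smul (k := k), h2, kz_ofFn, add_assoc, ← Finset.sum_add_distrib]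
  congr 2
  have h4 : ∀ i j : Fin n, ((if j < i then 1 else 0) + (if π j < π i then 1 else 0) : ZMod 2) =
      (if i < j ∧ π j < π i then 1 else 0) + if j < i ∧ π i < π j then 1 else 0 := fun i j => by
    rcases lt_trichotomy i j with h | rfl | h
    · simp [h, h.not_gt]
    · simp
    · rcases lt_trichotomy (π i) (π j) with h' | h' | h'
      · simp [h, h', h.not_gt, h'.not_gt]
      · exact absurd (π.injective h') h.ne'
      · simp only [h, h', h.not_gt, h'.not_gt, if_true, false_and, and_false, if_false]
        exact one_add_one_eq_two.trans two_eq_zero_zmod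
  have h5 : ∑ i : Fin n, ((i.val : ZMod 2) * (d (π i) : ℤ) + ((π i).val : ZMod 2) * (d (π i) : ℤ)) =
      ∑ i, ∑ j, if i < j ∧ π j < π i then ((d (π i) : ℤ) + (d (π j) : ℤ) : ZMod 2) else 0 := by
    have : ∀ i : Fin n, ((i.val : ZMod 2) * (d (π i) : ℤ) + ((π i).val : ZMod 2) * (d (π i) : ℤ)) =
        ∑ j, (if i < j ∧ π j < π i then (d (π i) : ZMod 2) else 0) +
          ∑ j, (if j < i ∧ π i < π j then (d (π i) : ZMod 2) else 0) := fun i => by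
      rw [(h3 i).1, (h3 i).2, ← add_mul, ← Finset.sum_add_distrib, ← Finset.sum_add_distrib,
        Finset.sum_mul]
      refine Finset.sum_congr rfl fun j _ => ?_
      rw [h4, add_mul, ite_mul, ite_mul, one_mul, zero_mul]
    rw [Finset.sum_congr rfl fun i _ => this i, Finset.sum_add_distrib]
    refine (congrArg (_ + ·) Finset.sum_comm).trans ?_
    rw [← Finset.sum_add_distrib]
    refine Finset.sum_congr rfl fun i _ => ?_
    rw [← Finset.sum_add_distrib]
    refine Finset.sum_congr rfl fun j _ => ?_
    split_ifs <;> simp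
  rw [h5, ← Finset.sum_add_distrib]
  push_cast
  refine Finset.sum_congr rfl fun i _ => ?_
  rw [← Finset.sum_add_distrib]
  refine Finset.sum_congr rfl fun j _ => ?_
  split_ifs
  · linear_combination (-(d (π i) : ZMod 2) - (d (π j) : ZMod 2)) * two_eq_zero_zmod
  · simp

end

/-! ## Families of homogeneous elements -/

section

variable {k : Type t} [Field k] {M : Type*} [AddCommGroup M] [Module k M] {ι κ : Type*}

/-- Products of operators that commute up to a Koszul sign. -/
theorem prod_perm [LinearOrder κ] {E : κ → Module.End k M} {e : κ → ZMod 2}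
    (h : ∀ i j, E i * E j = sg k (e i * e j) • (E j * E i)) {l l' : List κ} (hl : l.Nodup)
    (hll' : l.Perm l') : sg k (kz e l) • (l.map E).prod = sg k (kz e l') • (l'.map E).prod := by
  have hperm : ∀ {l l' : List κ} (x : κ), l.Perm l' →
      ((l.filter (· < x)).map e).sum = ((l'.filter (· < x)).map e).sum := fun x h =>
    ((h.filter _).map e).sum_eq
  induction hll' with
  | nil => rfl
  | @cons x l l' hll' ih =>
    rw [kz, kz, hperm x hll', sg_add, sg_add, mul_smul, mul_smul, List.map_cons, List.map_cons,
      List.prod_cons, List.prod_cons, ← mul_smul_comm, ih (List.nodup_cons.1 hl).2, mul_smul_comm]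
  | swap x y l =>
    have hxy : y ≠ x := fun hxy => by simp [hxy] at hl
    simp only [List.map_cons, List.prod_cons, ← mul_assoc]
    rw [h y x, smul_mul_assoc, sg_smul_smul]
    congr 2
    simp only [kz, List.filter_cons]
    rcases lt_or_gt_of_ne hxy with h' | h'
    · simp only [h', h'.not_gt, decide_true, decide_false, if_true, if_false, Bool.false_eq_true,
        List.map_cons, List.sum_cons]
      ring
    · simp only [h', h'.not_gt, decide_true, decide_false, if_true, if_false, Bool.false_eq_true,
        List.map_cons, List.sum_cons]
      linear_combination (e y * e x) * two_eq_zero_zmod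
  | trans h1 _ ih1 ih2 => exact (ih1 hl).trans (ih2 (h1.nodup hl))

/-- The parity of the operators that go with elements of degree `d`. -/
def shPar (d : ι → ℤ) (i : ι) : ZMod 2 := ((d i + 1 : ℤ) : ZMod 2)

/-- The operators commute up to the Koszul sign, and `γ` is the grading operator. -/
structure Super (d : ι → ℤ) (E : ι → Module.End k M) (γ : Module.End k M) : Prop where
  comm : ∀ i j, E i * E j = sg k (shPar d i * shPar d j) • (E j * E i)
  grading : ∀ i, E i * γ = sg k (shPar d i) • (γ * E i)
  sq : γ * γ = 1

variable {d : ι → ℤ} {E : ι → Module.End k M} {γ : Module.End k M}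

theorem Super.prod_grading (h : Super d E γ) (l : List ι) :
    (l.map E).prod * γ = sg k (l.map (shPar d)).sum • (γ * (l.map E).prod) := by
  induction l with
  | nil => simp
  | cons i l ih =>
    rw [List.map_cons, List.prod_cons, List.map_cons, List.sum_cons, mul_assoc, ih, mul_smul_comm,
      ← mul_assoc, h.grading, smul_mul_assoc, sg_smul_smul, mul_assoc, add_comm]

variable {𝒰 : Type u} [Category.{v} 𝒰] {A : LinQuiver.{u, v, w, w', t} k 𝒰} [Fintype ι]

/-- The family of the homogeneous elements `θ i` of degree `d i`, with the operators `E i`. -/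
def fam (θ : ι → GSObj A) (d : ι → ℤ) (E : ι → Module.End k M) (γ : Module.End k M) :
    Family A M ι where
  θ := θ
  lab _ := Finset.univ
  ar i p := if (p : ℤ) ≤ d i + 1 then some (d i + 1 - p).toNat else none
  e := shPar d
  N := E
  T i := E i * γ

variable {θ : ι → GSObj A}

open Stacking

theorem ar_fam {i : ι} {p q : ℕ} : (fam θ d E γ).ar i p = some q ↔ (p : ℤ) + q = d i + 1 := by
  simp only [fam]
  split_ifs with h
  · rw [Option.some_inj]; omega
  · simp only [false_iff]; omega

theorem par_fam : (fam θ d E γ).Par := by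
  intro i p q _ h
  rw [ar_fam] at h
  change ((d i + 1 : ℤ) : ZMod 2) = _
  rw [← h]
  push_cast
  rfl

theorem rels_fam (h : Super d E γ) : (fam θ d E γ).Rels where
  par := par_fam
  relN i := ⟨fun j => by
      refine (h.comm i j).trans ?_
      rfl, fun j => by
      change E i * (E j * γ) = sg k (shPar d i * (shPar d j + 1) + 0) • (E j * γ * E i)
      rw [← mul_assoc, h.comm i j, smul_mul_assoc, mul_assoc, h.grading i, mul_smul_comm,
        sg_smul_smul, mul_assoc, add_zero, mul_add, mul_one]⟩
  relT i := ⟨fun j => by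
      change E i * γ * E j = sg k ((shPar d i + 1) * shPar d j) • (E j * (E i * γ))
      have : γ * E j = sg k (shPar d j) • (E j * γ) := by
        rw [h.grading j, sg_smul_smul, CharTwo.add_self_eq_zero, sg_zero, one_smul]
      rw [mul_assoc, this, mul_smul_comm, ← mul_assoc, h.comm i j, smul_mul_assoc, sg_smul_smul,
        mul_assoc, add_mul, one_mul, add_comm], fun j => by
      change E i * γ * (E j * γ) = sg k ((shPar d i + 1) * (shPar d j + 1) + 1) • (E j * γ * (E i * γ))
      have : ∀ j, γ * E j = sg k (shPar d j) • (E j * γ) := fun j => by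
        rw [h.grading j, sg_smul_smul, CharTwo.add_self_eq_zero, sg_zero, one_smul]
      have h2 : ∀ i j, E i * γ * (E j * γ) = sg k (shPar d j) • (E i * E j) := fun i j => by
        rw [mul_assoc, ← mul_assoc γ, this, smul_mul_assoc, mul_assoc, h.sq, mul_one, mul_smul_comm]
      rw [h2, h2, h.comm i j, sg_smul_smul, sg_smul_smul]
      congr 2
      linear_combination (-shPar d i - 1) * two_eq_zero_zmod⟩

theorem wordOp_fam (h : Super d E γ) {bs : List (ℕ × ℕ × ℕ)} {w : List ι}
    (hw : (fam θ d E γ).Match bs w) : (fam θ d E γ).wordOp bs w =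
      sg k (thinSign bs) • ((w.map E).prod * γ ^ bs.countP fun b => b.1 = 0) := by
  have hs : ∀ {bs : List (ℕ × ℕ × ℕ)} {w : List ι}, (fam θ d E γ).Match bs w →
      (bs.map fun b => (b.1 : ZMod 2) + b.2.1).sum = (w.map (shPar d)).sum := by
    intro bs w hw
    induction hw with
    | nil => rfl
    | @cons b i bs w hi _ ih =>
      rw [List.map_cons, List.sum_cons, ih, List.map_cons, List.sum_cons, shPar, ← ar_fam.1 hi.2]
      push_cast
      rfl
  induction hw with
  | nil => simp [Family.wordOp, thinSign, pairSum]
  | @cons b i bs w hi hw ih =>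
    rw [Family.wordOp, ih, Family.op, show thinSign (b :: bs) = thinInd b *
      (bs.map fun b => (b.1 : ZMod 2) + b.2.1).sum + thinSign bs from rfl, hs hw, List.map_cons, List.prod_cons,
      List.countP_cons, sg_add, thinInd, mul_smul]
    by_cases hb : b.1 = 0
    · simp only [hb, if_true, decide_true, one_mul]
      change (E i * γ) * _ = _
      have h1 : γ * (w.map E).prod = sg k (w.map (shPar d)).sum • ((w.map E).prod * γ) := by
        rw [h.prod_grading, smul_smul, sg_mul_self, one_smul]
      rw [mul_smul_comm, mul_assoc, ← mul_assoc γ, h1, smul_mul_assoc, mul_smul_comm, smul_comm,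
        pow_succ', mul_assoc, mul_assoc]
    · simp only [hb, if_false, decide_false, zero_mul, sg_zero, one_smul, Bool.false_eq_true,
        add_zero]
      change E i * _ = _
      rw [mul_smul_comm, mul_assoc]

end

/-! ## The brackets as sums over words -/

section

variable {k : Type t} [Field k] {𝒰 : Type u} [Category.{v} 𝒰] {A : LinQuiver.{u, v, w, w', t} k 𝒰}

namespace Stacking

theorem size_eq_td {b : ℕ × ℕ × ℕ} (h : IsGSBox b) : (b.1 : ℤ) + b.2.1 = td b + 1 := by
  rw [td, h]
  rcases Nat.eq_zero_or_pos b.1 with h | h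
  · simp [h]
  · rw [if_neg (by omega), Nat.min_eq_left h]; push_cast; ring

/-- If a filling by homogeneous elements is not zero, then their degrees are those of the boxes. -/
theorem size_eq_of_act_ne_zero {S : Stacking} (hS : S.GS) {q : ℕ} {V X : 𝒰} {σ : Simp V X}
    (hσ : S.Admissible σ.length) {a : Fin (q + 1) → A.Ob X} {θ : ℕ → GSObj A} {D : ℕ → ℤ}
    (hθ : ∀ i < S.card, θ i ∈ gsDegree A (D i)) (h : S.act θ q σ a ≠ 0) {t : ℕ} {b : ℕ × ℕ × ℕ}
    (ht : S.sizes[t]? = some b) : (b.1 : ℤ) + b.2.1 = D t + 1 := by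
  by_contra hb
  obtain ⟨f, hf, hf0⟩ := S.act_slot θ hS q σ hσ a t ht
  refine h ?_
  rw [← Function.update_eq_self t θ, hf]
  refine hf0 _ fun V X σ a h => ?_
  exact hθ t (List.getElem?_eq_some_iff.1 ht).1 b.2.1 V X σ a (by rw [h]; exact hb)

theorem mem_quad_of_act_ne_zero {S : Stacking} {q : ℕ} {V X : 𝒰} {σ : Simp V X}
    (hS : S.TQ σ.length) {a : Fin (q + 1) → A.Ob X} {θ : ℕ → GSObj A} {D : ℕ → ℤ}
    (hθ : ∀ i < S.card, θ i ∈ gsDegree A (D i)) (h : S.act θ q σ a ≠ 0) {Q : ℕ}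
    (hQ : ∀ i < S.card, D i + 1 ≤ Q) : S ∈ quad Q σ.length := by
  refine hS.mem_quad fun b hb => ?_
  obtain ⟨t, ht, rfl⟩ := List.getElem_of_mem hb
  have := size_eq_of_act_ne_zero hS.gs hS.adm hθ h (List.getElem?_eq_getElem ht)
  have := hQ t ht
  omega

theorem sum_td_of_act_ne_zero {S : Stacking} {q : ℕ} {V X : 𝒰} {σ : Simp V X}
    (hS : S.TQ σ.length) {a : Fin (q + 1) → A.Ob X} {θ : ℕ → GSObj A} {D : ℕ → ℤ}
    (hθ : ∀ i < S.card, θ i ∈ gsDegree A (D i)) (h : S.act θ q σ a ≠ 0) :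
    S.sizes.map td = List.ofFn fun i : Fin S.card => D i := by
  refine List.ext_getElem (by simp [card]) fun i h1 h2 => ?_
  rw [List.length_map] at h1
  rw [List.getElem_map, List.getElem_ofFn]
  change td _ = D i
  have := size_eq_of_act_ne_zero hS.gs hS.adm hθ h (List.getElem?_eq_getElem h1)
  have := size_eq_td (hS.gs _ (List.getElem_mem h1))
  omega

theorem pairSum_one (l : List (ℕ × ℕ × ℕ)) (g : ℕ × ℕ × ℕ → ZMod 2) :
    pairSum (fun _ => 1) g l = ∑ i : Fin l.length, (i.val : ZMod 2) * g (l.get i) := by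
  rw [pairSum_eq, Finset.sum_comm]
  refine Finset.sum_congr rfl fun j _ => ?_
  have : (j.val : ZMod 2) = ∑ i, if i < j then 1 else 0 := by
    rw [Finset.sum_boole, Finset.filter_gt_eq_Iio, Fin.card_Iio]
  rw [this, Finset.sum_mul]
  exact Finset.sum_congr rfl fun i _ => by split_ifs <;> simp

end Stacking

open Stacking

/-- The exponent of the sign of the brackets, in terms of the degrees. -/
def degSign {n : ℕ} (D : Fin n → ℤ) : ZMod 2 :=
  ∑ i : Fin n, (i.val : ZMod 2) * (D i : ℤ) + n + n * (∑ i, D i : ℤ)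

theorem brace_apply {n : ℕ} (π : Equiv.Perm (Fin n)) {θ : Fin n → GSObj A} {D : Fin n → ℤ}
    (hθ : ∀ i, θ i ∈ gsDegree A (D i)) {Q : ℕ} (hQ : ∀ i, D i + 1 ≤ Q) (q : ℕ) {V X : 𝒰}
    (σ : Simp V X) (a : Fin (q + 1) → A.Ob X) : brace n π θ q V X σ a =
      ∑ S ∈ quad Q σ.length with S.card = n,
        sg k (rootThin S + S.mSign σ.length 0 + thinSign S.sizes + degSign D +
          kz (shPar D) (List.ofFn π)) • S.act (extend fun i => θ (π i)) q σ a := by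
  classical
  have hext : ∀ i < n, extend (fun i => θ (π i)) i ∈
      gsDegree A (if h : i < n then D (π ⟨i, h⟩) else 0) := fun i hi => by
    rw [extend, dif_pos hi, dif_pos hi]
    exact hθ _
  have hD : ∀ i < n, (if h : i < n then D (π ⟨i, h⟩) else 0) + 1 ≤ (Q : ℤ) := fun i hi => by
    rw [dif_pos hi]
    exact hQ _
  rw [brace, finsum_eq_sum_of_support_subset (s := (quad Q σ.length).filter fun S => S.card = n)]
  swap
  · intro S hS
    rw [Function.mem_support, finsum_eq_if] at hS
    split_ifs at hS with h
    · obtain ⟨h1, h2, h3⟩ := isThinQuadratic_iff.1 h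
      subst h2
      have h4 : S.act (extend fun i => θ (π i)) q σ a ≠ 0 := fun h => hS (by rw [h, smul_zero])
      exact Finset.mem_coe.2 (Finset.mem_filter.2 ⟨mem_quad_of_act_ne_zero h1 hext h4 hD, rfl⟩)
    · exact absurd rfl hS
  refine Finset.sum_congr rfl fun S hS => ?_
  obtain ⟨h1, h2⟩ := Finset.mem_filter.1 hS
  have h1 := tq_of_mem_quad h1
  rw [finsum_eq_if]
  by_cases h4 : S.act (extend fun i => θ (π i)) q σ a = 0
  · rw [h4, smul_zero, smul_zero, ite_self]
  by_cases h5 : S.inputs = q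
  swap
  · exact absurd (act_of_ne _ h5 σ a) h4
  rw [if_pos (isThinQuadratic_iff.2 ⟨h1, h2, h5⟩)]
  subst h2
  have h6 := sum_td_of_act_ne_zero h1 hext h4
  have h7 : ∀ i : Fin S.card, td (S.sizes.getD i (0, 0, 0)) = D (π i) := fun i => by
    have := congrArg (fun l => l.getD i 0) h6
    simp only [List.getD_eq_getElem?_getD, List.getElem?_map] at this
    rw [List.getD_eq_getElem?_getD]
    have hi : i.val < S.sizes.length := i.2
    rw [List.getElem?_eq_getElem hi] at this ⊢
    simpa using this
  have h8 := h1.sign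
  rw [pairSum_one] at h8
  have h9 : ∀ i : Fin S.card, ((td (S.sizes.get i) : ℤ) : ZMod 2) = (D (π i) : ℤ) := fun i => by
    rw [← h7 i]
    exact congrArg (fun b => ((td b : ℤ) : ZMod 2)) (List.getD_eq_getElem _ _ _).symm
  have h10 : (S.sizes.map fun b => ((td b : ℤ) : ZMod 2)).sum = ((∑ i, D i : ℤ) : ZMod 2) := by
    have : (S.sizes.map td).sum = ∑ i, D (π i) := by
      rw [h6, List.sum_ofFn]
      exact Finset.sum_congr rfl fun i _ => by rw [dif_pos i.2]
    rw [← Equiv.sum_comp π D, ← this, Int.cast_list_sum, List.map_map]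
    rfl
  rw [mul_smul, negOnePow_smul (k := k)]
  simp only [h7]
  rw [sign_mul_koszul (k := k), sg_smul_smul]
  congr 2
  rw [h10] at h8
  have h11 : ∑ i : Fin S.sizes.length, (i.val : ZMod 2) * ((td (S.sizes.get i) : ℤ) : ZMod 2) =
      ∑ i : Fin S.card, (i.val : ZMod 2) * (D (π i) : ℤ) :=
    Finset.sum_congr rfl fun i _ => by rw [h9 i]
  rw [h11] at h8
  rw [degSign]
  change kz (shPar D) (List.ofFn π) + _ + _ + _ = _
  linear_combination h8

end

/-! ## Words with repetitions of one letter -/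

section

variable {ι : Type*} [Fintype ι] [DecidableEq ι] {m : ℕ}

theorem exists_perm_of_ofFn_perm {β : Type*} {n : ℕ} {f : Fin n → β} {w : List β}
    (h : w.Perm (List.ofFn f)) : ∃ π : Equiv.Perm (Fin n), w = List.ofFn (f ∘ π) := by
  have key : ∀ {l₀ : List (Fin n)} {w : List β}, w.Perm (l₀.map f) →
      ∃ l : List (Fin n), l.Perm l₀ ∧ w = l.map f := by
    intro l₀ w h
    generalize hl : l₀.map f = w' at h
    induction h generalizing l₀ with
    | nil => exact ⟨[], by rw [List.map_eq_nil_iff.1 hl], rfl⟩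
    | cons x _ ih =>
      obtain ⟨i, l, rfl, rfl, h1⟩ := List.map_eq_cons_iff.1 hl
      obtain ⟨l', h2, rfl⟩ := ih h1
      exact ⟨i :: l', h2.cons i, rfl⟩
    | swap x y l =>
      obtain ⟨i, l₁, rfl, rfl, h1⟩ := List.map_eq_cons_iff.1 hl
      obtain ⟨j, l₂, rfl, rfl, rfl⟩ := List.map_eq_cons_iff.1 h1
      exact ⟨j :: i :: l₂, List.Perm.swap _ _ _, rfl⟩
    | trans _ _ ih1 ih2 =>
      obtain ⟨l, h1, rfl⟩ := ih2 hl
      obtain ⟨l', h2, rfl⟩ := ih1 rfl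
      exact ⟨l', h2.trans h1, rfl⟩
  rw [List.ofFn_eq_map] at h
  obtain ⟨l, hl, rfl⟩ := key h
  have hlen : l.length = n := by simpa using hl.length_eq
  have hinj : Function.Injective fun i : Fin n => l.get (i.cast hlen.symm) :=
    (List.nodup_iff_injective_get.1 (hl.nodup_iff.2 (List.nodup_finRange _))).comp
      (Fin.cast_injective _)
  refine ⟨Equiv.ofBijective _ (Finite.injective_iff_bijective.1 hinj), ?_⟩
  refine List.ext_getElem (by simpa using hlen) fun i h1 h2 => ?_
  simp

/-- A letter `o`, repeated `r` times, followed by other letters. -/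
def pad (o : ι) (J : Fin m → ι) (r : ℕ) : Fin (r + m) → ι := Fin.append (fun _ => o) J

variable {o : ι} {J : Fin m → ι}

theorem ofFn_pad (r : ℕ) : List.ofFn (pad o J r) = List.replicate r o ++ List.ofFn J := by
  rw [pad, List.ofFn_fin_append, List.ofFn_const]

theorem filter_pad_perm (hJ : ∀ i, J i ≠ o) {r : ℕ} (π : Equiv.Perm (Fin (r + m))) :
    ((List.ofFn (pad o J r ∘ π)).filter (· ≠ o)).Perm (List.ofFn J) := by
  refine ((π.ofFn_comp_perm (pad o J r)).filter _).trans ?_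
  rw [ofFn_pad, List.filter_append, List.filter_replicate]
  simp only [ne_eq, not_true_eq_false, decide_false, Bool.false_eq_true, if_false, List.nil_append]
  rw [List.filter_eq_self.2]
  intro x hx
  obtain ⟨i, rfl⟩ := List.mem_ofFn.1 hx
  simpa using hJ i

theorem exists_eq_pad {w : List ι} {r : ℕ} (hw : (w.filter (· ≠ o)).Perm (List.ofFn J))
    (hr : w.length = r + m) : ∃ π : Equiv.Perm (Fin (r + m)), w = List.ofFn (pad o J r ∘ π) := by
  refine exists_perm_of_ofFn_perm ?_
  rw [ofFn_pad]
  have h1 := List.filter_append_perm (· ≠ o) w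
  have h2 : w.filter (fun x => !decide (x ≠ o)) = List.replicate r o := by
    rw [List.eq_replicate_iff]
    refine ⟨?_, fun b hb => by simpa using (List.mem_filter.1 hb).2⟩
    have := h1.length_eq
    rw [List.length_append, hw.length_eq, List.length_ofFn] at this
    omega
  rw [h2] at h1
  exact (h1.symm.trans (List.perm_append_comm)).trans (hw.append_left _)

theorem card_fiber_pad (hJ : ∀ i, J i ≠ o) (hinj : Function.Injective J) {r : ℕ}
    (π₀ : Equiv.Perm (Fin (r + m))) :
    (Finset.univ.filter fun π : Equiv.Perm (Fin (r + m)) =>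
      List.ofFn (pad o J r ∘ π) = List.ofFn (pad o J r ∘ π₀)).card = r.factorial := by
  have h1 := DomMulAct.stabilizer_card (pad o J r)
  have h2 : ∀ i, (Fintype.card {a // pad o J r a = i}).factorial =
      if i = o then r.factorial else 1 := fun i => by
    split_ifs with hi
    · subst hi
      congr 1
      rw [Fintype.card_subtype, ← Finset.card_map (finSumFinEquiv (m := r) (n := m)).symm.toEmbedding,
        show Finset.map _ _ = (Finset.univ : Finset (Fin r)).map Function.Embedding.inl from ?_]
      · simp
      · ext x
        simp only [Finset.mem_map, Finset.mem_filter, Finset.mem_univ, true_and]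
        constructor
        · rintro ⟨a, ha, rfl⟩
          induction a using Fin.addCases with
          | left a => exact ⟨a, by simp⟩
          | right a => exact absurd (by simpa [pad] using ha) (hJ a)
        · rintro ⟨a, rfl⟩
          exact ⟨Fin.castAdd m a, by simp [pad], by simp⟩
    · rw [Nat.factorial_eq_one, Fintype.card_le_one_iff]
      rintro ⟨a, ha⟩ ⟨b, hb⟩
      rw [Subtype.mk.injEq]
      induction a using Fin.addCases with
      | left a => exact absurd (by simpa [pad] using ha.symm) hi
      | right a =>
        induction b using Fin.addCases with
        | left b => exact absurd (by simpa [pad] using hb.symm) hi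
        | right b =>
          simp only [pad, Fin.append_right] at ha hb
          rw [hinj (ha.trans hb.symm)]
  rw [Finset.prod_congr rfl fun i _ => h2 i, Finset.prod_ite_eq'] at h1
  rw [if_pos (Finset.mem_univ _), Fintype.card_subtype] at h1
  rw [← h1]
  refine Finset.card_equiv (Equiv.mulRight π₀⁻¹) fun π => ?_
  simp only [Finset.mem_filter, Finset.mem_univ, true_and, List.ofFn_inj, Equiv.coe_mulRight]
  constructor
  · intro h
    funext i
    have := congrFun h (π₀⁻¹ i)
    simpa using this
  · intro h
    funext i
    have := congrFun h (π₀ i)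
    simpa using this

end

/-! ## Degrees and finiteness -/

section

variable {k : Type t} [Field k] {𝒰 : Type u} [Category.{v} 𝒰] {A : LinQuiver.{u, v, w, w', t} k 𝒰}

open Stacking

theorem exists_natBound {n : ℕ} (D : Fin n → ℤ) : ∃ Q : ℕ, ∀ i, D i + 1 ≤ Q := by
  refine ⟨∑ i, (D i + 1).toNat, fun i => ?_⟩
  have h1 := Int.self_le_toNat (D i + 1)
  have h2 : (D i + 1).toNat ≤ ∑ i, (D i + 1).toNat :=
    Finset.single_le_sum (f := fun i => (D i + 1).toNat) (fun _ _ => Nat.zero_le _)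
      (Finset.mem_univ i)
  omega

theorem bracket_apply (n : ℕ) (θ : Fin n → GSObj A) (q : ℕ) {V X : 𝒰} (σ : Simp V X)
    (a : Fin (q + 1) → A.Ob X) :
    bracket A n θ q V X σ a = ∑ π : Equiv.Perm (Fin n), brace n π θ q V X σ a := by
  rw [bracket]
  have (s : Finset (Equiv.Perm (Fin n))) (f : Equiv.Perm (Fin n) → GSObj A) :
      (∑ i ∈ s, f i) q V X σ a = ∑ i ∈ s, f i q V X σ a := by
    classical
    induction s using Finset.induction_on with
    | empty => rfl
    | insert i s hi ih => rw [Finset.sum_insert hi, Finset.sum_insert hi, gsObj_add_apply, ih]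
  exact this _ _

/-- A component of a bracket of homogeneous elements that is not zero comes from a stacking. -/
theorem exists_of_bracket_ne_zero {n : ℕ} {θ : Fin n → GSObj A} {D : Fin n → ℤ}
    (hθ : ∀ i, θ i ∈ gsDegree A (D i)) {Q : ℕ} (hQ : ∀ i, D i + 1 ≤ Q) {q : ℕ} {V X : 𝒰}
    {σ : Simp V X} {a : Fin (q + 1) → A.Ob X} (h : bracket A n θ q V X σ a ≠ 0) :
    (∃ S ∈ quad Q σ.length, S.card = n) ∧ (σ.length : ℤ) + q = ∑ i, D i + 2 - n + 1 := by
  rw [bracket_apply] at h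
  obtain ⟨π, -, h⟩ := Finset.exists_ne_zero_of_sum_ne_zero h
  rw [brace_apply π hθ hQ] at h
  obtain ⟨S, hS, h⟩ := Finset.exists_ne_zero_of_sum_ne_zero h
  obtain ⟨h1, h2⟩ := Finset.mem_filter.1 hS
  refine ⟨⟨S, h1, h2⟩, ?_⟩
  have h1 := tq_of_mem_quad h1
  have h4 : S.act (extend fun i => θ (π i)) q σ a ≠ 0 := fun h' => h (by rw [h', smul_zero])
  by_cases h5 : S.inputs = q
  swap
  · exact absurd (act_of_ne _ h5 σ a) h4
  subst h2 h5
  have h6 := sum_td_of_act_ne_zero h1 (D := fun i => if h : i < S.card then D (π ⟨i, h⟩) else 0)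
    (fun i hi => by rw [extend, dif_pos hi, dif_pos hi]; exact hθ _) h4
  have h7 := h1.degree_eq
  rw [degree, h6, List.sum_ofFn, result, h1.rdepth] at h7
  have h8 := size_eq_td (b := (σ.length, S.inputs, min 1 σ.length)) rfl
  simp only [Fin.is_lt, dif_pos, Fin.eta, Equiv.sum_comp π D] at h7
  change (σ.length : ℤ) + S.inputs = _ at h8
  omega

theorem bracket_mem {n : ℕ} {θ : Fin n → GSObj A} {D : Fin n → ℤ}
    (hθ : ∀ i, θ i ∈ gsDegree A (D i)) : bracket A n θ ∈ gsDegree A (∑ i, D i + 2 - n) := by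
  obtain ⟨Q, hQ⟩ := exists_natBound D
  intro q V X σ a h
  by_contra h'
  exact h (exists_of_bracket_ne_zero hθ hQ h').2

variable {α : GSObj A} {m : ℕ} {ω : Fin m → GSObj A} {D : Fin m → ℤ}

theorem append_mem (hα : α ∈ gsDegree A 1) (hω : ∀ i, ω i ∈ gsDegree A (D i)) (r : ℕ)
    (i : Fin (r + m)) : Fin.append (fun _ => α) ω i ∈
      gsDegree A ((Fin.append (fun _ => 1) D : Fin (r + m) → ℤ) i) := by
  induction i using Fin.addCases with
  | left i => simpa using hα
  | right i => simpa using hω i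

theorem sum_append_one (D : Fin m → ℤ) (r : ℕ) :
    ∑ i, (Fin.append (fun _ => 1) D : Fin (r + m) → ℤ) i = r + ∑ i, D i := by
  rw [Fin.sum_univ_add]
  simp

theorem twistTerm_mem (hα : α ∈ gsDegree A 1) (hω : ∀ i, ω i ∈ gsDegree A (D i)) (r : ℕ) :
    twistTerm (k := k) (bracket A) α m ω r ∈ gsDegree A (∑ i, D i + 2 - m) := by
  refine Submodule.smul_mem _ _ ?_
  have := bracket_mem (append_mem hα hω r)
  rw [sum_append_one] at this
  convert this using 1
  push_cast
  ring

/-- There are only finitely many terms in the twisted operations. -/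
theorem exists_twistTerm_eq_zero (hα : α ∈ gsDegree A 1) (hω : ∀ i, ω i ∈ gsDegree A (D i)) :
    ∃ R, ∀ r, R ≤ r → twistTerm (k := k) (bracket A) α m ω r = 0 := by
  obtain ⟨Q, hQ⟩ := exists_natBound D
  let P := (∑ i, D i + 3 - m).toNat
  refine ⟨∑ p ∈ Finset.range (P + 1), ∑ S ∈ quad (max Q 2) p, S.card + 1, fun r hr => ?_⟩
  rw [twistTerm]
  refine smul_eq_zero_of_right _ ?_
  funext q V X σ a
  by_contra h
  obtain ⟨⟨S, hS, hc⟩, h2⟩ := exists_of_bracket_ne_zero (append_mem hα hω r) (Q := max Q 2)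
    (fun i => by
      induction i using Fin.addCases with
      | left i => simp
      | right i => simp only [Fin.append_right]; exact (hQ i).trans (by simp)) h
  rw [sum_append_one] at h2
  have h3 : σ.length ∈ Finset.range (P + 1) := by
    rw [Finset.mem_range]
    push_cast at h2
    omega
  have h4 := Finset.single_le_sum (f := fun p => ∑ S ∈ quad (max Q 2) p, S.card)
    (fun _ _ => Nat.zero_le _) h3
  have h5 := Finset.single_le_sum (f := fun S => S.card) (fun _ _ => Nat.zero_le _) hS
  omega

theorem support_twistTerm (hα : α ∈ gsDegree A 1) (hω : ∀ i, ω i ∈ gsDegree A (D i)) :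
    (Function.support (twistTerm (k := k) (bracket A) α m ω)).Finite := by
  obtain ⟨R, hR⟩ := exists_twistTerm_eq_zero hα hω
  refine (Finset.finite_toSet (Finset.range R)).subset fun r hr => ?_
  by_contra h
  exact hr (hR r (by simpa using h))

theorem twist_eq_sum {R : ℕ} (hR : ∀ r, R ≤ r → twistTerm (k := k) (bracket A) α m ω r = 0) :
    twist (k := k) (bracket A) α m ω = ∑ r ∈ Finset.range R, twistTerm (k := k) (bracket A) α m ω r := by
  refine finsum_eq_sum_of_support_subset _ fun r hr => ?_
  by_contra h
  exact hr (hR r (by simpa using h))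

theorem twist_mem (hα : α ∈ gsDegree A 1) (hω : ∀ i, ω i ∈ gsDegree A (D i)) :
    twist (k := k) (bracket A) α m ω ∈ gsDegree A (∑ i, D i + 2 - m) := by
  obtain ⟨R, hR⟩ := exists_twistTerm_eq_zero hα hω
  rw [twist_eq_sum hR]
  exact Submodule.sum_mem _ fun r _ => twistTerm_mem hα hω r

/-! ## Multilinearity -/

theorem brace_slot {n : ℕ} (π : Equiv.Perm (Fin n)) {θ : Fin n → GSObj A} {D : Fin n → ℤ}
    (hθ : ∀ i, θ i ∈ gsDegree A (D i)) (i : Fin n) (q : ℕ) {V X : 𝒰} (σ : Simp V X)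
    (a : Fin (q + 1) → A.Ob X) : ∃ f : GSObj A →ₗ[k] MultilinearMap k
        (fun i : Fin q => A.Hom (a i.castSucc) (a i.succ))
        (A.Hom (A.lower σ (a 0)) (A.upper σ (a (Fin.last q)))),
      ∀ y ∈ gsDegree A (D i), brace n π (Function.update θ i y) q V X σ a = f y := by
  obtain ⟨Q, hQ⟩ := exists_natBound D
  have h1 : ∀ S ∈ (quad Q σ.length).filter fun S => S.card = n, ∃ f : GSObj A →ₗ[k] MultilinearMap k
        (fun i : Fin q => A.Hom (a i.castSucc) (a i.succ))
        (A.Hom (A.lower σ (a 0)) (A.upper σ (a (Fin.last q)))),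
      ∀ y, S.act (extend fun j => Function.update θ i y (π j)) q σ a = f y := by
    intro S hS
    obtain ⟨h1, h2⟩ := Finset.mem_filter.1 hS
    have h1 := tq_of_mem_quad h1
    have ht : (π⁻¹ i).val < S.sizes.length := h2 ▸ (π⁻¹ i).2
    obtain ⟨f, hf, -⟩ := S.act_slot (extend fun j => θ (π j)) h1.gs q σ h1.adm a (π⁻¹ i).val
      (List.getElem?_eq_getElem ht)
    refine ⟨f, fun y => ?_⟩
    rw [← hf]
    refine congrArg (fun θ => S.act θ q σ a) (funext fun j => ?_)
    by_cases hj : j = (π⁻¹ i).val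
    · subst hj
      rw [Function.update_self, extend, dif_pos (π⁻¹ i).2]
      simp
    · rw [Function.update_of_ne hj, extend, extend]
      split_ifs with hjn
      · refine Function.update_of_ne ?_ _ _
        rintro rfl
        simp at hj
      · rfl
  choose f hf using h1
  refine ⟨∑ S ∈ ((quad Q σ.length).filter fun S => S.card = n).attach, sg k (rootThin S.1 +
    S.1.mSign σ.length 0 + thinSign S.1.sizes + degSign D + kz (shPar D) (List.ofFn π)) • f S.1 S.2,
    fun y hy => ?_⟩
  rw [brace_apply π (D := D) (fun j => ?_) hQ, ← Finset.sum_attach, LinearMap.sum_apply]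
  · refine Finset.sum_congr rfl fun S _ => ?_
    rw [LinearMap.smul_apply, hf S.1 S.2]
  · by_cases hj : j = i
    · subst hj; rwa [Function.update_self]
    · rw [Function.update_of_ne hj]; exact hθ j

theorem bracket_slot {n : ℕ} {θ : Fin n → GSObj A} {D : Fin n → ℤ}
    (hθ : ∀ i, θ i ∈ gsDegree A (D i)) (i : Fin n) {y z : GSObj A} (hy : y ∈ gsDegree A (D i))
    (hz : z ∈ gsDegree A (D i)) (c : k) :
    bracket A n (Function.update θ i (y + c • z)) =
      bracket A n (Function.update θ i y) + c • bracket A n (Function.update θ i z) := by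
  funext q V X σ a
  choose f hf using fun π => brace_slot π hθ i q σ a
  rw [gsObj_add_apply, gsObj_smul_apply, bracket_apply, bracket_apply, bracket_apply,
    Finset.smul_sum, ← Finset.sum_add_distrib]
  refine Finset.sum_congr rfl fun π _ => ?_
  rw [hf π _ hy, hf π _ hz, hf π _ (Submodule.add_mem _ hy (Submodule.smul_mem _ c hz)), map_add,
    map_smul]

theorem append_update (α : GSObj A) (ω : Fin m → GSObj A) (r : ℕ) (i : Fin m) (y : GSObj A) :
    (Fin.append (fun _ => α) (Function.update ω i y) : Fin (r + m) → GSObj A) =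
      Function.update (Fin.append (fun _ => α) ω) (Fin.natAdd r i) y := by
  funext j
  induction j using Fin.addCases with
  | left j =>
    rw [Function.update_of_ne (by simp [Fin.ext_iff]; omega), Fin.append_left, Fin.append_left]
  | right j =>
    rw [Fin.append_right]
    by_cases hj : j = i
    · subst hj; rw [Function.update_self, Function.update_self]
    · rw [Function.update_of_ne hj, Function.update_of_ne (by simpa [Fin.ext_iff] using hj),
        Fin.append_right]

theorem twist_slot (hα : α ∈ gsDegree A 1) (hω : ∀ i, ω i ∈ gsDegree A (D i)) (i : Fin m)
    {y z : GSObj A} (hy : y ∈ gsDegree A (D i)) (hz : z ∈ gsDegree A (D i)) (c : k) :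
    twist (k := k) (bracket A) α m (Function.update ω i (y + c • z)) =
      twist (k := k) (bracket A) α m (Function.update ω i y) +
        c • twist (k := k) (bracket A) α m (Function.update ω i z) := by
  have hup : ∀ y ∈ gsDegree A (D i), ∀ j, Function.update ω i y j ∈ gsDegree A (D j) := by
    intro y hy j
    by_cases hj : j = i
    · subst hj; rwa [Function.update_self]
    · rw [Function.update_of_ne hj]; exact hω j
  obtain ⟨R₁, h1⟩ := exists_twistTerm_eq_zero hα (hup y hy)
  obtain ⟨R₂, h2⟩ := exists_twistTerm_eq_zero hα (hup z hz)
  obtain ⟨R₃, h3⟩ := exists_twistTerm_eq_zero hα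
    (hup (y + c • z) (Submodule.add_mem _ hy (Submodule.smul_mem _ c hz)))
  rw [twist_eq_sum (R := R₁ + R₂ + R₃) fun r hr => h1 r (by omega),
    twist_eq_sum (R := R₁ + R₂ + R₃) fun r hr => h2 r (by omega),
    twist_eq_sum (R := R₁ + R₂ + R₃) fun r hr => h3 r (by omega), Finset.smul_sum,
    ← Finset.sum_add_distrib]
  refine Finset.sum_congr rfl fun r _ => ?_
  rw [twistTerm, twistTerm, twistTerm, append_update, append_update, append_update, bracket_slot (append_mem hα hω r) _ (by simpa using hy)
      (by simpa using hz), smul_add, smul_comm c]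

end

/-! ## Twisted operations as sums over words -/

section

variable {k : Type t} [Field k] [CharZero k] {𝒰 : Type u} [Category.{v} 𝒰]
  {A : LinQuiver.{u, v, w, w', t} k 𝒰} {M : Type*} [AddCommGroup M] [Module k M]
  {ι : Type*} [Fintype ι] [DecidableEq ι]

open Stacking

theorem degSign_pad {m : ℕ} (d : ι → ℤ) {o : ι} (ho : d o = 1) (J : Fin m → ι) (r : ℕ) :
    degSign (fun i => d (pad o J r i)) + ((r * m + r * (r + 1) / 2 : ℕ) : ZMod 2) =
      degSign (fun i => d (J i)) + r := by
  have h1 : ∑ i, (d (pad o J r i) : ℤ) = r + ∑ i, d (J i) := by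
    rw [Fin.sum_univ_add]
    simp [pad, ho]
  have h2 : ((r * (r + 1) / 2 : ℕ) : ZMod 2) = ∑ i : Fin r, (i.val : ZMod 2) + r := by
    have := Finset.sum_range_id (r + 1)
    rw [Nat.add_sub_cancel, mul_comm] at this
    rw [← this, Finset.sum_range_succ, Finset.sum_range]
    push_cast
    rfl
  rw [degSign, degSign, h1, Fin.sum_univ_add]
  simp only [pad, Fin.append_left, Fin.append_right, ho, Fin.val_castAdd, Fin.val_natAdd]
  push_cast at h2 ⊢
  rw [h2]
  simp only [add_mul, Finset.sum_add_distrib, mul_one, ← Finset.mul_sum]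
  linear_combination (∑ i : Fin r, (i.val : ZMod 2) + r * ∑ i, (d (J i) : ZMod 2) +
    (r : ZMod 2) * m + r) * two_eq_zero_zmod + zmod_two_sq (r : ZMod 2)

variable {d : ι → ℤ} {E : ι → Module.End k M} {γ : Module.End k M} {θ : ι → GSObj A}

theorem word_ofFn {n : ℕ} (f : Fin n → ι) {S : Stacking} (q : ℕ) {V X : 𝒰}
    (σ : Simp V X) (a : Fin (q + 1) → A.Ob X) :
    S.act ((fam θ d E γ).word (List.ofFn f)) q σ a = S.act (extend fun i => θ (f i)) q σ a := by
  congr 1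
  funext i
  rw [Family.word, extend]
  split_ifs with h
  · rw [List.getElem?_eq_getElem (by simpa using h), List.getElem_ofFn]
    rfl
  · rw [List.getElem?_eq_none (by simpa using h)]
    rfl

/-- Only homogeneous elements of the right degrees can be filled into a stacking. -/
theorem fill_eq_zero (hθ : ∀ i, θ i ∈ gsDegree A (d i)) {S : Stacking} {p q : ℕ} (hS : S.TQ p)
    {w : List ι} (hw : w.length = S.card) (hm : ¬ (fam θ d E γ).Match S.sizes w)
    {φ : GSObj A →ₗ[k] M} (hφ : LocalAt φ p q) : φ (S.fill ((fam θ d E γ).word w)) = 0 := by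
  refine hφ _ fun V X σ a hσ => ?_
  subst hσ
  by_contra h
  refine hm (List.forall₂_iff_get.2 ⟨hw.symm, fun i h1 h2 => ⟨Finset.mem_univ _, ar_fam.2 ?_⟩⟩)
  have := size_eq_of_act_ne_zero hS.gs hS.adm (θ := (fam θ d E γ).word w)
    (D := fun i => if h : i < w.length then d (w.get ⟨i, h⟩) else 0) (fun i hi => by
      rw [← hw] at hi
      rw [dif_pos hi, Family.word, List.getElem?_eq_getElem hi]
      exact hθ _) h (List.getElem?_eq_getElem h1)
  rw [dif_pos h2] at this
  exact this

variable (d E γ θ) in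
/-- The term of a word in the sum over all words. -/
noncomputable def wordTerm (φ : GSObj A →ₗ[k] M) (p : ℕ) (S : Stacking) (w : List ι) : M :=
  sg k (rootThin S + S.mSign p 0) •
    (fam θ d E γ).wordOp S.sizes w (φ (S.fill ((fam θ d E γ).word w)))

theorem wordTerm_eq_zero (hθ : ∀ i, θ i ∈ gsDegree A (d i)) {S : Stacking} {p q : ℕ} (hS : S.TQ p)
    {w : List ι} (hw : w.length = S.card) (hm : ¬ (fam θ d E γ).Match S.sizes w)
    {φ : GSObj A →ₗ[k] M} (hφ : LocalAt φ p q) : wordTerm d E γ θ φ p S w = 0 := by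
  rw [wordTerm, fill_eq_zero hθ hS hw hm hφ, map_zero, smul_zero]

variable {m : ℕ} {o : ι} {J : Fin m → ι}

theorem wordTerm_pad (h : Super d E γ) (hθ : ∀ i, θ i ∈ gsDegree A (d i)) (hE : E o = -1)
    {S : Stacking} {p q : ℕ} (hS : S.TQ p) {φ : GSObj A →ₗ[k] M} (hφ : LocalAt φ p q) {r : ℕ}
    (hr : S.card = r + m) (π : Equiv.Perm (Fin (r + m))) :
    wordTerm d E γ θ φ p S (List.ofFn (pad o J r ∘ π)) =
      sg k (rootThin S + S.mSign p 0 + thinSign S.sizes +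
        kz (shPar fun i => d (pad o J r i)) (List.ofFn π) + r) •
        (((List.ofFn J).map E).prod * γ ^ if p = 0 then 2 else 1)
          (φ (S.fill (extend fun i => θ (pad o J r (π i))))) := by
  have hfill : φ (S.fill ((fam θ d E γ).word (List.ofFn (pad o J r ∘ π)))) =
      φ (S.fill (extend fun i => θ (pad o J r (π i)))) := by
    congr 1
    funext q V X σ a
    exact word_ofFn _ q σ a
  by_cases hm : (fam θ d E γ).Match S.sizes (List.ofFn (pad o J r ∘ π))
  · rw [wordTerm, wordOp_fam h hm, hfill, show S.sizes.countP _ = S.thinCard from rfl, hS.thin]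
    have h1 := prod_perm (E := fun i => E (pad o J r i)) (e := shPar fun i => d (pad o J r i))
      (fun i j => h.comm _ _) (List.nodup_finRange (r + m))
      (l' := List.ofFn π) ((π.ofFn_comp_perm id).trans (by rw [List.ofFn_id])).symm
    have h2 : (List.finRange (r + m)).map (fun i => E (pad o J r i)) =
        List.replicate r (-1) ++ (List.ofFn J).map E := by
      rw [← hE, ← List.map_replicate, ← List.map_append, ← ofFn_pad, List.ofFn_eq_map, List.map_map]
      rfl
    have h3 : (List.ofFn π).map (fun i => E (pad o J r i)) = (List.ofFn (pad o J r ∘ π)).map E := by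
      rw [List.map_ofFn, List.map_ofFn]
      rfl
    rw [kz_of_sorted _ (List.pairwise_lt_finRange _), sg_zero, one_smul, h2, h3, List.prod_append,
      List.prod_replicate] at h1
    have h4 : ((List.ofFn (pad o J r ∘ π)).map E).prod =
        sg k (kz (shPar fun i => d (pad o J r i)) (List.ofFn π) + r) • ((List.ofFn J).map E).prod := by
      rw [sg_add, mul_smul, ← neg_one_pow_eq_sg]
      have h5 : ((-1 : k) ^ r) • ((List.ofFn J).map E).prod = (-1) ^ r * ((List.ofFn J).map E).prod := by
        rcases Nat.even_or_odd r with hr | hr <;> simp [hr.neg_one_pow]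
      rw [h5, h1, sg_smul_smul, CharTwo.add_self_eq_zero, sg_zero, one_smul]
    rw [h4]
    simp only [smul_mul_assoc, LinearMap.smul_apply, sg_smul_smul]
    congr 2
    ring
  · rw [wordTerm_eq_zero hθ hS (by simp [hr]) hm hφ, ← hfill,
      fill_eq_zero hθ hS (by simp [hr]) hm hφ, map_zero, smul_zero]

theorem sum_wordTerm_of_card (hθ : ∀ i, θ i ∈ gsDegree A (d i))
    (hJ : ∀ i, J i ≠ o) (hinj : Function.Injective J) {S : Stacking} {p q : ℕ} (hS : S.TQ p)
    {φ : GSObj A →ₗ[k] M} (hφ : LocalAt φ p q) {r : ℕ} (hr : S.card = r + m) :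
    (r.factorial : k) • ∑ w ∈ (fam θ d E γ).words S.sizes with
        (w.filter (· ≠ o)).Perm (List.ofFn J), wordTerm d E γ θ φ p S w =
      ∑ π : Equiv.Perm (Fin (r + m)), wordTerm d E γ θ φ p S (List.ofFn (pad o J r ∘ π)) := by
  rw [Finset.sum_comp (fun w => wordTerm d E γ θ φ p S w) fun π : Equiv.Perm (Fin (r + m)) =>
    List.ofFn (pad o J r ∘ π), Finset.smul_sum]
  refine Finset.sum_subset_zero_on_sdiff (fun w hw => ?_) (fun w hw => ?_) fun w hw => ?_
  · obtain ⟨h1, h2⟩ := Finset.mem_filter.1 hw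
    obtain ⟨π, rfl⟩ := exists_eq_pad h2 (((Family.mem_words _).1 h1).length_eq.symm.trans hr)
    exact Finset.mem_image_of_mem _ (Finset.mem_univ _)
  · obtain ⟨h1, h2⟩ := Finset.mem_sdiff.1 hw
    obtain ⟨π, -, rfl⟩ := Finset.mem_image.1 h1
    rw [wordTerm_eq_zero hθ hS (by simp [hr]) (fun hm => h2 (Finset.mem_filter.2
      ⟨(Family.mem_words _).2 hm, filter_pad_perm hJ π⟩)) hφ, smul_zero]
  · obtain ⟨h1, h2⟩ := Finset.mem_filter.1 hw
    obtain ⟨π, rfl⟩ := exists_eq_pad h2 (((Family.mem_words _).1 h1).length_eq.symm.trans hr)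
    rw [card_fiber_pad hJ hinj, Nat.cast_smul_eq_nsmul]

/-- A component of a bracket with repetitions. -/
theorem map_bracket_pad (hθ : ∀ i, θ i ∈ gsDegree A (d i)) {Q : ℕ} (hQ : ∀ i, d i + 1 ≤ Q) {p q : ℕ}
    {φ : GSObj A →ₗ[k] M} (hφ : LocalAt φ p q) (r : ℕ) :
    φ (bracket A (r + m) fun i => θ (pad o J r i)) = ∑ S ∈ quad Q p with S.card = r + m,
      ∑ π : Equiv.Perm (Fin (r + m)), sg k (rootThin S + S.mSign p 0 + thinSign S.sizes +
        degSign (fun i => d (pad o J r i)) + kz (shPar fun i => d (pad o J r i)) (List.ofFn π)) •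
          φ (S.fill (extend fun i => θ (pad o J r (π i)))) := by
  simp only [← map_smul, ← map_sum]
  rw [← sub_eq_zero, ← map_sub]
  refine hφ _ fun V X σ a hσ => ?_
  subst hσ
  have hs {β : Type} (s : Finset β) (f : β → GSObj A) :
      (∑ i ∈ s, f i) q V X σ a = ∑ i ∈ s, f i q V X σ a := by
    classical
    induction s using Finset.induction_on with
    | empty => rfl
    | insert i s hi ih => rw [Finset.sum_insert hi, Finset.sum_insert hi, gsObj_add_apply, ih]
  refine sub_eq_zero.2 (Eq.trans ?_ (hs _ _).symm)
  rw [bracket_apply, Finset.sum_congr rfl fun π _ =>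
    brace_apply π (D := fun i => d (pad o J r i)) (fun i => hθ _) (fun i => hQ _) q σ a,
    Finset.sum_comm]
  refine Finset.sum_congr rfl fun S _ => ?_
  rw [hs]
  exact Finset.sum_congr rfl fun π _ => rfl

/-- The twisted operation is the sum over all words that consist of the given letters, and of any
number of copies of one additional letter. -/
theorem sum_words_eq_twist (h : Super d E γ) (hθ : ∀ i, θ i ∈ gsDegree A (d i)) (hE : E o = -1)
    (ho : d o = 1) (hJ : ∀ i, J i ≠ o) (hinj : Function.Injective J) {Q : ℕ}
    (hQ : ∀ i, d i + 1 ≤ Q) {p q : ℕ} {φ : GSObj A →ₗ[k] M} (hφ : LocalAt φ p q) :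
    ∑ S ∈ quad Q p, ∑ w ∈ (fam θ d E γ).words S.sizes with
        (w.filter (· ≠ o)).Perm (List.ofFn J), wordTerm d E γ θ φ p S w =
      sg k (degSign fun i => d (J i)) • (((List.ofFn J).map E).prod * γ ^ if p = 0 then 2 else 1)
        (φ (twist (k := k) (bracket A) (θ o) m fun i => θ (J i))) := by
  obtain ⟨R, hR⟩ := exists_twistTerm_eq_zero (k := k) (ho ▸ hθ o) fun i => hθ (J i)
  let R' := R + ∑ S ∈ quad Q p, S.card + 1
  rw [twist_eq_sum (R := R') fun r hr => hR r (by omega), map_sum, map_sum, Finset.smul_sum]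
  have h1 : ∀ S ∈ quad Q p, (∑ w ∈ (fam θ d E γ).words S.sizes with
      (w.filter (· ≠ o)).Perm (List.ofFn J), wordTerm d E γ θ φ p S w) =
      ∑ r ∈ Finset.range R', if S.card = r + m then (∑ w ∈ (fam θ d E γ).words S.sizes with
        (w.filter (· ≠ o)).Perm (List.ofFn J), wordTerm d E γ θ φ p S w) else 0 := fun S hS => by
    by_cases hm : m ≤ S.card
    · have h2 := Finset.single_le_sum (f := fun S => S.card) (fun _ _ => Nat.zero_le _) hS
      rw [Finset.sum_eq_single_of_mem (S.card - m) (Finset.mem_range.2 (by simp only [R']; omega))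
        fun r _ hr => if_neg (by omega), if_pos (by omega)]
    · rw [Finset.sum_eq_zero fun r _ => if_neg (by omega)]
      refine Finset.sum_eq_zero fun w hw => ?_
      obtain ⟨h3, h4⟩ := Finset.mem_filter.1 hw
      have h5 := ((Family.mem_words _).1 h3).length_eq
      have h6 := h4.length_eq
      have h7 := List.length_filter_le (fun x => decide (x ≠ o)) w
      rw [List.length_ofFn] at h6
      rw [card] at hm
      omega
  rw [Finset.sum_congr rfl h1, Finset.sum_comm]
  refine Finset.sum_congr rfl fun r _ => ?_
  have h2 : (Fin.append (fun _ => θ o) fun i => θ (J i) : Fin (r + m) → GSObj A) =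
      fun i => θ (pad o J r i) := by
    funext i
    induction i using Fin.addCases with
    | left i => simp [pad]
    | right i => simp [pad]
  have h3 : (r.factorial : k) ≠ 0 := Nat.cast_ne_zero.2 (Nat.factorial_ne_zero r)
  rw [← Finset.sum_filter, twistTerm, h2, map_smul, map_bracket_pad hθ hQ hφ r, map_smul, map_sum]
  rw [div_eq_mul_inv, mul_comm, mul_smul, smul_comm _ (r.factorial : k)⁻¹, eq_inv_smul_iff₀ h3,
    Finset.smul_sum, Finset.smul_sum, Finset.smul_sum]
  refine Finset.sum_congr rfl fun S hS => ?_
  obtain ⟨h4, h5⟩ := Finset.mem_filter.1 hS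
  rw [sum_wordTerm_of_card hθ hJ hinj (tq_of_mem_quad h4) hφ h5, map_sum, Finset.smul_sum,
    Finset.smul_sum]
  refine Finset.sum_congr rfl fun π _ => ?_
  rw [wordTerm_pad h hθ hE (tq_of_mem_quad h4) hφ h5, map_smul, neg_one_pow_eq_sg, sg_smul_smul,
    sg_smul_smul]
  congr 2
  have h6 := degSign_pad d ho J r
  linear_combination h6 * (-1) - (degSign fun i => d (J i)) * two_eq_zero_zmod

end

/-! ## Totals of families -/

section

variable {k : Type t} [Field k] {𝒰 : Type u} [Category.{v} 𝒰] {A : LinQuiver.{u, v, w, w', t} k 𝒰}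
  {M : Type*} [AddCommGroup M] [Module k M] {ι : Type*}

open Stacking

/-- The value of an element of the Gerstenhaber-Schack object. -/
def evalAt (q : ℕ) {V X : 𝒰} (σ : Simp V X) (a : Fin (q + 1) → A.Ob X)
    (x : ∀ i : Fin q, A.Hom (a i.castSucc) (a i.succ)) :
    GSObj A →ₗ[k] A.Hom (A.lower σ (a 0)) (A.upper σ (a (Fin.last q))) where
  toFun θ := θ q V X σ a x
  map_add' _ _ := rfl
  map_smul' _ _ := rfl

theorem localAt_evalAt (q : ℕ) {V X : 𝒰} (σ : Simp V X) (a : Fin (q + 1) → A.Ob X)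
    (x : ∀ i : Fin q, A.Hom (a i.castSucc) (a i.succ))
    (vac : A.Hom (A.lower σ (a 0)) (A.upper σ (a (Fin.last q))) →ₗ[k] M) :
    LocalAt (vac ∘ₗ evalAt q σ a x) σ.length q := fun y hy =>
  comp_eq_zero _ _ _ (DFunLike.congr_fun (hy V X σ a rfl) x)

/-- The source that produces the given letters in the given order. -/
def letters {W : 𝒰} (y : ℕ → HH A W) : Tr A W (ULift.{max u v} ℕ) M where
  toFun κ s := κ ⟨s.down + 1⟩ (y s.down)
  map_add' _ _ := rfl
  map_smul' _ _ := rfl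

theorem chain_letters {W : 𝒰} (b : ℕ → A.Ob W) (y : ℕ → HH A W) (n : ℕ)
    (K : ULift.{max u v} ℕ → Word A W → M) (o : ℕ) :
    chain (fun s => b s.down) (letters y) n K ⟨o⟩ =
      K ⟨o + n⟩ (List.ofFn fun i : Fin n => (y (o + i), b (o + i + 1))) := by
  induction n generalizing K o with
  | zero => rfl
  | succ n ih =>
    refine (ih _ (o + 1)).trans ?_
    rw [List.ofFn_succ, Nat.add_right_comm o 1 n]
    congr 2
    congr 1
    funext i
    rw [Fin.val_succ, Nat.add_right_comm o 1 i]
    rfl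

namespace Family

/-- The sum over all words and thin-quadratic stackings. -/
noncomputable def total (F : Family A M ι) (Q p : ℕ) (φ : GSObj A →ₗ[k] M) : M :=
  ∑ S ∈ quad Q p, sg k (rootThin S + S.mSign p 0) • F.wordSum S.sizes fun w =>
    F.wordOp S.sizes w (φ (S.fill (F.word w)))

variable (F : Family A M ι) {q : ℕ} {V X : 𝒰} (σ : Simp V X) (a : Fin (q + 1) → A.Ob X)
  (x : ∀ i : Fin q, A.Hom (a i.castSucc) (a i.succ))
  (vac : A.Hom (A.lower σ (a 0)) (A.upper σ (a (Fin.last q))) →ₗ[k] M)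

/-- The vertices and the arrows, as sequences. -/
def vertex (n : ℕ) : A.Ob X := a ⟨min n q, Nat.lt_succ_of_le (min_le_right n q)⟩

/-- The arrows, as a sequence. -/
noncomputable def arrow (n : ℕ) : HH A X := if h : n < q then emb (x ⟨n, h⟩) else 0

theorem evO_letters {S : Stacking} (hS : S.TQ σ.length) (hq : S.inputs = q) (θ : ℕ → GSObj A) :
    evO θ (objAt (vertex a 0) (List.ofFn fun i : Fin S.inputs => (arrow a x (0 + i), vertex a (0 + i + 1))))
      (valAt (List.ofFn fun i : Fin S.inputs => (arrow a x (0 + i), vertex a (0 + i + 1)))) S σ 0 0 =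
      emb (S.act θ q σ a x) := by
  subst hq
  rw [← appL_act θ S hS.ne_unit σ hS.out_eq _ _ List.length_ofFn]
  refine (app_eq_appF _ σ List.length_ofFn _ _ a (fun j => emb (x j)) (fun j => ?_) fun j => ?_).trans ?_
  · cases j using Fin.cases with
    | zero => exact (objAt_zero _ _).trans (congrArg a (Fin.ext (Nat.zero_min _)))
    | succ j =>
      refine (objAt_ofFn_succ _ _ j).trans (congrArg a (Fin.ext ?_))
      simp
  · refine (valAt_ofFn _ j).trans ?_
    change arrow a x (0 + j) = _
    rw [Nat.zero_add, arrow, dif_pos j.2]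
  · simp only [appF, emb_apply]

theorem term_letters {S : Stacking} (hS : S.TQ σ.length) :
    F.term (fun s : ULift.{max u v} ℕ => vertex a s.down) (fun s => s.down) (letters (arrow a x)) S σ
      (fun s y => if s.down = q then vac (y _ _) else 0) ⟨0⟩ =
    sg k (rootThin S + S.mSign σ.length 0) • F.wordSum S.sizes fun w =>
      F.wordOp S.sizes w ((vac ∘ₗ evalAt q σ a x) (S.fill (F.word w))) := by
  rw [term, Nat.cast_zero, mul_zero, add_zero]
  congr 2
  funext w
  congr 1
  refine (chain_letters _ _ _ _ 0).trans ?_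
  by_cases hq : S.inputs = q
  · rw [if_pos (by rw [Nat.zero_add]; exact hq), evO_letters σ a x hS hq, emb_apply]
    rfl
  · rw [if_neg (by rw [Nat.zero_add]; exact hq)]
    change _ = vac (S.act (F.word w) q σ a x)
    rw [act_of_ne _ hq]
    exact (map_zero vac).symm

theorem good_letters (y : ℕ → HH A X) :
    F.Good (fun s : ULift.{max u v} ℕ => (s.down : ZMod 2)) (letters y) := by
  have h (z : Module.End k M) (ε : ZMod 2) :
      Comm (fun s : ULift.{max u v} ℕ => (s.down : ZMod 2)) (letters y) z ε 0 := fun κ s => by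
    change z (κ ⟨s.down + 1⟩ (y s.down)) =
      sg k (ε * ((s.down : ZMod 2) + ((s.down + 1 : ℕ) : ZMod 2) + 1) + 0) • z (κ ⟨s.down + 1⟩ (y s.down))
    rw [show ε * ((s.down : ZMod 2) + ((s.down + 1 : ℕ) : ZMod 2) + 1) + 0 = 0 by
      push_cast
      linear_combination (ε * (s.down + 1)) * two_eq_zero_zmod, sg_zero, one_smul]
  exact ⟨fun i => h _ _, fun i => h _ _⟩

variable {F}

theorem total_eq_QN (hF : F.Par) (hσ : 0 < σ.length) {Q : ℕ} (hQ : F.Bounded σ.length Q) :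
    F.total Q σ.length (vac ∘ₗ evalAt q σ a x) =
      F.QN (fun s : ULift.{max u v} ℕ => vertex a s.down) (fun s => s.down) (letters (arrow a x)) σ
        (fun s y => if s.down = q then vac (y _ _) else 0) ⟨0⟩ := by
  rw [QN_eq_sum hF (F.good_letters _) σ hQ hσ]
  exact Finset.sum_congr rfl fun S hS => (F.term_letters σ a x vac (tq_of_mem_quad hS)).symm

theorem total_eq_QT (hF : F.Par) {Q P : ℕ} (hQ : F.Bounded P Q)
    (vac : A.Hom (a 0) (a (Fin.last q)) →ₗ[k] M) :
    F.total Q 0 (vac ∘ₗ evalAt q (Simp.nil X) a x) =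
      F.QT (fun s : ULift.{max u v} ℕ => vertex a s.down) (fun s => s.down) (letters (arrow a x))
        (fun s y => if s.down = q then vac (y (a 0) (a (Fin.last q))) else 0) ⟨0⟩ := by
  rw [QT_eq_sum hF (F.good_letters _) hQ]
  exact Finset.sum_congr rfl fun S hS =>
    (F.term_letters (Simp.nil X) a x vac (tq_of_mem_quad hS)).symm

/-- In the total of an extended family all stackings with one of the new boxes cancel. -/
theorem total_ext {ι' : Type*} {G : Family A M ι'} {η : Module.End k M} (h : Deform F G η)
    (hc : Collects.{u, v, w, w', t, 0} F G) (hG : G.Par) {Q Q' : ℕ} (hQ : F.Bounded σ.length Q)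
    (hQ' : (F.ext G η).Bounded σ.length Q') :
    (F.ext G η).total Q' σ.length (vac ∘ₗ evalAt q σ a x) =
      F.total Q σ.length (vac ∘ₗ evalAt q σ a x) := by
  have hη : Comm (fun s : ULift.{max u v} ℕ => (s.down : ZMod 2))
      (letters (A := A) (M := M) (arrow a x)) η 0 0 := fun κ s => by
    simp only [zero_mul, zero_add, sg_zero, one_smul]
    rfl
  rcases Nat.eq_zero_or_pos σ.length with hσ | hσ
  · cases σ with
    | cons f τ => simp [Simp.length] at hσ
    | nil =>
      exact (total_eq_QT a x (par_ext h.rels.par hG η) hQ' vac).trans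
        ((h.ext_QT hc (F.good_letters _) hη _ _).trans (total_eq_QT a x h.rels.par hQ vac).symm)
  · rw [total_eq_QN σ a x vac (par_ext h.rels.par hG η) hσ hQ', total_eq_QN σ a x vac h.rels.par hσ hQ,
      h.ext_QN hc (F.good_letters _) hη σ hσ]

end Family

end

/-! ## Operators that add letters to a set of letters -/

section

variable {k : Type t} [Field k] {H : Type*} [AddCommGroup H] [Module k H] {κ : Type*} [LinearOrder κ]
  (e : κ → ZMod 2)

/-- Multiplication by the letter `i`, on a free graded commutative algebra without squares. -/
def raise (k : Type t) [Field k] {H : Type*} [AddCommGroup H] [Module k H] {κ : Type*} [LinearOrder κ]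
    (e : κ → ZMod 2) (i : κ) : Module.End k (Finset κ → H) where
  toFun m K := if i ∈ K then sg k (e i * ∑ j ∈ K with j < i, e j) • m (K.erase i) else 0
  map_add' m m' := by
    funext K
    by_cases h : i ∈ K <;> simp [h]
  map_smul' c m := by
    funext K
    by_cases h : i ∈ K <;> simp [h, smul_comm c]

/-- The grading operator. -/
def grad (k : Type t) [Field k] {H : Type*} [AddCommGroup H] [Module k H] {κ : Type*}
    (e : κ → ZMod 2) : Module.End k (Finset κ → H) where
  toFun m K := sg k (∑ j ∈ K, e j) • m K
  map_add' _ _ := funext fun _ => smul_add _ _ _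
  map_smul' _ _ := funext fun _ => smul_comm _ _ _

theorem raise_apply (i : κ) (m : Finset κ → H) (K : Finset κ) : raise k e i m K =
    if i ∈ K then sg k (e i * ∑ j ∈ K with j < i, e j) • m (K.erase i) else 0 := rfl

theorem grad_apply (m : Finset κ → H) (K : Finset κ) :
    grad k e m K = sg k (∑ j ∈ K, e j) • m K := rfl

theorem grad_mul_grad : grad k (H := H) e * grad k e = 1 := by
  refine LinearMap.ext fun m => funext fun K => ?_
  rw [Module.End.mul_apply, grad_apply, grad_apply, smul_smul, sg_mul_self, one_smul]
  rfl

theorem raise_mul_grad (i : κ) :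
    raise k (H := H) e i * grad k e = sg k (e i) • (grad k e * raise k e i) := by
  refine LinearMap.ext fun m => funext fun K => ?_
  rw [Module.End.mul_apply, raise_apply, LinearMap.smul_apply, Pi.smul_apply, Module.End.mul_apply,
    grad_apply, grad_apply, raise_apply]
  split_ifs with h
  · rw [← Finset.add_sum_erase K e h, sg_smul_smul, sg_smul_smul, sg_smul_smul]
    congr 2
    linear_combination (-e i) * two_eq_zero_zmod
  · rw [smul_zero, smul_zero]

theorem raise_mul_raise (i j : κ) : raise k (H := H) e i * raise k e j =
    sg k (e i * e j) • (raise k e j * raise k e i) := by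
  refine LinearMap.ext fun m => funext fun K => ?_
  rw [Module.End.mul_apply, LinearMap.smul_apply, Pi.smul_apply, Module.End.mul_apply]
  simp only [raise_apply]
  rcases eq_or_ne i j with rfl | hij
  · simp
  by_cases hi : i ∈ K
  swap
  · simp [hi]
  by_cases hj : j ∈ K
  swap
  · simp [hj]
  have h : ∀ i j, i ≠ j → i ∈ K → ∑ l ∈ K.erase i with l < j, e l =
      (∑ l ∈ K with l < j, e l) + if i < j then e i else 0 := fun i j hij hi => by
    rw [Finset.filter_erase]
    by_cases h : i < j
    · rw [if_pos h, ← Finset.add_sum_erase (K.filter (· < j)) e (Finset.mem_filter.2 ⟨hi, h⟩)]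
      linear_combination (-e i) * two_eq_zero_zmod
    · rw [if_neg h, Finset.erase_eq_of_notMem (s := K.filter (· < j)) (a := i) fun h' => h (Finset.mem_filter.1 h').2, add_zero]
  rw [if_pos hi, if_pos hj, if_pos (Finset.mem_erase.2 ⟨hij.symm, hj⟩),
    if_pos (Finset.mem_erase.2 ⟨hij, hi⟩), h i j hij hi, h j i hij.symm hj, Finset.erase_right_comm,
    sg_smul_smul, sg_smul_smul, sg_smul_smul]
  congr 2
  rcases lt_or_gt_of_ne hij with h' | h'
  · rw [if_pos h', if_neg h'.not_gt]; ring_nf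
  · rw [if_neg h'.not_gt, if_pos h']; linear_combination (-e i * e j) * two_eq_zero_zmod

/-- Multiplication by a product of letters. -/
def raiseL (k : Type t) [Field k] {H : Type*} [AddCommGroup H] [Module k H] {κ : Type*} [LinearOrder κ]
    (e : κ → ZMod 2) (l : List κ) : Module.End k (Finset κ → H) := (l.map (raise k e)).prod

theorem raiseL_append (l l' : List κ) :
    raiseL k (H := H) e (l ++ l') = raiseL k e l * raiseL k e l' := by
  rw [raiseL, List.map_append, List.prod_append]
  rfl

theorem raiseL_cons (i : κ) (l : List κ) :
    raiseL k (H := H) e (i :: l) = raise k e i * raiseL k e l := rfl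

theorem raiseL_mul_grad (l : List κ) :
    raiseL k (H := H) e l * grad k e = sg k (l.map e).sum • (grad k e * raiseL k e l) := by
  induction l with
  | nil => simp [raiseL]
  | cons i l ih =>
    rw [raiseL_cons, mul_assoc, ih, mul_smul_comm, ← mul_assoc, raise_mul_grad, smul_mul_assoc,
      smul_smul, ← sg_add, mul_assoc, List.map_cons, List.sum_cons, add_comm]

theorem raise_mul_raiseL (i : κ) (l : List κ) : raise k (H := H) e i * raiseL k e l =
    sg k (e i * (l.map e).sum) • (raiseL k e l * raise k e i) := by
  induction l with
  | nil => simp [raiseL]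
  | cons j l ih =>
    rw [raiseL_cons, ← mul_assoc, raise_mul_raise, smul_mul_assoc, mul_assoc, ih, mul_smul_comm,
      smul_smul, ← sg_add, mul_assoc, List.map_cons, List.sum_cons, mul_add]

theorem raiseL_mul_raiseL (l l' : List κ) : raiseL k (H := H) e l * raiseL k e l' =
    sg k ((l.map e).sum * (l'.map e).sum) • (raiseL k e l' * raiseL k e l) := by
  induction l with
  | nil => simp [raiseL]
  | cons i l ih =>
    rw [raiseL_cons, mul_assoc, ih, mul_smul_comm, ← mul_assoc, raise_mul_raiseL, smul_mul_assoc,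
      smul_smul, ← sg_add, mul_assoc, List.map_cons, List.sum_cons, add_mul, add_comm]

theorem exists_of_raiseL_ne_zero {l : List κ} {m : Finset κ → H} {K : Finset κ}
    (h : raiseL k e l m K ≠ 0) : ∃ K', m K' ≠ 0 ∧ K.val = (l : Multiset κ) + K'.val := by
  induction l generalizing K with
  | nil => exact ⟨K, h, (zero_add _).symm⟩
  | cons i l ih =>
    rw [raiseL_cons, Module.End.mul_apply, raise_apply] at h
    split_ifs at h with hi
    · obtain ⟨K', h1, h2⟩ := ih fun h' => h (by rw [h', smul_zero])
      refine ⟨K', h1, ?_⟩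
      rw [← Multiset.cons_coe, Multiset.cons_add, ← h2, Finset.erase_val,
        Multiset.cons_erase hi]
    · exact absurd rfl h

/-- The elements without letters. -/
def vacuum (k : Type t) [Field k] {H : Type*} [AddCommGroup H] [Module k H] (κ : Type*)
    [LinearOrder κ] : H →ₗ[k] (Finset κ → H) := LinearMap.single k (fun _ : Finset κ => H) ∅

theorem vacuum_apply (y : H) (K : Finset κ) : vacuum k κ y K = if K = ∅ then y else 0 := by
  rw [vacuum, LinearMap.single_apply, Pi.single_apply]

theorem grad_vacuum (y : H) : grad k e (vacuum k κ y) = vacuum k κ y := by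
  funext K
  rw [grad_apply, vacuum_apply]
  split_ifs with h
  · subst h; simp
  · rw [smul_zero]

theorem perm_of_raiseL_vacuum_ne_zero {l : List κ} {y : H} {K : Finset κ}
    (h : raiseL k e l (vacuum k κ y) K ≠ 0) : K.val = (l : Multiset κ) := by
  obtain ⟨K', h1, h2⟩ := exists_of_raiseL_ne_zero e h
  rw [vacuum_apply] at h1
  split_ifs at h1 with h3
  · rw [h2, h3, Finset.empty_val, add_zero]
  · exact absurd rfl h1

theorem raiseL_sorted {l : List κ} (h : l.Pairwise (· < ·)) (y : H) :
    raiseL k e l (vacuum k κ y) l.toFinset = y := by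
  induction h with
  | nil => rw [raiseL, List.map_nil, List.prod_nil, Module.End.one_apply, vacuum_apply]; rfl
  | @cons i l h _ ih =>
    have hi : i ∉ l.toFinset := fun hi => lt_irrefl i (h i (List.mem_toFinset.1 hi))
    rw [raiseL_cons, Module.End.mul_apply, raise_apply, List.toFinset_cons,
      if_pos (Finset.mem_insert_self _ _), Finset.erase_insert hi, ih, Finset.sum_eq_zero, mul_zero,
      sg_zero, one_smul]
    intro j hj
    obtain ⟨h1, h2⟩ := Finset.mem_filter.1 hj
    rcases Finset.mem_insert.1 h1 with rfl | h1
    · exact absurd h2 (lt_irrefl _)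
    · exact absurd h2 (h j (List.mem_toFinset.1 h1)).not_gt

theorem raiseL_vacuum [Fintype κ] {l : List κ} (hl : (Finset.univ : Finset κ).val = l) (y : H) :
    raiseL k e l (vacuum k κ y) Finset.univ = sg k (kz e l) • y := by
  have h1 : (Finset.univ.sort (· ≤ ·)).Perm l := by
    rw [← Multiset.coe_eq_coe, ← hl, Finset.sort_eq]
  have h2 := prod_perm (k := k) (E := raise k (H := H) e) (raise_mul_raise e)
    (Finset.sort_nodup (Finset.univ : Finset κ) (· ≤ ·)) h1
  have h3 := Finset.sortedLT_sort (Finset.univ : Finset κ)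
  rw [kz_of_sorted e h3.pairwise, sg_zero, one_smul] at h2
  have h4 := raiseL_sorted (k := k) e h3.pairwise y
  rw [Finset.sort_toFinset, raiseL, h2] at h4
  refine Eq.trans ?_ (congrArg (fun y => sg k (kz e l) • y) h4)
  rw [LinearMap.smul_apply, Pi.smul_apply, smul_smul, sg_mul_self, one_smul]
  rfl

variable {ι : Type*}

/-- Operators that are given by lists of letters. -/
def letterOp (k : Type t) [Field k] {H : Type*} [AddCommGroup H] [Module k H] {κ : Type*} [LinearOrder κ]
    (e : κ → ZMod 2) (s : ι → ZMod 2) (L : ι → List κ) (i : ι) : Module.End k (Finset κ → H) :=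
  sg k (s i) • raiseL k e (L i)

variable {e} {s : ι → ZMod 2} {L : ι → List κ} {d : ι → ℤ}

theorem super_letterOp (h : ∀ i, shPar d i = ((L i).map e).sum) :
    Super d (letterOp k (H := H) e s L) (grad k e) where
  comm i j := by
    simp only [letterOp]
    rw [smul_mul_smul_comm, smul_mul_smul_comm, raiseL_mul_raiseL, h, h, mul_comm (sg k (s i)), smul_comm]
  grading i := by
    simp only [letterOp]
    rw [smul_mul_assoc, raiseL_mul_grad, h, mul_smul_comm, smul_comm]
  sq := grad_mul_grad e

theorem prod_letterOp (w : List ι) : (w.map (letterOp k (H := H) e s L)).prod =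
    sg k (w.map s).sum • raiseL k e (w.flatMap L) := by
  induction w with
  | nil => simp [raiseL]
  | cons i w ih =>
    rw [List.map_cons, List.prod_cons, ih, letterOp, smul_mul_smul_comm, List.flatMap_cons,
      raiseL_append, List.map_cons, List.sum_cons, sg_add]

end

/-! ## Totals as sums of twisted operations -/

section

variable {k : Type t} [Field k] [CharZero k] {𝒰 : Type u} [Category.{v} 𝒰]
  {A : LinQuiver.{u, v, w, w', t} k 𝒰} {M M' : Type*} [AddCommGroup M] [Module k M]
  [AddCommGroup M'] [Module k M'] {ι : Type*} [Fintype ι] [DecidableEq ι]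
  {d : ι → ℤ} {E : ι → Module.End k M} {γ : Module.End k M} {θ : ι → GSObj A}

open Stacking

theorem bounded_fam {Q : ℕ} (hQ : ∀ i, d i + 1 ≤ Q) (P : ℕ) : (fam θ d E γ).Bounded P Q := by
  intro p _ i _ q hq
  have := hQ i
  rw [ar_fam] at hq
  omega

theorem total_eq_sum_wordTerm {Q p : ℕ} (φ : GSObj A →ₗ[k] M) : (fam θ d E γ).total Q p φ =
    ∑ S ∈ quad Q p, ∑ w ∈ (fam θ d E γ).words S.sizes, wordTerm d E γ θ φ p S w := by
  refine Finset.sum_congr rfl fun S _ => ?_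
  rw [← Family.sum_words, Finset.smul_sum]
  rfl

/-- If only the words with the letters `J c` contribute, then the total is a sum of twisted operations. -/
theorem total_eq_sum (h : Super d E γ) (hθ : ∀ i, θ i ∈ gsDegree A (d i)) {o : ι} (hE : E o = -1)
    (ho : d o = 1) {Q : ℕ} (hQ : ∀ i, d i + 1 ≤ Q) {p q : ℕ} {φ : GSObj A →ₗ[k] M}
    (hφ : LocalAt φ p q) (ψ : M →ₗ[k] M') {C : Type*} [Fintype C] {m : C → ℕ} {J : ∀ c, Fin (m c) → ι}
    (hJ : ∀ c i, J c i ≠ o) (hinj : ∀ c, Function.Injective (J c))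
    (hex : ∀ (w : List ι) (n : ℕ) (x : GSObj A), ψ ((w.map E).prod ((γ ^ n) (φ x))) ≠ 0 →
      ∃ c, (w.filter (· ≠ o)).Perm (List.ofFn (J c)))
    (huniq : ∀ c c', (List.ofFn (J c)).Perm (List.ofFn (J c')) → c = c') :
    ψ ((fam θ d E γ).total Q p φ) = ∑ c, sg k (degSign fun i => d (J c i)) •
      ψ ((((List.ofFn (J c)).map E).prod * γ ^ if p = 0 then 2 else 1)
        (φ (twist (k := k) (bracket A) (θ o) (m c) fun i => θ (J c i)))) := by
  have h1 : ∀ S ∈ quad Q p, ∀ w ∈ (fam θ d E γ).words S.sizes, ψ (wordTerm d E γ θ φ p S w) =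
      ∑ c, if (w.filter (· ≠ o)).Perm (List.ofFn (J c)) then ψ (wordTerm d E γ θ φ p S w) else 0 := by
    intro S _ w hw
    by_cases h0 : ψ (wordTerm d E γ θ φ p S w) = 0
    · simp [h0]
    · obtain ⟨c, hc⟩ : ∃ c, (w.filter (· ≠ o)).Perm (List.ofFn (J c)) := by
        rw [wordTerm, wordOp_fam h ((Family.mem_words _).1 hw), LinearMap.smul_apply, smul_smul,
          map_smul] at h0
        exact hex w _ _ (right_ne_zero_of_smul h0)
      rw [Finset.sum_eq_single c, if_pos hc]
      · exact fun c' _ hc' => if_neg fun h2 => hc' (huniq _ _ (h2.symm.trans hc))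
      · exact fun h2 => absurd (Finset.mem_univ c) h2
  rw [total_eq_sum_wordTerm, map_sum]
  simp only [map_sum]
  rw [Finset.sum_congr rfl fun S hS => Finset.sum_congr rfl (h1 S hS),
    Finset.sum_congr rfl fun S _ => Finset.sum_comm, Finset.sum_comm]
  refine Finset.sum_congr rfl fun c _ => ?_
  rw [← map_smul, ← sum_words_eq_twist h hθ hE ho (hJ c) (hinj c) hQ hφ, map_sum]
  refine Finset.sum_congr rfl fun S _ => ?_
  rw [map_sum, Finset.sum_filter]

end

/-! ## Unshuffles -/

section

variable {n : ℕ}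

/-- The unshuffles of `n` letters. -/
abbrev Unshuffle (n : ℕ) : Type := Σ l : Fin (n + 1), {π : Equiv.Perm (Fin n) // IsUnshuffle l.1 π}

noncomputable instance (l : ℕ) : Fintype {π : Equiv.Perm (Fin n) // IsUnshuffle l π} :=
  Fintype.ofFinite _

namespace Unshuffle

variable (c : Unshuffle n)

/-- The first block of an unshuffle. -/
def first (i : Fin c.1) : Fin n := c.2.1 ⟨i, i.2.trans_le (Nat.le_of_lt_succ c.1.2)⟩

/-- The second block of an unshuffle. -/
def rest (j : Fin (n - c.1)) : Fin n := c.2.1 ⟨c.1 + j, Nat.add_lt_of_lt_sub' j.2⟩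

theorem ofFn_eq : List.ofFn c.2.1 = List.ofFn c.first ++ List.ofFn c.rest := by
  have h : c.1.1 + (n - c.1) = n := Nat.add_sub_cancel' (Nat.le_of_lt_succ c.1.2)
  rw [← List.ofFn_fin_append]
  refine List.ext_getElem (by simp [h]) fun i h1 h2 => ?_
  rw [List.getElem_ofFn, List.getElem_ofFn]
  rcases lt_or_ge i c.1 with hi | hi
  · rw [show (⟨i, by simpa using h2⟩ : Fin (c.1.1 + (n - c.1))) = Fin.castAdd _ ⟨i, hi⟩ from rfl,
      Fin.append_left]
    rfl
  · rw [show (⟨i, by simpa using h2⟩ : Fin (c.1.1 + (n - c.1))) =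
      Fin.natAdd _ ⟨i - c.1, by simp at h2; omega⟩ from Fin.ext (by simp; omega), Fin.append_right]
    exact congrArg c.2.1 (Fin.ext (by simp; omega))

theorem perm_finRange : (List.ofFn c.first ++ List.ofFn c.rest).Perm (List.finRange n) := by
  rw [← ofFn_eq]
  simpa [List.ofFn_id] using c.2.1.ofFn_comp_perm id

theorem first_injective : Function.Injective c.first := fun i j h => by
  have := c.2.1.injective h
  simpa [Fin.ext_iff] using this

theorem rest_injective : Function.Injective c.rest := fun i j h => by
  have := c.2.1.injective h
  simpa [Fin.ext_iff] using this

theorem strictMono_first : StrictMono c.first := fun i j h => c.2.2 _ _ h (Or.inl j.2)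

theorem strictMono_rest : StrictMono c.rest := fun i j h =>
  c.2.2 _ _ (Fin.lt_def.2 (Nat.add_lt_add_left h _)) (Or.inr (Nat.le_add_right _ _))

theorem eq_of_perm {c c' : Unshuffle n} (h : (List.ofFn c.first).Perm (List.ofFn c'.first)) :
    c = c' := by
  have h2 : (List.ofFn c.rest).Perm (List.ofFn c'.rest) := (List.perm_append_left_iff _).1
    (c.perm_finRange.trans (c'.perm_finRange.symm.trans (h.symm.append_right _)))
  have h3 : List.ofFn c.2.1 = List.ofFn c'.2.1 := by
    rw [ofFn_eq, ofFn_eq, h.eq_of_pairwise' (List.sortedLT_ofFn_iff.2 c.strictMono_first).pairwise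
      (List.sortedLT_ofFn_iff.2 c'.strictMono_first).pairwise,
      h2.eq_of_pairwise' (List.sortedLT_ofFn_iff.2 c.strictMono_rest).pairwise
      (List.sortedLT_ofFn_iff.2 c'.strictMono_rest).pairwise]
  have h4 : c.2.1 = c'.2.1 := Equiv.coe_fn_injective (List.ofFn_injective h3)
  have h5 : c.1 = c'.1 := Fin.ext (by simpa using h.length_eq)
  obtain ⟨l, π, hπ⟩ := c
  obtain ⟨l', π', hπ'⟩ := c'
  obtain rfl : l = l' := h5
  obtain rfl : π = π' := h4
  rfl

theorem exists_perm {l : List (Fin n)} (hl : l.Nodup) : ∃ c : Unshuffle n, l.Perm (List.ofFn c.first) := by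
  have h1 := Finset.card_add_card_compl l.toFinset
  rw [Fintype.card_fin] at h1
  let π : Equiv.Perm (Fin n) := (finCongr h1.symm).trans (finSumFinEquiv.symm.trans
    (finSumEquivOfFinset (s := l.toFinset) rfl rfl))
  have ha : ∀ i (hi : i < l.toFinset.card) h, π ⟨i, h⟩ = l.toFinset.orderEmbOfFin rfl ⟨i, hi⟩ :=
    fun i hi h => by
      rw [← finSumEquivOfFinset_inl (s := l.toFinset) rfl rfl]
      refine congrArg (finSumEquivOfFinset rfl rfl) ((Equiv.symm_apply_eq _).2 (Fin.ext rfl))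
  have hb : ∀ j (hj : j < l.toFinsetᶜ.card) i h, i = l.toFinset.card + j → π ⟨i, h⟩ =
      l.toFinsetᶜ.orderEmbOfFin rfl ⟨j, hj⟩ := fun j hj i h hi => by
      rw [← finSumEquivOfFinset_inr (s := l.toFinset) rfl rfl]
      refine congrArg (finSumEquivOfFinset rfl rfl) ((Equiv.symm_apply_eq _).2 (Fin.ext hi))
  have hπ : IsUnshuffle l.toFinset.card π := by
    intro i j hij h
    rcases h with h | h
    · rw [ha i.1 (lt_trans hij h) i.2, ha j.1 h j.2]
      exact (Finset.orderEmbOfFin _ _).strictMono hij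
    · have hij' : i.1 < j.1 := hij
      have h' : l.toFinset.card ≤ i.1 := h
      rw [hb (i.1 - l.toFinset.card) (by omega) i.1 i.2 (by omega),
        hb (j.1 - l.toFinset.card) (by omega) j.1 j.2 (by omega)]
      refine (Finset.orderEmbOfFin _ _).strictMono (Fin.lt_def.2 ?_)
      change _ - _ < _ - _
      omega
  refine ⟨⟨⟨l.toFinset.card, by omega⟩, π, hπ⟩, ?_⟩
  rw [show first ⟨⟨l.toFinset.card, by omega⟩, π, hπ⟩ = l.toFinset.orderEmbOfFin rfl from
    funext fun i => ha i.1 i.2 _]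
  refine (List.perm_ext_iff_of_nodup hl (List.nodup_ofFn.2
      (l.toFinset.orderEmbOfFin rfl).injective)).2 fun a => ?_
  rw [List.mem_ofFn', Finset.range_orderEmbOfFin, Finset.mem_coe, List.mem_toFinset]

theorem sum_eq {N : Type*} [AddCommMonoid N] (f : Unshuffle n → N) (h0 : ∀ c, c.1 = 0 → f c = 0) :
    ∑ c, f c = ∑ l ∈ (Finset.Icc 1 n).attach, ∑ π : {π : Equiv.Perm (Fin n) // IsUnshuffle l.1 π},
      f ⟨⟨l.1, Nat.lt_succ_of_le (Finset.mem_Icc.1 l.2).2⟩, π⟩ := by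
  rw [Fintype.sum_sigma]
  let g : ℕ → N := fun l => if h : l < n + 1 then
    ∑ π : {π : Equiv.Perm (Fin n) // IsUnshuffle l π}, f ⟨⟨l, h⟩, π⟩ else 0
  have h1 : ∀ l : Fin (n + 1), (∑ π, f ⟨l, π⟩) = g l := fun l => by simp only [g]; rw [dif_pos l.2]
  have h2 : ∀ l : {l // l ∈ Finset.Icc 1 n}, (∑ π : {π : Equiv.Perm (Fin n) // IsUnshuffle l.1 π},
      f ⟨⟨l.1, Nat.lt_succ_of_le (Finset.mem_Icc.1 l.2).2⟩, π⟩) = g l :=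
    fun l => by simp only [g]; rw [dif_pos (Nat.lt_succ_of_le (Finset.mem_Icc.1 l.2).2)]
  rw [Finset.sum_congr rfl fun l _ => h1 l, Finset.sum_congr rfl fun l _ => h2 l,
    Finset.sum_attach (Finset.Icc 1 n) g, Fin.sum_univ_eq_sum_range, Finset.sum_range_eq_add_Ico _
    (Nat.succ_pos n), show g 0 = 0 from ?_, zero_add]
  · rfl
  · rw [← Fin.val_zero (n + 1), ← h1]
    exact Finset.sum_eq_zero fun π _ => h0 _ rfl

end Unshuffle

end

/-! ## Families with one letter for each element -/

section

variable {k : Type t} [Field k] [CharZero k] {𝒰 : Type u} [Category.{v} 𝒰]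
  {A : LinQuiver.{u, v, w, w', t} k 𝒰} {H : Type*} [AddCommGroup H] [Module k H]
  {κ : Type*} [LinearOrder κ] {n : ℕ} {e : κ → ZMod 2} {g : Fin n → κ} {D : Fin n → ℤ}
  {α : GSObj A} {ω : Fin n → GSObj A}

open Stacking

theorem grad_pow_vacuum (r : ℕ) (y : H) : (grad k e ^ r) (vacuum k κ y) = vacuum k κ y := by
  induction r with
  | zero => rfl
  | succ r ih => rw [pow_succ, Module.End.mul_apply, grad_vacuum, ih]

/-- The elements `α, ω₀, …, ω_{n-1}`. -/
def base (α : GSObj A) (ω : Fin n → GSObj A) (i : Option (Fin n)) : GSObj A := i.elim α ω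

/-- The degrees of `α, ω₀, …, ω_{n-1}`. -/
def baseDeg (D : Fin n → ℤ) (i : Option (Fin n)) : ℤ := i.elim 1 D

/-- The letters of `α, ω₀, …, ω_{n-1}`. -/
def baseLet (g : Fin n → κ) (i : Option (Fin n)) : List κ := i.elim [] fun i => [g i]

/-- The operators of `α, ω₀, …, ω_{n-1}`. -/
def baseOp (k : Type t) [Field k] {H : Type*} [AddCommGroup H] [Module k H] {κ : Type*} [LinearOrder κ]
    (e : κ → ZMod 2) (g : Fin n → κ) : Option (Fin n) → Module.End k (Finset κ → H) :=
  letterOp k e (fun i => i.elim 1 fun _ => 0) (baseLet g)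

theorem base_mem (hα : α ∈ gsDegree A 1) (hω : ∀ i, ω i ∈ gsDegree A (D i)) (i : Option (Fin n)) :
    base α ω i ∈ gsDegree A (baseDeg D i) := by
  cases i with
  | none => exact hα
  | some i => exact hω i

theorem shPar_baseDeg (he : ∀ i, e (g i) = shPar D i) (i : Option (Fin n)) :
    shPar (baseDeg D) i = ((baseLet g i).map e).sum := by
  cases i with
  | none => exact congrArg (Int.cast (R := ZMod 2)) (one_add_one_eq_two (R := ℤ))
  | some i =>
    rw [baseLet, Option.elim_some, List.map_singleton, List.sum_singleton, he]
    rfl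

theorem super_baseOp (he : ∀ i, e (g i) = shPar D i) :
    Super (baseDeg D) (baseOp k (H := H) e g) (grad k e) :=
  super_letterOp (shPar_baseDeg he)

theorem baseOp_none : baseOp k (H := H) e g none = -1 := by
  change sg k 1 • raiseL k e [] = -1
  rw [sg_one]
  exact LinearMap.ext fun m => neg_one_smul k m

theorem flatMap_baseLet (w : List (Option (Fin n))) :
    w.flatMap (baseLet g) = w.reduceOption.map g := by
  induction w with
  | nil => rfl
  | cons i w ih => cases i <;> simp [baseLet, ← ih]

theorem filter_eq_reduceOption (w : List (Option (Fin n))) :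
    w.filter (· ≠ none) = w.reduceOption.map some := by
  induction w with
  | nil => rfl
  | cons i w ih => cases i <;> simp [← ih]

theorem prod_baseOp_some (l : List (Fin n)) :
    ((l.map some).map (baseOp k (H := H) e g)).prod = raiseL k e (l.map g) := by
  rw [baseOp, prod_letterOp, List.map_map, flatMap_baseLet, show (l.map some).reduceOption = l by
      simp [List.reduceOption, List.filterMap_map], List.sum_eq_zero, sg_zero, one_smul]
  intro x hx
  obtain ⟨i, -, rfl⟩ := List.mem_map.1 hx
  rfl

theorem exists_of_prod_baseOp_ne_zero {w : List (Option (Fin n))}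
    {m : Finset κ → H} {K : Finset κ} (h : (w.map (baseOp k e g)).prod m K ≠ 0) :
    w.reduceOption.Nodup ∧ ∃ K' : Finset κ, m K' ≠ 0 ∧ K.val = (w.reduceOption.map g : List κ) + K'.val := by
  rw [baseOp, prod_letterOp, flatMap_baseLet] at h
  obtain ⟨K', h1, h2⟩ := exists_of_raiseL_ne_zero e (right_ne_zero_of_smul (a := sg k _) h)
  refine ⟨?_, K', h1, h2⟩
  have := K.nodup
  rw [h2] at this
  exact (Multiset.coe_nodup.1 (Multiset.nodup_of_le (Multiset.le_add_right _ _) this)).of_map g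

theorem prod_baseOp_vacuum {e : Fin n → ZMod 2} (π : Equiv.Perm (Fin n)) (y : H) (r : ℕ) :
    (((List.ofFn fun i => some (π i)).map (baseOp k e id)).prod * grad k e ^ r :
      Module.End k (Finset (Fin n) → H)) (vacuum k (Fin n) y) Finset.univ = sg k (kz e (List.ofFn π)) • y := by
  rw [Module.End.mul_apply, grad_pow_vacuum, show (List.ofFn fun i => some (π i)) =
    (List.ofFn π).map some by rw [List.map_ofFn]; rfl, prod_baseOp_some, List.map_id, raiseL_vacuum]
  exact Multiset.coe_eq_coe.2 (by simpa [List.ofFn_id] using (π.ofFn_comp_perm id).symm)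

/-- The twisted operations are graded antisymmetric. -/
theorem twist_perm (hα : α ∈ gsDegree A 1) (hω : ∀ i, ω i ∈ gsDegree A (D i))
    (π : Equiv.Perm (Fin n)) : twist (k := k) (bracket A) α n (fun i => ω (π i)) =
      (Equiv.Perm.sign π * koszul π fun i => D (π i)) • twist (k := k) (bracket A) α n ω := by
  obtain ⟨Q, hQ⟩ := exists_natBound (Fin.cons 1 D : Fin (n + 1) → ℤ)
  have hQ : ∀ i, baseDeg D i + 1 ≤ Q := fun i => by
    cases i with
    | none => exact hQ 0
    | some i => exact hQ i.succ
  rw [sign_mul_koszul (k := k)]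
  funext q V X σ a
  refine MultilinearMap.ext fun x => ?_
  have hs := super_baseOp (k := k) (H := A.Hom (A.lower σ (a 0)) (A.upper σ (a (Fin.last q))))
    (e := shPar D) (g := id) (D := D) fun _ => rfl
  have key (π : Equiv.Perm (Fin n)) := sum_words_eq_twist hs (base_mem hα hω) baseOp_none rfl
    (J := fun i => some (π i)) (fun i => Option.some_ne_none _) (fun i j h => π.injective (Option.some_injective _ h))
    hQ (localAt_evalAt q σ a x (vacuum k (Fin n)))
  have h1 (π : Equiv.Perm (Fin n)) : (List.ofFn fun i => some (π i)).Perm (List.ofFn some) := by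
    have := π.ofFn_comp_perm (some : Fin n → _)
    exact this
  have h3 := (key π).symm.trans ((Finset.sum_congr rfl fun S _ => Finset.sum_congr
    (Finset.filter_congr fun w _ => ⟨fun h => h.trans ((h1 π).trans (h1 1).symm),
      fun h => h.trans ((h1 1).trans (h1 π).symm)⟩) fun _ _ => rfl).trans (key 1))
  have h4 := congrFun h3 Finset.univ
  rw [Pi.smul_apply, Pi.smul_apply, LinearMap.comp_apply, LinearMap.comp_apply,
    prod_baseOp_vacuum, prod_baseOp_vacuum,
    sg_smul_smul, sg_smul_smul] at h4
  change evalAt q σ a x _ = sg k _ • evalAt q σ a x _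
  have h5 := congrArg (fun y => sg k (degSign (fun i => baseDeg D (some (π i))) + kz (shPar D) (List.ofFn π)) • y) h4
  simp only [sg_smul_smul] at h5
  rw [CharTwo.add_self_eq_zero, sg_zero, one_smul] at h5
  refine h5.trans ?_
  change sg k _ • evalAt q σ a x (twist (bracket A) α n ω) = _
  congr 2
  have h6 : kz (shPar D) (List.ofFn (1 : Equiv.Perm (Fin n))) = 0 :=
    kz_of_sorted _ (List.sortedLT_ofFn_iff.2 strictMono_id).pairwise
  rw [h6, add_zero]
  simp only [degSign, baseDeg, Option.elim_some, Equiv.Perm.one_apply, Equiv.sum_comp π]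
  change _ = kz (shPar D) _ + _ + _
  linear_combination ((n : ZMod 2) + n * (((∑ i, D i : ℤ) : ℤ) : ZMod 2)) * two_eq_zero_zmod

end

/-! ## The Jacobi identities of the twisted operations -/

section

variable {k : Type t} [Field k] [CharZero k] {𝒰 : Type u} [Category.{v} 𝒰]
  {A : LinQuiver.{u, v, w, w', t} k 𝒰} {H : Type*} [AddCommGroup H] [Module k H]
  {n : ℕ} {e : Fin (n + 1) → ZMod 2} {D : Fin n → ℤ} {α : GSObj A} {ω : Fin n → GSObj A}

open Stacking

/-- The operator that adds the letter `0`, and takes the grading into account. -/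
def eta (k : Type t) [Field k] {H : Type*} [AddCommGroup H] [Module k H] {n : ℕ}
    (e : Fin (n + 1) → ZMod 2) : Module.End k (Finset (Fin (n + 1)) → H) := grad k e * raise k e 0

theorem eta_mul_raiseL (h0 : e 0 = 1) (l : List (Fin (n + 1))) :
    eta k (H := H) e * raiseL k e l = raiseL k e l * eta k e := by
  rw [eta, mul_assoc, raise_mul_raiseL, h0, one_mul, ← mul_assoc, raiseL_mul_grad, smul_mul_assoc,
    mul_smul_comm, mul_assoc]

theorem eta_mul_grad (h0 : e 0 = 1) : eta k (H := H) e * grad k e = sg k 1 • raise k e 0 := by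
  rw [eta, mul_assoc, raise_mul_grad, h0, mul_smul_comm, ← mul_assoc, grad_mul_grad, one_mul]

theorem grad_mul_eta : grad k (H := H) e * eta k e = raise k e 0 := by
  rw [eta, ← mul_assoc, grad_mul_grad, one_mul]

theorem eta_mul_eta (h0 : e 0 = 1) : eta k (H := H) e * eta k e = 0 := by
  rw [show eta k (H := H) e * eta k e = eta k e * grad k e * raise k e 0 from (mul_assoc _ _ _).symm,
    eta_mul_grad h0, smul_mul_assoc]
  refine LinearMap.ext fun m => funext fun K => ?_
  rw [LinearMap.smul_apply, Pi.smul_apply, Module.End.mul_apply, raise_apply, raise_apply, if_neg (Finset.notMem_erase _ _), smul_zero,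
    ite_self, smul_zero]
  rfl

theorem eta_mul_raiseL_mul_grad (h0 : e 0 = 1) (l : List (Fin (n + 1))) :
    eta k (H := H) e * raiseL k e l * grad k e = sg k (((0 :: l).map e).sum) • raiseL k e (0 :: l) := by
  rw [mul_assoc, raiseL_mul_grad, mul_smul_comm, ← mul_assoc, eta_mul_grad h0, List.map_cons,
    List.sum_cons, h0, sg_add, mul_smul, raiseL_cons, smul_mul_assoc, smul_comm]

/-- The parities of the letters: `0` is odd, and the others are those of the elements. -/
def letPar (D : Fin n → ℤ) : Fin (n + 1) → ZMod 2 := Fin.cons 1 (shPar D)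

/-- The family of the elements `α, ω₀, …, ω_{n-1}`. -/
def baseFam (k : Type t) [Field k] {A : LinQuiver.{u, v, w, w', t} k 𝒰} (H : Type*) [AddCommGroup H]
    [Module k H] (D : Fin n → ℤ) (α : GSObj A) (ω : Fin n → GSObj A) :
    Family A (Finset (Fin (n + 1)) → H) (Option (Fin n)) :=
  fam (base α ω) (baseDeg D) (baseOp k (letPar D) Fin.succ) (grad k (letPar D))

theorem super_baseFam : Super (baseDeg D) (baseOp k (H := H) (letPar D) Fin.succ) (grad k (letPar D)) :=
  super_baseOp fun _ => rfl

theorem rel_baseFam : (baseFam k H D α ω).Rel (eta k (letPar D)) 0 1 where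
  relN i := by
    change eta k (H := H) (letPar D) * (sg k _ • raiseL k (letPar D) _) =
      _ • ((sg k _ • raiseL k (letPar D) _) * eta k (letPar D))
    rw [zero_mul, sg_zero, one_smul, mul_smul_comm, eta_mul_raiseL rfl, smul_mul_assoc]
  relT i := by
    change eta k (H := H) (letPar D) * (sg k _ • raiseL k (letPar D) _ * grad k (letPar D)) =
      _ • ((sg k _ • raiseL k (letPar D) _ * grad k (letPar D)) * eta k (letPar D))
    rw [zero_mul, zero_add, smul_mul_assoc, mul_smul_comm, ← mul_assoc, eta_mul_raiseL rfl,
      mul_assoc, eta_mul_grad rfl, smul_mul_assoc, mul_assoc, grad_mul_eta, mul_smul_comm, smul_comm]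

theorem total_baseFam (hα : α ∈ gsDegree A 1) (hω : ∀ i, ω i ∈ gsDegree A (D i)) {Q : ℕ}
    (hQ : ∀ i, baseDeg D i + 1 ≤ Q) {p q : ℕ} {φ : GSObj A →ₗ[k] (Finset (Fin (n + 1)) → H)}
    (hφ : LocalAt φ p q) : (baseFam k H D α ω).total Q p φ =
      ∑ c : Unshuffle n, sg k (degSign fun i => D (c.first i)) •
        (raiseL k (letPar D) ((List.ofFn c.first).map Fin.succ) *
          grad k (letPar D) ^ (if p = 0 then 2 else 1) : Module.End k (Finset (Fin (n + 1)) → H))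
        (φ (twist (k := k) (bracket A) α c.1 fun i => ω (c.first i))) := by
  have h1 (c : Unshuffle n) : (List.ofFn fun i => some (c.first i)) = (List.ofFn c.first).map some := by
    rw [List.map_ofFn]; rfl
  refine (total_eq_sum super_baseFam (base_mem hα hω) baseOp_none rfl hQ hφ LinearMap.id
    (J := fun (c : Unshuffle n) i => some (c.first i)) (fun _ _ => Option.some_ne_none _)
    (fun c i j h => c.first_injective (Option.some_injective _ h)) (fun w r x h => ?_)
    fun c c' h => ?_).trans ?_
  · obtain ⟨K, hK⟩ := Function.ne_iff.1 h
    obtain ⟨c, hc⟩ := Unshuffle.exists_perm (exists_of_prod_baseOp_ne_zero hK).1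
    exact ⟨c, by rw [filter_eq_reduceOption, h1]; exact hc.map _⟩
  · rw [h1, h1, List.map_perm_map_iff (Option.some_injective _)] at h
    exact Unshuffle.eq_of_perm h
  · refine Finset.sum_congr rfl fun c _ => ?_
    rw [h1, prod_baseOp_some]
    rfl

theorem total_baseFam_univ (hα : α ∈ gsDegree A 1) (hω : ∀ i, ω i ∈ gsDegree A (D i)) {Q : ℕ}
    (hQ : ∀ i, baseDeg D i + 1 ≤ Q) {p q : ℕ} {φ : GSObj A →ₗ[k] H} (hφ : LocalAt (vacuum k (Fin (n + 1)) ∘ₗ φ) p q) :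
    (baseFam k H D α ω).total Q p (vacuum k (Fin (n + 1)) ∘ₗ φ) Finset.univ = 0 := by
  refine (total_eq_sum super_baseFam (base_mem hα hω) baseOp_none rfl hQ hφ
    (LinearMap.proj (R := k) (φ := fun _ => H) Finset.univ) (C := Empty) (m := Empty.elim)
    (J := fun c => c.elim) (fun c => c.elim) (fun c => c.elim) (fun w r x h => ?_)
    fun c => c.elim).trans (Finset.sum_empty)
  rw [LinearMap.comp_apply, grad_pow_vacuum] at h
  obtain ⟨-, K', h1, h2⟩ := exists_of_prod_baseOp_ne_zero h
  rw [vacuum_apply] at h1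
  split_ifs at h1 with h3
  · have h4 : (0 : Fin (n + 1)) ∈ (Finset.univ : Finset (Fin (n + 1))).val := Finset.mem_def.1 (Finset.mem_univ _)
    rw [h2, h3, Finset.empty_val, add_zero, Multiset.mem_coe, List.mem_map] at h4
    obtain ⟨i, -, hi⟩ := h4
    exact absurd hi (Fin.succ_ne_zero i)
  · exact absurd rfl h1

variable (k α ω D) in
/-- The values of the twisted operations, up to a sign. -/
noncomputable def inner (c : Unshuffle n) : GSObj A := sg k (degSign fun i => D (c.first i)) •
  twist (k := k) (bracket A) α c.1 fun i => ω (c.first i)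

variable (D) in
/-- The degrees of `α, ω₀, …, ω_{n-1}` and of the values of the twisted operations. -/
def mixDeg : Option (Fin n) ⊕ Unshuffle n → ℤ :=
  Sum.elim (baseDeg D) fun c => ∑ i, D (c.first i) + 2 - c.1.1

/-- The letters of `α, ω₀, …, ω_{n-1}` and of the values of the twisted operations. -/
def mixLet : Option (Fin n) ⊕ Unshuffle n → List (Fin (n + 1)) :=
  Sum.elim (baseLet Fin.succ) fun c => 0 :: (List.ofFn c.first).map Fin.succ

variable (D) in
/-- The signs of the operators. -/
def mixSign : Option (Fin n) ⊕ Unshuffle n → ZMod 2 :=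
  Sum.elim (fun i => i.elim 1 fun _ => 0) fun c => ((mixLet (Sum.inr c)).map (letPar D)).sum

theorem sum_letPar_first (c : Unshuffle n) : ((mixLet (Sum.inr c)).map (letPar D)).sum =
    1 + (∑ i, D (c.first i) : ℤ) + c.1.1 := by
  change (((0 : Fin (n + 1)) :: (List.ofFn c.first).map Fin.succ).map (letPar D)).sum = _
  rw [List.map_cons, List.sum_cons, List.map_map, List.map_ofFn, List.sum_ofFn]
  change 1 + ∑ i, shPar D (c.first i) = _
  simp only [shPar, Int.cast_add, Finset.sum_add_distrib, Int.cast_sum]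
  simp [add_assoc]

theorem super_mix : Super (mixDeg D) (letterOp k (H := H) (letPar D) (mixSign D) mixLet)
    (grad k (letPar D)) := by
  refine super_letterOp fun i => ?_
  rcases i with i | c
  · exact shPar_baseDeg (g := Fin.succ) (e := letPar D) (fun _ => rfl) i
  · rw [sum_letPar_first, shPar, mixDeg, Sum.elim_inr]
    push_cast
    linear_combination (1 - (c.1.1 : ZMod 2)) * two_eq_zero_zmod

end

/-! ## Words with a value of a twisted operation -/

section

variable {k : Type t} [Field k] [CharZero k] {𝒰 : Type u} [Category.{v} 𝒰]
  {A : LinQuiver.{u, v, w, w', t} k 𝒰} {H : Type*} [AddCommGroup H] [Module k H]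
  {n : ℕ} {D : Fin n → ℤ} {α : GSObj A} {ω : Fin n → GSObj A}

open Stacking

/-- The family of the elements and of the values of the twisted operations. -/
noncomputable def mixFam (k : Type t) [Field k] [CharZero k] {A : LinQuiver.{u, v, w, w', t} k 𝒰} (H : Type*)
    [AddCommGroup H] [Module k H] (D : Fin n → ℤ) (α : GSObj A) (ω : Fin n → GSObj A) :
    Family A (Finset (Fin (n + 1)) → H) (Option (Fin n) ⊕ Unshuffle n) :=
  fam (Sum.elim (base α ω) (inner k D α ω)) (mixDeg D) (letterOp k (letPar D) (mixSign D) mixLet)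
    (grad k (letPar D))

theorem mix_mem (hα : α ∈ gsDegree A 1) (hω : ∀ i, ω i ∈ gsDegree A (D i))
    (i : Option (Fin n) ⊕ Unshuffle n) :
    Sum.elim (base α ω) (inner k D α ω) i ∈ gsDegree A (mixDeg D i) := by
  rcases i with i | c
  · exact base_mem hα hω i
  · exact Submodule.smul_mem _ _ (twist_mem hα fun i => hω _)

theorem boxSum_composites (F : Family A (Finset (Fin (n + 1)) → H) (Option (Fin n)))
    (η : Module.End k (Finset (Fin (n + 1)) → H)) (Q p q : ℕ)
    {φ : GSObj A →ₗ[k] (Finset (Fin (n + 1)) → H)} (hφ : LocalAt φ p q) :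
    (∑ x ∈ (F.composites fun _ => Q).lab p, if (F.composites fun _ => Q).ar x p = some q then
      (F.ext (F.composites fun _ => Q) η).op (Sum.inr x) p (φ ((F.composites fun _ => Q).θ x)) else 0) =
    η (F.total Q p φ) := by
  rw [Family.sum_lab_composites, Family.total, map_sum]
  refine Finset.sum_congr rfl fun S _ => ?_
  rw [map_smul, show η (F.wordSum S.sizes _) = _ from F.map_wordSum η.toAddMonoidHom _ _,
    show sg k _ • F.wordSum S.sizes _ = _ from F.map_wordSum (DistribSMul.toAddMonoidHom _ (sg k _)) _ _]
  refine F.wordSum_congr _ fun w _ => ?_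
  have h2 : (F.ext (F.composites fun _ => Q) η).op (Sum.inr (p, ⟨S, w⟩)) p =
      η * (sg k (rootThin S + S.mSign p 0) • F.wordOp S.sizes w) := ite_self _
  rw [h2]
  by_cases hq : S.inputs = q
  · refine (if_pos (congrArg some hq)).trans ?_
    exact map_smul η _ _
  · have h3 : φ (S.fill (F.word w)) = 0 := hφ _ fun V X σ a _ => act_of_ne _ hq σ a
    refine (if_neg fun h => hq (Option.some_injective _ h)).trans ?_
    change 0 = sg k _ • η (F.wordOp S.sizes w (φ (S.fill (F.word w))))
    rw [h3, map_zero, map_zero, smul_zero]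

theorem boxSum_mixFam (hα : α ∈ gsDegree A 1) (hω : ∀ i, ω i ∈ gsDegree A (D i)) {Q : ℕ}
    (hQ : ∀ i, baseDeg D i + 1 ≤ Q) {p q : ℕ} {φ : GSObj A →ₗ[k] (Finset (Fin (n + 1)) → H)}
    (hφ : LocalAt φ p q) :
    ((baseFam k H D α ω).ext ((baseFam k H D α ω).composites fun _ => Q) (eta k (letPar D))).boxSum p q φ =
      (mixFam k H D α ω).boxSum p q φ := by
  refine (Finset.sum_disjSum _ _ _).trans (Eq.trans ?_ (Fintype.sum_sum_type _).symm)
  refine congrArg₂ (· + ·) rfl ?_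
  refine (boxSum_composites _ _ _ _ _ hφ).trans ?_
  rw [total_baseFam hα hω hQ hφ, map_sum]
  refine Finset.sum_congr rfl fun c _ => ?_
  have h1 : (mixFam k H D α ω).op (Sum.inr c) p = eta k (letPar D) *
      (raiseL k (letPar D) ((List.ofFn c.first).map Fin.succ) *
        grad k (letPar D) ^ (if p = 0 then 2 else 1)) := by
    have h2 := eta_mul_raiseL_mul_grad (k := k) (H := H) (e := letPar D) rfl
      ((List.ofFn c.first).map Fin.succ)
    by_cases hp : p = 0
    · rw [Family.op, if_pos hp, if_pos hp, pow_two, ← mul_assoc, ← mul_assoc, h2]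
      rfl
    · rw [Family.op, if_neg hp, if_neg hp, pow_one, ← mul_assoc, h2]
      rfl
  change _ = if (mixFam k H D α ω).ar (Sum.inr c) p = some q then
    (mixFam k H D α ω).op (Sum.inr c) p (φ (inner k D α ω c)) else 0
  rw [map_smul, h1, inner, map_smul, map_smul]
  by_cases h3 : (mixFam k H D α ω).ar (Sum.inr c) p = some q
  · rw [if_pos h3]
    rfl
  · have h4 : φ (twist (k := k) (bracket A) α c.1 fun i => ω (c.first i)) = 0 := hφ _ fun V X σ a hσ =>
      twist_mem hα (fun i => hω (c.first i)) q V X σ a fun h => h3 (ar_fam.2 (by rw [← hσ]; exact h))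
    rw [if_neg h3, h4, map_zero, map_zero, smul_zero]

/-- The letters of a term of the Jacobi identity. -/
def outer (c : Unshuffle n) : Fin (n - c.1 + 1) → Option (Fin n) ⊕ Unshuffle n :=
  Fin.cons (Sum.inr c) fun j => Sum.inl (some (c.rest j))

theorem ofFn_outer (c : Unshuffle n) :
    List.ofFn (outer c) = Sum.inr c :: (List.ofFn c.rest).map fun i => Sum.inl (some i) := by
  rw [List.ofFn_succ, List.map_ofFn]
  rfl

theorem outer_injective (c : Unshuffle n) : Function.Injective (outer c) := by
  refine Fin.cons_injective_iff.2 ⟨fun ⟨j, hj⟩ => Sum.inl_ne_inr hj, fun i j h => ?_⟩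
  exact c.rest_injective (Option.some_injective _ (Sum.inl_injective h))

theorem flatMap_mixLet_inl (l : List (Fin n)) :
    (l.map fun i => (Sum.inl (some i) : Option (Fin n) ⊕ Unshuffle n)).flatMap mixLet = l.map Fin.succ := by
  induction l with
  | nil => rfl
  | cons i l ih => rw [List.map_cons, List.flatMap_cons, ih]; rfl

theorem finRange_perm_univ : ((Finset.univ : Finset (Fin (n + 1))).val : Multiset (Fin (n + 1))) =
    ((0 :: (List.finRange n).map Fin.succ : List (Fin (n + 1))) : Multiset (Fin (n + 1))) := by
  rw [← List.finRange_succ]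
  rfl

theorem exists_outer {w : List (Option (Fin n) ⊕ Unshuffle n)}
    (h : (Finset.univ : Finset (Fin (n + 1))).val = (w.flatMap mixLet : List (Fin (n + 1)))) :
    ∃ c, (w.filter (· ≠ Sum.inl none)).Perm (List.ofFn (outer c)) := by
  have h1 : w.flatMap mixLet = (w.filter (· ≠ Sum.inl none)).flatMap mixLet := by
    clear h
    induction w with
    | nil => rfl
    | cons i w ih =>
      rw [List.flatMap_cons, List.filter_cons, ih]
      split_ifs with hi
      · rw [List.flatMap_cons]
      · obtain rfl : i = Sum.inl none := by simpa using hi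
        rfl
  rw [finRange_perm_univ, h1, Multiset.coe_eq_coe] at h
  have hw : ∀ i ∈ w.filter (· ≠ Sum.inl none), i ≠ Sum.inl none := fun i hi => by
    simpa using (List.mem_filter.1 hi).2
  generalize w.filter (· ≠ Sum.inl none) = w' at h hw
  obtain ⟨i, hi, h2⟩ := List.mem_flatMap.1 (h.subset List.mem_cons_self)
  rcases i with (_ | i) | c
  · exact absurd rfl (hw _ hi)
  · exact absurd (List.mem_singleton.1 h2) (Fin.succ_ne_zero i).symm
  obtain ⟨r, h3⟩ : ∃ r, w'.Perm (Sum.inr c :: r) := by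
    obtain ⟨a, b, rfl⟩ := List.append_of_mem hi
    exact ⟨a ++ b, List.perm_middle⟩
  have h4 : (mixLet (Sum.inr c) ++ r.flatMap mixLet).Perm
      (0 :: (List.finRange n).map Fin.succ) := by
    rw [← List.flatMap_cons]
    exact (h3.symm.flatMap_right _).trans h.symm
  have h5 : ((List.ofFn c.first).map Fin.succ ++ r.flatMap mixLet).Perm
      ((List.finRange n).map Fin.succ) := (List.perm_cons _).1 h4
  have h6 : ∀ i ∈ r, ∃ j, Sum.inl (some j) = i := fun i hi' => by
    rcases i with (_ | i) | c'
    · exact absurd rfl (hw _ (h3.symm.subset (List.mem_cons_of_mem _ hi')))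
    · exact ⟨i, rfl⟩
    · obtain ⟨j, -, hj⟩ := List.mem_map.1 (h5.subset (List.mem_append_right _
        (List.mem_flatMap.2 ⟨_, hi', List.mem_cons_self⟩)))
      exact absurd hj (Fin.succ_ne_zero j)
  obtain ⟨l, hl⟩ : ∃ l : List (Fin n), l.map (fun i => Sum.inl (some i)) = r := by
    clear * - h6
    induction r with
    | nil => exact ⟨[], rfl⟩
    | cons i w ih =>
      obtain ⟨j, rfl⟩ := h6 i List.mem_cons_self
      obtain ⟨l, rfl⟩ := ih fun i hi => h6 i (List.mem_cons_of_mem _ hi)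
      exact ⟨j :: l, rfl⟩
  refine ⟨c, h3.trans ?_⟩
  rw [ofFn_outer]
  refine List.Perm.cons _ ?_
  rw [← hl]
  refine List.Perm.map _ ?_
  rw [← hl, flatMap_mixLet_inl, ← List.map_append,
    List.map_perm_map_iff (Fin.succ_injective n)] at h5
  exact (List.perm_append_left_iff _).1 (h5.trans c.perm_finRange.symm)

theorem flatMap_outer (c : Unshuffle n) :
    (List.ofFn (outer c)).flatMap mixLet = 0 :: (List.ofFn c.2.1).map Fin.succ := by
  rw [ofFn_outer, List.flatMap_cons, flatMap_mixLet_inl, Unshuffle.ofFn_eq, List.map_append]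
  rfl

theorem kz_map {κ κ' : Type*} [LinearOrder κ] [LinearOrder κ'] (e : κ' → ZMod 2) {g : κ → κ'}
    (hg : StrictMono g) (l : List κ) : kz e (l.map g) = kz (fun i => e (g i)) l := by
  induction l with
  | nil => rfl
  | cons i l ih =>
    rw [List.map_cons, kz, kz, ih, List.filter_map, List.map_map]
    simp only [Function.comp_def, hg.lt_iff_lt]

theorem kz_flatMap_outer (c : Unshuffle n) :
    kz (letPar D) ((List.ofFn (outer c)).flatMap mixLet) = kz (shPar D) (List.ofFn c.2.1) := by
  rw [flatMap_outer, kz, kz_map _ Fin.strictMono_succ]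
  simp only [Fin.not_lt_zero, decide_false, List.filter_false, List.map_nil, List.sum_nil, mul_zero, zero_add]
  rfl

end

/-! ## The twisted operations form an `L∞`-algebra -/

section

variable {k : Type t} [Field k] [CharZero k] {𝒰 : Type u} [Category.{v} 𝒰]
  {A : LinQuiver.{u, v, w, w', t} k 𝒰} {n : ℕ} {D : Fin n → ℤ} {α : GSObj A} {ω : Fin n → GSObj A}

open Stacking

theorem prod_outer {H : Type*} [AddCommGroup H] [Module k H] (c : Unshuffle n) (y : H) (r : ℕ) :
    (((List.ofFn (outer c)).map (letterOp k (letPar D) (mixSign D) mixLet)).prod *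
      grad k (letPar D) ^ r : Module.End k (Finset (Fin (n + 1)) → H)) (vacuum k _ y) Finset.univ =
    sg k (1 + (∑ i, D (c.first i) : ℤ) + c.1.1 + kz (shPar D) (List.ofFn c.2.1)) • y := by
  have h1 : (Finset.univ : Finset (Fin (n + 1))).val = ((List.ofFn (outer c)).flatMap mixLet : List _) := by
    rw [finRange_perm_univ, flatMap_outer, Multiset.coe_eq_coe]
    refine List.Perm.cons _ (List.Perm.map _ ?_)
    rw [Unshuffle.ofFn_eq]
    exact c.perm_finRange.symm
  have h2 : ((List.ofFn (outer c)).map (mixSign D)).sum = 1 + (∑ i, D (c.first i) : ℤ) + c.1.1 := by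
    rw [ofFn_outer, List.map_cons, List.sum_cons, List.map_map, List.sum_eq_zero, add_zero]
    · exact sum_letPar_first c
    · intro x hx
      obtain ⟨i, -, rfl⟩ := List.mem_map.1 hx
      rfl
  rw [Module.End.mul_apply, grad_pow_vacuum, prod_letterOp, LinearMap.smul_apply, Pi.smul_apply,
    raiseL_vacuum _ h1, sg_smul_smul, h2, kz_flatMap_outer]

theorem gsObj_eq_zero {θ : GSObj A} (h : ∀ (q : ℕ) (V X : 𝒰) (σ : Simp V X) (a : Fin (q + 1) → A.Ob X)
    (x : ∀ i : Fin q, A.Hom (a i.castSucc) (a i.succ)), evalAt q σ a x θ = 0) : θ = 0 := by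
  funext q V X σ a
  exact MultilinearMap.ext fun x => h q V X σ a x

/-- The Jacobi identity, with a value of a twisted operation as an additional letter. -/
theorem sum_outer (hα : α ∈ gsDegree A 1) (hω : ∀ i, ω i ∈ gsDegree A (D i)) :
    ∑ c : Unshuffle n, sg k (degSign (fun i => mixDeg D (outer c i)) +
      (1 + (∑ i, D (c.first i) : ℤ) + c.1.1 + kz (shPar D) (List.ofFn c.2.1))) •
        twist (k := k) (bracket A) α (n - c.1 + 1)
          (fun i => Sum.elim (base α ω) (inner k D α ω) (outer c i)) = 0 := by
  refine gsObj_eq_zero fun q V X σ a x => ?_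
  let H := A.Hom (A.lower σ (a 0)) (A.upper σ (a (Fin.last q)))
  have hφ : LocalAt (vacuum k (Fin (n + 1)) ∘ₗ evalAt q σ a x) σ.length q := localAt_evalAt q σ a x _
  obtain ⟨Q, hQ⟩ := exists_natBound (Fin.cons 1 D : Fin (n + 1) → ℤ)
  have hQ : ∀ i, baseDeg D i + 1 ≤ Q := fun i => by
    cases i with
    | none => exact hQ 0
    | some i => exact hQ i.succ
  have hs := super_baseFam (k := k) (H := H) (D := D)
  obtain ⟨R, hR⟩ := ((baseFam k H D α ω).ext ((baseFam k H D α ω).composites fun _ => Q)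
    (eta k (letPar D))).exists_bounded σ.length
  let Q' : ℕ := R + ∑ i : Option (Fin n) ⊕ Unshuffle n, (mixDeg D i + 1).toNat
  have hQ' : ∀ i, mixDeg D i + 1 ≤ Q' := fun i => by
    have := Finset.single_le_sum (f := fun i => (mixDeg D i + 1).toNat) (fun _ _ => Nat.zero_le _)
      (Finset.mem_univ i)
    simp only [Q']
    omega
  have h1 := (baseFam k H D α ω).total_ext σ a x (vacuum k (Fin (n + 1)))
    (Family.deform_composites (Q := fun _ => Q) (rels_fam hs) (eta_mul_eta rfl) rel_baseFam)
    (Family.collects_composites par_fam fun p => bounded_fam hQ p) (Family.par_composites _)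
    (bounded_fam hQ σ.length) (Q' := Q') fun p hp i hi q h => (hR p hp i hi q h).trans (Nat.le_add_right _ _)
  have h2 : ((baseFam k H D α ω).ext ((baseFam k H D α ω).composites fun _ => Q)
      (eta k (letPar D))).total Q' σ.length (vacuum k (Fin (n + 1)) ∘ₗ evalAt q σ a x) =
      (mixFam k H D α ω).total Q' σ.length (vacuum k (Fin (n + 1)) ∘ₗ evalAt q σ a x) := by
    refine Finset.sum_congr rfl fun S hS => congrArg _ ?_
    simp only [Family.word_eq_seq]
    exact Family.wordSum_exchange (fun b _ φ hφ => boxSum_mixFam hα hω hQ hφ)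
      (Φ := fun l => (vacuum k (Fin (n + 1)) ∘ₗ evalAt q σ a x) (S.fill (seq l)))
      (multiAt_fill (tq_of_mem_quad hS).gs (tq_of_mem_quad hS).adm hφ)
  have h3 := congrFun (h2.symm.trans h1) Finset.univ
  rw [total_baseFam_univ hα hω hQ hφ] at h3
  have h4 := total_eq_sum (super_mix (k := k) (H := H) (D := D)) (mix_mem hα hω) (o := Sum.inl none)
    (baseOp_none (g := Fin.succ)) rfl hQ' hφ (LinearMap.proj (R := k) (φ := fun _ => H) Finset.univ) (J := outer)
    (fun c i => by
      rw [outer]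
      cases i using Fin.cases with
      | zero => exact Sum.inr_ne_inl
      | succ i => exact fun h => Option.some_ne_none _ (Sum.inl_injective h)) outer_injective
    (fun w r y h => by
      rw [LinearMap.comp_apply, grad_pow_vacuum, prod_letterOp] at h
      exact exists_outer (perm_of_raiseL_vacuum_ne_zero _ (right_ne_zero_of_smul (a := sg k _) h)))
    (fun c c' h => by
      rw [ofFn_outer, ofFn_outer] at h
      rcases List.mem_cons.1 (h.subset List.mem_cons_self) with h | h
      · exact Sum.inr_injective h
      · obtain ⟨i, -, hi⟩ := List.mem_map.1 h
        exact absurd hi Sum.inl_ne_inr)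
  rw [map_sum]
  refine Eq.trans (Finset.sum_congr rfl fun c _ => ?_) (h4.symm.trans h3)
  rw [map_smul, sg_add, mul_smul]
  exact congrArg (fun y => sg k _ • y) (prod_outer c _ _).symm

theorem twist_smul (hα : α ∈ gsDegree A 1) (hω : ∀ i, ω i ∈ gsDegree A (D i)) (i : Fin n)
    {z : GSObj A} (hz : z ∈ gsDegree A (D i)) (c : k) :
    twist (k := k) (bracket A) α n (Function.update ω i (c • z)) =
      c • twist (k := k) (bracket A) α n (Function.update ω i z) := by
  have := twist_slot hα hω i hz hz (c - 1)
  rwa [sub_smul, one_smul, add_sub_cancel, sub_smul, one_smul, add_sub_cancel] at this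

theorem degSign_outer (c : Unshuffle n) :
    degSign (fun i => mixDeg D (outer c i)) + (1 + (∑ i, D (c.first i) : ℤ) + c.1.1 +
      kz (shPar D) (List.ofFn c.2.1)) + degSign (fun i => D (c.first i)) =
    (n + n * (∑ i, D i : ℤ) + ∑ i : Fin n, (i.val : ZMod 2) * (D i : ℤ)) + ((((n - c.1 : ℕ) : ℤ) * c.1 : ℤ) +
      (kz (shPar D) (List.ofFn c.2.1) + ∑ i : Fin n, (i.val : ZMod 2) * (D (c.2.1 i) : ℤ) +
        ∑ i : Fin n, (i.val : ZMod 2) * (D i : ℤ))) := by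
  have hn : c.1.1 + (n - c.1) = n := Nat.add_sub_cancel' (Nat.le_of_lt_succ c.1.2)
  have hcast : (n : ZMod 2) = c.1.1 + (n - c.1 : ℕ) := by rw [← Nat.cast_add, hn]
  have h1 {N : Type} [AddCommMonoid N] (f : Fin n → N) : ∑ i, f i =
      ∑ i : Fin c.1.1, f ⟨i, i.2.trans_le (Nat.le_of_lt_succ c.1.2)⟩ +
        ∑ j : Fin (n - c.1), f ⟨c.1 + j, Nat.add_lt_of_lt_sub' j.2⟩ := by
    rw [← (finCongr hn).sum_comp, Fin.sum_univ_add]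
    rfl
  have h2 : ((∑ i, D i : ℤ) : ZMod 2) = ∑ i, (D (c.first i) : ZMod 2) + ∑ j, (D (c.rest j) : ZMod 2) := by
    rw [← Equiv.sum_comp c.2.1 D, h1 fun i => D (c.2.1 i)]
    push_cast
    rfl
  have h3 : ∑ i : Fin n, (i.val : ZMod 2) * (D (c.2.1 i) : ℤ) =
      ∑ i, (i.val : ZMod 2) * (D (c.first i) : ZMod 2) +
        (c.1.1 * ∑ j, (D (c.rest j) : ZMod 2) + ∑ j, (j.val : ZMod 2) * (D (c.rest j) : ZMod 2)) := by
    rw [h1, Finset.mul_sum, ← Finset.sum_add_distrib]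
    refine congrArg₂ _ rfl (Finset.sum_congr rfl fun j _ => ?_)
    push_cast
    rw [add_mul]
    rfl
  rw [h2, h3, degSign, degSign, Fin.sum_univ_succ, Fin.sum_univ_succ, hcast]
  simp only [outer, Fin.cons_zero, Fin.cons_succ, mixDeg, Sum.elim_inr, Sum.elim_inl, baseDeg,
    Option.elim_some, Fin.val_zero, Fin.val_succ]
  push_cast
  simp only [add_mul, one_mul, Finset.sum_add_distrib]
  generalize ((n - c.1 : ℕ) : ZMod 2) = m
  generalize (c.1.1 : ZMod 2) = l
  generalize ∑ i, (D (c.first i) : ZMod 2) = P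
  generalize ∑ j, (D (c.rest j) : ZMod 2) = R
  generalize kz (shPar D) (List.ofFn c.2.1) = K
  generalize ∑ i, (i.val : ZMod 2) * (D (c.first i) : ZMod 2) = x
  generalize ∑ j, (j.val : ZMod 2) * (D (c.rest j) : ZMod 2) = y
  generalize ∑ i, (i.val : ZMod 2) * (D i : ZMod 2) = z
  linear_combination (2 + P - l * R - l * m + R + m - z) * two_eq_zero_zmod

/-- The Jacobi identities with the terms of the twisted operation without arguments. -/
theorem jacobi_twist (hα : α ∈ gsDegree A 1) (hω : ∀ i, ω i ∈ gsDegree A (D i)) :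
    ∑ c : Unshuffle n, ((((n - c.1 : ℕ) : ℤ) * c.1.1).negOnePow * Equiv.Perm.sign c.2.1 *
      koszul c.2.1 fun i => D (c.2.1 i)) • twist (k := k) (bracket A) α (n - c.1 + 1)
        (Fin.cons (twist (k := k) (bracket A) α c.1 fun i => ω (c.first i)) fun j => ω (c.rest j)) = 0 := by
  have h1 := congrArg (fun y => sg k (n + n * (∑ i, D i : ℤ) +
    ∑ i : Fin n, (i.val : ZMod 2) * (D i : ℤ)) • y) (sum_outer hα hω)
  simp only [smul_zero, Finset.smul_sum] at h1
  refine Eq.trans (Finset.sum_congr rfl fun c _ => ?_) h1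
  have h2 : (fun i => Sum.elim (base α ω) (inner k D α ω) (outer c i)) =
      Function.update (fun i => Sum.elim (base α ω) (inner k D α ω) (outer c i)) 0
        (sg k (degSign fun i => D (c.first i)) • twist (k := k) (bracket A) α c.1 fun i => ω (c.first i)) :=
    (Function.update_eq_self _ _).symm
  have h3 : Function.update (fun i => Sum.elim (base α ω) (inner k D α ω) (outer c i)) 0
      (twist (k := k) (bracket A) α c.1 fun i => ω (c.first i)) =
      Fin.cons (twist (k := k) (bracket A) α c.1 fun i => ω (c.first i)) fun j => ω (c.rest j) := by
    funext i
    cases i using Fin.cases <;> rfl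
  rw [h2, twist_smul hα (fun i => mix_mem hα hω _) 0 (twist_mem hα fun i => hω (c.first i)), h3,
    mul_assoc, mul_smul, negOnePow_smul (k := k), sign_mul_koszul (k := k), sg_smul_smul, sg_smul_smul,
    sg_smul_smul]
  congr 2
  have h4 := degSign_outer (D := D) c
  rw [show shPar D = fun i => ((D i + 1 : ℤ) : ZMod 2) from rfl] at h4 ⊢
  linear_combination (-1) * h4 - ((n : ZMod 2) + n * (∑ i, D i : ℤ) +
    ∑ i : Fin n, (i.val : ZMod 2) * (D i : ℤ)) * two_eq_zero_zmod
theorem twist_cons_zero (hα : α ∈ gsDegree A 1) (hω : ∀ i, ω i ∈ gsDegree A (D i)) :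
    twist (k := k) (bracket A) α (n + 1) (Fin.cons 0 ω) = 0 := by
  have h1 : ∀ i, (Fin.cons 0 ω : Fin (n + 1) → GSObj A) i ∈ gsDegree A
      ((Fin.cons 0 D : Fin (n + 1) → ℤ) i) := fun i => by
    cases i using Fin.cases with
    | zero => exact Submodule.zero_mem _
    | succ i => exact hω i
  have h2 := twist_smul (k := k) hα h1 0 (Submodule.zero_mem _) 0
  rw [zero_smul, zero_smul] at h2
  rwa [show Function.update (Fin.cons 0 ω : Fin (n + 1) → GSObj A) 0 0 = Fin.cons 0 ω from
    Function.update_eq_self (f := (Fin.cons 0 ω : Fin (n + 1) → GSObj A)) 0] at h2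

/-- The twisted operations form an `L∞`-algebra if the twisting element satisfies the Maurer-Cartan
equation. -/
theorem isLInfinityAlgebra_twist (hα : α ∈ gsDegree A 1)
    (h0 : ∀ x : Fin 0 → GSObj A, twist (k := k) (bracket A) α 0 x = 0) :
    IsLInfinityAlgebra (gsDegree A) (twist (k := k) (bracket A) α) where
  map_add n _ d x hx i y hy z hz := by
    have := twist_slot (k := k) hα hx i hy hz 1
    rwa [one_smul, one_smul] at this
  map_smul n _ d x hx i c y hy := twist_smul hα hx i hy c
  degree n _ d x hx := twist_mem hα hx
  antisymm n _ d x hx π := twist_perm hα hx π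
  jacobi n _ d x hx := by
    have h1 := jacobi_twist hα hx
    rw [Unshuffle.sum_eq] at h1
    · refine Eq.trans (Finset.sum_congr rfl fun l _ => ?_) h1
      exact Finset.sum_subtype _ (fun π => by simp) _
    · intro c hc
      have h2 : ∀ l, l = 0 → ∀ y : Fin l → GSObj A, twist (k := k) (bracket A) α l y = 0 := by
        rintro _ rfl
        exact h0
      rw [h2 _ (congrArg Fin.val hc), twist_cons_zero hα fun j => hx _, smul_zero]

end

/-! ## The curvature of lax data -/

section

variable {k : Type t} [Field k] [CharZero k] {𝒰 : Type u} [Category.{v} 𝒰]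
  {A : LinQuiver.{u, v, w, w', t} k 𝒰} {M : Type*} [AddCommGroup M] [Module k M] (β : LaxData A)

open Stacking Simp

theorem toGS_mem : β.toGS ∈ gsDegree A 1 := by
  intro q V X σ a h
  rcases σ with _ | ⟨f, _ | ⟨g, _ | ⟨g', σ⟩⟩⟩ <;> rcases q with _ | _ | _ | q <;>
    first
    | rfl
    | exact absurd rfl h

/-- The family of a single element of degree `1`. -/
def unitFam (M : Type*) [AddCommGroup M] [Module k M] : Family A M Unit :=
  fam (fun _ => β.toGS) (fun _ => 1) (fun _ => -1) 1

theorem evalAt_twist_zero {q : ℕ} {V X : 𝒰} (σ : Simp V X) (a : Fin (q + 1) → A.Ob X)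
    (x : ∀ i : Fin q, A.Hom (a i.castSucc) (a i.succ)) (y : Fin 0 → GSObj A) :
    evalAt q σ a x (twist (k := k) (bracket A) β.toGS 0 y) =
      (unitFam β _).total 2 σ.length (LinearMap.id ∘ₗ evalAt q σ a x) := by
  obtain rfl : y = fun _ => β.toGS := Subsingleton.elim _ _
  have hs : Super (fun _ : Unit => 1) (fun _ => (-1 : Module.End k
      (A.Hom (A.lower σ (a 0)) (A.upper σ (a (Fin.last q)))))) 1 := by
    have h0 : ((1 + 1 : ℤ) : ZMod 2) = 0 := by decide
    refine ⟨fun _ _ => ?_, fun _ => ?_, one_mul 1⟩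
    · rw [shPar, h0, zero_mul, sg_zero, one_smul]
    · rw [shPar, h0, sg_zero, one_smul, mul_one, one_mul]
  have h := total_eq_sum hs (θ := fun _ => β.toGS) (fun _ => toGS_mem β) (o := ()) rfl rfl (Q := 2)
    (fun _ => le_rfl) (localAt_evalAt q σ a x LinearMap.id) LinearMap.id (C := Unit) (m := fun _ => 0)
    (J := fun _ => Fin.elim0) (fun _ i => i.elim0) (fun _ i => i.elim0)
    (fun w _ _ _ => ⟨(), by simp⟩) fun _ _ _ => rfl
  rw [LinearMap.id_apply] at h
  rw [unitFam, h, Fintype.sum_unique, one_pow, mul_one]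
  simp [degSign]

variable {W : 𝒰} {St : Type*} {obj : St → A.Ob W} {par : St → ZMod 2}

theorem boxN_unit {V : 𝒰} {σ : Simp V W} {q : ℕ} (h : σ.length + q = 2) (C : ℕ → WTr A W St M) (κ s) :
    (unitFam β M).boxN obj par σ C κ s =
      -C q (fun s' l => κ s' (appL β.toGS σ (obj s) l)) s := by
  rw [boxN_apply]
  change ∑ i : Unit, _ = _
  rw [Fintype.sum_unique, show (unitFam β M).ar () σ.length = some q from ar_fam.2 (by omega)]
  change sg k (0 * par s) • (-_ : M) = _
  rw [zero_mul, sg_zero, one_smul]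
  rfl

theorem boxN_unit_zero {V : 𝒰} {σ : Simp V W} (h : 2 < σ.length) (C : ℕ → WTr A W St M) (κ s) :
    (unitFam β M).boxN obj par σ C κ s = 0 := by
  rw [boxN_apply]
  change ∑ i : Unit, _ = _
  rw [Fintype.sum_unique, show (unitFam β M).ar () σ.length = none from
    if_neg (by change ¬ (_ ≤ (1 : ℤ) + 1); omega)]
  rfl

theorem boxT_unit (C : ℕ → WTr A W St M) (κ s) : (unitFam β M).boxT obj par C κ s =
    -(sg k (par s) • C 2 (fun s' l => κ s' (appL β.toGS (nil W) (obj s) l)) s) := by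
  rw [boxT_apply]
  change ∑ i : Unit, _ = _
  rw [Fintype.sum_unique, show (unitFam β M).ar () 0 = some 2 from ar_fam.2 rfl]
  change sg k ((0 + 1) * par s) • (-_ : M) = _
  rw [zero_add, one_mul, smul_neg]
  rfl

theorem appL_m (b b' b'' : A.Ob W) (y y' : HH A W) :
    appL β.toGS (nil W) b [(y, b'), (y', b'')] = emb (β.m b b' b'' (y b b') (y' b' b'')) := rfl

theorem appL_f {V : 𝒰} (f : V ⟶ W) (b b' : A.Ob W) (y : HH A W) :
    appL β.toGS (cons f (nil W)) b [(y, b')] = emb (β.f f b b' (y b b')) := rfl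

theorem appL_c {V V' : 𝒰} (h : V ⟶ V') (g : V' ⟶ W) (b : A.Ob W) :
    appL β.toGS (cons h (cons g (nil W))) b [] = emb (β.c h g b) := rfl

variable {b : ULift.{max u v} ℕ → A.Ob W} {y : ℕ → HH A W} {V V' V'' : 𝒰}
  {par : ULift.{max u v} ℕ → ZMod 2}

theorem Z_unit_one (f : V ⟶ W) (κ) (s : ULift.{max u v} ℕ) :
    (unitFam β M).Z b par (letters y) V κ (cons f (nil W), s) =
      -κ (cons f (nil W), ⟨s.down + 1⟩) (emb (β.f f (b s) (b ⟨s.down + 1⟩) (y s.down _ _))) := by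
  rw [Z_eq, leaf_cons, zero_add, Family.recB_apply]
  exact boxN_unit β (q := 1) rfl _ _ _

theorem Z_unit_two (h : V ⟶ V') (g : V' ⟶ W) (κ) (s : ULift.{max u v} ℕ) :
    (unitFam β M).Z b par (letters y) V κ (cons h (cons g (nil W)), s) =
      κ (cons h (cons g (nil W)), ⟨s.down + 1⟩) (emb (β.f h _ _ (β.f g (b s) (b ⟨s.down + 1⟩) (y s.down _ _)))) -
        κ (cons (h ≫ g) (nil W), s) (emb (β.c h g (b s))) := by
  rw [Z_eq, leaf_cons, zero_add, Family.recB_apply]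
  refine (congrArg₂ (· + ·) (boxN_unit β (q := 1) rfl _ _ _) (boxN_unit β (q := 0) rfl _ _ _)).trans ?_
  rw [sub_eq_add_neg]
  refine congrArg₂ (· + ·) ((congrArg Neg.neg (Z_unit_one β g _ s)).trans ((neg_neg _).trans ?_)) rfl
  refine congrArg (κ (cons h (cons g (nil W)), ⟨s.down + 1⟩)) ((appL_f β h _ _ _).trans ?_)
  exact congrArg (fun z => emb (β.f h _ _ z)) (emb_apply _)

theorem Z_unit_three (e : V ⟶ V') (h : V' ⟶ V'') (g : V'' ⟶ W) (κ) (s : ULift.{max u v} ℕ) :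
    (unitFam β M).Z b par (letters y) V κ (cons e (cons h (cons g (nil W))), s) =
      -(unitFam β M).Z b par (letters y) V' (fun p z => κ (cons e p.1, p.2) (emb (β.f e (A.res h (A.res g (b s))) (lev b V' p) (z _ _)))) (cons h (cons g (nil W)), s) -
        κ (cons (e ≫ h) (cons g (nil W)), s) (emb (β.c e h (A.res g (b s)))) := by
  rw [Z_eq, leaf_cons, zero_add, Family.recB_apply]
  refine (congrArg₂ (· + ·) (boxN_unit β (q := 1) rfl _ _ _) (congrArg₂ (· + ·)
    (boxN_unit β (q := 0) rfl _ _ _) (boxN_unit_zero β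
      (σ := cons e (cons h (cons g (nil W)))) (Nat.lt_succ_self 2) _ _ _))).trans ?_
  rw [add_zero, sub_eq_add_neg]
  rfl

theorem letters_apply (κ : ULift.{max u v} ℕ → HH A W → M) (s) :
    letters y κ s = κ ⟨s.down + 1⟩ (y s.down) := rfl

theorem nilT_apply (κ : St → Word A W → M) (s) : nilT κ s = κ s [] := rfl

theorem sg_two : sg k ((2 : ℕ) : ZMod 2) = 1 := if_pos (by decide)

theorem sg_three : sg k ((3 : ℕ) : ZMod 2) = -1 := if_neg (by decide)

theorem QT_unit (κ : ULift.{max u v} ℕ → HH A W → M) :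
    (unitFam β M).QT b (fun s => s.down) (letters y) κ ⟨0⟩ =
      κ ⟨3⟩ (emb (β.m _ (b ⟨1⟩) (b ⟨3⟩) (y 0 (b ⟨0⟩) _) (β.m _ (b ⟨2⟩) _ (y 1 _ _) (y 2 _ _)))) -
        κ ⟨3⟩ (emb (β.m _ (b ⟨2⟩) (b ⟨3⟩) (β.m (b ⟨0⟩) (b ⟨1⟩) _ (y 0 _ _) (y 1 _ _)) (y 2 _ _))) := by
  rw [Family.QT, Family.ttHat]
  simp only [Family.tHat, boxT_unit, dchain, chain, LinearMap.add_apply, Pi.add_apply, bindT_apply,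
    letters_apply, nilT_apply, appL_m, emb_apply, LinearMap.zero_apply, Pi.zero_apply]
  dsimp only [lev, LinQuiver.lower, Nat.reduceAdd]
  simp only [Nat.cast_zero, Nat.cast_one, sg_zero, sg_one, one_smul, neg_smul, neg_neg, add_zero, neg_add_rev,
    sub_eq_add_neg]
  exact add_comm _ _

theorem QN_unit_one (f : V ⟶ W) (κ : ULift.{max u v} ℕ → HH A V → M) :
    (unitFam β M).QN b (fun s => s.down) (letters y) (cons f (nil W)) κ ⟨0⟩ =
      κ ⟨2⟩ (emb (β.f f _ _ (β.m (b ⟨0⟩) (b ⟨1⟩) (b ⟨2⟩) (y 0 _ _) (y 1 _ _)))) -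
        κ ⟨2⟩ (emb (β.m _ _ _ (β.f f (b ⟨0⟩) (b ⟨1⟩) (y 0 _ _)) (β.f f (b ⟨1⟩) (b ⟨2⟩) (y 1 _ _)))) := by
  rw [Family.QN, boxN_unit β (q := 1) rfl]
  simp only [Family.tHat, boxT_unit, dchain, chain, LinearMap.add_apply, Pi.add_apply, bindT_apply, Z_unit_one,
    letters_apply, nilT_apply, appL_m, appL_f, emb_apply, LinearMap.zero_apply, Pi.zero_apply, lpar, length]
  dsimp only [lev, LinQuiver.lower, Nat.reduceAdd]
  simp only [emb_apply, Nat.cast_zero, Nat.cast_one, sg_zero, sg_one, one_smul, neg_smul, neg_neg, add_zero, if_true,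
    sub_eq_add_neg]
  rfl

theorem QN_unit_two (h : V ⟶ V') (g : V' ⟶ W) (κ : ULift.{max u v} ℕ → HH A V → M) :
    (unitFam β M).QN b (fun s => s.down) (letters y) (cons h (cons g (nil W))) κ ⟨0⟩ =
      κ ⟨1⟩ (emb (β.m _ _ _ (β.c h g (b ⟨0⟩)) (β.f (h ≫ g) _ (b ⟨1⟩) (y 0 _ _)))) -
      κ ⟨1⟩ (emb (β.m _ _ _ (β.f h _ _ (β.f g (b ⟨0⟩) (b ⟨1⟩) (y 0 _ _))) (β.c h g (b ⟨1⟩)))) := by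
  rw [Family.QN, boxN_unit β (q := 0) rfl]
  simp only [Family.tHat, boxT_unit, dchain, chain, bindT_apply, Z_unit_one, Z_unit_two,
    nilT_apply, appL_m, LinearMap.zero_apply, Pi.zero_apply, lpar, length]
  dsimp only [lev, LinQuiver.lower, Nat.reduceAdd]
  simp only [emb_apply, sg_two, Nat.cast_zero, neg_zero, zero_add, one_smul, neg_neg, add_zero, if_true,
    sub_eq_add_neg, Nat.reduceEqDiff, if_false]
  exact add_comm _ _

theorem QN_unit_three (e : V ⟶ V') (h : V' ⟶ V'') (g : V'' ⟶ W) (κ : ULift.{max u v} ℕ → HH A V → M)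
    (hκ : ∀ n z, κ ⟨n + 1⟩ z = 0) :
    (unitFam β M).QN b (fun s => s.down) (letters y) (cons e (cons h (cons g (nil W)))) κ ⟨0⟩ =
      κ ⟨0⟩ (emb (β.m _ _ _ (β.f e _ _ (β.c h g (b ⟨0⟩))) (β.c e (h ≫ g) (b ⟨0⟩)))) -
      κ ⟨0⟩ (emb (β.m _ _ _ (β.c e h (A.res g (b ⟨0⟩))) (β.c (e ≫ h) g (b ⟨0⟩)))) := by
  rw [Family.QN, boxN_unit_zero β (σ := cons e (cons h (cons g (nil W)))) (Nat.lt_succ_self 2)]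
  simp only [Family.tHat, boxT_unit, chain, bindT_apply, Z_unit_two, Z_unit_three,
    nilT_apply, appL_m, lpar, length, hκ]
  dsimp only [lev, LinQuiver.lower, Nat.reduceAdd]
  simp only [emb_apply, sg_three, Nat.cast_zero, neg_zero, zero_add, one_smul, neg_neg, add_zero, if_true,
    sub_eq_add_neg, Nat.reduceEqDiff, if_false, neg_smul]
  rw [neg_add, neg_neg]
  exact congrArg₂ (· + ·) (congrArg (fun z => κ ⟨0⟩ (emb (β.m _ _ _ z _))) (emb_apply _)) rfl

end

section

variable {k : Type t} [Field k] [CharZero k] {𝒰 : Type u} [Category.{v} 𝒰]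
  {A : LinQuiver.{u, v, w, w', t} k 𝒰} (β : LaxData A) {V V' V'' X : 𝒰} (y : Fin 0 → GSObj A)

open Stacking Simp

theorem evalAt_twist_nil {q : ℕ} (a : Fin (q + 1) → A.Ob X) (x : ∀ i : Fin q, A.Hom (a i.castSucc) (a i.succ)) :
    evalAt q (nil X) a x (twist (k := k) (bracket A) β.toGS 0 y) =
      (unitFam β (A.Hom (A.lower (nil X) (a 0)) (A.upper (nil X) (a (Fin.last q))))).QT (fun s : ULift.{max u v} ℕ => Family.vertex a s.down)
        (fun s => s.down) (letters (Family.arrow a x)) (fun s z => if s.down = q then z (a 0) (a (Fin.last q)) else 0) ⟨0⟩ :=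
  (evalAt_twist_zero β (nil X) a x y).trans
    ((unitFam β (A.Hom (A.lower (nil X) (a 0)) (A.upper (nil X) (a (Fin.last q))))).total_eq_QT (P := 0) a x par_fam (bounded_fam (fun _ => le_rfl) _)
      LinearMap.id)

theorem evalAt_twist_cons {q : ℕ} (f : V ⟶ V') (τ : Simp V' X) (a : Fin (q + 1) → A.Ob X)
    (x : ∀ i : Fin q, A.Hom (a i.castSucc) (a i.succ)) :
    evalAt q (cons f τ) a x (twist (k := k) (bracket A) β.toGS 0 y) =
      (unitFam β _).QN (fun s : ULift.{max u v} ℕ => Family.vertex a s.down) (fun s => s.down) (letters (Family.arrow a x)) (cons f τ)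
        (fun s z => if s.down = q then z (A.lower (cons f τ) (a 0)) (A.upper (cons f τ) (a (Fin.last q))) else 0) ⟨0⟩ :=
  (evalAt_twist_zero β (cons f τ) a x y).trans
    ((unitFam β _).total_eq_QN (cons f τ) a x LinearMap.id par_fam (Nat.succ_pos _) (bounded_fam (fun _ => le_rfl) _))

theorem curvature_nil (a : Fin 4 → A.Ob X) (x : ∀ i : Fin 3, A.Hom (a i.castSucc) (a i.succ)) :
    evalAt 3 (nil X) a x (twist (k := k) (bracket A) β.toGS 0 y) =
      β.m (a 0) (a 1) (a 3) (x 0) (β.m (a 1) (a 2) (a 3) (x 1) (x 2)) -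
        β.m (a 0) (a 2) (a 3) (β.m (a 0) (a 1) (a 2) (x 0) (x 1)) (x 2) := by
  refine (evalAt_twist_nil β y a x).trans ((QT_unit β _).trans ?_)
  refine congrArg₂ (· - ·) ((if_pos rfl).trans ((emb_apply _).trans ?_)) ((if_pos rfl).trans ((emb_apply _).trans ?_))
  · exact congrArg₂ (fun z z' => β.m (a 0) (a 1) (a 3) z z') (emb_apply (x 0))
      (congrArg₂ (fun z z' => β.m (a 1) (a 2) (a 3) z z') (emb_apply (x 1)) (emb_apply (x 2)))
  · exact congrArg₂ (fun z z' => β.m (a 0) (a 2) (a 3) z z')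
      (congrArg₂ (fun z z' => β.m (a 0) (a 1) (a 2) z z') (emb_apply (x 0)) (emb_apply (x 1))) (emb_apply (x 2))

theorem curvature_one (g : V ⟶ X) (a : Fin 3 → A.Ob X) (x : ∀ i : Fin 2, A.Hom (a i.castSucc) (a i.succ)) :
    evalAt 2 (cons g (nil X)) a x (twist (k := k) (bracket A) β.toGS 0 y) =
      β.f g (a 0) (a 2) (β.m (a 0) (a 1) (a 2) (x 0) (x 1)) -
        β.m _ _ _ (β.f g (a 0) (a 1) (x 0)) (β.f g (a 1) (a 2) (x 1)) := by
  refine (evalAt_twist_cons β y _ _ a x).trans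
    ((QN_unit_one β g _).trans ?_)
  rw [if_pos rfl, if_pos rfl]
  refine congrArg₂ (· - ·) ((emb_apply _).trans ?_) ((emb_apply _).trans ?_)
  · exact congrArg₂ (fun z z' => β.f g (a 0) (a 2) (β.m (a 0) (a 1) (a 2) z z')) (emb_apply (x 0)) (emb_apply (x 1))
  · exact congrArg₂ (fun z z' => β.m _ _ _ (β.f g (a 0) (a 1) z) (β.f g (a 1) (a 2) z'))
      (emb_apply (x 0)) (emb_apply (x 1))

theorem curvature_two (h : V ⟶ V') (g : V' ⟶ X) (a : Fin 2 → A.Ob X)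
    (x : ∀ i : Fin 1, A.Hom (a i.castSucc) (a i.succ)) :
    evalAt 1 (cons h (cons g (nil X))) a x (twist (k := k) (bracket A) β.toGS 0 y) =
      β.m _ _ _ (β.c h g (a 0)) (β.f (h ≫ g) (a 0) (a 1) (x 0)) -
        β.m _ _ _ (β.f h _ _ (β.f g (a 0) (a 1) (x 0))) (β.c h g (a 1)) := by
  refine (evalAt_twist_cons β y _ _ a x).trans
    ((QN_unit_two β h g _).trans ?_)
  rw [if_pos rfl, if_pos rfl]
  refine congrArg₂ (· - ·) ((emb_apply _).trans ?_) ((emb_apply _).trans ?_)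
  · exact congrArg (fun z => β.m _ _ _ (β.c h g (a 0)) (β.f (h ≫ g) (a 0) (a 1) z)) (emb_apply (x 0))
  · exact congrArg (fun z => β.m _ _ _ (β.f h _ _ (β.f g (a 0) (a 1) z)) (β.c h g (a 1))) (emb_apply (x 0))

theorem curvature_three (e : V ⟶ V') (h : V' ⟶ V'') (g : V'' ⟶ X) (a : Fin 1 → A.Ob X)
    (x : ∀ i : Fin 0, A.Hom (a i.castSucc) (a i.succ)) :
    evalAt 0 (cons e (cons h (cons g (nil X)))) a x (twist (k := k) (bracket A) β.toGS 0 y) =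
      β.m _ _ _ (β.f e _ _ (β.c h g (a 0))) (β.c e (h ≫ g) (a 0)) -
      A.homCast rfl (congrArg (fun i => A.res i (a 0)) (Category.assoc e h g))
        (β.m _ _ _ (β.c e h (A.res g (a 0))) (β.c (e ≫ h) g (a 0))) := by
  refine (evalAt_twist_cons β y _ _ a x).trans
    ((QN_unit_three β e h g _ fun n z => if_neg (Nat.succ_ne_zero n)).trans ?_)
  rw [if_pos rfl, if_pos rfl]
  exact congrArg₂ (· - ·) (emb_apply _) (emb_apply_cast _ _ _)

theorem twist_zero_eq_zero_iff : (∀ y, twist (k := k) (bracket A) β.toGS 0 y = 0) ↔ β.IsLaxPrestack := by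
  constructor
  · intro h
    refine ⟨fun a₀ a₁ a₂ a₃ x y z => ?_, fun g a₀ a₁ a₂ x y => ?_, fun h' g a₀ a₁ x => ?_,
      fun e h' g a => ?_⟩
    · have h1 := curvature_nil β Fin.elim0 ![a₀, a₁, a₂, a₃] (Fin.cons x (Fin.cons y (Fin.cons z fun i => i.elim0)))
      rw [h, map_zero] at h1
      exact (sub_eq_zero.1 h1.symm).symm
    · have h1 := curvature_one β Fin.elim0 g ![a₀, a₁, a₂] (Fin.cons x (Fin.cons y fun i => i.elim0))
      rw [h, map_zero] at h1
      exact sub_eq_zero.1 h1.symm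
    · have h1 := curvature_two β Fin.elim0 h' g ![a₀, a₁] (Fin.cons x fun i => i.elim0)
      rw [h, map_zero] at h1
      exact (sub_eq_zero.1 h1.symm).symm
    · have h1 := curvature_three β Fin.elim0 e h' g ![a] fun i => i.elim0
      rw [h, map_zero] at h1
      exact (sub_eq_zero.1 h1.symm).symm
  · intro h y
    have hm : twist (k := k) (bracket A) β.toGS 0 y ∈ gsDegree A 2 := by
      simpa using twist_mem (D := Fin.elim0) (toGS_mem β) (ω := y) fun i => i.elim0
    refine gsObj_eq_zero fun q V X σ a x => ?_
    by_cases hq : (σ.length : ℤ) + q ≠ 2 + 1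
    · exact (congrArg (fun g : MultilinearMap k _ _ => g x) (hm q V X σ a hq)).trans rfl
    rw [not_not] at hq
    replace hq : σ.length + q = 3 := by omega
    rcases σ with _ | ⟨e, _ | ⟨f, _ | ⟨g, _ | ⟨g', σ⟩⟩⟩⟩ <;> simp only [length] at hq
    · obtain rfl : q = 3 := by omega
      exact (curvature_nil β y a x).trans (sub_eq_zero.2 (h.assoc ..).symm)
    · obtain rfl : q = 2 := by omega
      exact (curvature_one β y e a x).trans (sub_eq_zero.2 (h.functorial ..))
    · obtain rfl : q = 1 := by omega
      exact (curvature_two β y e f a x).trans (sub_eq_zero.2 (h.natural ..).symm)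
    · obtain rfl : q = 0 := by omega
      exact (curvature_three β y e f g a x).trans (sub_eq_zero.2 (h.coherent ..).symm)
    · omega

end

/-! ## The Maurer-Cartan equation -/

section

variable {k : Type t} [Field k] [CharZero k] {𝒰 : Type u} [Category.{v} 𝒰]
  {A : LinQuiver.{u, v, w, w', t} k 𝒰} {N : ℕ} {θ : Fin N → GSObj A} {α α' : GSObj A}

open Stacking

theorem bracket_perm (hθ : ∀ i, θ i ∈ gsDegree A 1) (π : Equiv.Perm (Fin N)) :
    bracket A N (fun i => θ (π i)) = bracket A N θ := by
  have h0 : shPar (fun _ : Fin N => 1) = fun _ => 0 := by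
    funext i
    exact (by decide : ((1 + 1 : ℤ) : ZMod 2) = 0)
  have hk (l : List (Fin N)) : kz (fun _ : Fin N => (0 : ZMod 2)) l = 0 := by
    induction l with
    | nil => rfl
    | cons i l ih => simp [kz, ih]
  funext q V X σ a
  rw [bracket_apply, bracket_apply]
  refine Fintype.sum_equiv (Equiv.mulLeft π) _ _ fun ρ => ?_
  rw [brace_apply (D := fun _ => 1) (Q := 2) ρ (fun i => hθ _) (fun _ => le_rfl),
    brace_apply (D := fun _ => 1) (Q := 2) _ hθ (fun _ => le_rfl), h0]
  simp only [hk]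
  rfl

theorem exists_bracket_eq_zero (A : LinQuiver.{u, v, w, w', t} k 𝒰) :
    ∃ R, ∀ N, R ≤ N → ∀ θ : Fin N → GSObj A, (∀ i, θ i ∈ gsDegree A 1) → bracket A N θ = 0 := by
  refine ⟨∑ p ∈ Finset.range 4, ∑ S ∈ quad 2 p, S.card + 1, fun N hN θ hθ => ?_⟩
  funext q V X σ a
  by_contra h
  obtain ⟨⟨S, hS, hc⟩, h2⟩ := exists_of_bracket_ne_zero (D := fun _ => 1) hθ (Q := 2) (fun _ => le_rfl) h
  have h3 : σ.length ∈ Finset.range 4 := by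
    rw [Finset.mem_range]
    simp at h2
    omega
  have h4 := Finset.single_le_sum (f := fun p => ∑ S ∈ quad 2 p, S.card) (fun _ _ => Nat.zero_le _) h3
  have h5 := Finset.single_le_sum (f := fun S => S.card) (fun _ _ => Nat.zero_le _) hS
  omega

/-- The bracket on the elements of degree `1`. -/
noncomputable def bracketOne (A : LinQuiver.{u, v, w, w', t} k 𝒰) (N : ℕ) :
    MultilinearMap k (fun _ : Fin N => gsDegree A 1) (GSObj A) where
  toFun θ := bracket A N fun i => θ i
  map_update_add' {inst} θ i y z := by
    obtain rfl : inst = instDecidableEqFin N := Subsingleton.elim _ _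
    have h (y : gsDegree A 1) : (fun j => (Function.update θ i y j : GSObj A)) =
        Function.update (fun j => (θ j : GSObj A)) i y := by
      funext j
      exact Function.apply_update (fun _ (y : gsDegree A 1) => (y : GSObj A)) θ i y j
    have := bracket_slot (D := fun _ => 1) (fun j => (θ j).2) i y.2 z.2 (1 : k)
    rw [one_smul, one_smul] at this
    rw [h, h, h]
    exact this
  map_update_smul' {inst} θ i c y := by
    obtain rfl : inst = instDecidableEqFin N := Subsingleton.elim _ _
    have h (y : gsDegree A 1) : (fun j => (Function.update θ i y j : GSObj A)) =
        Function.update (fun j => (θ j : GSObj A)) i y := by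
      funext j
      exact Function.apply_update (fun _ (y : gsDegree A 1) => (y : GSObj A)) θ i y j
    have h1 := bracket_slot (D := fun _ => 1) (fun j => (θ j).2) i (zero_mem _) y.2 c
    have h2 := bracket_slot (D := fun _ => 1) (fun j => (θ j).2) i (zero_mem _) (zero_mem _) (1 : k)
    rw [one_smul, add_zero, one_smul, left_eq_add] at h2
    rw [zero_add, h2, zero_add] at h1
    rw [h, h]
    exact h1

/-- The brackets of `r` times `α` and `N - r` times `α'`. -/
noncomputable def mixed (α α' : GSObj A) (N r : ℕ) : GSObj A :=
  bracket A N fun i => if i.val < r then α else α'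

theorem bracket_piecewise (hα : α ∈ gsDegree A 1) (hα' : α' ∈ gsDegree A 1) (s : Finset (Fin N)) :
    bracket A N (s.piecewise (fun _ => α) fun _ => α') = mixed α α' N s.card := by
  have hc : Fintype.card {i : Fin N // i ∈ s} = Fintype.card {i : Fin N // i.val < s.card} := by
    rw [Fintype.card_coe, Fintype.card_subtype, Fin.card_filter_val_lt, min_eq_right]
    simpa using Finset.card_le_univ s
  have e := (Fintype.equivOfCardEq hc)
  rw [mixed, ← bracket_perm (θ := fun i : Fin N => if i.val < s.card then α else α') (fun i => by
    split_ifs <;> assumption) e.extendSubtype]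
  congr 1
  funext i
  by_cases hi : i ∈ s
  · rw [Finset.piecewise_eq_of_mem _ _ _ hi, if_pos (e.extendSubtype_mem i hi)]
  · rw [Finset.piecewise_eq_of_notMem _ _ _ hi, if_neg (e.extendSubtype_not_mem i hi)]

theorem bracket_add (hα : α ∈ gsDegree A 1) (hα' : α' ∈ gsDegree A 1) (N : ℕ) :
    bracket A N (fun _ => α + α') = ∑ r ∈ Finset.range (N + 1), N.choose r • mixed α α' N r := by
  classical
  have h := (bracketOne A N).map_add_univ (fun _ => ⟨α, hα⟩) fun _ => ⟨α', hα'⟩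
  have h1 : bracketOne A N ((fun _ => ⟨α, hα⟩) + fun _ => ⟨α', hα'⟩) = bracket A N fun _ => α + α' := rfl
  rw [← h1, h, ← Finset.powerset_univ]
  have h2 : ∀ s : Finset (Fin N), bracketOne A N (s.piecewise (fun _ => ⟨α, hα⟩) fun _ => ⟨α', hα'⟩) =
      mixed α α' N s.card := fun s => by
    rw [← bracket_piecewise hα hα' s]
    refine congrArg (bracket A N) (funext fun i => ?_)
    by_cases hi : i ∈ s
    · rw [Finset.piecewise_eq_of_mem _ _ _ hi, Finset.piecewise_eq_of_mem _ _ _ hi]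
    · rw [Finset.piecewise_eq_of_notMem _ _ _ hi, Finset.piecewise_eq_of_notMem _ _ _ hi]
  simp only [h2]
  rw [Finset.sum_powerset_apply_card (mixed α α' N), Finset.card_univ, Fintype.card_fin]

/-- The coefficients of the Maurer-Cartan equation. -/
def mcCoeff (k : Type*) [Field k] (N : ℕ) : k := (-1) ^ (N * (N + 1) / 2) / (N.factorial : k)

theorem mcCoeff_add (r n : ℕ) : mcCoeff k (r + n) * ((r + n).choose r : k) =
    (-1) ^ (n * (n + 1) / 2) / (n.factorial : k) *
      ((-1) ^ (r * n + r * (r + 1) / 2) / (r.factorial : k)) := by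
  have h1 : (r + n) * (r + n + 1) / 2 = n * (n + 1) / 2 + (r * n + r * (r + 1) / 2) := by
    have e1 := Nat.even_mul_succ_self n
    have e2 := Nat.even_mul_succ_self r
    obtain ⟨x, hx⟩ := e1
    obtain ⟨y, hy⟩ := e2
    have : (r + n) * (r + n + 1) = r * (r + 1) + n * (n + 1) + 2 * (r * n) := by ring
    omega
  have h2 : ((r + n).choose r : k) * (r.factorial * n.factorial) = (r + n).factorial := by
    rw [← mul_assoc]
    exact_mod_cast Nat.choose_symm_add (a := r) (b := n) ▸ Nat.add_choose_mul_factorial_mul_factorial r n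
  have h3 := Nat.cast_ne_zero (R := k).2 (Nat.factorial_ne_zero r)
  have h4 := Nat.cast_ne_zero (R := k).2 (Nat.factorial_ne_zero n)
  have h5 := Nat.cast_ne_zero (R := k).2 (Nat.factorial_ne_zero (r + n))
  rw [mcCoeff, h1, pow_add, div_mul_eq_mul_div, div_mul_div_comm, div_eq_div_iff h5 (mul_ne_zero h4 h3), ← h2]
  ring

theorem append_const (r n : ℕ) : Fin.append (fun _ : Fin r => α) (fun _ : Fin n => α') =
    fun i => if i.val < r then α else α' := by
  funext i
  induction i using Fin.addCases with
  | left i => simp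
  | right i => simp

theorem twistTerm_const (n r : ℕ) : twistTerm (k := k) (bracket A) α n (fun _ => α') r =
    ((-1 : k) ^ (r * n + r * (r + 1) / 2) / (r.factorial : k)) • mixed α α' (r + n) r := by
  rw [twistTerm, append_const]
  rfl

theorem mixed_eq_zero {R : ℕ}
    (hR : ∀ N, R ≤ N → ∀ θ : Fin N → GSObj A, (∀ i, θ i ∈ gsDegree A 1) → bracket A N θ = 0)
    (hα : α ∈ gsDegree A 1) (hα' : α' ∈ gsDegree A 1) {N : ℕ} (hN : R ≤ N) (r : ℕ) : mixed α α' N r = 0 :=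
  hR N hN _ fun i => by split_ifs <;> assumption

theorem mcTerm_twist {R : ℕ}
    (hR : ∀ N, R ≤ N → ∀ θ : Fin N → GSObj A, (∀ i, θ i ∈ gsDegree A 1) → bracket A N θ = 0)
    (hα : α ∈ gsDegree A 1) (hα' : α' ∈ gsDegree A 1) (n : ℕ) :
    mcTerm (k := k) (twist (k := k) (bracket A) α) α' n =
      ∑ r ∈ Finset.range (R - n), (mcCoeff k (r + n) * ((r + n).choose r : k)) • mixed α α' (r + n) r := by
  rw [mcTerm, twist_eq_sum (R := R - n) fun r hr => by
    rw [twistTerm_const, mixed_eq_zero hR hα hα' (by omega), smul_zero], Finset.smul_sum]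
  refine Finset.sum_congr rfl fun r _ => ?_
  rw [twistTerm_const, smul_smul, mcCoeff_add]

theorem sum_mcTerm {R : ℕ}
    (hR : ∀ N, R ≤ N → ∀ θ : Fin N → GSObj A, (∀ i, θ i ∈ gsDegree A 1) → bracket A N θ = 0)
    (hα : α ∈ gsDegree A 1) (hα' : α' ∈ gsDegree A 1) (y : Fin 0 → GSObj A) :
    ∑ n ∈ Finset.range R, mcTerm (k := k) (twist (k := k) (bracket A) α) α' n =
      twist (k := k) (bracket A) (α + α') 0 y := by
  have hs := Submodule.add_mem _ hα hα'
  obtain rfl : y = fun _ => α + α' := Subsingleton.elim _ _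
  rw [twist_eq_sum (R := R) fun r hr => by
    rw [twistTerm_const, mixed_eq_zero hR hs hs (by omega), smul_zero]]
  simp only [mcTerm_twist hR hα hα']
  rw [← Finset.sum_range_diag_flip R fun n r =>
    (mcCoeff k (r + n) * ((r + n).choose r : k)) • mixed α α' (r + n) r]
  refine Finset.sum_congr rfl fun N _ => ?_
  have h1 : mixed (α + α') (α + α') (N + 0) N = bracket A N fun _ => α + α' := by
    change mixed (α + α') (α + α') N N = _
    simp [mixed]
  rw [twistTerm_const, mul_zero, zero_add, h1, bracket_add hα hα', Finset.smul_sum,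
    ← Finset.sum_flip fun r => ((-1 : k) ^ (N * (N + 1) / 2) / (N.factorial : k)) • N.choose r • mixed α α' N r]
  refine Finset.sum_congr rfl fun n hn => ?_
  rw [Nat.sub_add_cancel (Nat.lt_succ_iff.1 (Finset.mem_range.1 hn)), mul_smul, Nat.cast_smul_eq_nsmul, mcCoeff]

theorem isMaurerCartan_iff (hα : α ∈ gsDegree A 1) (hα' : α' ∈ gsDegree A 1)
    (h0 : ∀ y, twist (k := k) (bracket A) α 0 y = 0) :
    IsMaurerCartan (gsDegree A) (twist (k := k) (bracket A) α) α' ↔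
      ∀ y, twist (k := k) (bracket A) (α + α') 0 y = 0 := by
  obtain ⟨R, hR⟩ := exists_bracket_eq_zero A
  have h1 (n : ℕ) (hn : R ≤ n) : mcTerm (k := k) (twist (k := k) (bracket A) α) α' n = 0 := by
    rw [mcTerm_twist hR hα hα', Nat.sub_eq_zero_of_le hn, Finset.sum_range_zero]
  have hsup : (Function.support fun n => mcTerm (k := k) (twist (k := k) (bracket A) α) α' (n + 1)) ⊆
      Finset.range R := fun n hn => by
    by_contra h
    exact hn (h1 _ (by simp at h; omega))
  have h2 (y : Fin 0 → GSObj A) : ∑ᶠ n, mcTerm (k := k) (twist (k := k) (bracket A) α) α' (n + 1) =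
      twist (k := k) (bracket A) (α + α') 0 y := by
    rw [finsum_eq_sum_of_support_subset _ hsup, ← sum_mcTerm (fun N hN => hR N ((Nat.le_succ R).trans hN)) hα hα' y,
      Finset.sum_range_succ']
    refine (add_zero _).symm.trans (congrArg _ ?_)
    rw [mcTerm, h0, smul_zero]
  refine ⟨fun h y => (h2 y).symm.trans h.2.2, fun h => ⟨hα', (Finset.finite_toSet _).subset hsup, (h2 0).trans (h 0)⟩⟩

theorem toGS_add (β β' : LaxData A) : (β + β').toGS = β.toGS + β'.toGS := by
  funext q V X σ a
  refine MultilinearMap.ext fun x => ?_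
  rcases σ with _ | ⟨f, _ | ⟨g, _ | ⟨g', σ⟩⟩⟩ <;> rcases q with _ | _ | _ | q <;>
    first
    | rfl
    | exact (add_zero _).symm

end

end LaxPrestack

open LaxPrestack in
theorem mainTheorem5 {k : Type*} [Field k] [CharZero k] {𝒰 : Type*} [Category 𝒰] (A : LinQuiver k 𝒰)
    (α : LaxData A) (hα : α.IsLaxPrestack) :
    (∀ n : ℕ, 1 ≤ n → ∀ (d : Fin n → ℤ) (θ : Fin n → GSObj A), (∀ i, θ i ∈ gsDegree A (d i)) →
      (Function.support (twistTerm (k := k) (bracket A) α.toGS n θ)).Finite) ∧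
    IsLInfinityAlgebra (gsDegree A) (twist (k := k) (bracket A) α.toGS) ∧
    ∀ α' : LaxData A,
      IsMaurerCartan (gsDegree A) (twist (k := k) (bracket A) α.toGS) α'.toGS ↔
        (α + α').IsLaxPrestack := by
  have h0 := (twist_zero_eq_zero_iff α).2 hα
  refine ⟨fun n _ d θ hθ => support_twistTerm (toGS_mem α) hθ, isLInfinityAlgebra_twist (toGS_mem α) h0,
    fun α' => ?_⟩
  rw [isMaurerCartan_iff (toGS_mem α) (toGS_mem α') h0, ← toGS_add, twist_zero_eq_zero_iff]
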